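/- **Conventions.** For a coframe $v_0,\dots,v_6$ of a real seven-dimensional vector space put $v_{ij\dots}=v_i\wedge v_j\wedge\cdots$, $\alpha=v_{246}-v_{235}-v_{145}-v_{136}$, $\beta=v_{135}-v_{146}-v_{236}-v_{245}$ and $\phi(\theta)=(v_{12}+v_{34}+v_{56})\wedge v_0+\cos\theta\,\alpha+\sin\theta\,\beta$. A $G_2$-structure on a seven-manifold $M$ is a three-form $\phi$ that at each point equals $\phi(\theta)$ in some coframe, for some $\theta$; its metric makes this coframe orthonormal, and $*\phi=v_{1234}+v_{3456}+v_{5612}+(\cos\theta\,\beta-\sin\theta\,\alpha)\wedge v_0$ is the Hodge dual. It is cosymplectic if $d{*\phi}=0$. It is of class $C^n$ if the form $\phi$ is. Let $E_1,\dots,E_6\in\mathfrak{su}(3)$ be $$E_1=\tfrac12\begin{pmatrix}0&0&0\\0&0&-1\\0&1&0\end{pmatrix},\quad E_3=\tfrac12\begin{pmatrix}0&0&1\\0&0&0\\-1&0&0\end{pmatrix},\quad E_5=\tfrac12\begin{pmatrix}0&-1&0\\1&0&0\\0&0&0\end{pmatrix},$$ $$E_2=\tfrac1{2i}\begin{pmatrix}0&0&0\\0&0&1\\0&1&0\end{pmatrix},\quad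 E_4=\tfrac1{2i}\begin{pmatrix}0&0&1\\0&0&0\\1&0&0\end{pmatrix},\quad E_6=\tfrac1{2i}\begin{pmatrix}0&1&0\\1&0&0\\0&0&0\end{pmatrix},$$ let $e_1,\dots,e_6$ be the dual covectors, vanishing on the Lie algebra of the diagonal torus $T^2\subset SU(3)$, and put $g_1=e_1^2+e_2^2$, $g_2=e_3^2+e_4^2$, $g_3=e_5^2+e_6^2$, $\omega_1=e_{12}$, $\omega_2=e_{34}$, $\omega_3=e_{56}$, and $\alpha,\beta$ as above with $e_i$ for $v_i$. These define $SU(3)$-invariant tensors on $SU(3)/T^2$. For $0\le\mu\le\nu$ and $x\ne0$ let $$\Xi(x,\mu,\nu)=\frac{x^8+2(2\nu^2-\mu^2)x^4+\mu^4}{2x^4\left(x^4+(2\nu^2-\mu^2)+\sqrt{x^8+2(2\nu^2-\mu^2)x^4+\mu^4}\right)}.$$ **Theorem.** (1) Let $\phi$ be a smooth cosymplectic $G_2$-structure on a smooth (Hausdorff) seven-manifold $M$, preserved by a smooth action of $SU(3)$ whose largest orbits have dimension six. Through every point with a six-dimensional orbit there passes a smooth curve that is parametrized by arc length and orthogonal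 to the orbits. Let $\gamma\colon I\to M$ be any such curve, $I\subset\mathbb R$ an open interval, running through orbits of dimension six. After replacing $\gamma$ by $h\gamma$ for some $h\in SU(3)$, the torus $T^2$ fixes $\gamma(t)$ for every $t\in I$, and the pull-backs of the metric and of $\phi$ by $(t,kT^2)\mapsto k\gamma(t)$, $I\times SU(3)/T^2\to M$, are $$g=dt^2+f_1^2g_1+f_2^2g_2+f_3^2g_3,\qquad \phi=(f_1^2\omega_1+f_2^2\omega_2+f_3^2\omega_3)\wedge dt+f_1f_2f_3(\cos\theta\,\alpha+\sin\theta\,\beta)$$ for smooth nowhere vanishing functions $f_i$ and a smooth function $\theta$ on $I$. The $f_i$ can be relabelled by a permutation so that $f_3^2\ge f_2^2\ge f_1^2$ on $I$, and then there are constants $\nu\ge\mu\ge0$ with $$|f_1'|\le\sqrt{\Xi(f_1,\mu,\nu)},\qquad(\mathrm a)$$ $$f_1^2-\mu^2f_1^{-2}=f_2^2-\nu^2f_2^{-2},\qquad f_3^2-(\nu^2-\mu^2)f_3^{-2}=f_1^2+\mu^2f_1^{-2},\qquad(\mathrm b)$$ $$f_3\cos\theta=(f_1f_2)'.\qquad(\mathrm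 c)$$ (2) Conversely, let $I$ be an open interval, $\nu\ge\mu\ge0$, and $f_1$ a smooth nowhere vanishing function on $I$ satisfying (a). Then (b) has solutions $f_2,f_3$ that are smooth and positive, and $f_2^2,f_3^2$ are uniquely determined by (b). For all smooth nowhere vanishing $f_2,f_3$ satisfying (b): one has $f_3^2\ge f_2^2\ge f_1^2$; there is a $C^1$ function $\theta$ satisfying (c), and a smooth one if the inequality (a) is strict on $I$; and for every $\theta$ of class $C^n$ ($1\le n\le\infty$) satisfying (c), there is exactly one $SU(3)$-invariant cosymplectic $G_2$-structure of class $C^n$ on $I\times SU(3)/T^2$ whose metric and three-form are given by the formulas in (1). -/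

import Mathlib

open scoped Manifold ContDiff Matrix

namespace G2SU3

/-! ### Exterior products of covectors, `G₂`-forms, their metrics and their Hodge duals -/

section Linear

variable {V : Type*} [AddCommGroup V] [Module ℝ V] [TopologicalSpace V]

/-- The exterior product `a₀ ∧ ⋯ ∧ aₖ₋₁` of `k` covectors, with the determinant convention
`(a₀ ∧ ⋯ ∧ aₖ₋₁)(x₀, …, xₖ₋₁) = det (aⱼ xᵢ)`. -/
noncomputable def wedge {k : ℕ} (a : Fin k → V →L[ℝ] ℝ) : V [⋀^Fin k]→L[ℝ] ℝ :=
  { (Matrix.detRowAlternating (n := Fin k) (R := ℝ)).compLinearMap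
      (LinearMap.pi fun j => (a j : V →ₗ[ℝ] ℝ)) with
    cont := by
      have h : Continuous fun x : Fin k → V => Matrix.det (fun i j => a j (x i)) := by
        apply Continuous.matrix_det
        fun_prop
      exact h }

theorem wedge_apply {k : ℕ} (a : Fin k → V →L[ℝ] ℝ) (x : Fin k → V) :
    wedge a x = Matrix.det (Matrix.of fun i j => a j (x i)) := rfl

/-- `α = v₂₄₆ - v₂₃₅ - v₁₄₅ - v₁₃₆`. -/
noncomputable def alphaForm (v : Fin 7 → V →L[ℝ] ℝ) : V [⋀^Fin 3]→L[ℝ] ℝ :=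
  wedge ![v 2, v 4, v 6] - wedge ![v 2, v 3, v 5] - wedge ![v 1, v 4, v 5]
    - wedge ![v 1, v 3, v 6]

/-- `β = v₁₃₅ - v₁₄₆ - v₂₃₆ - v₂₄₅`. -/
noncomputable def betaForm (v : Fin 7 → V →L[ℝ] ℝ) : V [⋀^Fin 3]→L[ℝ] ℝ :=
  wedge ![v 1, v 3, v 5] - wedge ![v 1, v 4, v 6] - wedge ![v 2, v 3, v 6]
    - wedge ![v 2, v 4, v 5]

/-- `φ(θ) = ω ∧ v₀ + cos θ α + sin θ β` with `ω = v₁₂ + v₃₄ + v₅₆`. -/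
noncomputable def phiForm (v : Fin 7 → V →L[ℝ] ℝ) (θ : ℝ) : V [⋀^Fin 3]→L[ℝ] ℝ :=
  wedge ![v 1, v 2, v 0] + wedge ![v 3, v 4, v 0] + wedge ![v 5, v 6, v 0]
    + Real.cos θ • alphaForm v + Real.sin θ • betaForm v

/-- The Hodge dual of `φ(θ)` for the metric in which `v₀, …, v₆` is an orthonormal coframe and the
orientation `v₁ ∧ v₂ ∧ v₃ ∧ v₄ ∧ v₅ ∧ v₆ ∧ v₀`:
`*φ(θ) = v₁₂₃₄ + v₃₄₅₆ + v₅₆₁₂ + (cos θ β - sin θ α) ∧ v₀`. -/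
noncomputable def starPhiForm (v : Fin 7 → V →L[ℝ] ℝ) (θ : ℝ) : V [⋀^Fin 4]→L[ℝ] ℝ :=
  wedge ![v 1, v 2, v 3, v 4] + wedge ![v 3, v 4, v 5, v 6] + wedge ![v 5, v 6, v 1, v 2]
    + Real.cos θ • (wedge ![v 1, v 3, v 5, v 0] - wedge ![v 1, v 4, v 6, v 0]
        - wedge ![v 2, v 3, v 6, v 0] - wedge ![v 2, v 4, v 5, v 0])
    - Real.sin θ • (wedge ![v 2, v 4, v 6, v 0] - wedge ![v 2, v 3, v 5, v 0]
        - wedge ![v 1, v 4, v 5, v 0] - wedge ![v 1, v 3, v 6, v 0])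

/-- Euclidean seven-space, also the model space of the seven-manifolds below. -/
abbrev W : Type := EuclideanSpace ℝ (Fin 7)

/-- The standard orthonormal coframe of `W`. -/
noncomputable def stdCoframe (i : Fin 7) : W →L[ℝ] ℝ := EuclideanSpace.proj i

/-- `b : V ≃ W` identifies the three-form `φ` with `φ(θ)`. -/
def IsAdapted (φ : V [⋀^Fin 3]→L[ℝ] ℝ) (b : V ≃L[ℝ] W) (θ : ℝ) : Prop :=
  φ = (phiForm stdCoframe θ).compContinuousLinearMap (b : V →L[ℝ] W)

/-- A three-form on `V` is a `G₂`-form if it is `φ(θ)` in some basis, for some `θ`. -/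
def IsG2Form (φ : V [⋀^Fin 3]→L[ℝ] ℝ) : Prop :=
  ∃ (b : V ≃L[ℝ] W) (θ : ℝ), IsAdapted φ b θ

open Classical in
/-- The inner product of a `G₂`-form: an adapted basis is orthonormal. (The stabiliser of `φ(0)`
preserves the Euclidean metric and the `φ(θ)` are related by isometries, so that the choice of the
adapted basis is immaterial; the same holds for the Hodge dual.) -/
noncomputable def g2Metric (φ : V [⋀^Fin 3]→L[ℝ] ℝ) (x y : V) : ℝ :=
  if h : IsG2Form φ then inner ℝ (h.choose x) (h.choose y) else 0

open Classical in
/-- The Hodge dual `*φ` of a `G₂`-form. -/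
noncomputable def g2Star (φ : V [⋀^Fin 3]→L[ℝ] ℝ) : V [⋀^Fin 4]→L[ℝ] ℝ :=
  if h : IsG2Form φ then
    (starPhiForm stdCoframe h.choose_spec.choose).compContinuousLinearMap
      (h.choose : V →L[ℝ] W)
  else 0

end Linear

/-! ### The group `SU(3)`, its Lie algebra and its diagonal torus -/

/-- The Lie group `SU(3)`. -/
abbrev SU3 : Type := Matrix.specialUnitaryGroup (Fin 3) ℂ

/-- The diagonal maximal torus of `SU(3)`. -/
def T2 : Subgroup SU3 where
  carrier := {g | ∀ i j, i ≠ j → g.1 i j = 0}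
  mul_mem' := by
    intro a b ha hb i j hij
    simp only [Set.mem_ofPred_eq] at ha hb
    change (a.1 * b.1) i j = 0
    rw [Matrix.mul_apply]
    refine Finset.sum_eq_zero fun k _ => ?_
    by_cases hik : i = k
    · subst hik
      rw [hb _ _ hij, mul_zero]
    · rw [ha _ _ hik, zero_mul]
  one_mem' := by
    intro i j hij
    exact Matrix.one_apply_ne hij
  inv_mem' := by
    intro a ha i j hij
    change (star a.1) i j = 0
    rw [Matrix.star_apply, ha _ _ hij.symm, star_zero]

/-- A basis of `su(3)`: `E₁, …, E₆` (indices `0, …, 5`) span the orthogonal complement of the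
diagonal matrices, the last two elements span the diagonal matrices. -/
noncomputable def suBasis : Fin 8 → Matrix (Fin 3) (Fin 3) ℂ :=
  ![(1 / 2 : ℂ) • !![0, 0, 0; 0, 0, -1; 0, 1, 0],
    (1 / (2 * Complex.I)) • !![0, 0, 0; 0, 0, 1; 0, 1, 0],
    (1 / 2 : ℂ) • !![0, 0, 1; 0, 0, 0; -1, 0, 0],
    (1 / (2 * Complex.I)) • !![0, 0, 1; 0, 0, 0; 1, 0, 0],
    (1 / 2 : ℂ) • !![0, -1, 0; 1, 0, 0; 0, 0, 0],
    (1 / (2 * Complex.I)) • !![0, 1, 0; 1, 0, 0; 0, 0, 0],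
    !![Complex.I, 0, 0; 0, -Complex.I, 0; 0, 0, 0],
    !![0, 0, 0; 0, Complex.I, 0; 0, 0, -Complex.I]]

/-- The Lie algebra `su(3)`, in coordinates with respect to `suBasis`. -/
abbrev LieSU3 : Type := EuclideanSpace ℝ (Fin 8)

/-- The matrix with given coordinates. -/
noncomputable def suMat (c : LieSU3) : Matrix (Fin 3) (Fin 3) ℂ :=
  ∑ i, (c i : ℂ) • suBasis i

theorem suBasis_star (i : Fin 8) : star (suBasis i) = -suBasis i := by
  ext a b
  fin_cases i <;> fin_cases a <;> fin_cases b <;> simp [suBasis]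

theorem suBasis_trace (i : Fin 8) : (suBasis i).trace = 0 := by
  fin_cases i <;> simp [suBasis, Matrix.trace_fin_three]

theorem suMat_star (c : LieSU3) : star (suMat c) = -suMat c := by
  simp [suMat, star_sum, suBasis_star]

theorem suMat_trace (c : LieSU3) : (suMat c).trace = 0 := by
  simp [suMat, Matrix.trace_sum, suBasis_trace]

theorem exp_mem_SU {S : Matrix (Fin 3) (Fin 3) ℂ} (hs : star S = -S) (ht : S.trace = 0) :
    NormedSpace.exp S ∈ Matrix.specialUnitaryGroup (Fin 3) ℂ := by
  rw [Matrix.mem_specialUnitaryGroup_iff]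
  constructor
  · rw [Matrix.mem_unitaryGroup_iff]
    have h1 : star (NormedSpace.exp S) = NormedSpace.exp (-S) := by
      rw [← hs]; exact (Matrix.exp_conjTranspose S).symm
    rw [h1, ← Matrix.exp_add_of_commute _ _ (Commute.refl S).neg_right, add_neg_cancel]
    exact NormedSpace.exp_zero
  · have hH : (Complex.I • S).IsHermitian := by
      change star (Complex.I • S) = _
      rw [star_smul, hs]; simp
    have hsp := hH.spectral_theorem
    rw [Unitary.conjStarAlgAut_apply] at hsp
    set U : Matrix (Fin 3) (Fin 3) ℂ := (hH.eigenvectorUnitary : Matrix (Fin 3) (Fin 3) ℂ) with hU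
    have hUU : U * star U = 1 := Unitary.mul_star_self_of_mem hH.eigenvectorUnitary.2
    have hinv : U⁻¹ = star U := Matrix.inv_eq_right_inv hUU
    have hunit : IsUnit U := IsUnit.of_mul_eq_one _ hUU
    have hS : S = U * Matrix.diagonal (fun i => -Complex.I * (hH.eigenvalues i : ℂ)) * U⁻¹ := by
      have h2 : S = (-Complex.I) • (Complex.I • S) := by
        rw [smul_smul]; simp
      have h3 : Matrix.diagonal (fun i => -Complex.I * (hH.eigenvalues i : ℂ))
          = (-Complex.I) • Matrix.diagonal (fun i => (hH.eigenvalues i : ℂ)) := by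
        rw [← Matrix.diagonal_smul]; rfl
      rw [h3, Matrix.mul_smul, Matrix.smul_mul, hinv]
      exact h2.trans (congrArg (fun A => (-Complex.I) • A) hsp)
    have htr : ∑ i, (hH.eigenvalues i : ℂ) = 0 := by
      have := hH.trace_eq_sum_eigenvalues
      rw [Matrix.trace_smul, ht, smul_zero] at this
      exact this.symm
    have hd : (U.det) * (U⁻¹).det = 1 := by
      rw [← Matrix.det_mul, hinv, hUU, Matrix.det_one]
    rw [hS, Matrix.exp_conj _ _ hunit, Matrix.exp_diagonal, Matrix.det_mul, Matrix.det_mul,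
      mul_right_comm, hd, one_mul, Matrix.det_diagonal]
    simp only [Pi.coe_exp]
    rw [← NormedSpace.exp_sum, ← Finset.mul_sum, htr, mul_zero, NormedSpace.exp_zero]

theorem exp_suMat_mem (c : LieSU3) :
    NormedSpace.exp (suMat c) ∈ Matrix.specialUnitaryGroup (Fin 3) ℂ :=
  exp_mem_SU (suMat_star c) (suMat_trace c)

/-- The exponential map `su(3) → SU(3)`. -/
noncomputable def suExp (c : LieSU3) : SU3 := ⟨NormedSpace.exp (suMat c), exp_suMat_mem c⟩

/-! ### Differential forms on seven-manifolds -/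

section Forms

variable {M : Type*} [TopologicalSpace M] [ChartedSpace W M]

variable (M) in
/-- Fields of alternating `k`-forms on `M`. -/
abbrev FormField (k : ℕ) : Type _ := ∀ p : M, TangentSpace 𝓘(ℝ, W) p [⋀^Fin k]→L[ℝ] ℝ

/-- The expression of a form in a chart: its pull-back by the inverse of the chart. -/
noncomputable def localRep {k : ℕ} (η : FormField M k) (e : OpenPartialHomeomorph M W) (y : W) :
    W [⋀^Fin k]→L[ℝ] ℝ :=
  (η (e.symm y)).compContinuousLinearMap (mfderiv 𝓘(ℝ, W) 𝓘(ℝ, W) e.symm y)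

/-- `η` is of class `C^n`. -/
def IsCnForm (n : WithTop ℕ∞) {k : ℕ} (η : FormField M k) : Prop :=
  ∀ e ∈ atlas W M, ContDiffOn ℝ n (localRep η e) e.target

/-- `dη = 0` (meaningful for `η` of class `C¹`). -/
def IsClosedForm {k : ℕ} (η : FormField M k) : Prop :=
  ∀ e ∈ atlas W M, ∀ y ∈ e.target, extDeriv (localRep η e) y = 0

variable [MulAction SU3 M]

variable (M) in
/-- The action of `SU(3)` on `M` is smooth. As `exp` is a diffeomorphism from a neighbourhood of
`0` onto a neighbourhood of `1` and `(g exp c) • p = g • (exp c • p)`, this is smoothness of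
`SU(3) × M → M`. -/
structure IsSmoothAction : Prop where
  smul : ∀ g : SU3, ContMDiff 𝓘(ℝ, W) 𝓘(ℝ, W) ∞ fun p : M => g • p
  exp : ContMDiff (𝓘(ℝ, LieSU3).prod 𝓘(ℝ, W)) 𝓘(ℝ, W) ∞
    fun q : LieSU3 × M => suExp q.1 • q.2

/-- `SU(3)` preserves the form `η`. -/
def IsInvariantForm {k : ℕ} (η : FormField M k) : Prop :=
  ∀ (g : SU3) (p : M), (η (g • p)).compContinuousLinearMap
    (mfderiv 𝓘(ℝ, W) 𝓘(ℝ, W) (fun q : M => g • q) p) = η p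

/-- `φ` is an `SU(3)`-invariant cosymplectic `G₂`-structure of class `C^n` on `M`. -/
structure IsInvariantCosymplectic (n : WithTop ℕ∞) (φ : FormField M 3) : Prop where
  isG2Form : ∀ p, IsG2Form (φ p)
  isCn : IsCnForm n φ
  invariant : IsInvariantForm φ
  closed : IsClosedForm fun p => g2Star (φ p)

/-- The fundamental vector fields at `p`: `c ↦ d/ds (exp (s c) • p)` at `s = 0`. -/
noncomputable def fundamental (p : M) : LieSU3 →L[ℝ] TangentSpace 𝓘(ℝ, W) p :=
  mfderiv 𝓘(ℝ, LieSU3) 𝓘(ℝ, W) (fun c : LieSU3 => suExp c • p) 0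

/-- The dimension of the orbit of `p`. -/
noncomputable def orbitDim (p : M) : ℕ :=
  Module.finrank ℝ (LinearMap.range (fundamental p).toLinearMap)

variable (M) in
/-- The orbits of largest dimension have dimension six. -/
def IsCohomogeneityOne : Prop := (∃ p : M, orbitDim p = 6) ∧ ∀ p : M, orbitDim p ≤ 6

/-- The velocity `γ'(t)`. -/
noncomputable def velocity (γ : ℝ → M) (t : ℝ) : TangentSpace 𝓘(ℝ, W) (γ t) :=
  mfderiv 𝓘(ℝ, ℝ) 𝓘(ℝ, W) γ t (1 : ℝ)

/-- `γ : I → M` is smooth, runs through orbits of dimension six, is parametrized by arc length and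
is orthogonal to the orbits, for the metric of `φ`. -/
structure IsNormalCurve (φ : FormField M 3) (I : Set ℝ) (γ : ℝ → M) : Prop where
  smooth : ContMDiffOn 𝓘(ℝ, ℝ) 𝓘(ℝ, W) ∞ γ I
  regular : ∀ t ∈ I, orbitDim (γ t) = 6
  unit : ∀ t ∈ I, g2Metric (φ (γ t)) (velocity γ t) (velocity γ t) = 1
  orthogonal : ∀ t ∈ I, ∀ c, g2Metric (φ (γ t)) (velocity γ t) (fundamental (γ t) c) = 0

/-- The differential at `(t, 1)` of the map `ℝ × SU(3) → M`, `(t, g) ↦ g • γ t`. -/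
noncomputable def tubeMap (γ : ℝ → M) (t : ℝ) :
    ℝ × LieSU3 →L[ℝ] TangentSpace 𝓘(ℝ, W) (γ t) :=
  (ContinuousLinearMap.fst ℝ ℝ LieSU3).smulRight (velocity γ t)
    + (fundamental (γ t)).comp (ContinuousLinearMap.snd ℝ ℝ LieSU3)

/-- `M` is `I × SU(3)/T²` as a manifold with `SU(3)`-action: the smooth map `(t, g) ↦ g • γ t`
induces an equivariant bijection `I × SU(3)/T² → M` with surjective (hence, by dimension, bijective)
differentials. -/
structure IsProductTube (I : Set ℝ) (γ : ℝ → M) : Prop where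
  smooth : ContMDiffOn 𝓘(ℝ, ℝ) 𝓘(ℝ, W) ∞ γ I
  surjective : ∀ p : M, ∃ t ∈ I, ∃ g : SU3, g • γ t = p
  fibres : ∀ s ∈ I, ∀ t ∈ I, ∀ g h : SU3, g • γ s = h • γ t ↔ s = t ∧ g⁻¹ * h ∈ T2
  submersion : ∀ t ∈ I, Function.Surjective (tubeMap γ t)

end Forms

/-! ### The invariant forms and the metrics on `I × SU(3)/T²` -/

/-- The coframe `dt, e₁, …, e₆` on `ℝ × su(3)`; here `e₁, …, e₆` are dual to `E₁, …, E₆` and vanish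
on the diagonal matrices. -/
noncomputable def tubeCoframe : Fin 7 → ℝ × LieSU3 →L[ℝ] ℝ :=
  Fin.cons (ContinuousLinearMap.fst ℝ ℝ LieSU3) fun i : Fin 6 =>
    (EuclideanSpace.proj (Fin.castLE (by norm_num) i : Fin 8) : LieSU3 →L[ℝ] ℝ).comp
      (ContinuousLinearMap.snd ℝ ℝ LieSU3)

/-- `(f₁² ω₁ + f₂² ω₂ + f₃² ω₃) ∧ dt + f₁ f₂ f₃ (cos θ α + sin θ β)`,
where `ω₁ = e₁₂`, `ω₂ = e₃₄`, `ω₃ = e₅₆`. -/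
noncomputable def tubePhi (a₁ a₂ a₃ θ : ℝ) : (ℝ × LieSU3) [⋀^Fin 3]→L[ℝ] ℝ :=
  a₁ ^ 2 • wedge ![tubeCoframe 1, tubeCoframe 2, tubeCoframe 0]
    + a₂ ^ 2 • wedge ![tubeCoframe 3, tubeCoframe 4, tubeCoframe 0]
    + a₃ ^ 2 • wedge ![tubeCoframe 5, tubeCoframe 6, tubeCoframe 0]
    + (a₁ * a₂ * a₃) • (Real.cos θ • alphaForm tubeCoframe + Real.sin θ • betaForm tubeCoframe)

/-- `dt² + f₁² g₁ + f₂² g₂ + f₃² g₃`,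
where `g₁ = e₁² + e₂²`, `g₂ = e₃² + e₄²`, `g₃ = e₅² + e₆²`. -/
noncomputable def tubeMetric (a₁ a₂ a₃ : ℝ) (x y : ℝ × LieSU3) : ℝ :=
  tubeCoframe 0 x * tubeCoframe 0 y
    + a₁ ^ 2 * (tubeCoframe 1 x * tubeCoframe 1 y + tubeCoframe 2 x * tubeCoframe 2 y)
    + a₂ ^ 2 * (tubeCoframe 3 x * tubeCoframe 3 y + tubeCoframe 4 x * tubeCoframe 4 y)
    + a₃ ^ 2 * (tubeCoframe 5 x * tubeCoframe 5 y + tubeCoframe 6 x * tubeCoframe 6 y)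

section Tube

variable {M : Type*} [TopologicalSpace M] [ChartedSpace W M] [MulAction SU3 M]

/-- Along `γ : I → M`, the metric of `φ` is `dt² + f₁² g₁ + f₂² g₂ + f₃² g₃`. By invariance this
describes the metric on `SU(3) • γ(I)`. -/
def HasTubeMetric (φ : FormField M 3) (I : Set ℝ) (γ : ℝ → M) (f₁ f₂ f₃ : ℝ → ℝ) : Prop :=
  ∀ t ∈ I, ∀ x y : ℝ × LieSU3,
    g2Metric (φ (γ t)) (tubeMap γ t x) (tubeMap γ t y) = tubeMetric (f₁ t) (f₂ t) (f₃ t) x y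

/-- Along `γ : I → M`, the three-form `φ` is
`(f₁² ω₁ + f₂² ω₂ + f₃² ω₃) ∧ dt + f₁ f₂ f₃ (cos θ α + sin θ β)`. By invariance this describes `φ`
on `SU(3) • γ(I)`. -/
def HasTubeForm (φ : FormField M 3) (I : Set ℝ) (γ : ℝ → M) (f₁ f₂ f₃ θ : ℝ → ℝ) : Prop :=
  ∀ t ∈ I, (φ (γ t)).compContinuousLinearMap (tubeMap γ t) =
    tubePhi (f₁ t) (f₂ t) (f₃ t) (θ t)

end Tube

/-- The function `Ξ(x, μ, ν)`. -/
noncomputable def Xi (x μ ν : ℝ) : ℝ :=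
  (x ^ 8 + 2 * (2 * ν ^ 2 - μ ^ 2) * x ^ 4 + μ ^ 4) /
    (2 * x ^ 4 * (x ^ 4 + (2 * ν ^ 2 - μ ^ 2)
      + √(x ^ 8 + 2 * (2 * ν ^ 2 - μ ^ 2) * x ^ 4 + μ ^ 4)))

/-- The algebraic relations
`f₁² - μ² f₁⁻² = f₂² - ν² f₂⁻²` and `f₃² - (ν² - μ²) f₃⁻² = f₁² + μ² f₁⁻²` on `I`. -/
def AlgebraicRelations (μ ν : ℝ) (I : Set ℝ) (f₁ f₂ f₃ : ℝ → ℝ) : Prop :=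
  ∀ t ∈ I,
    f₁ t ^ 2 - μ ^ 2 / f₁ t ^ 2 = f₂ t ^ 2 - ν ^ 2 / f₂ t ^ 2 ∧
    f₃ t ^ 2 - (ν ^ 2 - μ ^ 2) / f₃ t ^ 2 = f₁ t ^ 2 + μ ^ 2 / f₁ t ^ 2

/-- The relation `f₃ cos θ = (f₁ f₂)'` on `I`. -/
def AngleRelation (I : Set ℝ) (f₁ f₂ f₃ θ : ℝ → ℝ) : Prop :=
  ∀ t ∈ I, f₃ t * Real.cos (θ t) = deriv (fun s => f₁ s * f₂ s) t

end G2SU3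

namespace G2SU3

/-! Linear algebra. A `G₂`-form knows lengths up to volume: the skew matrix `A` of `φ(u,·,·)` kills
`u` and satisfies `A Aᵀ = |u|² - u uᵀ`, whence `det (A + η ηᵀ)² = η(u)⁴ |u|⁸`
(`det_contraction_sq`). Comparing determinants under a change of basis shows that linear maps
between the `φ(θ)` are isometries, and yields a formula for the metric that is smooth in the form.
The cross product identity `inner_cross_cross` expresses `*φ` through the metric and `φ`, so metric
and Hodge dual may be computed in any adapted basis.

Closedness is a system of ordinary differential equations. Near a point of the tube, `M` is
parametrized by `q ↦ g exp(q₁E₁)⋯exp(q₆E₆) γ(t₀+q₀)`. An invariant form pulls back to products of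
`dt` and the components of a left logarithmic derivative, with coefficients depending on `t` only.
By invariance it suffices to differentiate at `q = 0`, where the Maurer–Cartan equation supplies the
structure equations. The outcome is that `d*φ = 0` means `(fᵢ² fⱼ²)' = 2 f₁f₂f₃ cos θ` for all `i <
j` (`extDeriv_tubeStar_eq_zero_iff`). The right side is the same for all pairs, so `f₁²(f₃²-f₂²) =
μ²` and `f₂²(f₃²-f₁²) = ν²` are conserved; these are (b) in polynomial form (`relations_iff`). What
is left is (c), and (a) is `cos² θ ≤ 1` once `f₂` and `f₃` are eliminated (`sq_deriv_mul_Xi`).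

Geometry of part (1). Orbits of dimension six have locally a smooth unit normal field `N`, and
normal curves are the integral curves of `±N`; they exist and are determined by one velocity. The
isotropy algebra of a point of `γ` has dimension `8 - 6 = 2`. It is abelian, hence conjugate to the
diagonal one. An element `exp c` of its group is a square, so it fixes the unit normal and therefore
all of `γ`. After a translation `T²` fixes `γ`, and the pull-back of `φ` is a `T²`-invariant form on
`ℝ ⊕ su(3)/t`. Such forms are `(a₁ω₁ + a₂ω₂ + a₃ω₃) ∧ dt + pα + qβ`. Being a `G₂`-form with unit
`∂ₜ` forces the `aᵢ` to have one sign and `(p² + q²)² = (a₁a₂a₃)²` (`IsAdapted.normalForm`). A Weyl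
group element makes the `aᵢ` positive; then `fᵢ = √aᵢ`, and `θ` is the angle of `(p, q)`.

Part (2). The quadratic equation behind (b) has one positive root, smooth in `f₁`. Condition (a)
makes `1 - c²` nonnegative for `c = (f₁f₂)'/f₃`. A nonnegative smooth function of one variable has a
`C¹` square root if its sign is switched at nondegenerate zeros, and a `C¹` curve in the circle has
a `C¹` angle. Finally the form prescribed along `γ` is `T²`-invariant, so it spreads uniquely to an
invariant form, which is closed by the equations above. -/

/-! ### Linear algebra of `G₂`-forms: the cross product, the metric and the Hodge dual -/

theorem wedge_three {V : Type*} [AddCommGroup V] [Module ℝ V] [TopologicalSpace V]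
    (a b c : V →L[ℝ] ℝ) (x y z : V) :
    wedge ![a, b, c] ![x, y, z] =
      a x * b y * c z - a x * c y * b z - b x * a y * c z + b x * c y * a z
        + c x * a y * b z - c x * b y * a z := by
  rw [wedge_apply, Matrix.det_fin_three]
  simp

theorem wedge_four {V : Type*} [AddCommGroup V] [Module ℝ V] [TopologicalSpace V]
    (a b c d : V →L[ℝ] ℝ) (x y z w : V) :
    wedge ![a, b, c, d] ![x, y, z, w] =
      (a x * b y - b x * a y) * (c z * d w - d z * c w)
      - (a x * c y - c x * a y) * (b z * d w - d z * b w)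
      + (a x * d y - d x * a y) * (b z * c w - c z * b w)
      + (b x * c y - c x * b y) * (a z * d w - d z * a w)
      - (b x * d y - d x * b y) * (a z * c w - c z * a w)
      + (c x * d y - d x * c y) * (a z * b w - b z * a w) := by
  rw [wedge_apply, Matrix.det_succ_row_zero]
  simp [Fin.sum_univ_succ, Matrix.det_fin_three, Fin.succAbove, Matrix.submatrix]
  ring

/-- The components of the cross product of `φ(θ)`. -/
noncomputable def cross (θ : ℝ) (u v : W) : W :=
  WithLp.toLp 2 fun k => phiForm stdCoframe θ ![u, v, EuclideanSpace.single k 1]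

theorem stdCoframe_apply (i : Fin 7) (x : W) : stdCoframe i x = x i := rfl

theorem cross_apply (θ : ℝ) (u v : W) (k : Fin 7) :
    cross θ u v k = phiForm stdCoframe θ ![u, v, EuclideanSpace.single k 1] := rfl

theorem inner_eq_sum (x y : W) : inner ℝ x y = ∑ i, x i * y i := by
  simp [PiLp.inner_apply, mul_comm]

theorem phiForm_apply (θ : ℝ) (x y z : W) :
    phiForm stdCoframe θ ![x, y, z] = inner ℝ (cross θ x y) z := by
  rw [inner_eq_sum]
  simp only [cross_apply, phiForm, alphaForm, betaForm, ContinuousAlternatingMap.add_apply,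
    ContinuousAlternatingMap.sub_apply, ContinuousAlternatingMap.smul_apply, wedge_three,
    stdCoframe_apply, Fin.sum_univ_seven, smul_eq_mul, PiLp.single_apply]
  simp only [Fin.reduceEq, if_true, if_false]
  ring

-- This ties `*φ` to data that isometries preserving `φ` obviously respect, and it contains the
-- relation `A Aᵀ = |u|² - u uᵀ` as the case `w = u`. It is a polynomial identity modulo `cos² +
-- sin² = 1`.
set_option maxRecDepth 20000 in
set_option maxHeartbeats 1000000 in
theorem inner_cross_cross (θ : ℝ) (u v w x : W) :
    inner ℝ (cross θ u v) (cross θ w x) =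
      inner ℝ u w * inner ℝ v x - inner ℝ u x * inner ℝ v w
        + starPhiForm stdCoframe θ ![u, v, w, x] := by
  have h := Real.cos_sq_add_sin_sq θ
  simp only [inner_eq_sum]
  simp only [cross_apply, phiForm, alphaForm, betaForm, starPhiForm,
    ContinuousAlternatingMap.add_apply,
    ContinuousAlternatingMap.sub_apply, ContinuousAlternatingMap.smul_apply, wedge_three,
    wedge_four, stdCoframe_apply, Fin.sum_univ_seven, smul_eq_mul, PiLp.single_apply]
  simp only [Fin.reduceEq, if_true, if_false, mul_one, mul_zero, sub_zero, zero_sub, add_zero, zero_add]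
  generalize Real.cos θ = c at *
  generalize Real.sin θ = s at *
  -- In each of the planes `12`, `34`, `56` the covector `β(u,v,·)` is a quarter turn of `α(u,v,·)`,
  -- so the mixed terms in `cos θ sin θ` cancel. The coefficient is the sum of `α(u,v,eₖ) α(w,x,eₖ)`
  -- over `k = 1, …, 6`.
  linear_combination ((0 - (u 4 * v 5 - u 5 * v 4) - (u 3 * v 6 - u 6 * v 3)) * (0 - (w 4 * x 5 - w 5 * x 4) - (w 3 * x 6 - w 6 * x 3))
    + ((u 4 * v 6 - u 6 * v 4) - (u 3 * v 5 - u 5 * v 3)) * ((w 4 * x 6 - w 6 * x 4) - (w 3 * x 5 - w 5 * x 3))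
    + ((u 2 * v 5 - u 5 * v 2) + (u 1 * v 6 - u 6 * v 1)) * ((w 2 * x 5 - w 5 * x 2) + (w 1 * x 6 - w 6 * x 1))
    + (0 - (u 2 * v 6 - u 6 * v 2) + (u 1 * v 5 - u 5 * v 1)) * (0 - (w 2 * x 6 - w 6 * x 2) + (w 1 * x 5 - w 5 * x 1))
    + (0 - (u 2 * v 3 - u 3 * v 2) - (u 1 * v 4 - u 4 * v 1)) * (0 - (w 2 * x 3 - w 3 * x 2) - (w 1 * x 4 - w 4 * x 1))
    + ((u 2 * v 4 - u 4 * v 2) - (u 1 * v 3 - u 3 * v 1)) * ((w 2 * x 4 - w 4 * x 2) - (w 1 * x 3 - w 3 * x 1))) * h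


/-- The standard basis vectors of `W`. -/
noncomputable abbrev stdVec (i : Fin 7) : W := EuclideanSpace.single i 1

/-- The skew-symmetric matrix of the two-form `φ(u, ·, ·)`. -/
noncomputable def contraction (φ : W [⋀^Fin 3]→L[ℝ] ℝ) (u : W) : Matrix (Fin 7) (Fin 7) ℝ :=
  Matrix.of fun i j => φ ![u, stdVec i, stdVec j]

theorem sum_smul_stdVec (x : W) : ∑ i, x i • stdVec i = x := by
  ext j
  simp [Finset.sum_apply, stdVec, Pi.single_apply]

theorem inner_stdVec (x : W) (i : Fin 7) : inner ℝ x (stdVec i) = x i := by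
  simp [stdVec, EuclideanSpace.inner_single_right]

theorem contraction_phiForm (θ : ℝ) (u : W) (i j : Fin 7) :
    contraction (phiForm stdCoframe θ) u i j = cross θ u (stdVec i) j := rfl

theorem threeForm_first_last {V : Type*} [AddCommGroup V] [Module ℝ V] [TopologicalSpace V]
    (φ : V [⋀^Fin 3]→L[ℝ] ℝ) (u x : V) : φ ![u, x, u] = 0 :=
  φ.map_eq_zero_of_eq _ (i := 0) (j := 2) (by simp) (by decide)

theorem contraction_mulVec_self (θ : ℝ) (u : W) :
    contraction (phiForm stdCoframe θ) u *ᵥ (u : Fin 7 → ℝ) = 0 := by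
  ext i
  have h := phiForm_apply θ u (stdVec i) u
  rw [threeForm_first_last, inner_eq_sum] at h
  simpa [Matrix.mulVec, dotProduct, contraction_phiForm] using h.symm

theorem vecMul_contraction_self (θ : ℝ) (u : W) :
    (u : Fin 7 → ℝ) ᵥ* contraction (phiForm stdCoframe θ) u = 0 := by
  have ht : (contraction (phiForm stdCoframe θ) u)ᵀ = -contraction (phiForm stdCoframe θ) u := by
    ext i j
    have := (phiForm stdCoframe θ).map_swap ![u, stdVec i, stdVec j] (i := 1) (j := 2) (by decide)
    have e : (![u, stdVec i, stdVec j] ∘ Equiv.swap (1 : Fin 3) 2) = ![u, stdVec j, stdVec i] := by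
      ext k; fin_cases k <;> rfl
    rw [e] at this
    simpa [contraction] using this
  have h := contraction_mulVec_self θ u
  rw [← Matrix.mulVec_transpose, ht, Matrix.neg_mulVec, h, neg_zero]

/-- The four-form term of `inner_cross_cross` vanishes on `u, eᵢ, u, eⱼ`. Thus `u ×` is `|u|` times
an isometry on the orthogonal complement of `u`. -/
theorem contraction_mul_transpose (θ : ℝ) (u : W) :
    contraction (phiForm stdCoframe θ) u * (contraction (phiForm stdCoframe θ) u)ᵀ =
      ((u : Fin 7 → ℝ) ⬝ᵥ u) • (1 : Matrix (Fin 7) (Fin 7) ℝ) - Matrix.vecMulVec u u := by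
  ext i j
  have h := inner_cross_cross θ u (stdVec i) u (stdVec j)
  have h0 : starPhiForm stdCoframe θ ![u, stdVec i, u, stdVec j] = 0 :=
    (starPhiForm stdCoframe θ).map_eq_zero_of_eq _ (i := 0) (j := 2) (by simp) (by decide)
  rw [h0, inner_eq_sum, inner_eq_sum u u, inner_stdVec, inner_stdVec, real_inner_comm,
    inner_stdVec] at h
  simp only [Matrix.mul_apply, Matrix.transpose_apply, contraction_phiForm, h, Matrix.sub_apply,
    Matrix.smul_apply, Matrix.vecMulVec_apply, smul_eq_mul, Matrix.one_apply, dotProduct]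
  have h1 : (stdVec i : W) j = if i = j then 1 else 0 := by
    simp [stdVec, PiLp.single_apply, eq_comm]
  rw [h1]
  ring

/-- Adding `u uᵀ/|u|` to `A` repairs its kernel and makes it `|u|` times an orthogonal matrix `Q`,
so that `det Q² = |u|¹⁴`. The matrix in question differs from `Q` by a matrix of rank two, and the
determinant is reduced to one of size two. The auxiliary `η` allows the square of a length to be
read off from a determinant although `A` itself is singular. -/
theorem det_contraction_sq (θ : ℝ) (u : W) (hu : u ≠ 0) (η : Fin 7 → ℝ) :
    (contraction (phiForm stdCoframe θ) u + Matrix.vecMulVec η η).det ^ 2 =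
      (η ⬝ᵥ u) ^ 4 * ((u : Fin 7 → ℝ) ⬝ᵥ u) ^ 4 := by
  set A := contraction (phiForm stdCoframe θ) u with hA
  set s : ℝ := (u : Fin 7 → ℝ) ⬝ᵥ u with hs
  have hspos : 0 < s := by
    have : s = inner ℝ u u := by rw [inner_eq_sum]; rfl
    rw [this]; exact real_inner_self_pos.2 hu
  set r := √s with hr
  have hrpos : 0 < r := Real.sqrt_pos.2 hspos
  have hr2 : r ^ 2 = s := Real.sq_sqrt hspos.le
  have hAu : A *ᵥ (u : Fin 7 → ℝ) = 0 := contraction_mulVec_self θ u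
  have huA : (u : Fin 7 → ℝ) ᵥ* A = 0 := vecMul_contraction_self θ u
  set Q := A + (1 / r) • Matrix.vecMulVec (u : Fin 7 → ℝ) u with hQ
  have hQQ : Q * Qᵀ = s • (1 : Matrix (Fin 7) (Fin 7) ℝ) := by
    rw [hQ, Matrix.transpose_add, Matrix.transpose_smul, Matrix.transpose_vecMulVec, mul_add,
      add_mul, add_mul, contraction_mul_transpose, Matrix.smul_mul, Matrix.vecMulVec_mul,
      Matrix.vecMul_transpose, hAu, Matrix.vecMulVec_zero, Matrix.mul_smul, Matrix.mul_vecMulVec,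
      hAu, Matrix.zero_vecMulVec, Matrix.smul_mul, Matrix.mul_smul, Matrix.vecMulVec_mul_vecMulVec,
      ← hs, smul_smul, smul_zero, add_zero]
    rw [Matrix.vecMulVec_smul, smul_smul]
    have : 1 / r * (1 / r) * s = 1 := by rw [← hr2]; field_simp
    rw [zero_add, this, one_smul, sub_add_cancel]
  have hQu : Q *ᵥ (u : Fin 7 → ℝ) = r • (u : Fin 7 → ℝ) := by
    rw [hQ, Matrix.add_mulVec, hAu, zero_add, Matrix.smul_mulVec, Matrix.vecMulVec_mulVec]
    ext i
    simp only [Pi.smul_apply, op_smul_eq_mul, smul_eq_mul, ← hs, ← hr2]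
    field_simp
  have huQ : (u : Fin 7 → ℝ) ᵥ* Q = r • (u : Fin 7 → ℝ) := by
    rw [hQ, Matrix.vecMul_add, huA, zero_add, Matrix.vecMul_smul, Matrix.vecMul_vecMulVec]
    ext i
    simp only [Pi.smul_apply, smul_eq_mul, ← hs, ← hr2]
    field_simp
  have hdetQ : Q.det ^ 2 = s ^ 7 := by
    have := congrArg Matrix.det hQQ
    rw [Matrix.det_mul, Matrix.det_transpose, Matrix.det_smul, Matrix.det_one] at this
    simpa [sq] using this
  -- `ζ = Q⁻¹ η`, because `Q⁻¹ = Qᵀ / s`. The columns of `U` below are `-u/s` and `ζ`; the first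
  -- removes the correction `u uᵀ/r`, the second adds `η ηᵀ`.
  set ζ : Fin 7 → ℝ := (1 / s) • (Qᵀ *ᵥ η) with hζ
  have hQζ : Q *ᵥ ζ = η := by
    rw [hζ, Matrix.mulVec_smul, Matrix.mulVec_mulVec, hQQ, Matrix.smul_mulVec, Matrix.one_mulVec,
      smul_smul, one_div_mul_cancel hspos.ne', one_smul]
  let U : Matrix (Fin 7) (Fin 2) ℝ := Matrix.of fun i k => ![-(1 / s) * u i, ζ i] k
  let T : Matrix (Fin 2) (Fin 7) ℝ := Matrix.of ![(u : Fin 7 → ℝ), η]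
  have hfac : A + Matrix.vecMulVec η η = Q * (1 + U * T) := by
    have h1 : U * T = (-(1 / s)) • Matrix.vecMulVec (u : Fin 7 → ℝ) u + Matrix.vecMulVec ζ η := by
      ext i j
      simp [U, T, Matrix.mul_apply, Fin.sum_univ_two, Matrix.vecMulVec_apply]
      ring
    rw [h1, mul_add, mul_add, mul_one, Matrix.mul_smul, Matrix.mul_vecMulVec, hQu,
      Matrix.mul_vecMulVec, hQζ, hQ, Matrix.smul_vecMulVec, smul_smul]
    have : -(1 / s) * r = -(1 / r) := by rw [← hr2]; field_simp
    rw [this, neg_smul]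
    abel
  have huζ : (u : Fin 7 → ℝ) ⬝ᵥ ζ = (1 / r) * (η ⬝ᵥ u) := by
    rw [hζ, dotProduct_smul, Matrix.mulVec_transpose, dotProduct_comm, ← Matrix.dotProduct_mulVec,
      hQu, dotProduct_smul, smul_eq_mul, smul_eq_mul, ← hr2]
    field_simp
  have hsmall : (1 + T * U).det = (1 / r) * (η ⬝ᵥ u) * ((1 / s) * (η ⬝ᵥ u)) := by
    have e00 : (T * U) 0 0 = -1 := by
      have : (T * U) 0 0 = -(1 / s) * s := by
        simp only [T, U, Matrix.mul_apply, hs, dotProduct, Finset.mul_sum, Matrix.of_apply]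
        refine Finset.sum_congr rfl fun i _ => ?_
        simp; ring
      rw [this]; field_simp
    have e01 : (T * U) 0 1 = (u : Fin 7 → ℝ) ⬝ᵥ ζ := by
      simp [T, U, Matrix.mul_apply, dotProduct]
    have e10 : (T * U) 1 0 = -((1 / s) * (η ⬝ᵥ u)) := by
      simp only [T, U, Matrix.mul_apply, dotProduct, Finset.mul_sum, Matrix.of_apply,
        ← Finset.sum_neg_distrib]
      refine Finset.sum_congr rfl fun i _ => ?_
      simp; ring
    rw [Matrix.det_fin_two]
    simp only [Matrix.add_apply, e00, e01, e10, huζ, Matrix.one_apply]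
    simp
  rw [hfac, Matrix.det_mul, Matrix.det_one_add_mul_comm, hsmall, mul_pow, hdetQ, ← hr2]
  field_simp

/-- The matrix of a linear map of `W`. -/
noncomputable def stdMatrix (b : W →L[ℝ] W) : Matrix (Fin 7) (Fin 7) ℝ :=
  Matrix.of fun k i => b (stdVec i) k

theorem stdMatrix_mulVec (b : W →L[ℝ] W) (x : W) : stdMatrix b *ᵥ (x : Fin 7 → ℝ) = b x := by
  ext k
  conv_rhs => rw [← sum_smul_stdVec x]
  simp [stdMatrix, Matrix.mulVec, dotProduct, mul_comm]

theorem threeForm_sum_right {V : Type*} [AddCommGroup V] [Module ℝ V] [TopologicalSpace V]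
    (φ : V [⋀^Fin 3]→L[ℝ] ℝ) (u x : V) {ι : Type*} (s : Finset ι) (c : ι → ℝ) (y : ι → V) :
    φ ![u, x, ∑ i ∈ s, c i • y i] = ∑ i ∈ s, c i * φ ![u, x, y i] := by
  have e : ∀ z, ![u, x, z] = Function.update ![u, x, 0] 2 z := by
    intro z; ext k; fin_cases k <;> rfl
  have := map_sum (φ.toMultilinearMap.toLinearMap ![u, x, 0] 2) (fun i => c i • y i) s
  simp only [map_smul, smul_eq_mul] at this
  rw [e]
  simp only [e (y _)]
  exact this

theorem threeForm_swap {V : Type*} [AddCommGroup V] [Module ℝ V] [TopologicalSpace V]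
    (φ : V [⋀^Fin 3]→L[ℝ] ℝ) (u x y : V) : φ ![u, x, y] = -φ ![u, y, x] := by
  have := φ.map_swap ![u, y, x] (i := 1) (j := 2) (by decide)
  have e : (![u, y, x] ∘ Equiv.swap (1 : Fin 3) 2) = ![u, x, y] := by
    ext k; fin_cases k <;> rfl
  rw [e] at this
  exact this

theorem comp_three {V V' : Type*} [AddCommGroup V] [Module ℝ V] [TopologicalSpace V]
    [AddCommGroup V'] [Module ℝ V'] [TopologicalSpace V'] (b : V → V') (u x y : V) :
    b ∘ ![u, x, y] = ![b u, b x, b y] := by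
  ext k; fin_cases k <;> rfl

theorem contraction_comp (φ : W [⋀^Fin 3]→L[ℝ] ℝ) (b : W →L[ℝ] W) (u : W) :
    contraction (φ.compContinuousLinearMap b) u =
      (stdMatrix b)ᵀ * contraction φ (b u) * stdMatrix b := by
  ext i j
  have hb : ∀ i, b (stdVec i) = ∑ k, stdMatrix b k i • stdVec k := fun i =>
    (sum_smul_stdVec (b (stdVec i))).symm
  have h1 : ∀ x i, φ ![b u, x, b (stdVec i)] = ∑ k, stdMatrix b k i * φ ![b u, x, stdVec k] := by
    intro x i
    rw [hb i, threeForm_sum_right]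
  have h2 : contraction (φ.compContinuousLinearMap b) u i j
      = φ ![b u, b (stdVec i), b (stdVec j)] := by
    simp only [contraction, Matrix.of_apply, ContinuousAlternatingMap.compContinuousLinearMap_apply]
    congr 1
    ext k; fin_cases k <;> rfl
  rw [h2, h1, Matrix.mul_apply]
  refine Finset.sum_congr rfl fun k _ => ?_
  rw [mul_comm, threeForm_swap, h1, Matrix.mul_apply]
  congr 1
  rw [← Finset.sum_neg_distrib]
  refine Finset.sum_congr rfl fun l _ => ?_
  rw [threeForm_swap]
  simp [contraction]

/-- A linear map carrying one `φ(θ)` to another is an isometry. -/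
theorem norm_eq_of_comp_eq {θ θ' : ℝ} (b : W →L[ℝ] W)
    (h : phiForm stdCoframe θ = (phiForm stdCoframe θ').compContinuousLinearMap b)
    (hb : Function.Injective b) (x y : W) : inner ℝ (b x) (b y) = inner ℝ x y := by
  set B := stdMatrix b with hB
  have key : ∀ u : W, inner ℝ u u = |B.det| * inner ℝ (b u) (b u) := by
    intro u
    by_cases hu : u = 0
    · simp [hu]
    have hbu : b u ≠ 0 := fun h0 => hu (hb (by simpa using h0))
    have hBdet : B.det ≠ 0 := by
      intro h0
      obtain ⟨v, hv, hv'⟩ := Matrix.exists_mulVec_eq_zero_iff.2 h0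
      have h1 := stdMatrix_mulVec b (WithLp.toLp 2 v)
      apply hv
      have h2 : b (WithLp.toLp 2 v) = 0 := by
        ext k; rw [← h1]; exact congrFun hv' k
      have h3 := hb (h2.trans (map_zero b).symm)
      ext k
      exact congrArg (fun w : W => w k) h3
    -- The covector `u` transported to the target of `b`; then `A + u uᵀ` at `u` is congruent
    -- through `B` to `A' + η ηᵀ` at `b u`.
    set η : Fin 7 → ℝ := B⁻¹ᵀ *ᵥ (u : Fin 7 → ℝ) with hη
    have hunit : IsUnit B.det := isUnit_iff_ne_zero.2 hBdet
    have hBη : Bᵀ *ᵥ η = u := by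
      rw [hη, Matrix.mulVec_mulVec, ← Matrix.transpose_mul, Matrix.nonsing_inv_mul _ hunit,
        Matrix.transpose_one, Matrix.one_mulVec]
    have h1 := det_contraction_sq θ u hu (u : Fin 7 → ℝ)
    have h2 := det_contraction_sq θ' (b u) hbu η
    have hηu : η ⬝ᵥ (b u : Fin 7 → ℝ) = (u : Fin 7 → ℝ) ⬝ᵥ u := by
      rw [← stdMatrix_mulVec, Matrix.dotProduct_mulVec, ← Matrix.mulVec_transpose, hBη]
    have h3 : contraction (phiForm stdCoframe θ) u + Matrix.vecMulVec (u : Fin 7 → ℝ) u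
        = Bᵀ * (contraction (phiForm stdCoframe θ') (b u) + Matrix.vecMulVec η η) * B := by
      conv_lhs => rw [h]
      rw [contraction_comp, mul_add, add_mul, Matrix.mul_vecMulVec, Matrix.vecMulVec_mul, hBη,
        ← Matrix.mulVec_transpose, hBη]
    rw [h3, Matrix.det_mul, Matrix.det_mul, Matrix.det_transpose] at h1
    have h4 : ((u : Fin 7 → ℝ) ⬝ᵥ u) = inner ℝ u u := by rw [inner_eq_sum]; rfl
    have h5 : ((b u : Fin 7 → ℝ) ⬝ᵥ (b u)) = inner ℝ (b u) (b u) := by rw [inner_eq_sum]; rfl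
    rw [hηu, h5, h4] at h2
    rw [h4] at h1
    have hs : 0 < (inner ℝ u u : ℝ) := real_inner_self_pos.2 hu
    have hs' : 0 < (inner ℝ (b u) (b u) : ℝ) := real_inner_self_pos.2 hbu
    have h6 : (inner ℝ u u : ℝ) ^ 4 = (|B.det| * inner ℝ (b u) (b u)) ^ 4 := by
      have e : (|B.det|) ^ 4 = B.det ^ 4 := by
        rw [← abs_pow]; exact abs_of_nonneg (by positivity)
      rw [mul_pow, e]
      have h7 : (inner ℝ u u : ℝ) ^ 4 * (inner ℝ u u) ^ 4
          = (inner ℝ u u) ^ 4 * (B.det ^ 4 * (inner ℝ (b u) (b u)) ^ 4) := by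
        rw [← h1]
        linear_combination B.det ^ 4 * h2
      exact mul_left_cancel₀ (by positivity) h7
    exact (pow_left_inj₀ hs.le (by positivity) (by norm_num)).1 h6
  have pol : ∀ u v : W, inner ℝ u v = |B.det| * inner ℝ (b u) (b v) := by
    intro u v
    have h1 := key (u + v)
    rw [map_add, inner_add_left, inner_add_right, inner_add_right, inner_add_left, inner_add_right,
      inner_add_right, real_inner_comm u v, real_inner_comm (b u) (b v)] at h1
    linarith [key u, key v]
  have hmat : (1 : Matrix (Fin 7) (Fin 7) ℝ) = |B.det| • (Bᵀ * B) := by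
    ext i j
    have := pol (stdVec i) (stdVec j)
    rw [inner_stdVec, inner_eq_sum] at this
    simp only [Matrix.one_apply, Matrix.smul_apply, Matrix.mul_apply, Matrix.transpose_apply,
      smul_eq_mul]
    simpa [stdVec, PiLp.single_apply, eq_comm, hB, stdMatrix] using this
  -- So far `b` is conformal with factor governed by `|det B|`. Taking determinants in `1 = |det B|
  -- BᵀB` in dimension seven gives `|det B|⁹ = 1`.
  have hdet : |B.det| = 1 := by
    have h1 := congrArg Matrix.det hmat
    rw [Matrix.det_one, Matrix.det_smul, Matrix.det_mul, Matrix.det_transpose] at h1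
    have h2 : |B.det| ^ 9 = 1 := by
      rw [h1, ← abs_mul_abs_self B.det]
      simp only [Fintype.card_fin]
      ring
    exact (pow_eq_one_iff_of_nonneg (abs_nonneg _) (by norm_num)).1 h2
  rw [pol x y, hdet, one_mul]

section

variable {V : Type*} [AddCommGroup V] [Module ℝ V] [TopologicalSpace V]

theorem IsAdapted.comp_eq {φ : V [⋀^Fin 3]→L[ℝ] ℝ} {b b' : V ≃L[ℝ] W} {θ θ' : ℝ}
    (h : IsAdapted φ b θ) (h' : IsAdapted φ b' θ') :
    phiForm stdCoframe θ = (phiForm stdCoframe θ').compContinuousLinearMap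
      ((b.symm.trans b' : W ≃L[ℝ] W) : W →L[ℝ] W) := by
  ext x
  have h1 := DFunLike.congr_fun (h.symm.trans h') (fun i => b.symm (x i))
  simp only [ContinuousAlternatingMap.compContinuousLinearMap_apply] at h1
  have e : (⇑(b : V →L[ℝ] W) ∘ fun i => b.symm (x i)) = x := by ext i; simp
  rw [e] at h1
  rw [h1]
  rfl

/-- The metric of a `G₂`-form may be computed in any adapted basis. -/
theorem IsAdapted.g2Metric_eq {φ : V [⋀^Fin 3]→L[ℝ] ℝ} {b : V ≃L[ℝ] W} {θ : ℝ}
    (h : IsAdapted φ b θ) (x y : V) : g2Metric φ x y = inner ℝ (b x) (b y) := by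
  have hG : IsG2Form φ := ⟨b, θ, h⟩
  have h' : IsAdapted φ hG.choose hG.choose_spec.choose := hG.choose_spec.choose_spec
  rw [g2Metric, dif_pos hG]
  have := norm_eq_of_comp_eq _ (h.comp_eq h') (ContinuousLinearEquiv.injective _) (b x) (b y)
  simpa using this

theorem comp_four {V V' : Type*} (b : V → V') (u x y z : V) :
    b ∘ ![u, x, y, z] = ![b u, b x, b y, b z] := by
  ext k; fin_cases k <;> rfl

/-- An isometry that carries one three-form to the other also carries one cross product to the
other, and `inner_cross_cross` writes the four-form through inner and cross products. -/
theorem starPhiForm_comp {θ θ' : ℝ} (b : W ≃L[ℝ] W)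
    (h : phiForm stdCoframe θ = (phiForm stdCoframe θ').compContinuousLinearMap (b : W →L[ℝ] W)) :
    starPhiForm stdCoframe θ =
      (starPhiForm stdCoframe θ').compContinuousLinearMap (b : W →L[ℝ] W) := by
  have hi : ∀ x y : W, inner ℝ (b x) (b y) = inner ℝ x y :=
    norm_eq_of_comp_eq (b : W →L[ℝ] W) h b.injective
  have hc : ∀ u v : W, b (cross θ u v) = cross θ' (b u) (b v) := by
    intro u v
    refine ext_inner_right ℝ fun z => ?_
    obtain ⟨z, rfl⟩ := b.surjective z
    rw [hi, ← phiForm_apply, ← phiForm_apply, h,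
      ContinuousAlternatingMap.compContinuousLinearMap_apply]
    congr 1
    ext k; fin_cases k <;> rfl
  ext x
  have hx : x = ![x 0, x 1, x 2, x 3] := by ext k; fin_cases k <;> rfl
  rw [hx, ContinuousAlternatingMap.compContinuousLinearMap_apply, comp_four]
  have h1 := inner_cross_cross θ (x 0) (x 1) (x 2) (x 3)
  have h2 := inner_cross_cross θ' (b (x 0)) (b (x 1)) (b (x 2)) (b (x 3))
  rw [← hc, ← hc, hi, hi, hi, hi, hi] at h2
  exact add_left_cancel (h1.symm.trans h2)

/-- The Hodge dual of a `G₂`-form may be computed in any adapted basis. -/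
theorem IsAdapted.g2Star_eq {φ : V [⋀^Fin 3]→L[ℝ] ℝ} {b : V ≃L[ℝ] W} {θ : ℝ}
    (h : IsAdapted φ b θ) :
    g2Star φ = (starPhiForm stdCoframe θ).compContinuousLinearMap (b : V →L[ℝ] W) := by
  have hG : IsG2Form φ := ⟨b, θ, h⟩
  have h' : IsAdapted φ hG.choose hG.choose_spec.choose := hG.choose_spec.choose_spec
  rw [g2Star, dif_pos hG, starPhiForm_comp _ (h.comp_eq h')]
  ext x
  simp only [ContinuousAlternatingMap.compContinuousLinearMap_apply]
  congr 1
  ext i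
  simp

variable {V' : Type*} [AddCommGroup V'] [Module ℝ V'] [TopologicalSpace V']

theorem IsAdapted.comp {φ : V [⋀^Fin 3]→L[ℝ] ℝ} {b : V ≃L[ℝ] W} {θ : ℝ}
    (h : IsAdapted φ b θ) (T : V' ≃L[ℝ] V) :
    IsAdapted (φ.compContinuousLinearMap (T : V' →L[ℝ] V)) (T.trans b) θ := by
  unfold IsAdapted at *
  rw [h]
  rfl

theorem IsG2Form.comp {φ : V [⋀^Fin 3]→L[ℝ] ℝ} (h : IsG2Form φ) (T : V' ≃L[ℝ] V) :
    IsG2Form (φ.compContinuousLinearMap (T : V' →L[ℝ] V)) := by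
  obtain ⟨b, θ, hb⟩ := h
  exact ⟨_, _, hb.comp T⟩

theorem g2Metric_comp {φ : V [⋀^Fin 3]→L[ℝ] ℝ} (h : IsG2Form φ) (T : V' ≃L[ℝ] V) (x y : V') :
    g2Metric (φ.compContinuousLinearMap (T : V' →L[ℝ] V)) x y = g2Metric φ (T x) (T y) := by
  obtain ⟨b, θ, hb⟩ := h
  rw [(hb.comp T).g2Metric_eq, hb.g2Metric_eq]
  rfl

theorem g2Star_comp {φ : V [⋀^Fin 3]→L[ℝ] ℝ} (h : IsG2Form φ) (T : V' ≃L[ℝ] V) :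
    g2Star (φ.compContinuousLinearMap (T : V' →L[ℝ] V)) =
      (g2Star φ).compContinuousLinearMap (T : V' →L[ℝ] V) := by
  obtain ⟨b, θ, hb⟩ := h
  rw [(hb.comp T).g2Star_eq, hb.g2Star_eq]
  rfl

end

/-- The metric of a `G₂`-form on `W` depends smoothly on the form. -/
theorem exists_contDiffAt_g2Metric :
    ∃ G : (W [⋀^Fin 3]→L[ℝ] ℝ) → Matrix (Fin 7) (Fin 7) ℝ, ∀ φ, IsG2Form φ →
      (∀ i j, ContDiffAt ℝ ∞ (fun ψ => G ψ i j) φ) ∧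
      ∀ i j, G φ i j = g2Metric φ (stdVec i) (stdVec j) := by
  -- Normalized so that `η(u) = 1`. For `φ = b^*φ(θ)` the squared determinant is then `(|det B| |b
  -- u|²)⁴`, positive for `u ≠ 0`, and its fourth root is smooth in `φ`. Polarizing on the basis
  -- vectors and their sums gives `KM = |det B| BᵀB`.
  let η : W → Fin 7 → ℝ := fun u => (1 / inner ℝ u u) • (u : Fin 7 → ℝ)
  let K : (W [⋀^Fin 3]→L[ℝ] ℝ) → W → ℝ := fun φ u =>
    ((contraction φ u + Matrix.vecMulVec (η u) (η u)).det ^ 2) ^ (1 / 4 : ℝ)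
  let KM : (W [⋀^Fin 3]→L[ℝ] ℝ) → Matrix (Fin 7) (Fin 7) ℝ := fun φ => Matrix.of fun i j =>
    if i = j then K φ (stdVec i)
    else (K φ (stdVec i + stdVec j) - K φ (stdVec i) - K φ (stdVec j)) / 2
  -- The matrix of the metric is `BᵀB`, so `det KM = |det B|⁷ det B² = |det B|⁹`; the ninth root
  -- removes the unknown factor.
  refine ⟨fun φ => ((KM φ).det ^ (1 / 9 : ℝ))⁻¹ • KM φ, ?_⟩
  rintro φ ⟨b, θ, hb⟩
  set B := stdMatrix (b : W →L[ℝ] W) with hB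
  have hBdet : B.det ≠ 0 := by
    intro h0
    obtain ⟨v, hv, hv'⟩ := Matrix.exists_mulVec_eq_zero_iff.2 h0
    have h1 := stdMatrix_mulVec (b : W →L[ℝ] W) (WithLp.toLp 2 v)
    apply hv
    have h2 : b (WithLp.toLp 2 v) = 0 := by
      ext k; exact (congrFun h1 k).symm.trans (congrFun hv' k)
    have h3 := b.injective (h2.trans (map_zero b).symm)
    ext k
    exact congrArg (fun w : W => w k) h3
  have hunit : IsUnit B.det := isUnit_iff_ne_zero.2 hBdet
  have hsq : ∀ u : W, u ≠ 0 → (contraction φ u + Matrix.vecMulVec (η u) (η u)).det ^ 2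
      = (|B.det| * inner ℝ (b u) (b u)) ^ 4 := by
    intro u hu
    have hbu : b u ≠ 0 := fun h0 => hu (b.injective (by simpa using h0))
    set ξ : Fin 7 → ℝ := B⁻¹ᵀ *ᵥ (η u) with hξ
    have hBξ : Bᵀ *ᵥ ξ = η u := by
      rw [hξ, Matrix.mulVec_mulVec, ← Matrix.transpose_mul, Matrix.nonsing_inv_mul _ hunit,
        Matrix.transpose_one, Matrix.one_mulVec]
    have h2 := det_contraction_sq θ (b u) hbu ξ
    have hξu : ξ ⬝ᵥ (b u : Fin 7 → ℝ) = 1 := by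
      have e : (b u : Fin 7 → ℝ) = B *ᵥ (u : Fin 7 → ℝ) :=
        (stdMatrix_mulVec (b : W →L[ℝ] W) u).symm
      rw [e, Matrix.dotProduct_mulVec, ← Matrix.mulVec_transpose, hBξ, smul_dotProduct,
        smul_eq_mul]
      have e2 : (u : Fin 7 → ℝ) ⬝ᵥ u = inner ℝ u u := by rw [inner_eq_sum]; rfl
      rw [e2, one_div_mul_cancel (real_inner_self_pos.2 hu).ne']
    have h3 : contraction φ u + Matrix.vecMulVec (η u) (η u)
        = Bᵀ * (contraction (phiForm stdCoframe θ) (b u) + Matrix.vecMulVec ξ ξ) * B := by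
      have hb' : φ = (phiForm stdCoframe θ).compContinuousLinearMap (b : W →L[ℝ] W) := hb
      rw [hb', contraction_comp, mul_add, add_mul, Matrix.mul_vecMulVec, Matrix.vecMulVec_mul, hBξ,
        ← Matrix.mulVec_transpose, hBξ]
      rfl
    have e : (|B.det|) ^ 4 = B.det ^ 4 := by
      rw [← abs_pow]; exact abs_of_nonneg (by positivity)
    have h5 : ((b u : Fin 7 → ℝ) ⬝ᵥ (b u)) = inner ℝ (b u) (b u) := by rw [inner_eq_sum]; rfl
    rw [h3, Matrix.det_mul, Matrix.det_mul, Matrix.det_transpose, mul_pow |B.det|, e, ← h5]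
    rw [hξu] at h2
    linear_combination B.det ^ 4 * h2
  have hpos : ∀ u : W, u ≠ 0 → 0 < |B.det| * inner ℝ (b u) (b u) := fun u hu =>
    mul_pos (abs_pos.2 hBdet)
      (real_inner_self_pos.2 fun h0 => hu (b.injective (by simpa using h0)))
  have hKval : ∀ u : W, u ≠ 0 → K φ u = |B.det| * inner ℝ (b u) (b u) := by
    intro u hu
    simp only [K]
    rw [hsq u hu, ← Real.rpow_natCast, ← Real.rpow_mul (hpos u hu).le]
    norm_num
  have hcontr : ∀ u i j, ContDiff ℝ ∞
      fun ψ : W [⋀^Fin 3]→L[ℝ] ℝ => contraction ψ u i j := by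
    intro u i j
    exact (ContinuousAlternatingMap.apply ℝ W ℝ ![u, stdVec i, stdVec j]).contDiff
  have hdetsm : ∀ (M : (W [⋀^Fin 3]→L[ℝ] ℝ) → Matrix (Fin 7) (Fin 7) ℝ),
      (∀ i j, ContDiffAt ℝ ∞ (fun ψ => M ψ i j) φ) → ContDiffAt ℝ ∞ (fun ψ => (M ψ).det) φ := by
    intro M hM
    simp only [Matrix.det_apply]
    refine ContDiffAt.sum fun σ _ => ?_
    exact (contDiffAt_prod fun i _ => hM _ _).const_smul _
  have hKsm : ∀ u : W, u ≠ 0 → ContDiffAt ℝ ∞ (fun ψ => K ψ u) φ := by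
    intro u hu
    refine ContDiffAt.rpow_const_of_ne ?_ ?_
    · refine (hdetsm _ fun i j => ?_).pow 2
      exact (hcontr u i j).contDiffAt.add contDiffAt_const
    · rw [hsq u hu]
      exact (pow_pos (hpos u hu) 4).ne'
  have hne : ∀ i : Fin 7, stdVec i ≠ 0 := by
    intro i h0
    have := congrArg (fun w : W => w i) h0
    simp [stdVec] at this
  have hne2 : ∀ i j : Fin 7, i ≠ j → stdVec i + stdVec j ≠ 0 := by
    intro i j hij h0
    have := congrArg (fun w : W => w i) h0
    simp [stdVec, hij] at this
  have hKMval : KM φ = |B.det| • (Bᵀ * B) := by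
    have hBB : ∀ i j, (Bᵀ * B) i j = inner ℝ (b (stdVec i)) (b (stdVec j)) := by
      intro i j
      rw [inner_eq_sum]
      rfl
    ext i j
    rw [Matrix.smul_apply, hBB, smul_eq_mul]
    by_cases hij : i = j
    · subst hij
      simp only [KM, Matrix.of_apply, if_true]
      exact hKval _ (hne i)
    · simp only [KM, Matrix.of_apply, if_neg hij]
      rw [hKval _ (hne i), hKval _ (hne j), hKval _ (hne2 i j hij), map_add, inner_add_left,
        inner_add_right, inner_add_right, real_inner_comm (b (stdVec i)) (b (stdVec j))]
      ring
  have hKMdet : (KM φ).det = |B.det| ^ 9 := by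
    rw [hKMval, Matrix.det_smul, Matrix.det_mul, Matrix.det_transpose, ← abs_mul_abs_self B.det]
    simp only [Fintype.card_fin]
    ring
  have hKMsm : ∀ i j, ContDiffAt ℝ ∞ (fun ψ => KM ψ i j) φ := by
    intro i j
    by_cases hij : i = j
    · subst hij
      simp only [KM, Matrix.of_apply, if_true]
      exact hKsm _ (hne i)
    · simp only [KM, Matrix.of_apply, if_neg hij]
      exact (((hKsm _ (hne2 i j hij)).sub (hKsm _ (hne i))).sub (hKsm _ (hne j))).div_const 2
  have hdpos : 0 < |B.det| := abs_pos.2 hBdet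
  constructor
  · intro i j
    simp only [Matrix.smul_apply, smul_eq_mul]
    refine ContDiffAt.mul (ContDiffAt.inv ?_ ?_) (hKMsm i j)
    · refine ContDiffAt.rpow_const_of_ne (hdetsm _ hKMsm) ?_
      rw [hKMdet]; positivity
    · rw [hKMdet]; positivity
  · intro i j
    have hroot : (|B.det| ^ 9) ^ (1 / 9 : ℝ) = |B.det| := by
      rw [← Real.rpow_natCast, ← Real.rpow_mul hdpos.le]
      norm_num
    simp only [Matrix.smul_apply, hKMdet, hroot]
    rw [hKMval, Matrix.smul_apply, smul_smul, inv_mul_cancel₀ hdpos.ne', one_smul,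
      hb.g2Metric_eq, inner_eq_sum]
    rfl

/-! ### Square roots and angles of functions of one variable, and the algebra of the relations (b)
-/

section Calculus

open Set Filter Topology

/-- A locally constant choice of signs on an open set of reals which changes at the points of a
discrete set. -/
theorem exists_sign_changing {U Z : Set ℝ} (hU : IsOpen U)
    (hZ : ∀ x ∈ U, ∀ᶠ y in 𝓝[≠] x, y ∉ Z) :
    ∃ s : ℝ → ℝ, (∀ x, s x = 1 ∨ s x = -1) ∧ ∀ x ∈ U, (∀ᶠ y in 𝓝[>] x, s y = s x) ∧
      (x ∈ Z → ∀ᶠ y in 𝓝[<] x, s y = -s x) ∧ (x ∉ Z → ∀ᶠ y in 𝓝[<] x, s y = s x) := by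
  classical
  -- A base point that depends only on the component of `x` in `U`.
  let b : ℝ → ℝ := fun x => Classical.epsilon fun z => z ∈ ordConnectedComponent U x
  -- The parity of the number of points of `Z` between the base point and `x`. The interval contains
  -- its right end only, which makes `s` constant to the right of every point and puts the jump to
  -- the left of the points of `Z`.
  let s : ℝ → ℝ := fun x => (-1) ^ (Z ∩ uIoc (b x) x).ncard
  have hfin : ∀ a c, uIcc a c ⊆ U → (Z ∩ uIoc a c).Finite := by
    intro a c hac
    have hK : IsCompact (uIcc a c) := isCompact_uIcc
    have : (uIcc a c ∩ Z).Finite := by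
      refine hK.induction_on (p := fun t => (t ∩ Z).Finite) (by simp)
        (fun t t' h1 h2 => h2.subset (inter_subset_inter_left _ h1))
        (fun t t' h1 h2 => by rw [union_inter_distrib_right]; exact h1.union h2) ?_
      intro x hx
      have h1 := hZ x (hac hx)
      rw [eventually_nhdsWithin_iff] at h1
      refine ⟨{y | y ∈ ({x} : Set ℝ)ᶜ → y ∉ Z}, mem_nhdsWithin_of_mem_nhds h1, ?_⟩
      refine (finite_singleton x).subset ?_
      rintro y ⟨hy1, hy2⟩
      by_contra hne
      exact hy1 hne hy2
    exact this.subset fun y hy => ⟨uIoc_subset_uIcc hy.2, hy.1⟩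
  have hb : ∀ x ∈ U, uIcc (b x) x ⊆ U := by
    intro x hx
    have h1 : b x ∈ ordConnectedComponent U x :=
      Classical.epsilon_spec (p := fun z => z ∈ ordConnectedComponent U x)
        ⟨x, self_mem_ordConnectedComponent.2 hx⟩
    rw [uIcc_comm]; exact h1
  have hbeq : ∀ x ∈ U, ∀ᶠ y in 𝓝 x, b y = b x := by
    intro x hx
    have h1 : ordConnectedComponent U x ∈ 𝓝 x :=
      ordConnectedComponent_mem_nhds.2 (hU.mem_nhds hx)
    filter_upwards [h1] with y hy
    have : ordConnectedComponent U x = ordConnectedComponent U y := ordConnectedComponent_eq hy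
    simp only [b, this]
  have hstep : ∀ A : Set ℝ, A.Finite → ∀ x ∉ A, ((-1 : ℝ)) ^ (insert x A).ncard = -(-1) ^ A.ncard := by
    intro A hA x hx
    rw [ncard_insert_of_notMem hx hA, pow_succ]; ring
  refine ⟨s, fun x => neg_one_pow_eq_or ℝ _, fun x hx => ?_⟩
  have hfx := hfin _ _ (hb x hx)
  have hright : ∀ᶠ y in 𝓝[>] x, ∀ z ∈ Ioc x y, z ∉ Z := by
    have h1 := (hZ x hx).filter_mono (nhdsWithin_mono x (fun y (hy : x < y) => ne_of_gt hy))
    obtain ⟨u, hu, hu'⟩ := (mem_nhdsGT_iff_exists_Ioo_subset).1 h1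
    filter_upwards [Ioo_mem_nhdsGT hu] with y hy z hz
    exact hu' ⟨hz.1, hz.2.trans_lt hy.2⟩
  have hleft : ∀ᶠ y in 𝓝[<] x, ∀ z ∈ Ico y x, z ∉ Z := by
    have h1 := (hZ x hx).filter_mono (nhdsWithin_mono x (fun y (hy : y < x) => ne_of_lt hy))
    obtain ⟨u, hu, hu'⟩ := (mem_nhdsLT_iff_exists_Ioo_subset).1 h1
    filter_upwards [Ioo_mem_nhdsLT hu] with y hy z hz
    exact hu' ⟨hy.1.trans_le hz.1, hz.2⟩
  have hL : ∀ᶠ y in 𝓝[<] x, (b y = b x ∧ (∀ z ∈ Ico y x, z ∉ Z) ∧ y < x) ∧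
      ((b x < x ∧ b x < y) ∨ x ≤ b x) := by
    refine ((((hbeq x hx).filter_mono nhdsWithin_le_nhds)).and
      (hleft.and self_mem_nhdsWithin)).and ?_
    rcases lt_or_ge (b x) x with h | h
    · filter_upwards [(lt_mem_nhds h).filter_mono nhdsWithin_le_nhds] with y hy
      exact Or.inl ⟨h, hy⟩
    · exact Eventually.of_forall fun y => Or.inr h
  refine ⟨?_, fun hxZ => ?_, fun hxZ => ?_⟩
  · have h3 : ∀ᶠ y in 𝓝[>] x, b x ≤ x ∨ (x < b x ∧ y < b x) := by
      rcases le_or_gt (b x) x with h | h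
      · exact Eventually.of_forall fun y => Or.inl h
      · filter_upwards [(gt_mem_nhds h).filter_mono nhdsWithin_le_nhds] with y hy
        exact Or.inr ⟨h, hy⟩
    filter_upwards [(hbeq x hx).filter_mono nhdsWithin_le_nhds, hright, self_mem_nhdsWithin, h3]
      with y hby hy hxy h3
    have hxy : x < y := hxy
    have : Z ∩ uIoc (b y) y = Z ∩ uIoc (b x) x := by
      rw [hby]
      rcases h3 with h | ⟨h, h'⟩
      · rw [uIoc_of_le h, uIoc_of_le (h.trans hxy.le)]
        ext z
        simp only [mem_inter_iff, mem_Ioc]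
        refine ⟨fun ⟨h1, h2, h3⟩ => ⟨h1, h2, ?_⟩, fun ⟨h1, h2, h3⟩ => ⟨h1, h2, h3.trans hxy.le⟩⟩
        by_contra hc
        exact hy z ⟨not_le.1 hc, h3⟩ h1
      · rw [uIoc_of_ge h.le, uIoc_of_ge h'.le]
        ext z
        simp only [mem_inter_iff, mem_Ioc]
        refine ⟨fun ⟨h1, h2, h3⟩ => ⟨h1, hxy.trans h2, h3⟩, fun ⟨h1, h2, h3⟩ => ⟨h1, ?_, h3⟩⟩
        by_contra hc
        exact hy z ⟨h2, not_lt.1 hc⟩ h1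
    simp only [s, this]
  · filter_upwards [hL] with y ⟨⟨hby, hy, hyx⟩, hcase⟩
    rcases hcase with ⟨h, h'⟩ | h
    · have e : Z ∩ uIoc (b x) x = insert x (Z ∩ uIoc (b y) y) := by
        rw [hby, uIoc_of_le h.le, uIoc_of_le h'.le]
        ext z
        simp only [mem_inter_iff, mem_Ioc, mem_insert_iff]
        constructor
        · rintro ⟨h1, h2, h3⟩
          rcases h3.eq_or_lt with h4 | h4
          · exact Or.inl h4
          · refine Or.inr ⟨h1, h2, ?_⟩
            by_contra hc
            exact hy z ⟨(not_le.1 hc).le, h4⟩ h1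
        · rintro (rfl | ⟨h1, h2, h3⟩)
          · exact ⟨hxZ, h, le_rfl⟩
          · exact ⟨h1, h2, h3.trans hyx.le⟩
      have hni : x ∉ Z ∩ uIoc (b y) y := by
        rw [hby, uIoc_of_le h'.le]
        rintro ⟨-, -, h4⟩
        exact absurd hyx (not_lt.2 h4)
      have hf : (Z ∩ uIoc (b y) y).Finite := hfx.subset (by rw [e]; exact subset_insert _ _)
      simp only [s]
      rw [e, hstep _ hf x hni, neg_neg]
    · have e : Z ∩ uIoc (b y) y = insert x (Z ∩ uIoc (b x) x) := by
        rw [hby, uIoc_of_ge h, uIoc_of_ge (hyx.le.trans h)]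
        ext z
        simp only [mem_inter_iff, mem_Ioc, mem_insert_iff]
        constructor
        · rintro ⟨h1, h2, h3⟩
          rcases lt_trichotomy z x with h4 | h4 | h4
          · exact absurd h1 (hy z ⟨h2.le, h4⟩)
          · exact Or.inl h4
          · exact Or.inr ⟨h1, h4, h3⟩
        · rintro (rfl | ⟨h1, h2, h3⟩)
          · exact ⟨hxZ, hyx, h⟩
          · exact ⟨h1, hyx.trans h2, h3⟩
      have hni : x ∉ Z ∩ uIoc (b x) x := by
        rw [uIoc_of_ge h]
        rintro ⟨-, h4, -⟩
        exact lt_irrefl _ h4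
      simp only [s]
      rw [e, hstep _ hfx x hni]
  · filter_upwards [hL] with y ⟨⟨hby, hy, hyx⟩, hcase⟩
    have e : Z ∩ uIoc (b y) y = Z ∩ uIoc (b x) x := by
      rcases hcase with ⟨h, h'⟩ | h
      · rw [hby, uIoc_of_le h.le, uIoc_of_le h'.le]
        ext z
        simp only [mem_inter_iff, mem_Ioc]
        refine ⟨fun ⟨h1, h2, h3⟩ => ⟨h1, h2, h3.trans hyx.le⟩, fun ⟨h1, h2, h3⟩ => ⟨h1, h2, ?_⟩⟩
        by_contra hc
        have hzx : z ≠ x := fun h0 => hxZ (h0 ▸ h1)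
        exact hy z ⟨(not_le.1 hc).le, lt_of_le_of_ne h3 hzx⟩ h1
      · rw [hby, uIoc_of_ge h, uIoc_of_ge (hyx.le.trans h)]
        ext z
        simp only [mem_inter_iff, mem_Ioc]
        refine ⟨fun ⟨h1, h2, h3⟩ => ⟨h1, ?_, h3⟩, fun ⟨h1, h2, h3⟩ => ⟨h1, hyx.trans h2, h3⟩⟩
        by_contra hc
        have hzx : z ≠ x := fun h0 => hxZ (h0 ▸ h1)
        exact hy z ⟨h2.le, lt_of_le_of_ne (not_lt.1 hc) hzx⟩ h1
    simp only [s, e]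

theorem abs_deriv_sub_le {F' F'' : ℝ → ℝ} {x r M : ℝ}
    (hF' : ∀ y ∈ Ioo (x - r) (x + r), HasDerivAt F' (F'' y) y)
    (hb : ∀ y ∈ Ioo (x - r) (x + r), |F'' y| ≤ M) {y z : ℝ}
    (hy : y ∈ Ioo (x - r) (x + r)) (hz : z ∈ Ioo (x - r) (x + r)) :
    |F' z - F' y| ≤ M * |z - y| :=
  (convex_Ioo _ _).norm_image_sub_le_of_norm_hasDerivWithin_le
    (fun u hu => (hF' u hu).hasDerivWithinAt) hb hy hz

/-- Glaeser's inequality `F'² ≤ 4 M F` near a zero of `F'` for nonnegative functions with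
`|F''| ≤ M`. -/
theorem sq_deriv_le {F F' F'' : ℝ → ℝ} {x r M : ℝ} (hM : 0 < M)
    (hF : ∀ y ∈ Ioo (x - r) (x + r), HasDerivAt F (F' y) y)
    (hF' : ∀ y ∈ Ioo (x - r) (x + r), HasDerivAt F' (F'' y) y)
    (hb : ∀ y ∈ Ioo (x - r) (x + r), |F'' y| ≤ M) (h0 : ∀ y ∈ Ioo (x - r) (x + r), 0 ≤ F y)
    (hx : F' x = 0) {y : ℝ} (hy : |y - x| < r / 2) : F' y ^ 2 ≤ 4 * M * F y := by
  have hr : 0 < r := by have := abs_nonneg (y - x); linarith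
  have hxm : x ∈ Ioo (x - r) (x + r) := ⟨by linarith, by linarith⟩
  have hy' := abs_lt.1 hy
  have hym : y ∈ Ioo (x - r) (x + r) := ⟨by linarith, by linarith⟩
  have h1 : |F' y| ≤ M * |y - x| := by
    have := abs_deriv_sub_le hF' hb hxm hym
    rwa [hx, sub_zero] at this
  -- The step that makes `F(y) - F'(y)τ + Mτ²` minimal. This bounds `F(y - τ) ≥ 0` from above, which
  -- is the inequality. Halving the radius keeps `y - τ` in the interval.
  set τ := F' y / (2 * M) with hτ
  have hτabs : |τ| < r / 2 := by
    rw [hτ, abs_div, abs_of_pos (by positivity : (0 : ℝ) < 2 * M), div_lt_iff₀ (by positivity)]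
    nlinarith [abs_nonneg (y - x)]
  have hτ' := abs_lt.1 hτabs
  set z := y - τ with hz
  have hzm : z ∈ Ioo (x - r) (x + r) := ⟨by rw [hz]; linarith, by rw [hz]; linarith⟩
  have hseg : ∀ u ∈ uIcc y z, u ∈ Ioo (x - r) (x + r) ∧ |u - y| ≤ |τ| := by
    intro u hu
    have hc : uIcc y z ⊆ Ioo (x - r) (x + r) := ordConnected_Ioo.uIcc_subset hym hzm
    refine ⟨hc hu, ?_⟩
    have h3 := abs_sub_left_of_mem_uIcc hu
    rwa [hz, show y - τ - y = -τ by ring, abs_neg] at h3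
  have h2 : |(F z - F' y * (z - y)) - (F y - F' y * (y - y))| ≤ (M * |τ|) * |z - y| := by
    refine (convex_uIcc y z).norm_image_sub_le_of_norm_hasDerivWithin_le
      (f := fun u => F u - F' y * (u - y)) (f' := fun u => F' u - F' y) (fun u hu => ?_)
      (fun u hu => ?_) left_mem_uIcc right_mem_uIcc
    · have h3 := ((hasDerivAt_id u).sub_const y).const_mul (F' y)
      simpa using ((hF u (hseg u hu).1).fun_sub h3).hasDerivWithinAt
    · refine (abs_deriv_sub_le hF' hb hym (hseg u hu).1).trans ?_
      exact mul_le_mul_of_nonneg_left (hseg u hu).2 hM.le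
  have h4 : z - y = -τ := by rw [hz]; ring
  rw [h4, abs_neg, mul_assoc, abs_mul_abs_self] at h2
  have h5 := (abs_le.1 h2).2
  have h6 := (abs_le.1 h2).1
  have h7 := h0 z hzm
  have h8 : F' y = 2 * M * τ := by rw [hτ]; field_simp
  rw [h8] at h5 h6 ⊢
  nlinarith

/-- A nonnegative smooth function on an open interval has a square root of class `C¹`. -/
theorem exists_contDiffOn_one_sqrt {I : Set ℝ} (hI : IsOpen I) {F : ℝ → ℝ}
    (hF : ContDiffOn ℝ ∞ F I) (h0 : ∀ t ∈ I, 0 ≤ F t) :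
    ∃ g : ℝ → ℝ, ContDiffOn ℝ 1 g I ∧ ∀ t ∈ I, g t ^ 2 = F t := by
  classical
  set F1 := deriv F with hF1
  set F2 := deriv F1 with hF2
  have hs1 : ContDiffOn ℝ ∞ F1 I := ((contDiffOn_infty_iff_deriv_of_isOpen hI).1 hF).2
  have hs2 : ContDiffOn ℝ ∞ F2 I := ((contDiffOn_infty_iff_deriv_of_isOpen hI).1 hs1).2
  have hd : ∀ t ∈ I, HasDerivAt F (F1 t) t := fun t ht =>
    ((hF.contDiffAt (hI.mem_nhds ht)).differentiableAt (by simp)).hasDerivAt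
  have hd1 : ∀ t ∈ I, HasDerivAt F1 (F2 t) t := fun t ht =>
    ((hs1.contDiffAt (hI.mem_nhds ht)).differentiableAt (by simp)).hasDerivAt
  have hc2 : ∀ t ∈ I, ContinuousAt F2 t := fun t ht =>
    hs2.continuousOn.continuousAt (hI.mem_nhds ht)
  have hz : ∀ t ∈ I, F t = 0 → F1 t = 0 := by
    intro t ht hFt
    refine IsLocalMin.hasDerivAt_eq_zero (f := F) ?_ (hd t ht)
    filter_upwards [hI.mem_nhds ht] with y hy
    rw [hFt]; exact h0 y hy
  set Z : Set ℝ := {t | F t = 0} with hZdef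
  -- In `U` the zeros of `F` are isolated, and there the root must change sign in order to be
  -- differentiable. At the zeros outside `U` also `F''` vanishes and the sign does not matter.
  set U : Set ℝ := {t | t ∈ I ∧ (F t ≠ 0 ∨ F2 t ≠ 0)} with hUdef
  have hU : IsOpen U := by
    rw [isOpen_iff_mem_nhds]
    rintro t ⟨ht, h | h⟩
    · filter_upwards [hI.mem_nhds ht, (hd t ht).continuousAt.eventually_ne h] with y hy hy'
      exact ⟨hy, Or.inl hy'⟩
    · filter_upwards [hI.mem_nhds ht, (hc2 t ht).eventually_ne h] with y hy hy'
      exact ⟨hy, Or.inr hy'⟩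
  have hZ : ∀ x ∈ U, ∀ᶠ y in 𝓝[≠] x, y ∉ Z := by
    rintro x ⟨hx, h⟩
    by_cases hFx : F x = 0
    · have h2 : F2 x ≠ 0 := h.resolve_left (not_not.2 hFx)
      have h3 := (hd1 x hx).eventually_ne h2 (c := 0)
      filter_upwards [h3, (hI.eventually_mem hx).filter_mono nhdsWithin_le_nhds]
        with y hy hyI hyZ
      exact hy (hz y hyI hyZ)
    · exact ((hd x hx).continuousAt.eventually_ne hFx).filter_mono nhdsWithin_le_nhds
  obtain ⟨s, hs, hloc⟩ := exists_sign_changing hU hZ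
  set g : ℝ → ℝ := fun t => s t * √(F t) with hg
  -- The derivative of `g`. At a zero its absolute value is the limit of `√F / |y - x|`, which is
  -- `√(F''/2)` by l'Hôpital's rule (`hlim`).
  set h : ℝ → ℝ := fun t => s t * (if F t = 0 then √(F2 t / 2) else F1 t / (2 * √(F t))) with hh
  have hsabs : ∀ t, |s t| = 1 := fun t => by rcases hs t with h | h <;> simp [h]
  have hss : ∀ t, s t ^ 2 = 1 := fun t => by rcases hs t with h | h <;> simp [h]
  have hlim : ∀ x ∈ I, F x = 0 → Tendsto (fun y => F y / (y - x) ^ 2) (𝓝[≠] x) (𝓝 (F2 x / 2)) := by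
    intro x hx hFx
    have hI' : ∀ᶠ y in 𝓝[≠] x, y ∈ I :=
      (hI.eventually_mem hx).filter_mono nhdsWithin_le_nhds
    refine HasDerivAt.lhopital_zero_nhdsNE (f' := F1) (g' := fun y => 2 * (y - x)) ?_ ?_ ?_ ?_ ?_ ?_
    · filter_upwards [hI'] with y hy using hd y hy
    · refine Eventually.of_forall fun y => ?_
      have := ((hasDerivAt_id y).sub_const x).fun_pow 2
      simpa using this
    · filter_upwards [self_mem_nhdsWithin] with y hy
      exact mul_ne_zero two_ne_zero (sub_ne_zero.2 hy)
    · have := (hd x hx).continuousAt.tendsto.mono_left (nhdsWithin_le_nhds (s := {x}ᶜ))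
      rwa [hFx] at this
    · have : ContinuousAt (fun y : ℝ => (y - x) ^ 2) x := by fun_prop
      have := this.tendsto.mono_left (nhdsWithin_le_nhds (s := {x}ᶜ))
      simpa using this
    · have h1 := (hasDerivAt_iff_tendsto_slope.1 (hd1 x hx)).div_const 2
      refine h1.congr' ?_
      filter_upwards [self_mem_nhdsWithin] with y hy
      rw [slope_def_field, hz x hx hFx, sub_zero, div_div, mul_comm]
  have key : ∀ x ∈ I, HasDerivAt g (h x) x ∧ ContinuousAt h x := by
    intro x hx
    have hI' : ∀ᶠ y in 𝓝 x, y ∈ I := hI.eventually_mem hx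
    by_cases hFx : F x = 0
    · by_cases hF2 : F2 x = 0
      · have hgx : g x = 0 := by simp [hg, hFx]
        have hhx : h x = 0 := by simp [hh, hFx, hF2]
        constructor
        · rw [hasDerivAt_iff_tendsto_slope, hhx]
          rw [tendsto_zero_iff_abs_tendsto_zero]
          have h1 := (hlim x hx hFx).sqrt
          rw [hF2, zero_div, Real.sqrt_zero] at h1
          refine h1.congr' ?_
          filter_upwards [self_mem_nhdsWithin] with y hy
          have : (abs ∘ slope g x) y = |g y| / |y - x| := by
            simp [slope_def_field, hgx, abs_div]
          rw [this, Real.sqrt_div' _ (sq_nonneg _), Real.sqrt_sq_eq_abs]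
          simp [hg, abs_mul, hsabs, abs_of_nonneg (Real.sqrt_nonneg _)]
        · rw [Metric.continuousAt_iff]
          intro ε hε
          -- Near a degenerate zero `|F''| ≤ M`, and Glaeser's inequality gives `h² = F'²/(4F) ≤ M`
          -- where `F ≠ 0`; where `F = 0` the bound on `F''` suffices.
          set M := ε ^ 2 / 4 with hM
          have hMpos : 0 < M := by positivity
          have h1 : ∀ᶠ y in 𝓝 x, |F2 y| < M := by
            have := (hc2 x hx).abs.eventually_lt_const (u := M) (by simpa [hF2] using hMpos)
            exact this
          obtain ⟨r, hr, hball⟩ := Metric.eventually_nhds_iff.1 (h1.and hI')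
          have hball' : ∀ y ∈ Ioo (x - r) (x + r), |F2 y| < M ∧ y ∈ I := by
            intro y hy
            exact hball (by rw [Real.dist_eq, abs_lt]; constructor <;> linarith [hy.1, hy.2])
          refine ⟨r / 2, by positivity, fun y hy => ?_⟩
          rw [Real.dist_eq] at hy ⊢
          rw [hhx, sub_zero]
          have hym : y ∈ Ioo (x - r) (x + r) := by
            have := abs_lt.1 hy
            constructor <;> linarith
          have hG := sq_deriv_le hMpos (fun y hy => hd y (hball' y hy).2)
            (fun y hy => hd1 y (hball' y hy).2) (fun y hy => (hball' y hy).1.le)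
            (fun y hy => h0 y (hball' y hy).2) (hz x hx hFx) hy
          simp only [hh, abs_mul, hsabs, one_mul]
          split_ifs with hFy
          · rw [abs_of_nonneg (Real.sqrt_nonneg _)]
            refine (Real.sqrt_lt' hε).2 ?_
            have := (abs_lt.1 (hball' y hym).1).2
            nlinarith
          · have hFpos : 0 < F y := lt_of_le_of_ne (h0 y (hball' y hym).2) (Ne.symm hFy)
            refine abs_lt_of_sq_lt_sq ?_ hε.le
            rw [div_pow, mul_pow, Real.sq_sqrt hFpos.le, div_lt_iff₀ (by positivity)]
            nlinarith
      · have hxU : x ∈ U := ⟨hx, Or.inr hF2⟩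
        obtain ⟨hr, hl, -⟩ := hloc x hxU
        have hl := hl hFx
        have hF2pos : 0 < F2 x := by
          have h1 := hlim x hx hFx
          have h2 : 0 ≤ F2 x / 2 := by
            refine ge_of_tendsto h1 ?_
            filter_upwards [hI'.filter_mono nhdsWithin_le_nhds] with y hy
            exact div_nonneg (h0 y hy) (sq_nonneg _)
          exact lt_of_le_of_ne (by linarith) (Ne.symm hF2)
        -- The sign change turns `s(y)|y - x|` into the linear function `s(x)(y - x)`, so that the
        -- one-sided derivatives of `s√F` agree.
        have hsg : ∀ᶠ y in 𝓝[≠] x, s y * |y - x| = s x * (y - x) ∧ y ≠ x ∧ y ∉ Z := by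
          have hne : ∀ᶠ y in 𝓝[≠] x, s y * |y - x| = s x * (y - x) := by
            rw [← Iio_union_Ioi, nhdsWithin_union, eventually_sup]
            constructor
            · filter_upwards [hl, self_mem_nhdsWithin] with y hy hyx
              rw [hy, abs_of_neg (sub_neg.2 hyx)]; ring
            · filter_upwards [hr, self_mem_nhdsWithin] with y hy hyx
              rw [hy, abs_of_pos (sub_pos.2 hyx)]
          have hne' : ∀ᶠ y in 𝓝[≠] x, y ≠ x := eventually_mem_nhdsWithin
          exact hne.and (hne'.and (hZ x hxU))
        have hgx : g x = 0 := by simp [hg, hFx]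
        have hhx : h x = s x * √(F2 x / 2) := by simp [hh, hFx]
        have hsq := (hlim x hx hFx).sqrt
        constructor
        · rw [hasDerivAt_iff_tendsto_slope, hhx]
          refine (hsq.const_mul (s x)).congr' ?_
          filter_upwards [hsg] with y ⟨hy1, hy2, _⟩
          have hyx : y - x ≠ 0 := sub_ne_zero.2 hy2
          rw [Real.sqrt_div' _ (sq_nonneg _), Real.sqrt_sq_eq_abs, slope_def_field, hgx, sub_zero]
          have habs : |y - x| ≠ 0 := abs_ne_zero.2 hyx
          simp only [hg]
          field_simp
          linear_combination (-√(F y)) * hy1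
        · rw [continuousAt_iff_punctured_nhds]
          have h1 := hasDerivAt_iff_tendsto_slope.1 (hd1 x hx)
          have h2 : Tendsto (fun y => s x * (slope F1 x y / (2 * √(F y / (y - x) ^ 2)))) (𝓝[≠] x)
              (𝓝 (s x * (F2 x / (2 * √(F2 x / 2))))) :=
            (h1.div (hsq.const_mul 2) (by positivity)).const_mul (s x)
          have h3 : F2 x / (2 * √(F2 x / 2)) = √(F2 x / 2) := by
            have : F2 x = 2 * √(F2 x / 2) ^ 2 := by
              rw [Real.sq_sqrt (by positivity)]; ring
            have hp : 0 < √(F2 x / 2) := Real.sqrt_pos.2 (by positivity)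
            rw [div_eq_iff (by positivity)]
            linarith
          rw [h3, ← hhx] at h2
          refine h2.congr' ?_
          filter_upwards [hsg, hI'.filter_mono nhdsWithin_le_nhds] with y ⟨hy1, hy2, hy3⟩ hyI
          have hyx : y - x ≠ 0 := sub_ne_zero.2 hy2
          have habs : |y - x| ≠ 0 := abs_ne_zero.2 hyx
          have hFy : F y ≠ 0 := hy3
          have hFpos : 0 < F y := lt_of_le_of_ne (h0 y hyI) (Ne.symm hFy)
          have hsp : √(F y) ≠ 0 := (Real.sqrt_pos.2 hFpos).ne'
          rw [Real.sqrt_div' _ (sq_nonneg _), Real.sqrt_sq_eq_abs, slope_def_field, hz x hx hFx,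
            sub_zero]
          simp only [hh, if_neg hFy]
          have h5 : |y - x| * |y - x| = (y - x) * (y - x) := abs_mul_abs_self _
          have h6 : s x * |y - x| = s y * (y - x) := by
            have : (s x * |y - x|) * |y - x| = (s y * (y - x)) * |y - x| := by
              linear_combination s x * h5 - (y - x) * hy1
            exact mul_right_cancel₀ habs this
          field_simp
          linear_combination (F1 y) * h6
    · have hxU : x ∈ U := ⟨hx, Or.inl hFx⟩
      obtain ⟨hr, -, hl⟩ := hloc x hxU
      have hl := hl hFx
      have hseq : ∀ᶠ y in 𝓝 x, s y = s x := by
        have hne : ∀ᶠ y in 𝓝[≠] x, s y = s x := by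
          rw [← Iio_union_Ioi, nhdsWithin_union, eventually_sup]
          exact ⟨hl, hr⟩
        rw [eventually_nhdsWithin_iff] at hne
        filter_upwards [hne] with y hy
        by_cases hyx : y = x
        · rw [hyx]
        · exact hy hyx
      have hFpos : 0 < F x := lt_of_le_of_ne (h0 x hx) (Ne.symm hFx)
      constructor
      · have h1 : HasDerivAt (fun y => s x * √(F y)) (s x * (F1 x / (2 * √(F x)))) x :=
          ((hd x hx).sqrt hFx).const_mul _
        have : h x = s x * (F1 x / (2 * √(F x))) := by simp [hh, hFx]
        rw [this]
        refine h1.congr_of_eventuallyEq ?_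
        filter_upwards [hseq] with y hy
        simp only [hg, hy]
      · have h1 : ContinuousAt (fun y => s x * (F1 y / (2 * √(F y)))) x := by
          refine ContinuousAt.mul continuousAt_const (ContinuousAt.div (hd1 x hx).continuousAt
            (continuousAt_const.mul (hd x hx).continuousAt.sqrt) ?_)
          exact mul_ne_zero two_ne_zero (Real.sqrt_pos.2 hFpos).ne'
        refine h1.congr ?_
        filter_upwards [hseq, (hd x hx).continuousAt.eventually_ne hFx] with y hy hy'
        simp only [hh, hy, if_neg hy']
  refine ⟨g, ?_, fun t ht => ?_⟩
  · have h1 := (contDiffOn_succ_iff_deriv_of_isOpen (𝕜 := ℝ) (n := 0) (f := g) hI).2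
      ⟨fun t ht => (key t ht).1.differentiableAt.differentiableWithinAt, by simp, ?_⟩
    · simpa using h1
    · rw [contDiffOn_zero]
      refine ContinuousOn.congr (f := h) (fun t ht => (key t ht).2.continuousWithinAt) ?_
      intro t ht
      exact (key t ht).1.deriv
  · simp only [hg, mul_pow, hss, one_mul]
    exact Real.sq_sqrt (h0 t ht)

/-- A curve in the unit circle has an angle function of the same class. -/
theorem exists_angle {I : Set ℝ} (hI : IsOpen I) (hc : I.OrdConnected) {m : WithTop ℕ∞}
    (hm : m ≠ ⊤) {a b : ℝ → ℝ} (ha : ContDiffOn ℝ (m + 1) a I) (hb : ContDiffOn ℝ (m + 1) b I)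
    (hab : ∀ t ∈ I, a t ^ 2 + b t ^ 2 = 1) :
    ∃ θ : ℝ → ℝ, ContDiffOn ℝ (m + 1) θ I ∧ ∀ t ∈ I, Real.cos (θ t) = a t ∧ Real.sin (θ t) = b t := by
  rcases I.eq_empty_or_nonempty with rfl | ⟨t₀, ht₀⟩
  · exact ⟨0, by simp, by simp⟩
  have hda := (contDiffOn_succ_iff_deriv_of_isOpen hI).1 ha
  have hdb := (contDiffOn_succ_iff_deriv_of_isOpen hI).1 hb
  -- The angular velocity of the curve `(a, b)`. It has one derivative less than the curve, which
  -- its integral `θ` regains.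
  set ρ : ℝ → ℝ := fun t => a t * deriv b t - b t * deriv a t with hρ
  have hle : m ≤ m + 1 := le_self_add
  have hρs : ContDiffOn ℝ m ρ I :=
    ((ha.of_le hle).mul hdb.2.2).sub ((hb.of_le hle).mul hda.2.2)
  have hρc := hρs.continuousOn
  set θ₀ := Complex.arg (⟨a t₀, b t₀⟩ : ℂ) with hθ₀
  have hnorm : ‖(⟨a t₀, b t₀⟩ : ℂ)‖ = 1 := by
    rw [Complex.norm_def, Complex.normSq_mk, ← sq, ← sq, hab t₀ ht₀, Real.sqrt_one]
  have hne : (⟨a t₀, b t₀⟩ : ℂ) ≠ 0 := by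
    intro h; rw [h, norm_zero] at hnorm; exact zero_ne_one hnorm
  have hcos0 : Real.cos θ₀ = a t₀ := by rw [hθ₀, Complex.cos_arg hne, hnorm, div_one]
  have hsin0 : Real.sin θ₀ = b t₀ := by rw [hθ₀, Complex.sin_arg, hnorm, div_one]
  set θ : ℝ → ℝ := fun t => θ₀ + ∫ u in t₀..t, ρ u with hθ
  have hθd : ∀ t ∈ I, HasDerivAt θ (ρ t) t := by
    intro t ht
    refine HasDerivAt.const_add _ (intervalIntegral.integral_hasDerivAt_right ?_ ?_ ?_)
    · exact (hρc.mono (hc.uIcc_subset ht₀ ht)).intervalIntegrable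
    · exact hρc.stronglyMeasurableAtFilter hI t ht
    · exact hρc.continuousAt (hI.mem_nhds ht)
  refine ⟨θ, ?_, ?_⟩
  · refine (contDiffOn_succ_iff_deriv_of_isOpen hI).2
      ⟨fun t ht => (hθd t ht).differentiableAt.differentiableWithinAt, fun h => absurd h hm, ?_⟩
    exact hρs.congr fun t ht => (hθd t ht).deriv
  · have hA : ∀ t ∈ I, HasDerivAt a (deriv a t) t := fun t ht =>
      (hda.1.differentiableAt (hI.mem_nhds ht)).hasDerivAt
    have hB : ∀ t ∈ I, HasDerivAt b (deriv b t) t := fun t ht =>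
      (hdb.1.differentiableAt (hI.mem_nhds ht)).hasDerivAt
    have hrel : ∀ t ∈ I, a t * deriv a t + b t * deriv b t = 0 := by
      intro t ht
      have h1 := ((hA t ht).fun_pow 2).fun_add ((hB t ht).fun_pow 2)
      have h2 : HasDerivAt (fun t => a t ^ 2 + b t ^ 2) 0 t := by
        refine (hasDerivAt_const t (1 : ℝ)).congr_of_eventuallyEq ?_
        filter_upwards [hI.mem_nhds ht] with y hy using hab y hy
      have h3 := h1.unique h2
      simp only [Nat.cast_ofNat, Nat.add_one_sub_one, pow_one] at h3
      linarith
    have hda' : ∀ t ∈ I, deriv a t = -b t * ρ t := by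
      intro t ht
      simp only [hρ]
      linear_combination (-(deriv a t)) * hab t ht + a t * hrel t ht
    have hdb' : ∀ t ∈ I, deriv b t = a t * ρ t := by
      intro t ht
      simp only [hρ]
      linear_combination (-(deriv b t)) * hab t ht + b t * hrel t ht
    -- With `hq`: the real and imaginary parts of `e^{iθ}` times the conjugate of `a + ib` are
    -- constant, and equal to `1` and `0` at `t₀`.
    have hp : ∀ t ∈ I, HasDerivAt (fun t => a t * Real.cos (θ t) + b t * Real.sin (θ t)) 0 t := by
      intro t ht
      have h1 := ((hA t ht).fun_mul (hθd t ht).cos).fun_add ((hB t ht).fun_mul (hθd t ht).sin)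
      refine h1.congr_deriv ?_
      rw [hda' t ht, hdb' t ht]; ring
    have hq : ∀ t ∈ I, HasDerivAt (fun t => a t * Real.sin (θ t) - b t * Real.cos (θ t)) 0 t := by
      intro t ht
      have h1 := ((hA t ht).fun_mul (hθd t ht).sin).fun_sub ((hB t ht).fun_mul (hθd t ht).cos)
      refine h1.congr_deriv ?_
      rw [hda' t ht, hdb' t ht]; ring
    have hθt₀ : θ t₀ = θ₀ := by simp [hθ]
    intro t ht
    have hpc := hI.is_const_of_deriv_eq_zero hc.isPreconnected
      (fun t ht => (hp t ht).differentiableAt.differentiableWithinAt)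
      (fun t ht => (hp t ht).deriv) ht ht₀
    have hqc := hI.is_const_of_deriv_eq_zero hc.isPreconnected
      (fun t ht => (hq t ht).differentiableAt.differentiableWithinAt)
      (fun t ht => (hq t ht).deriv) ht ht₀
    simp only [hθt₀, hcos0, hsin0] at hpc hqc
    have h0 := hab t₀ ht₀
    have h1 := hab t ht
    have hp1 : a t * Real.cos (θ t) + b t * Real.sin (θ t) = 1 := by rw [hpc, ← h0]; ring
    have hq1 : a t * Real.sin (θ t) - b t * Real.cos (θ t) = 0 := by rw [hqc]; ring
    constructor
    · linear_combination a t * hp1 - b t * hq1 - Real.cos (θ t) * h1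
    · linear_combination b t * hp1 + a t * hq1 - Real.sin (θ t) * h1

/-! ### The algebraic relations -/

/-- The algebraic relations in polynomial form. -/
theorem relations_iff {x y z m n : ℝ} (hx : 0 < x) (hy : 0 < y) (hz : 0 < z) (hm : 0 ≤ m)
    (hmn : m ≤ n) :
    (x - m / x = y - n / y ∧ z - (n - m) / z = x + m / x) ↔
      (x * (z - y) = m ∧ y * (z - x) = n) := by
  constructor
  · rintro ⟨h1, h2⟩
    have h1' : n / y = y - x + m / x := by linarith
    -- `w` is the value of `z` demanded by the polynomial relations. Both `z` and `w` solve `ζ² - (x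
    -- + m/x) ζ - (n - m) = 0`. The product of its roots is `-(n - m) ≤ 0`, so two positive
    -- solutions must coincide.
    set w := y + m / x with hw
    have hw' : w = x + n / y := by rw [hw]; linarith
    have e1 : (w - y) * x = m := by rw [hw]; field_simp; ring
    have e2 : (w - x) * y = n := by rw [hw']; field_simp; ring
    have e3 : z * z - (n - m) = (x + m / x) * z := by
      have := congrArg (· * z) h2
      simp only [sub_mul, div_mul_cancel₀ _ hz.ne'] at this
      linarith
    have e4 : w * w - (n - m) = (x + m / x) * w := by
      have hmx : m / x = w - y := by rw [hw]; ring
      rw [hmx, ← e1, ← e2]; ring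
    have e5 : (z - w) * (z + w - (x + m / x)) = 0 := by linear_combination e3 - e4
    have hzw : z = w := by
      rcases mul_eq_zero.1 e5 with h | h
      · linarith
      · exfalso
        have h5 : z * w = -(n - m) := by
          have : x + m / x = z + w := by linarith
          rw [this] at e3
          linarith
        have hw0 : 0 < w := by positivity
        have := mul_pos hz hw0
        linarith
    rw [hzw]
    exact ⟨by linarith, by linarith⟩
  · rintro ⟨h1, h2⟩
    have e1 : m / x = z - y := by rw [← h1]; field_simp
    have e2 : n / y = z - x := by rw [← h2]; field_simp
    have e3 : (n - m) / z = y - x := by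
      rw [← h1, ← h2]; field_simp; ring
    rw [e1, e2, e3]
    exact ⟨by ring, by ring⟩

theorem AlgebraicRelations.polynomial {μ ν : ℝ} {I : Set ℝ} {f₁ f₂ f₃ : ℝ → ℝ} (hμ : 0 ≤ μ)
    (hμν : μ ≤ ν) (h1 : ∀ t ∈ I, f₁ t ≠ 0) (h2 : ∀ t ∈ I, f₂ t ≠ 0) (h3 : ∀ t ∈ I, f₃ t ≠ 0) :
    AlgebraicRelations μ ν I f₁ f₂ f₃ ↔ ∀ t ∈ I,
      f₁ t ^ 2 * (f₃ t ^ 2 - f₂ t ^ 2) = μ ^ 2 ∧ f₂ t ^ 2 * (f₃ t ^ 2 - f₁ t ^ 2) = ν ^ 2 := by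
  refine forall₂_congr fun t ht => ?_
  have h1 := h1 t ht
  have h2 := h2 t ht
  have h3 := h3 t ht
  exact relations_iff (by positivity) (by positivity) (by positivity) (by positivity)
    (pow_le_pow_left₀ hμ hμν 2)

/-- The relations order the squares. -/
theorem le_of_relations {x y z m n : ℝ} (hx : 0 < x) (hz : 0 < z) (hm : 0 ≤ m)
    (hmn : m ≤ n) (h1 : x * (z - y) = m) (h2 : y * (z - x) = n) : x ≤ y ∧ y ≤ z := by
  constructor
  · by_contra hc
    have : z * (y - x) = n - m := by linarith
    nlinarith [not_le.1 hc]
  · by_contra hc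
    nlinarith [not_le.1 hc]

/-- The relations determine `y` and `z` from `x`. -/
theorem relations_unique {x y z y' z' m n : ℝ} (hx : 0 < x) (hy : 0 < y) (hy' : 0 < y')
    (hn : 0 ≤ n) (h1 : x * (z - y) = m) (h2 : y * (z - x) = n)
    (h1' : x * (z' - y') = m) (h2' : y' * (z' - x) = n) : y' = y ∧ z' = z := by
  -- Eliminating `z` leaves `x y² - (x² - m) y - n x = 0`, whose roots have product `-n ≤ 0`; hence
  -- there is only one positive root.
  have e : (y - y') * (x * y * y' + n * x) = 0 := by
    linear_combination (-(y * y')) * h1 + (y * y') * h1' + (x * y') * h2 - (x * y) * h2'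
  have hp : 0 < x * y * y' := by positivity
  have hyy : y' = y := by
    rcases mul_eq_zero.1 e with h | h
    · linarith
    · nlinarith
  refine ⟨hyy, ?_⟩
  subst hyy
  have : x * (z' - z) = 0 := by linarith
  rcases mul_eq_zero.1 this with h | h <;> linarith

/-- Existence of smooth solutions of the algebraic relations. -/
theorem exists_relations {I : Set ℝ} {μ ν : ℝ} {f₁ : ℝ → ℝ} (hμ : 0 ≤ μ)
    (hμν : μ ≤ ν) (hf : ContDiffOn ℝ ∞ f₁ I) (h0 : ∀ t ∈ I, f₁ t ≠ 0) :
    ∃ f₂ f₃ : ℝ → ℝ, ContDiffOn ℝ ∞ f₂ I ∧ ContDiffOn ℝ ∞ f₃ I ∧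
      (∀ t ∈ I, 0 < f₂ t ∧ 0 < f₃ t) ∧ AlgebraicRelations μ ν I f₁ f₂ f₃ := by
  set D : ℝ → ℝ := fun t => f₁ t ^ 2 - μ ^ 2 / f₁ t ^ 2 with hD
  set R : ℝ → ℝ := fun t => D t ^ 2 + 4 * ν ^ 2 with hR
  -- The larger root of `y² - D y - ν² = 0`, which is (b) for `y = f₂²`.
  set Y : ℝ → ℝ := fun t => (D t + √(R t)) / 2 with hY
  set Z : ℝ → ℝ := fun t => Y t + μ ^ 2 / f₁ t ^ 2 with hZ
  have hx : ∀ t ∈ I, 0 < f₁ t ^ 2 := fun t ht => by have := h0 t ht; positivity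
  -- The discriminant could only vanish for `ν = 0`. This forces `μ = 0`, and then `D = f₁²` does
  -- not vanish.
  have hRpos : ∀ t ∈ I, 0 < R t := by
    intro t ht
    rcases (hμ.trans hμν).eq_or_lt with h | h
    · have hμ0 : μ = 0 := le_antisymm (h ▸ hμν) hμ
      have := hx t ht
      simp only [hR, hD, ← h, hμ0]
      simp
      positivity
    · have := sq_nonneg (D t)
      simp only [hR]
      positivity
  have hYpos : ∀ t ∈ I, 0 < Y t := by
    intro t ht
    rcases (hμ.trans hμν).eq_or_lt with h | h
    · have hμ0 : μ = 0 := le_antisymm (h ▸ hμν) hμ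
      have hd : 0 < D t := by simp only [hD, hμ0]; simpa using hx t ht
      have := Real.sqrt_nonneg (R t)
      simp only [hY]; positivity
    · have : |D t| < √(R t) := by
        refine Real.lt_sqrt_of_sq_lt ?_
        rw [sq_abs]
        simp only [hR]
        have : 0 < ν ^ 2 := by positivity
        linarith
      have := (abs_lt.1 this).1
      simp only [hY]; linarith
  have hZpos : ∀ t ∈ I, 0 < Z t := fun t ht => by
    have := hYpos t ht; have := hx t ht; simp only [hZ]; positivity
  have hYR : ∀ t ∈ I, Y t ^ 2 - D t * Y t - ν ^ 2 = 0 := by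
    intro t ht
    have h1 : √(R t) ^ 2 = D t ^ 2 + 4 * ν ^ 2 := Real.sq_sqrt (hRpos t ht).le
    simp only [hY]
    linear_combination (1 / 4) * h1
  have hDs : ContDiffOn ℝ ∞ D I :=
    (hf.pow 2).sub (contDiffOn_const.div (hf.pow 2) fun t ht => (hx t ht).ne')
  have hRs : ContDiffOn ℝ ∞ R I := (hDs.pow 2).add contDiffOn_const
  have hYs : ContDiffOn ℝ ∞ Y I := (hDs.add (hRs.sqrt fun t ht => (hRpos t ht).ne')).div_const 2
  have hZs : ContDiffOn ℝ ∞ Z I :=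
    hYs.add (contDiffOn_const.div (hf.pow 2) fun t ht => (hx t ht).ne')
  refine ⟨fun t => √(Y t), fun t => √(Z t), hYs.sqrt fun t ht => (hYpos t ht).ne',
    hZs.sqrt fun t ht => (hZpos t ht).ne', fun t ht =>
      ⟨Real.sqrt_pos.2 (hYpos t ht), Real.sqrt_pos.2 (hZpos t ht)⟩, ?_⟩
  rw [AlgebraicRelations.polynomial hμ hμν h0 (fun t ht => (Real.sqrt_pos.2 (hYpos t ht)).ne')
    (fun t ht => (Real.sqrt_pos.2 (hZpos t ht)).ne')]
  intro t ht
  have hx0 := (hx t ht).ne'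
  rw [Real.sq_sqrt (hYpos t ht).le, Real.sq_sqrt (hZpos t ht).le]
  have hy := hYR t ht
  simp only [hD] at hy
  simp only [hZ]
  constructor
  · rw [add_sub_cancel_left, mul_div_cancel₀ _ hx0]
  · linear_combination hy

/-- The derivative of `f₁ f₂` in terms of that of `f₁`. -/
theorem sq_deriv_mul_Xi {I : Set ℝ} (hI : IsOpen I) {μ ν : ℝ} {f₁ f₂ f₃ : ℝ → ℝ} (hμ : 0 ≤ μ)
    (hμν : μ ≤ ν) (hf₁ : ContDiffOn ℝ ∞ f₁ I) (hf₂ : ContDiffOn ℝ ∞ f₂ I)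
    (h1 : ∀ t ∈ I, f₁ t ≠ 0) (h2 : ∀ t ∈ I, f₂ t ≠ 0) (h3 : ∀ t ∈ I, f₃ t ≠ 0)
    (h : AlgebraicRelations μ ν I f₁ f₂ f₃) {t : ℝ} (ht : t ∈ I) :
    0 < Xi (f₁ t) μ ν ∧
      deriv (fun s => f₁ s * f₂ s) t ^ 2 * Xi (f₁ t) μ ν = f₃ t ^ 2 * deriv f₁ t ^ 2 := by
  rw [AlgebraicRelations.polynomial hμ hμν h1 h2 h3] at h
  set p := deriv f₁ t with hp
  set u : ℝ → ℝ := fun s => f₁ s * f₂ s with hu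
  set q := deriv u t with hq
  have hus : ContDiffOn ℝ ∞ u I := hf₁.mul hf₂
  have hdp : HasDerivAt f₁ p t :=
    ((hf₁.contDiffAt (hI.mem_nhds ht)).differentiableAt (by simp)).hasDerivAt
  have hdq : HasDerivAt u q t :=
    ((hus.contDiffAt (hI.mem_nhds ht)).differentiableAt (by simp)).hasDerivAt
  -- Elimination of `f₃` leaves a quadratic equation for `u² = f₁²f₂²` with coefficients in `f₁`;
  -- its derivative relates `u'` to `f₁'`.
  have hrel : ∀ s ∈ I, u s ^ 4 - (f₁ s ^ 4 - μ ^ 2) * u s ^ 2 - ν ^ 2 * f₁ s ^ 4 = 0 := by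
    intro s hs
    obtain ⟨e1, e2⟩ := h s hs
    simp only [hu]
    linear_combination (-(f₁ s ^ 2 * f₂ s ^ 2)) * e1 + (f₁ s ^ 4) * e2
  have hd0 : HasDerivAt (fun s => u s ^ 4 - (f₁ s ^ 4 - μ ^ 2) * u s ^ 2 - ν ^ 2 * f₁ s ^ 4) 0 t := by
    refine (hasDerivAt_const t (0 : ℝ)).congr_of_eventuallyEq ?_
    filter_upwards [hI.mem_nhds ht] with y hy using hrel y hy
  have hd1 := ((hdq.fun_pow 4).fun_sub ((((hdp.fun_pow 4).sub_const (μ ^ 2))).fun_mul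
    (hdq.fun_pow 2))).fun_sub ((hdp.fun_pow 4).const_mul (ν ^ 2))
  have hE := hd1.unique hd0
  obtain ⟨e1, e2⟩ := h t ht
  have hr := hrel t ht
  have hx0 := h1 t ht
  have hy0 := h2 t ht
  have hz0 := h3 t ht
  have huf : u t = f₁ t * f₂ t := rfl
  have hut : u t ≠ 0 := mul_ne_zero hx0 hy0
  set x := f₁ t
  set y := f₂ t
  set z := f₃ t
  set P := u t ^ 2 with hP
  have hPpos : 0 < P := by positivity
  -- The derivative of the quadratic polynomial at its root `P`. Therefore `S²` is its discriminant,
  -- which is the radicand in `Ξ`, and positivity of `S` identifies the square root in `Ξ`.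
  set S := 2 * P - x ^ 4 + μ ^ 2 with hS
  have hSP : S * P = P ^ 2 + ν ^ 2 * x ^ 4 := by
    rw [hS, hP]; linear_combination hr
  have hSpos : 0 < S := by
    have : 0 < S * P := by rw [hSP]; positivity
    exact pos_of_mul_pos_left this hPpos.le
  have hΔ : x ^ 8 + 2 * (2 * ν ^ 2 - μ ^ 2) * x ^ 4 + μ ^ 4 = S ^ 2 := by
    rw [hS, hP]; linear_combination (-4) * hr
  have hsq : √(x ^ 8 + 2 * (2 * ν ^ 2 - μ ^ 2) * x ^ 4 + μ ^ 4) = S := by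
    rw [hΔ, Real.sqrt_sq hSpos.le]
  have hXi : Xi x μ ν = S ^ 2 / (4 * x ^ 4 * (P + ν ^ 2)) := by
    rw [Xi, hsq, hΔ]
    congr 1
    rw [hS]; ring
  have hPν : 0 < P + ν ^ 2 := by positivity
  have hE' : q * u t * S = 2 * x ^ 3 * p * (P + ν ^ 2) := by
    rw [hS, hP]
    simp only [Nat.cast_ofNat, Nat.add_one_sub_one, pow_one] at hE
    linear_combination (1 / 2) * hE
  have hPz : P * z ^ 2 = x ^ 2 * (P + ν ^ 2) := by
    rw [hP, huf]; linear_combination x ^ 2 * e2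
  rw [hXi]
  refine ⟨by positivity, ?_⟩
  have h5 : q ^ 2 * P * S ^ 2 = 4 * x ^ 6 * p ^ 2 * (P + ν ^ 2) ^ 2 := by
    have : (q * u t * S) ^ 2 = (2 * x ^ 3 * p * (P + ν ^ 2)) ^ 2 := by rw [hE']
    rw [hP]
    linear_combination this
  rw [mul_div_assoc', div_eq_iff (by positivity)]
  have h6 : P * (q ^ 2 * S ^ 2) = P * (z ^ 2 * p ^ 2 * (4 * x ^ 4 * (P + ν ^ 2))) := by
    linear_combination h5 - 4 * x ^ 4 * p ^ 2 * (P + ν ^ 2) * hPz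
  exact mul_left_cancel₀ hPpos.ne' h6

end Calculus

/-! ### The adjoint representation of `SU(3)` in coordinates -/

section Adjoint

open scoped Matrix.Norms.Operator

/-- The coordinates of a matrix in `su(3)`. -/
noncomputable def suCoord : Matrix (Fin 3) (Fin 3) ℂ →L[ℝ] LieSU3 :=
  LinearMap.toContinuousLinearMap
    { toFun := fun m => WithLp.toLp 2 ![2 * (m 2 1).re, -2 * (m 2 1).im, 2 * (m 0 2).re,
        -2 * (m 0 2).im, 2 * (m 1 0).re, -2 * (m 1 0).im, (m 0 0).im, -(m 2 2).im]
      map_add' := by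
        intro x y
        ext i; fin_cases i <;> simp <;> ring
      map_smul' := by
        intro r x
        ext i; fin_cases i <;> simp <;> ring }

theorem suCoord_apply (m : Matrix (Fin 3) (Fin 3) ℂ) :
    suCoord m = WithLp.toLp 2 ![2 * (m 2 1).re, -2 * (m 2 1).im, 2 * (m 0 2).re,
        -2 * (m 0 2).im, 2 * (m 1 0).re, -2 * (m 1 0).im, (m 0 0).im, -(m 2 2).im] := rfl

theorem suMat_eq (c : LieSU3) : suMat c =
    !![⟨0, c 6⟩, ⟨-(c 4) / 2, -(c 5) / 2⟩, ⟨c 2 / 2, -(c 3) / 2⟩;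
       ⟨c 4 / 2, -(c 5) / 2⟩, ⟨0, c 7 - c 6⟩, ⟨-(c 0) / 2, -(c 1) / 2⟩;
       ⟨-(c 2) / 2, -(c 3) / 2⟩, ⟨c 0 / 2, -(c 1) / 2⟩, ⟨0, -(c 7)⟩] := by
  ext i j
  simp only [suMat, Fin.sum_univ_eight, Matrix.add_apply, Matrix.smul_apply, suBasis]
  fin_cases i <;> fin_cases j <;>
    simp [Complex.ext_iff] <;> ring_nf <;> simp

theorem suCoord_suMat (c : LieSU3) : suCoord (suMat c) = c := by
  rw [suCoord_apply, suMat_eq]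
  ext i
  fin_cases i <;> simp <;> ring

theorem suMat_suCoord {m : Matrix (Fin 3) (Fin 3) ℂ} (hs : star m = -m) (ht : m.trace = 0) :
    suMat (suCoord m) = m := by
  have h : ∀ i j, star (m j i) = -m i j := fun i j => congrFun (congrFun hs i) j
  have hre : ∀ i j, (m j i).re = -(m i j).re := fun i j => by
    have := congrArg Complex.re (h i j); simpa using this
  have him : ∀ i j, (m j i).im = (m i j).im := fun i j => by
    have := congrArg Complex.im (h i j); simpa using this
  rw [Matrix.trace_fin_three] at ht
  have ht' := congrArg Complex.im ht
  simp only [Complex.add_im, Complex.zero_im] at ht'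
  have h00 := hre 0 0
  have h11 := hre 1 1
  have h22 := hre 2 2
  rw [suMat_eq, suCoord_apply]
  ext i j
  fin_cases i <;> fin_cases j <;> refine Complex.ext ?_ ?_ <;> simp <;>
    linarith [hre 0 1, hre 0 2, hre 1 2, him 0 1, him 0 2, him 1 2, hre 1 0, hre 2 0, hre 2 1]

theorem suMat_injective : Function.Injective suMat := fun a b h => by
  rw [← suCoord_suMat a, h, suCoord_suMat]

theorem suMat_add (a b : LieSU3) : suMat (a + b) = suMat a + suMat b := by
  simp [suMat, add_smul, Finset.sum_add_distrib]

theorem suMat_smul (r : ℝ) (a : LieSU3) : suMat (r • a) = r • suMat a := by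
  simp [suMat, Finset.smul_sum, mul_smul]

theorem suMat_neg (a : LieSU3) : suMat (-a) = -suMat a := by
  have := suMat_smul (-1) a
  simpa using this

theorem suMat_zero : suMat 0 = 0 := by simp [suMat]

theorem SU3_mul_star (g : SU3) : g.1 * star g.1 = 1 :=
  Matrix.mem_unitaryGroup_iff.1 (Matrix.mem_specialUnitaryGroup_iff.1 g.2).1

theorem SU3_star_mul (g : SU3) : star g.1 * g.1 = 1 :=
  Matrix.mem_unitaryGroup_iff'.1 (Matrix.mem_specialUnitaryGroup_iff.1 g.2).1

theorem SU3_coe_inv (g : SU3) : (g⁻¹).1 = star g.1 := rfl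

/-- The adjoint representation, in coordinates. -/
noncomputable def Ad (g : SU3) : LieSU3 →L[ℝ] LieSU3 :=
  LinearMap.toContinuousLinearMap
    { toFun := fun c => suCoord (g.1 * suMat c * star g.1)
      map_add' := fun a b => by rw [suMat_add, mul_add, add_mul, map_add]
      map_smul' := fun r a => by
        rw [suMat_smul, Matrix.mul_smul, Matrix.smul_mul, map_smul, RingHom.id_apply] }

theorem Ad_apply (g : SU3) (c : LieSU3) : Ad g c = suCoord (g.1 * suMat c * star g.1) := rfl

theorem suMat_Ad (g : SU3) (c : LieSU3) : suMat (Ad g c) = g.1 * suMat c * star g.1 := by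
  rw [Ad_apply, suMat_suCoord]
  · rw [star_mul, star_mul, star_star, suMat_star, neg_mul, mul_neg, mul_assoc]
  · rw [Matrix.trace_mul_comm, ← mul_assoc, SU3_star_mul, one_mul, suMat_trace]

theorem Ad_mul (g h : SU3) (c : LieSU3) : Ad (g * h) c = Ad g (Ad h c) := by
  apply suMat_injective
  rw [suMat_Ad, suMat_Ad, suMat_Ad]
  change g.1 * h.1 * _ * star (g.1 * h.1) = _
  rw [star_mul]
  simp only [mul_assoc]

theorem Ad_one (c : LieSU3) : Ad 1 c = c := by
  apply suMat_injective
  rw [suMat_Ad]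
  change 1 * _ * star 1 = _
  rw [star_one, one_mul, mul_one]

theorem Ad_inv_apply_Ad (g : SU3) (c : LieSU3) : Ad g⁻¹ (Ad g c) = c := by
  rw [← Ad_mul, inv_mul_cancel, Ad_one]

theorem Ad_apply_Ad_inv (g : SU3) (c : LieSU3) : Ad g (Ad g⁻¹ c) = c := by
  rw [← Ad_mul, mul_inv_cancel, Ad_one]

theorem suExp_Ad (g : SU3) (c : LieSU3) : suExp (Ad g c) = g * suExp c * g⁻¹ := by
  apply Subtype.ext
  change NormedSpace.exp (suMat (Ad g c)) = g.1 * NormedSpace.exp (suMat c) * star g.1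
  have hinv : g.1⁻¹ = star g.1 := Matrix.inv_eq_right_inv (SU3_mul_star g)
  rw [suMat_Ad, ← hinv, Matrix.exp_conj _ _ (IsUnit.of_mul_eq_one _ (SU3_mul_star g))]

theorem suExp_zero : suExp 0 = 1 := by
  apply Subtype.ext
  change NormedSpace.exp (suMat 0) = 1
  rw [suMat_zero, NormedSpace.exp_zero]

theorem suExp_add_smul (s t : ℝ) (c : LieSU3) :
    suExp ((s + t) • c) = suExp (s • c) * suExp (t • c) := by
  apply Subtype.ext
  change NormedSpace.exp (suMat _) = NormedSpace.exp (suMat _) * NormedSpace.exp (suMat _)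
  rw [suMat_smul, suMat_smul, suMat_smul, add_smul]
  exact Matrix.exp_add_of_commute _ _ (((Commute.refl _).smul_left _).smul_right _)

theorem suExp_neg (c : LieSU3) : suExp (-c) = (suExp c)⁻¹ := by
  rw [eq_inv_iff_mul_eq_one]
  have := suExp_add_smul (-1) 1 c
  simpa [suExp_zero] using this.symm

/-- The Lie bracket in coordinates. -/
noncomputable def lie (a b : LieSU3) : LieSU3 := suCoord (suMat a * suMat b - suMat b * suMat a)

theorem suMat_lie (a b : LieSU3) : suMat (lie a b) = suMat a * suMat b - suMat b * suMat a := by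
  rw [lie, suMat_suCoord]
  · rw [star_sub, star_mul, star_mul, suMat_star, suMat_star]
    simp
  · rw [Matrix.trace_sub, Matrix.trace_mul_comm, sub_self]

theorem lie_add_left (a b c : LieSU3) : lie (a + b) c = lie a c + lie b c := by
  simp only [lie, suMat_add, ← map_add]
  congr 1; noncomm_ring

theorem lie_add_right (a b c : LieSU3) : lie a (b + c) = lie a b + lie a c := by
  simp only [lie, suMat_add, ← map_add]
  congr 1; noncomm_ring

theorem lie_smul_left (r : ℝ) (a b : LieSU3) : lie (r • a) b = r • lie a b := by
  simp only [lie, suMat_smul, ← map_smul, Matrix.smul_mul, Matrix.mul_smul, smul_sub]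

theorem lie_smul_right (r : ℝ) (a b : LieSU3) : lie a (r • b) = r • lie a b := by
  simp only [lie, suMat_smul, ← map_smul, Matrix.smul_mul, Matrix.mul_smul, smul_sub]

theorem lie_swap (a b : LieSU3) : lie a b = -lie b a := by
  simp only [lie, ← map_neg, neg_sub]

theorem lie_zero_left (a : LieSU3) : lie 0 a = 0 := by simp [lie, suMat_zero]

theorem contDiff_exp_smul (m : Matrix (Fin 3) (Fin 3) ℂ) :
    ContDiff ℝ ∞ fun s : ℝ => NormedSpace.exp (s • m) := by
  rw [contDiff_iff_contDiffAt]
  intro s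
  have h1 : ContDiffAt ℝ ∞ (NormedSpace.exp : Matrix (Fin 3) (Fin 3) ℂ → _) (s • m) :=
    (NormedSpace.exp_analytic (𝕂 := ℝ) (s • m)).contDiffAt
  exact h1.comp s (contDiff_id.smul contDiff_const).contDiffAt

theorem Ad_suExp_apply (s : ℝ) (b c : LieSU3) : Ad (suExp (s • b)) c =
    suCoord (NormedSpace.exp (s • suMat b) * suMat c * NormedSpace.exp (s • -suMat b)) := by
  have h1 : star (suExp (s • b)).1 = (suExp (-(s • b))).1 := by rw [suExp_neg, SU3_coe_inv]
  have h2 : (suExp (-(s • b))).1 = NormedSpace.exp (s • -suMat b) := by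
    change NormedSpace.exp (suMat _) = _
    rw [suMat_neg, suMat_smul, smul_neg]
  rw [Ad_apply, h1, h2]
  congr 3
  change NormedSpace.exp (suMat _) = _
  rw [suMat_smul]

theorem contDiff_Ad_suExp (b : LieSU3) : ContDiff ℝ ∞ fun s : ℝ => Ad (suExp (s • b)) := by
  rw [contDiff_clm_apply_iff]
  intro c
  simp only [Ad_suExp_apply]
  exact suCoord.contDiff.comp
    (((contDiff_exp_smul _).mul contDiff_const).mul (contDiff_exp_smul _))

theorem hasDerivAt_Ad_suExp (b c : LieSU3) :
    HasDerivAt (fun s : ℝ => Ad (suExp (s • b)) c) (lie b c) 0 := by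
  simp only [Ad_suExp_apply]
  have h1 := hasDerivAt_exp_smul_const (𝕂 := ℝ) (suMat b) 0
  have h2 := hasDerivAt_exp_smul_const (𝕂 := ℝ) (-suMat b) 0
  have h3 := (h1.mul_const (suMat c)).fun_mul h2
  refine (suCoord.hasFDerivAt.comp_hasDerivAt (0 : ℝ) h3).congr_deriv ?_
  rw [lie]
  congr 1
  simp [NormedSpace.exp_zero]
  rw [sub_eq_add_neg]

end Adjoint

/-! ### Products of one-parameter subgroups -/

/-- The map `q ↦ exp (ℓ₁(q) b₁) ⋯ exp (ℓₙ(q) bₙ)`. -/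
noncomputable def prodExp : List ((W →L[ℝ] ℝ) × LieSU3) → W → SU3
  | [], _ => 1
  | x :: L, q => suExp (x.1 q • x.2) * prodExp L q

/-- The left logarithmic derivative of `prodExp`. -/
noncomputable def logDeriv : List ((W →L[ℝ] ℝ) × LieSU3) → W → W →L[ℝ] LieSU3
  | [], _ => 0
  | x :: L, q => x.1.smulRight (Ad (prodExp L q)⁻¹ x.2) + logDeriv L q

/-- The linear map `q ↦ ∑ ℓᵢ(q) bᵢ`. -/
noncomputable def sumExp : List ((W →L[ℝ] ℝ) × LieSU3) → W →L[ℝ] LieSU3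
  | [] => 0
  | x :: L => x.1.smulRight x.2 + sumExp L

theorem prodExp_zero (L : List ((W →L[ℝ] ℝ) × LieSU3)) : prodExp L 0 = 1 := by
  induction L with
  | nil => rfl
  | cons x L ih => simp [prodExp, ih, suExp_zero]

theorem logDeriv_zero (L : List ((W →L[ℝ] ℝ) × LieSU3)) : logDeriv L 0 = sumExp L := by
  induction L with
  | nil => rfl
  | cons x L ih => simp [logDeriv, sumExp, ih, prodExp_zero, Ad_one]

theorem Ad_prodExp_cons_inv (x : (W →L[ℝ] ℝ) × LieSU3) (L : List ((W →L[ℝ] ℝ) × LieSU3)) (q : W) :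
    Ad (prodExp (x :: L) q)⁻¹ = (Ad (prodExp L q)⁻¹).comp (Ad (suExp ((-x.1 q) • x.2))) := by
  ext1 c
  rw [prodExp, mul_inv_rev, Ad_mul, neg_smul, suExp_neg]
  rfl

theorem contDiff_Ad_prodExp_inv (L : List ((W →L[ℝ] ℝ) × LieSU3)) :
    ContDiff ℝ ∞ fun q => Ad (prodExp L q)⁻¹ := by
  induction L with
  | nil => exact (contDiff_const : ContDiff ℝ ∞ fun _ : W => Ad (1 : SU3)⁻¹)
  | cons x L ih =>
    simp only [Ad_prodExp_cons_inv]
    exact ih.clm_comp ((contDiff_Ad_suExp x.2).comp x.1.contDiff.neg)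

theorem contDiff_logDeriv (L : List ((W →L[ℝ] ℝ) × LieSU3)) : ContDiff ℝ ∞ (logDeriv L) := by
  induction L with
  | nil => exact (contDiff_const : ContDiff ℝ ∞ fun _ : W => (0 : W →L[ℝ] LieSU3))
  | cons x L ih =>
    refine ContDiff.add ?_ ih
    have h1 : ContDiff ℝ ∞ fun q => Ad (prodExp L q)⁻¹ x.2 :=
      (contDiff_Ad_prodExp_inv L).clm_apply contDiff_const
    exact ((ContinuousLinearMap.smulRightL ℝ W LieSU3) x.1).contDiff.comp h1

/-- All factors equal `1` at the origin, so each factor `exp(-ℓ b)` contributes `-ℓ(u) ad b` and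
nothing else. -/
theorem fderiv_Ad_prodExp_inv (L : List ((W →L[ℝ] ℝ) × LieSU3)) (c : LieSU3) (u : W) :
    fderiv ℝ (fun q => Ad (prodExp L q)⁻¹ c) 0 u = -lie (sumExp L u) c := by
  induction L generalizing c with
  | nil =>
    have : (fun q : W => Ad (prodExp [] q)⁻¹ c) = fun _ => c := by
      funext q; simp [prodExp, Ad_one]
    rw [this]
    simp [sumExp, lie_zero_left]
  | cons x L ih =>
    simp only [Ad_prodExp_cons_inv, ContinuousLinearMap.comp_apply]
    have hd1 : DifferentiableAt ℝ (fun q => Ad (prodExp L q)⁻¹) 0 :=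
      (contDiff_Ad_prodExp_inv L).contDiffAt.differentiableAt (by simp)
    have h2 : HasFDerivAt (fun q : W => Ad (suExp ((-x.1 q) • x.2)) c)
        ((-x.1).smulRight (lie x.2 c)) 0 := by
      have h3 := hasDerivAt_Ad_suExp x.2 c
      have h4 : HasFDerivAt (fun q : W => -x.1 q) (-x.1) 0 := x.1.hasFDerivAt.neg
      have h5 : (-x.1 (0 : W)) = 0 := by simp
      rw [← h5] at h3
      refine (HasFDerivAt.comp (0 : W) h3.hasFDerivAt h4).congr_fderiv ?_
      ext1 u
      simp
    have h6 := hd1.hasFDerivAt.clm_apply h2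
    rw [h6.fderiv]
    have h7 : fderiv ℝ (fun q => Ad (prodExp L q)⁻¹) 0 u c = -lie (sumExp L u) c := by
      rw [← ih c, (hd1.hasFDerivAt.clm_apply (hasFDerivAt_const c (0 : W))).fderiv]
      simp
    simp [h7, prodExp_zero, Ad_one, suExp_zero, sumExp, lie_add_left, lie_smul_left]
    abel

/-- The Maurer–Cartan equation at the origin. -/
theorem fderiv_logDeriv_sub (L : List ((W →L[ℝ] ℝ) × LieSU3)) (u v : W) :
    fderiv ℝ (logDeriv L) 0 u v - fderiv ℝ (logDeriv L) 0 v u = -lie (sumExp L u) (sumExp L v) := by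
  induction L with
  | nil =>
    have : logDeriv [] = fun _ => 0 := rfl
    rw [this]
    simp [sumExp, lie_zero_left]
  | cons x L ih =>
    have hd : DifferentiableAt ℝ (fun q => Ad (prodExp L q)⁻¹ x.2) 0 :=
      ((contDiff_Ad_prodExp_inv L).clm_apply contDiff_const).contDiffAt.differentiableAt (by simp)
    have hdL : DifferentiableAt ℝ (logDeriv L) 0 :=
      (contDiff_logDeriv L).contDiffAt.differentiableAt (by simp)
    have h1 : HasFDerivAt (fun q => x.1.smulRight (Ad (prodExp L q)⁻¹ x.2))
        (((ContinuousLinearMap.smulRightL ℝ W LieSU3) x.1).comp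
          (fderiv ℝ (fun q => Ad (prodExp L q)⁻¹ x.2) 0)) 0 :=
      ((ContinuousLinearMap.smulRightL ℝ W LieSU3) x.1).hasFDerivAt.comp 0 hd.hasFDerivAt
    have h2 : HasFDerivAt (logDeriv (x :: L)) _ 0 := h1.add hdL.hasFDerivAt
    rw [h2.fderiv]
    simp only [add_apply, ContinuousLinearMap.comp_apply,
      ContinuousLinearMap.smulRightL_apply_apply, fderiv_Ad_prodExp_inv, sumExp,
      lie_add_left, lie_add_right, lie_smul_left, lie_smul_right,
      ContinuousLinearMap.smulRight_apply]
    have h3 : lie x.2 x.2 = 0 := by simp [lie]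
    -- Only the brackets of the new generator with the old ones appear; the bracket of the new
    -- generator with itself is zero.
    rw [h3, lie_swap x.2 (sumExp L v)]
    simp only [smul_neg, neg_add, smul_zero]
    rw [← ih, zero_add]
    abel

/-! ### Tori in `SU(3)` -/

/-- Commuting Hermitian matrices are simultaneously diagonalised by a unitary matrix. -/
theorem exists_unitary_diagonal {A B : Matrix (Fin 3) (Fin 3) ℂ} (hA : A.IsHermitian)
    (hB : B.IsHermitian) (hAB : Commute A B) :
    ∃ U ∈ Matrix.unitaryGroup (Fin 3) ℂ, ∃ a b : Fin 3 → ℂ,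
      A * U = U * Matrix.diagonal a ∧ B * U = U * Matrix.diagonal b := by
  classical
  let TA := Matrix.toEuclideanLin A
  let TB := Matrix.toEuclideanLin B
  have hTA : TA.IsSymmetric := Matrix.isSymmetric_toEuclideanLin_iff.2 hA
  have hTB : TB.IsSymmetric := Matrix.isSymmetric_toEuclideanLin_iff.2 hB
  have hT : Commute TA TB := by
    have h1 : ∀ (C D : Matrix (Fin 3) (Fin 3) ℂ) (x : EuclideanSpace ℂ (Fin 3)),
        Matrix.toEuclideanLin C (Matrix.toEuclideanLin D x)
          = Matrix.toEuclideanLin (C * D) x := by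
      intro C D x
      simp [Matrix.toLpLin_apply, Matrix.mulVec_mulVec]
    refine LinearMap.ext fun x => ?_
    change TA (TB x) = TB (TA x)
    rw [h1, h1, hAB.eq]
  have hint := LinearMap.IsSymmetric.directSum_isInternal_of_commute hTA hTB hT
  have horth := LinearMap.IsSymmetric.orthogonalFamily_eigenspace_inf_eigenspace hTA hTB
  let v := fun i : ℂ × ℂ => stdOrthonormalBasis ℂ
    ((Module.End.eigenspace TA i.2 ⊓ Module.End.eigenspace TB i.1 :
      Submodule ℂ (EuclideanSpace ℂ (Fin 3))))
  let b0 := hint.collectedBasis fun i => (v i).toBasis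
  have hb0 : Orthonormal ℂ b0 := by
    simpa [b0] using
      horth.orthonormal_sigma_orthonormal (show ∀ i, Orthonormal ℂ (v i).toBasis by simp)
  have hfin : Finite ((i : ℂ × ℂ) × Fin (Module.finrank ℂ
    ((Module.End.eigenspace TA i.2 ⊓ Module.End.eigenspace TB i.1 :
      Submodule ℂ (EuclideanSpace ℂ (Fin 3)))))) := Module.Finite.finite_basis b0
  have := Fintype.ofFinite ((i : ℂ × ℂ) × Fin (Module.finrank ℂ
    ((Module.End.eigenspace TA i.2 ⊓ Module.End.eigenspace TB i.1 :
      Submodule ℂ (EuclideanSpace ℂ (Fin 3))))))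
  have hcard := Module.finrank_eq_card_basis b0
  rw [finrank_euclideanSpace_fin] at hcard
  let e := Fintype.equivFinOfCardEq hcard.symm
  let b : OrthonormalBasis (Fin 3) ℂ (EuclideanSpace ℂ (Fin 3)) :=
    (b0.toOrthonormalBasis hb0).reindex e
  have hmem : ∀ j, ∃ x y : ℂ, TA (b j) = x • b j ∧ TB (b j) = y • b j := by
    intro j
    have h1 : b j = b0 (e.symm j) := by simp [b]
    have h2 : b0 (e.symm j) ∈ ((Module.End.eigenspace TA (e.symm j).1.2 ⊓
        Module.End.eigenspace TB (e.symm j).1.1 :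
        Submodule ℂ (EuclideanSpace ℂ (Fin 3)))) :=
      hint.collectedBasis_mem (fun i => (v i).toBasis) (e.symm j)
    rw [h1]
    exact ⟨_, _, Module.End.mem_eigenspace_iff.1 h2.1, Module.End.mem_eigenspace_iff.1 h2.2⟩
  choose x y hx hy using hmem
  let U : Matrix (Fin 3) (Fin 3) ℂ := Matrix.of fun i j => b j i
  have hmul : ∀ (C : Matrix (Fin 3) (Fin 3) ℂ) (z : Fin 3 → ℂ),
      (∀ j, Matrix.toEuclideanLin C (b j) = z j • b j) → C * U = U * Matrix.diagonal z := by
    intro C z hz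
    ext i j
    have := congrArg (fun w : EuclideanSpace ℂ (Fin 3) => w i) (hz j)
    rw [Matrix.mul_diagonal]
    simp only [Matrix.toLpLin_apply] at this
    rw [Matrix.mul_apply]
    simpa [U, Matrix.mulVec, dotProduct, mul_comm] using this
  refine ⟨U, ?_, x, y, hmul A x hx, hmul B y hy⟩
  rw [Matrix.mem_unitaryGroup_iff']
  ext i j
  have := b.inner_eq_ite i j
  rw [PiLp.inner_apply] at this
  rw [Matrix.mul_apply, Matrix.one_apply, ← this]
  refine Finset.sum_congr rfl fun k _ => ?_
  simp [U, Matrix.star_apply, mul_comm]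

/-- Commuting skew-Hermitian matrices are conjugate to diagonal ones under `SU(3)`. -/
theorem exists_SU3_diagonal {x y : LieSU3} (hxy : lie x y = 0) :
    ∃ h : SU3, ∀ c, (∃ p q : ℝ, c = p • x + q • y) →
      ∀ i j, i ≠ j → (h.1 * suMat c * star h.1) i j = 0 := by
  have hherm : ∀ c : LieSU3, (Complex.I • suMat c).IsHermitian := by
    intro c
    change star (Complex.I • suMat c) = _
    rw [star_smul, suMat_star]; simp
  have hcomm : suMat x * suMat y = suMat y * suMat x := by
    have := suMat_lie x y
    rw [hxy, suMat_zero] at this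
    exact (sub_eq_zero.1 this.symm)
  obtain ⟨U, hU, a, b, ha, hb⟩ := exists_unitary_diagonal (hherm x) (hherm y)
    ((show Commute (suMat x) (suMat y) from hcomm).smul_left _ |>.smul_right _)
  have hUU : star U * U = 1 := Matrix.mem_unitaryGroup_iff'.1 hU
  set d := U.det with hd
  have hdd : star d * d = 1 := by
    have := congrArg Matrix.det hUU
    rw [Matrix.det_mul, Matrix.det_one] at this
    rw [← this]
    congr 1
    exact (Matrix.det_conjTranspose U).symm
  -- Rescaling one eigenvector makes the determinant one, without affecting the diagonalization.
  let P : Matrix (Fin 3) (Fin 3) ℂ := Matrix.diagonal ![star d, 1, 1]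
  have hPP : star P * P = 1 := by
    change Pᴴ * P = 1
    simp only [P, Matrix.diagonal_conjTranspose, Matrix.diagonal_mul_diagonal]
    rw [← Matrix.diagonal_one]
    congr 1
    ext i; fin_cases i <;> simp
    rw [mul_comm]; exact hdd
  set T := U * P with hT
  have hTT : star T * T = 1 := by
    rw [hT, star_mul, mul_assoc, ← mul_assoc (star U), hUU, one_mul, hPP]
  have hTdet : T.det = 1 := by
    rw [hT, Matrix.det_mul, Matrix.det_diagonal, Fin.prod_univ_three]
    simp only [Matrix.cons_val_zero, Matrix.cons_val_one, Matrix.cons_val_two, Matrix.head_cons,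
      Matrix.tail_cons, mul_one]
    rw [mul_comm]; exact hdd
  let t : SU3 := ⟨T, Matrix.mem_specialUnitaryGroup_iff.2
    ⟨Matrix.mem_unitaryGroup_iff'.2 hTT, hTdet⟩⟩
  refine ⟨t⁻¹, ?_⟩
  rintro c ⟨p, q, rfl⟩ i j hij
  have h1 : (t⁻¹).1 = star T := rfl
  rw [h1, star_star]
  have hx : suMat x * U = U * Matrix.diagonal (-Complex.I • a) := by
    rw [Matrix.diagonal_smul, Matrix.mul_smul, ← ha, Matrix.smul_mul, smul_smul]
    simp
  have hy : suMat y * U = U * Matrix.diagonal (-Complex.I • b) := by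
    rw [Matrix.diagonal_smul, Matrix.mul_smul, ← hb, Matrix.smul_mul, smul_smul]
    simp
  have h2 : suMat (p • x + q • y) * U = U * Matrix.diagonal
      (p • (-Complex.I • a) + q • (-Complex.I • b)) := by
    have h4 : ∀ u v : Fin 3 → ℂ, Matrix.diagonal (p • u + q • v)
        = p • Matrix.diagonal u + q • Matrix.diagonal v := by
      intro u v
      ext i j
      by_cases hij : i = j
      · subst hij; simp
      · simp [Matrix.diagonal_apply_ne _ hij]
    rw [suMat_add, suMat_smul, suMat_smul, add_mul, Matrix.smul_mul, Matrix.smul_mul, hx, hy,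
      h4, mul_add, Matrix.mul_smul, Matrix.mul_smul]
  rw [hT, mul_assoc, ← mul_assoc (suMat _), h2, star_mul]
  have h3 : star P * star U * (U * Matrix.diagonal (p • (-Complex.I • a) + q • (-Complex.I • b)) * P)
      = star P * Matrix.diagonal (p • (-Complex.I • a) + q • (-Complex.I • b)) * P := by
    simp only [mul_assoc]
    rw [← mul_assoc (star U), hUU, one_mul]
  rw [h3]
  rw [Matrix.star_eq_conjTranspose]
  simp only [P, Matrix.diagonal_conjTranspose, Matrix.diagonal_mul_diagonal]
  exact Matrix.diagonal_apply_ne _ hij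

/-- The coordinates of the part of `su(3)` orthogonal to the torus. -/
def offDiag (i : Fin 6) : Fin 8 := Fin.castLE (by norm_num) i

theorem offDiag_suCoord_eq_zero {m : Matrix (Fin 3) (Fin 3) ℂ} (h : ∀ i j, i ≠ j → m i j = 0)
    (i : Fin 6) : suCoord m (offDiag i) = 0 := by
  have h21 := h 2 1 (by decide)
  have h02 := h 0 2 (by decide)
  have h10 := h 1 0 (by decide)
  rw [suCoord_apply]
  fin_cases i <;> simp [offDiag, h21, h02, h10]

open ComplexOrder in
/-- A two-dimensional subalgebra of `su(3)` is conjugate to the diagonal one. -/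
theorem exists_Ad_diagonal (K : Submodule ℝ LieSU3) (hK : Module.finrank ℝ K = 2)
    (hlie : ∀ x ∈ K, ∀ y ∈ K, lie x y ∈ K) :
    ∃ h : SU3, ∀ c ∈ K, ∀ i, Ad h c (offDiag i) = 0 := by
  let b := Module.finBasisOfFinrankEq ℝ K hK
  set x : LieSU3 := ((b 0 : K) : LieSU3) with hx
  set y : LieSU3 := ((b 1 : K) : LieSU3) with hy
  have hspan : ∀ c ∈ K, ∃ p q : ℝ, c = p • x + q • y := by
    intro c hc
    have := b.sum_repr ⟨c, hc⟩
    rw [Fin.sum_univ_two] at this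
    exact ⟨_, _, (congrArg Subtype.val this).symm⟩
  -- A commutator `z = [x, y]` is orthogonal to `x` and `y` for the trace form. If it is also in
  -- their span, then `tr z² = 0`, and a skew-Hermitian `z` vanishes.
  have hxy : lie x y = 0 := by
    set z := lie x y with hz
    obtain ⟨p, q, hpq⟩ := hspan z (hlie x (b 0).2 y (b 1).2)
    have hZ : suMat z = suMat x * suMat y - suMat y * suMat x := suMat_lie x y
    have h1 : (suMat z * suMat x).trace = 0 := by
      rw [hZ, sub_mul, Matrix.trace_sub, Matrix.trace_mul_comm (suMat x * suMat y), ← mul_assoc,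
        Matrix.trace_mul_comm, ← mul_assoc, Matrix.trace_mul_comm, ← mul_assoc, sub_self]
    have h2 : (suMat z * suMat y).trace = 0 := by
      rw [hZ, sub_mul, Matrix.trace_sub, mul_assoc (suMat y), Matrix.trace_mul_comm (suMat y),
        sub_self]
    have h3 : (suMat z * suMat z).trace = 0 := by
      have : suMat z = p • suMat x + q • suMat y := by
        rw [hpq, suMat_add, suMat_smul, suMat_smul]
      have h4 : suMat z * suMat z = p • (suMat z * suMat x) + q • (suMat z * suMat y) := by
        rw [← Matrix.mul_smul, ← Matrix.mul_smul, ← mul_add, ← this]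
      rw [h4, Matrix.trace_add, Matrix.trace_smul, Matrix.trace_smul, h1, h2]
      simp
    have h4 : ((suMat z)ᴴ * suMat z).trace = 0 := by
      have : (suMat z)ᴴ = -suMat z := suMat_star z
      rw [this, neg_mul, Matrix.trace_neg, h3, neg_zero]
    have h5 := Matrix.trace_conjTranspose_mul_self_eq_zero_iff.1 h4
    apply suMat_injective
    rw [h5, suMat_zero]
  obtain ⟨h, hh⟩ := exists_SU3_diagonal hxy
  refine ⟨h, fun c hc i => ?_⟩
  rw [Ad_apply]
  exact offDiag_suCoord_eq_zero (hh c (hspan c hc)) i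

theorem T2_diagonal {k : SU3} (hk : k ∈ T2) : k.1 = Matrix.diagonal fun i => k.1 i i := by
  ext i j
  by_cases hij : i = j
  · subst hij; simp
  · rw [Matrix.diagonal_apply_ne _ hij]; exact hk i j hij

theorem Ad_T2_entry {k : SU3} (hk : k ∈ T2) (m : Matrix (Fin 3) (Fin 3) ℂ) (i j : Fin 3) :
    (k.1 * m * star k.1) i j = k.1 i i * m i j * star (k.1 j j) := by
  have h := T2_diagonal hk
  generalize k.1 = K at h
  rw [h]
  rw [Matrix.star_eq_conjTranspose, Matrix.diagonal_conjTranspose, Matrix.mul_diagonal, Matrix.diagonal_mul]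
  simp

/-- The torus acts on the root spaces by rotations whose product is trivial. -/
structure IsRotation (p q : Fin 3 → ℝ) : Prop where
  sq : ∀ i, p i ^ 2 + q i ^ 2 = 1
  re : p 0 * p 1 * p 2 - p 0 * q 1 * q 2 - q 0 * p 1 * q 2 - q 0 * q 1 * p 2 = 1
  im : q 0 * p 1 * p 2 + p 0 * q 1 * p 2 + p 0 * p 1 * q 2 - q 0 * q 1 * q 2 = 0

/-- Conjugation by `diag(z₀, z₁, z₂)` multiplies the entries `21`, `02`, `10` by `z₂z̄₁`, `z₀z̄₂`,
`z₁z̄₀`. These numbers are of modulus one, with product one. The diagonal entries are unchanged. -/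
theorem exists_rotation {k : SU3} (hk : k ∈ T2) : ∃ p q : Fin 3 → ℝ, IsRotation p q ∧ ∀ c : LieSU3,
    Ad k c = WithLp.toLp 2 ![p 0 * c 0 + q 0 * c 1, p 0 * c 1 - q 0 * c 0,
      p 1 * c 2 + q 1 * c 3, p 1 * c 3 - q 1 * c 2,
      p 2 * c 4 + q 2 * c 5, p 2 * c 5 - q 2 * c 4, c 6, c 7] := by
  set z : Fin 3 → ℂ := fun i => k.1 i i with hz
  have hunit : ∀ i, z i * star (z i) = 1 := by
    intro i
    have h1 := congrFun (congrFun (SU3_mul_star k) i) i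
    have h2 := Ad_T2_entry hk 1 i i
    rw [mul_one, h1, Matrix.one_apply_eq, mul_one] at h2
    exact h2.symm
  let w : Fin 3 → ℂ := ![z 2 * star (z 1), z 0 * star (z 2), z 1 * star (z 0)]
  have hw : w 0 * w 1 * w 2 = 1 := by
    simp only [w, Matrix.cons_val_zero, Matrix.cons_val_one, Matrix.cons_val]
    calc _ = (z 0 * star (z 0)) * (z 1 * star (z 1)) * (z 2 * star (z 2)) := by ring
      _ = 1 := by rw [hunit, hunit, hunit]; norm_num
  have hwu : ∀ i, w i * star (w i) = 1 := by
    intro i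
    have : ∀ i j, z i * star (z j) * star (z i * star (z j)) = 1 := by
      intro i j
      rw [star_mul, star_star]
      calc _ = (z i * star (z i)) * (z j * star (z j)) := by ring
        _ = 1 := by rw [hunit, hunit]; norm_num
    fin_cases i <;> exact this _ _
  refine ⟨fun i => (w i).re, fun i => (w i).im, ⟨?_, ?_, ?_⟩, ?_⟩
  · intro i
    have := congrArg Complex.re (hwu i)
    simp at this
    linarith
  · have := congrArg Complex.re hw
    simp at this
    linarith
  · have := congrArg Complex.im hw
    simp at this
    linarith
  · intro c
    have h21 := Ad_T2_entry hk (suMat c) 2 1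
    have h02 := Ad_T2_entry hk (suMat c) 0 2
    have h10 := Ad_T2_entry hk (suMat c) 1 0
    have h00 := Ad_T2_entry hk (suMat c) 0 0
    have h22 := Ad_T2_entry hk (suMat c) 2 2
    have e21 : (k.1 * suMat c * star k.1) 2 1 = w 0 * suMat c 2 1 := by
      rw [h21]; simp only [w, hz, Matrix.cons_val_zero]; ring
    have e02 : (k.1 * suMat c * star k.1) 0 2 = w 1 * suMat c 0 2 := by
      rw [h02]; simp only [w, hz, Matrix.cons_val_one, Matrix.cons_val_zero]; ring
    have e10 : (k.1 * suMat c * star k.1) 1 0 = w 2 * suMat c 1 0 := by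
      rw [h10]; simp only [w, hz, Matrix.cons_val]; ring
    have e00 : (k.1 * suMat c * star k.1) 0 0 = suMat c 0 0 := by
      rw [h00, mul_right_comm, hunit, one_mul]
    have e22 : (k.1 * suMat c * star k.1) 2 2 = suMat c 2 2 := by
      rw [h22, mul_right_comm, hunit, one_mul]
    rw [Ad_apply, suCoord_apply, e21, e02, e10, e00, e22, suMat_eq]
    ext i
    fin_cases i <;> simp <;> ring

/-! ### The frame of the tube -/

/-- The orthonormal coframe `dt, f₁ e₁, f₁ e₂, …, f₃ e₆`. -/
noncomputable def tubeFrame (a₁ a₂ a₃ : ℝ) : ℝ × LieSU3 →L[ℝ] W :=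
  LinearMap.toContinuousLinearMap
    { toFun := fun x => WithLp.toLp 2 ![x.1, a₁ * x.2 0, a₁ * x.2 1, a₂ * x.2 2, a₂ * x.2 3,
        a₃ * x.2 4, a₃ * x.2 5]
      map_add' := by intro x y; ext i; fin_cases i <;> simp <;> ring
      map_smul' := by intro r x; ext i; fin_cases i <;> simp <;> ring }

theorem tubeFrame_apply (a₁ a₂ a₃ : ℝ) (x : ℝ × LieSU3) : tubeFrame a₁ a₂ a₃ x =
    WithLp.toLp 2 ![x.1, a₁ * x.2 0, a₁ * x.2 1, a₂ * x.2 2, a₂ * x.2 3,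
        a₃ * x.2 4, a₃ * x.2 5] := rfl

theorem tubeCoframe_0 (x : ℝ × LieSU3) : tubeCoframe 0 x = x.1 := rfl
theorem tubeCoframe_1 (x : ℝ × LieSU3) : tubeCoframe 1 x = x.2 0 := rfl
theorem tubeCoframe_2 (x : ℝ × LieSU3) : tubeCoframe 2 x = x.2 1 := rfl
theorem tubeCoframe_3 (x : ℝ × LieSU3) : tubeCoframe 3 x = x.2 2 := rfl
theorem tubeCoframe_4 (x : ℝ × LieSU3) : tubeCoframe 4 x = x.2 3 := rfl
theorem tubeCoframe_5 (x : ℝ × LieSU3) : tubeCoframe 5 x = x.2 4 := rfl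
theorem tubeCoframe_6 (x : ℝ × LieSU3) : tubeCoframe 6 x = x.2 5 := rfl

theorem three_eta {V : Type*} (x : Fin 3 → V) : x = ![x 0, x 1, x 2] := by
  ext k; fin_cases k <;> rfl

theorem four_eta {V : Type*} (x : Fin 4 → V) : x = ![x 0, x 1, x 2, x 3] := by
  ext k; fin_cases k <;> rfl

theorem tubePhi_eq (a₁ a₂ a₃ θ : ℝ) : tubePhi a₁ a₂ a₃ θ =
    (phiForm stdCoframe θ).compContinuousLinearMap (tubeFrame a₁ a₂ a₃) := by
  ext x
  rw [three_eta x, ContinuousAlternatingMap.compContinuousLinearMap_apply, comp_three]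
  simp only [tubePhi, phiForm, alphaForm, betaForm, ContinuousAlternatingMap.add_apply,
    ContinuousAlternatingMap.sub_apply, ContinuousAlternatingMap.smul_apply, wedge_three,
    stdCoframe_apply, smul_eq_mul, tubeCoframe_0, tubeCoframe_1, tubeCoframe_2, tubeCoframe_3,
    tubeCoframe_4, tubeCoframe_5, tubeCoframe_6, tubeFrame_apply]
  simp only [Matrix.cons_val]
  ring

theorem tubeMetric_eq (a₁ a₂ a₃ : ℝ) (x y : ℝ × LieSU3) : tubeMetric a₁ a₂ a₃ x y =
    inner ℝ (tubeFrame a₁ a₂ a₃ x) (tubeFrame a₁ a₂ a₃ y) := by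
  rw [inner_eq_sum, Fin.sum_univ_seven]
  simp only [tubeMetric, tubeCoframe_0, tubeCoframe_1, tubeCoframe_2, tubeCoframe_3,
    tubeCoframe_4, tubeCoframe_5, tubeCoframe_6, tubeFrame_apply]
  simp only [Matrix.cons_val]
  ring

/-- Rotations of the three planes preserve the `ωᵢ` and rotate the pair `(α, β)` by the sum of the
three angles, which is zero on the torus by `IsRotation`. This is why the formula defines a form on
`I × SU(3)/T²`. -/
theorem tubePhi_comp_Ad {k : SU3} (hk : k ∈ T2) (a₁ a₂ a₃ θ : ℝ) :
    (tubePhi a₁ a₂ a₃ θ).compContinuousLinearMap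
      ((ContinuousLinearMap.id ℝ ℝ).prodMap (Ad k)) = tubePhi a₁ a₂ a₃ θ := by
  obtain ⟨p, q, hr, hAd⟩ := exists_rotation hk
  ext x
  rw [three_eta x, ContinuousAlternatingMap.compContinuousLinearMap_apply, comp_three]
  generalize x 0 = u
  generalize x 1 = v
  generalize x 2 = w
  set T := (ContinuousLinearMap.id ℝ ℝ).prodMap (Ad k)
  have hT : ∀ x : ℝ × LieSU3, T x = (x.1, Ad k x.2) := fun x => rfl
  have hα : alphaForm tubeCoframe ![T u, T v, T w]
      = (p 0 * p 1 * p 2 - p 0 * q 1 * q 2 - q 0 * p 1 * q 2 - q 0 * q 1 * p 2)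
          * alphaForm tubeCoframe ![u, v, w]
        + (q 0 * p 1 * p 2 + p 0 * q 1 * p 2 + p 0 * p 1 * q 2 - q 0 * q 1 * q 2)
          * betaForm tubeCoframe ![u, v, w] := by
    simp only [alphaForm, betaForm, ContinuousAlternatingMap.sub_apply, wedge_three,
      tubeCoframe_1, tubeCoframe_2, tubeCoframe_3, tubeCoframe_4, tubeCoframe_5, tubeCoframe_6,
      hT, hAd]
    simp only [Matrix.cons_val]
    ring
  have hβ : betaForm tubeCoframe ![T u, T v, T w]
      = (p 0 * p 1 * p 2 - p 0 * q 1 * q 2 - q 0 * p 1 * q 2 - q 0 * q 1 * p 2)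
          * betaForm tubeCoframe ![u, v, w]
        - (q 0 * p 1 * p 2 + p 0 * q 1 * p 2 + p 0 * p 1 * q 2 - q 0 * q 1 * q 2)
          * alphaForm tubeCoframe ![u, v, w] := by
    simp only [alphaForm, betaForm, ContinuousAlternatingMap.sub_apply, wedge_three,
      tubeCoframe_1, tubeCoframe_2, tubeCoframe_3, tubeCoframe_4, tubeCoframe_5, tubeCoframe_6,
      hT, hAd]
    simp only [Matrix.cons_val]
    ring
  have h1 : wedge ![tubeCoframe 1, tubeCoframe 2, tubeCoframe 0] ![T u, T v, T w]
      = (p 0 ^ 2 + q 0 ^ 2) * wedge ![tubeCoframe 1, tubeCoframe 2, tubeCoframe 0] ![u, v, w] := by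
    simp only [wedge_three, tubeCoframe_0, tubeCoframe_1, tubeCoframe_2, hT, hAd]
    simp only [Matrix.cons_val]
    ring
  have h2 : wedge ![tubeCoframe 3, tubeCoframe 4, tubeCoframe 0] ![T u, T v, T w]
      = (p 1 ^ 2 + q 1 ^ 2) * wedge ![tubeCoframe 3, tubeCoframe 4, tubeCoframe 0] ![u, v, w] := by
    simp only [wedge_three, tubeCoframe_0, tubeCoframe_3, tubeCoframe_4, hT, hAd]
    simp only [Matrix.cons_val]
    ring
  have h3 : wedge ![tubeCoframe 5, tubeCoframe 6, tubeCoframe 0] ![T u, T v, T w]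
      = (p 2 ^ 2 + q 2 ^ 2) * wedge ![tubeCoframe 5, tubeCoframe 6, tubeCoframe 0] ![u, v, w] := by
    simp only [wedge_three, tubeCoframe_0, tubeCoframe_5, tubeCoframe_6, hT, hAd]
    simp only [Matrix.cons_val]
    ring
  rw [hr.re, hr.im] at hα hβ
  rw [hr.sq] at h1 h2 h3
  simp only [tubePhi, ContinuousAlternatingMap.add_apply, ContinuousAlternatingMap.smul_apply,
    h1, h2, h3, hα, hβ]
  simp

/-- The Hodge dual of `tubePhi`. -/
noncomputable def tubeStar (a₁ a₂ a₃ θ : ℝ) : (ℝ × LieSU3) [⋀^Fin 4]→L[ℝ] ℝ :=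
  (starPhiForm stdCoframe θ).compContinuousLinearMap (tubeFrame a₁ a₂ a₃)

/-! ### Smooth actions of `SU(3)` -/

section Action

variable {M : Type*} [TopologicalSpace M] [ChartedSpace W M] [MulAction SU3 M]

/-- The differential of `p ↦ g • p`, in terms of the model space. -/
noncomputable def push (g : SU3) (p : M) : W →L[ℝ] W :=
  mfderiv 𝓘(ℝ, W) 𝓘(ℝ, W) (fun q : M => g • q) p

/-- The fundamental vector fields, in terms of the model space. -/
noncomputable def fund (p : M) : LieSU3 →L[ℝ] W := fundamental p

/-- The velocity of a curve, in terms of the model space. -/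
noncomputable def vel (γ : ℝ → M) (t : ℝ) : W := velocity γ t

/-- The differential of `(t, g) ↦ g • γ t` at `(t, 1)`, in terms of the model space. -/
noncomputable def tube (γ : ℝ → M) (t : ℝ) : ℝ × LieSU3 →L[ℝ] W := tubeMap γ t

theorem tube_apply (γ : ℝ → M) (t : ℝ) (x : ℝ × LieSU3) :
    tube γ t x = x.1 • vel γ t + fund (γ t) x.2 := rfl

/-- A field of forms, in terms of the model space. -/
def toForm {k : ℕ} (η : FormField M k) (p : M) : W [⋀^Fin k]→L[ℝ] ℝ := η p

omit [MulAction SU3 M] in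
theorem toForm_star (φ : FormField M 3) (p : M) :
    toForm (fun p => g2Star (φ p)) p = g2Star (toForm φ p) := rfl

theorem isInvariantForm_iff {k : ℕ} (η : FormField M k) : IsInvariantForm η ↔
    ∀ (g : SU3) (p : M), (toForm η (g • p)).compContinuousLinearMap (push g p) = toForm η p :=
  Iff.rfl

theorem hasTubeForm_iff (φ : FormField M 3) (I : Set ℝ) (γ : ℝ → M) (f₁ f₂ f₃ θ : ℝ → ℝ) :
    HasTubeForm φ I γ f₁ f₂ f₃ θ ↔ ∀ t ∈ I, (toForm φ (γ t)).compContinuousLinearMap (tube γ t) =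
      tubePhi (f₁ t) (f₂ t) (f₃ t) (θ t) := Iff.rfl

theorem hasTubeMetric_iff (φ : FormField M 3) (I : Set ℝ) (γ : ℝ → M) (f₁ f₂ f₃ : ℝ → ℝ) :
    HasTubeMetric φ I γ f₁ f₂ f₃ ↔ ∀ t ∈ I, ∀ x y : ℝ × LieSU3,
      g2Metric (toForm φ (γ t)) (tube γ t x) (tube γ t y) =
        tubeMetric (f₁ t) (f₂ t) (f₃ t) x y := Iff.rfl

variable (hM : IsSmoothAction M)

include hM

theorem IsSmoothAction.hasMFDerivAt (g : SU3) (p : M) :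
    HasMFDerivAt 𝓘(ℝ, W) 𝓘(ℝ, W) (fun q : M => g • q) p (push g p) :=
  ((hM.smul g).mdifferentiableAt (by simp)).hasMFDerivAt

theorem IsSmoothAction.push_mul (g h : SU3) (p : M) :
    push (g * h) p = (push g (h • p)).comp (push h p) := by
  have h1 := (hM.hasMFDerivAt g (h • p)).comp p (hM.hasMFDerivAt h p)
  have h2 : (fun q : M => g • q) ∘ (fun q : M => h • q) = fun q => (g * h) • q := by
    funext q; simp [mul_smul]
  rw [h2] at h1
  exact hasMFDerivAt_unique (hM.hasMFDerivAt (g * h) p) h1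

omit hM in
theorem push_one (p : M) : push 1 p = ContinuousLinearMap.id ℝ W := by
  have h2 : (fun q : M => (1 : SU3) • q) = id := by
    funext q; simp
  rw [push, h2]
  exact mfderiv_id

theorem IsSmoothAction.push_inv_comp (g : SU3) (p : M) :
    (push g⁻¹ (g • p)).comp (push g p) = ContinuousLinearMap.id ℝ W := by
  rw [← hM.push_mul, inv_mul_cancel, push_one]

theorem IsSmoothAction.push_comp_inv (g : SU3) (p : M) :
    (push g p).comp (push g⁻¹ (g • p)) = ContinuousLinearMap.id ℝ W := by
  have := hM.push_mul g g⁻¹ (g • p)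
  rw [inv_smul_smul, mul_inv_cancel, push_one] at this
  exact this.symm

/-- The differential of `p ↦ g • p` as an equivalence. -/
noncomputable def IsSmoothAction.pushEquiv (g : SU3) (p : M) : W ≃L[ℝ] W :=
  ContinuousLinearEquiv.equivOfInverse (push g p) (push g⁻¹ (g • p))
    (fun x => DFunLike.congr_fun (hM.push_inv_comp g p) x)
    (fun x => DFunLike.congr_fun (hM.push_comp_inv g p) x)

theorem IsSmoothAction.hasMFDerivAt_exp (p : M) :
    HasMFDerivAt 𝓘(ℝ, LieSU3) 𝓘(ℝ, W) (fun c : LieSU3 => suExp c • p) 0 (fund p) := by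
  have h : ContMDiff 𝓘(ℝ, LieSU3) 𝓘(ℝ, W) ∞ (fun c : LieSU3 => suExp c • p) :=
    hM.exp.comp (contMDiff_id.prodMk contMDiff_const)
  exact (h.mdifferentiableAt (by simp)).hasMFDerivAt

/-- The fundamental vector fields are equivariant. -/
theorem IsSmoothAction.push_fund (g : SU3) (p : M) (c : LieSU3) :
    push g p (fund p c) = fund (g • p) (Ad g c) := by
  have h0 : HasMFDerivAt 𝓘(ℝ, W) 𝓘(ℝ, W) (fun q : M => g • q) (suExp 0 • p) (push g p) := by
    have := hM.hasMFDerivAt g p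
    rw [suExp_zero, one_smul]
    exact this
  have h1 := h0.comp (0 : LieSU3) (hM.hasMFDerivAt_exp p)
  have h2 : HasMFDerivAt 𝓘(ℝ, LieSU3) 𝓘(ℝ, LieSU3) (fun c : LieSU3 => Ad g c) 0 (Ad g) :=
    (Ad g).hasMFDerivAt
  have h4 : HasMFDerivAt 𝓘(ℝ, LieSU3) 𝓘(ℝ, W) (fun c : LieSU3 => suExp c • g • p) (Ad g 0)
      (fund (g • p)) := by
    rw [map_zero]; exact hM.hasMFDerivAt_exp (g • p)
  have h3 := h4.comp (0 : LieSU3) h2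
  have h5 : ((fun q : M => g • q) ∘ fun c : LieSU3 => suExp c • p)
      = (fun c : LieSU3 => suExp c • g • p) ∘ fun c => Ad g c := by
    funext c
    simp [suExp_Ad, mul_smul]
  rw [h5] at h1
  exact DFunLike.congr_fun (hasMFDerivAt_unique h1 h3) c

theorem IsSmoothAction.push_tube (g : SU3) (γ : ℝ → M) {t : ℝ}
    (hγ : MDifferentiableAt 𝓘(ℝ, ℝ) 𝓘(ℝ, W) γ t) (x : ℝ × LieSU3) :
    push g (γ t) (tube γ t x) = tube (fun s => g • γ s) t (x.1, Ad g x.2) := by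
  have h1 : HasMFDerivAt 𝓘(ℝ, ℝ) 𝓘(ℝ, W) (fun s => g • γ s) t
      ((push g (γ t)).comp (mfderiv 𝓘(ℝ, ℝ) 𝓘(ℝ, W) γ t)) :=
    (hM.hasMFDerivAt g (γ t)).comp t hγ.hasMFDerivAt
  have h2 : vel (fun s => g • γ s) t = push g (γ t) (vel γ t) :=
    DFunLike.congr_fun h1.mfderiv (1 : ℝ)
  rw [tube_apply, tube_apply, map_add, map_smul, h2, hM.push_fund]

/-- The derivative of `suExp (s q • b) • σ q`. -/
theorem IsSmoothAction.hasMFDerivAt_exp_smul {s : W → ℝ} {s' : W →L[ℝ] ℝ} {σ : W → M}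
    {σ' : W →L[ℝ] W} {q : W} (b : LieSU3) (hs : HasFDerivAt s s' q)
    (hσ : HasMFDerivAt 𝓘(ℝ, W) 𝓘(ℝ, W) σ q σ') :
    HasMFDerivAt 𝓘(ℝ, W) 𝓘(ℝ, W) (fun q => suExp (s q • b) • σ q) q
      ((push (suExp (s q • b)) (σ q)).comp ((fund (σ q)).comp (s'.smulRight b) + σ')) := by
  set c := s q • b with hc
  set p := σ q with hp
  obtain ⟨D, hD⟩ : ∃ D : LieSU3 × W →L[ℝ] W, HasMFDerivAt (𝓘(ℝ, LieSU3).prod 𝓘(ℝ, W)) 𝓘(ℝ, W)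
      (fun q : LieSU3 × M => suExp q.1 • q.2) (c, p) D :=
    ⟨_, (hM.exp.mdifferentiableAt (by simp)).hasMFDerivAt⟩
  have h1 : ∀ v, D (0, v) = push (suExp c) p v := by
    intro v
    have h := hD.comp p (HasMFDerivAt.prodMk (hasMFDerivAt_const c p) (hasMFDerivAt_id p))
    exact DFunLike.congr_fun (hasMFDerivAt_unique h (hM.hasMFDerivAt (suExp c) p)) v
  -- The direction `b` is parallel to `c = s(q) b`, so `exp(c + r b) = exp(c) exp(r b)` and the
  -- derivative of `exp` away from the origin is not needed.
  have h2 : D (b, 0) = push (suExp c) p (fund p b) := by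
    have hl : HasFDerivAt (fun r : ℝ => c + r • b)
        ((ContinuousLinearMap.id ℝ ℝ).smulRight b) (0 : ℝ) :=
      ((hasFDerivAt_id (0 : ℝ)).smul_const b).const_add c
    have hl0 : c + (0 : ℝ) • b = c := by simp
    have hD' : HasMFDerivAt (𝓘(ℝ, LieSU3).prod 𝓘(ℝ, W)) 𝓘(ℝ, W)
      (fun q : LieSU3 × M => suExp q.1 • q.2) (c + (0 : ℝ) • b, p) D := by rw [hl0]; exact hD
    have h := hD'.comp (0 : ℝ) (HasMFDerivAt.prodMk hl.hasMFDerivAt (hasMFDerivAt_const p (0 : ℝ)))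
    have hm : HasFDerivAt (fun r : ℝ => r • b)
        ((ContinuousLinearMap.id ℝ ℝ).smulRight b) (0 : ℝ) :=
      (hasFDerivAt_id (0 : ℝ)).smul_const b
    have he : HasMFDerivAt 𝓘(ℝ, LieSU3) 𝓘(ℝ, W) (fun c : LieSU3 => suExp c • p) ((0 : ℝ) • b)
        (fund p) := by rw [zero_smul]; exact hM.hasMFDerivAt_exp p
    have hg : HasMFDerivAt 𝓘(ℝ, W) 𝓘(ℝ, W) (fun p : M => suExp c • p) (suExp ((0 : ℝ) • b) • p)
        (push (suExp c) p) := by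
      rw [zero_smul, suExp_zero, one_smul]; exact hM.hasMFDerivAt (suExp c) p
    have h' := hg.comp (0 : ℝ) (he.comp (0 : ℝ) hm.hasMFDerivAt)
    have heq : (fun p : M => suExp c • p) ∘ (fun c : LieSU3 => suExp c • p) ∘ (fun r : ℝ => r • b)
        = (fun q : LieSU3 × M => suExp q.1 • q.2) ∘ fun r : ℝ => (c + r • b, p) := by
      funext r
      simp only [Function.comp_apply]
      rw [hc, ← add_smul, suExp_add_smul, mul_smul]
    rw [heq] at h'
    have h3 := DFunLike.congr_fun (hasMFDerivAt_unique h h') (1 : ℝ)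
    change D ((1 : ℝ) • b, 0) = push (suExp c) p (fund p ((1 : ℝ) • b)) at h3
    rwa [one_smul] at h3
  have h := hD.comp q (HasMFDerivAt.prodMk (hs.smul_const b).hasMFDerivAt hσ)
  have key : ∀ v : W, D (s' v • b, σ' v) = push (suExp c) p (fund p (s' v • b) + σ' v) := by
    intro v
    have h3 : ((s' v • b, σ' v) : LieSU3 × W) = s' v • (b, 0) + (0, σ' v) := by simp
    rw [h3, map_add, map_smul, h1, h2, map_add, map_smul, map_smul]
  exact h.congr_mfderiv (ContinuousLinearMap.ext key)

/-- Moving each inner factor to the left of the generators conjugates them by `Ad` of the inverse.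
The accumulated sum is the left logarithmic derivative. -/
theorem IsSmoothAction.hasMFDerivAt_prodExp (L : List ((W →L[ℝ] ℝ) × LieSU3)) {σ : W → M}
    {σ' : W →L[ℝ] W} {q : W} (hσ : HasMFDerivAt 𝓘(ℝ, W) 𝓘(ℝ, W) σ q σ') :
    HasMFDerivAt 𝓘(ℝ, W) 𝓘(ℝ, W) (fun q => prodExp L q • σ q) q
      ((push (prodExp L q) (σ q)).comp ((fund (σ q)).comp (logDeriv L q) + σ')) := by
  induction L with
  | nil =>
    have h1 : (fun q => prodExp [] q • σ q) = σ := by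
      funext q; exact one_smul _ _
    rw [h1]
    have key : ∀ v : W, σ' v = push 1 (σ q) (fund (σ q) 0 + σ' v) := by
      intro v; rw [push_one, map_zero, zero_add]; rfl
    exact hσ.congr_mfderiv (ContinuousLinearMap.ext key)
  | cons x L ih =>
    have h := hM.hasMFDerivAt_exp_smul x.2 x.1.hasFDerivAt ih
    have h1 : (fun q => prodExp (x :: L) q • σ q)
        = fun q => suExp (x.1 q • x.2) • prodExp L q • σ q := by
      funext q; simp only [prodExp, mul_smul]
    rw [h1]
    have key : ∀ v : W, push (suExp (x.1 q • x.2)) (prodExp L q • σ q)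
          (fund (prodExp L q • σ q) (x.1 v • x.2)
            + push (prodExp L q) (σ q) (fund (σ q) (logDeriv L q v) + σ' v))
        = push (suExp (x.1 q • x.2) * prodExp L q) (σ q)
          (fund (σ q) (x.1 v • Ad (prodExp L q)⁻¹ x.2 + logDeriv L q v) + σ' v) := by
      intro v
      have h2 := hM.push_fund (prodExp L q) (σ q) (Ad (prodExp L q)⁻¹ x.2)
      rw [Ad_apply_Ad_inv] at h2
      rw [hM.push_mul, ContinuousLinearMap.comp_apply]
      congr 1
      simp only [map_add, map_smul, ← h2]
      abel
    exact h.congr_mfderiv (ContinuousLinearMap.ext key)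

end Action

/-! ### Smooth families of forms -/

instance finiteDimensional_multilinear {k : ℕ} :
    FiniteDimensional ℝ (ContinuousMultilinearMap ℝ (fun _ : Fin k => W) ℝ) := by
  let f : ContinuousMultilinearMap ℝ (fun _ : Fin k => W) ℝ →ₗ[ℝ]
      MultilinearMap ℝ (fun _ : Fin k => W) ℝ :=
    { toFun := fun η => η.toMultilinearMap
      map_add' := fun _ _ => rfl
      map_smul' := fun _ _ => rfl }
  exact FiniteDimensional.of_injective f fun a b h => ContinuousMultilinearMap.ext fun x =>
    congrFun (congrArg DFunLike.coe h) x

/-- Transfers smoothness from multilinear to alternating maps. The left inverse exists as a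
continuous map because the target space of the inclusion has finite dimension. -/
theorem exists_leftInverse_toMultilinear (k : ℕ) :
    ∃ F : ContinuousMultilinearMap ℝ (fun _ : Fin k => W) ℝ →L[ℝ] (W [⋀^Fin k]→L[ℝ] ℝ),
      ∀ η : W [⋀^Fin k]→L[ℝ] ℝ, F η.toContinuousMultilinearMap = η := by
  let f : (W [⋀^Fin k]→L[ℝ] ℝ) →ₗ[ℝ] ContinuousMultilinearMap ℝ (fun _ : Fin k => W) ℝ :=
    (ContinuousAlternatingMap.toContinuousMultilinearMapCLM ℝ).toLinearMap
  obtain ⟨g, hg⟩ := f.exists_leftInverse_of_injective (LinearMap.ker_eq_bot.2 fun a b h =>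
    ContinuousAlternatingMap.toContinuousMultilinearMap_injective h)
  exact ⟨LinearMap.toContinuousLinearMap g, fun η => LinearMap.congr_fun hg η⟩

section

variable {E V : Type*} [NormedAddCommGroup E] [NormedSpace ℝ E] [NormedAddCommGroup V]
  [NormedSpace ℝ V]

/-- The pull-back is linear in the form and polynomial in the linear map. -/
theorem ContDiffAt.compForm {k : ℕ} {n : WithTop ℕ∞} {f : E → V [⋀^Fin k]→L[ℝ] ℝ}
    {g : E → W →L[ℝ] V} {x : E} (hf : ContDiffAt ℝ n f x) (hg : ContDiffAt ℝ n g x) :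
    ContDiffAt ℝ n (fun y => (f y).compContinuousLinearMap (g y)) x := by
  obtain ⟨F, hF⟩ := exists_leftInverse_toMultilinear k
  have h1 : ContDiffAt ℝ n (fun y =>
      ContinuousMultilinearMap.compContinuousLinearMapContinuousMultilinear ℝ
        (fun _ : Fin k => W) (fun _ : Fin k => V) ℝ (fun _ => g y)) x :=
    (ContinuousMultilinearMap.contDiff _).contDiffAt.comp x (contDiffAt_pi.2 fun _ => hg)
  have h2 : ContDiffAt ℝ n (fun y => (f y).toContinuousMultilinearMap) x :=
    (ContinuousAlternatingMap.toContinuousMultilinearMapCLM ℝ :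
      (V [⋀^Fin k]→L[ℝ] ℝ) →L[ℝ] _).contDiff.contDiffAt.comp x hf
  refine (F.contDiff.contDiffAt.comp x (h1.clm_apply h2)).congr_of_eventuallyEq
    (Filter.Eventually.of_forall fun y => ?_)
  exact (hF ((f y).compContinuousLinearMap (g y))).symm

end

/-! ### Local coordinates on a tube -/

/-- The one-parameter subgroups generated by `E₁, …, E₆`. -/
noncomputable def flagList : List ((W →L[ℝ] ℝ) × LieSU3) :=
  List.ofFn fun i : Fin 6 => (EuclideanSpace.proj i.succ, EuclideanSpace.single (offDiag i) 1)

theorem sumExp_flagList (v : W) :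
    sumExp flagList v = WithLp.toLp 2 ![v 1, v 2, v 3, v 4, v 5, v 6, 0, 0] := by
  simp only [flagList, List.ofFn_succ, List.ofFn_zero, sumExp]
  ext i
  fin_cases i <;> simp [offDiag]

section Tube

variable {M : Type*} [TopologicalSpace M] [ChartedSpace W M] [MulAction SU3 M]

/-- Local coordinates on `SU(3) • γ(I)`. -/
noncomputable def tubeChart (g : SU3) (γ : ℝ → M) (t₀ : ℝ) (q : W) : M :=
  g • prodExp flagList q • γ (t₀ + q 0)

/-- The pull-back of `dt` and the left invariant forms to the local coordinates. -/
noncomputable def pullMap (q : W) : W →L[ℝ] ℝ × LieSU3 :=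
  (EuclideanSpace.proj 0 : W →L[ℝ] ℝ).prod (logDeriv flagList q)

/-- The expression in local coordinates of an invariant form. -/
noncomputable def tubeForm {k : ℕ} (S : ℝ → (ℝ × LieSU3) [⋀^Fin k]→L[ℝ] ℝ) (t₀ : ℝ) (q : W) :
    W [⋀^Fin k]→L[ℝ] ℝ :=
  (S (t₀ + q 0)).compContinuousLinearMap (pullMap q)

theorem contDiff_pullMap : ContDiff ℝ ∞ pullMap := by
  have h : pullMap = fun q => (ContinuousLinearMap.inl ℝ ℝ LieSU3).comp (EuclideanSpace.proj 0)
      + (ContinuousLinearMap.inr ℝ ℝ LieSU3).comp (logDeriv flagList q) := by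
    funext q
    refine ContinuousLinearMap.ext fun v => ?_
    simp [pullMap]
  rw [h]
  exact contDiff_const.add (contDiff_const.clm_comp (contDiff_logDeriv _))

theorem contDiffAt_tubeForm {k : ℕ} {n : WithTop ℕ∞} (hn : n ≤ ∞)
    {S : ℝ → (ℝ × LieSU3) [⋀^Fin k]→L[ℝ] ℝ} {t₀ : ℝ} {q : W}
    (hS : ContDiffAt ℝ n S (t₀ + q 0)) : ContDiffAt ℝ n (tubeForm S t₀) q := by
  refine ContDiffAt.compForm ?_ (contDiff_pullMap.of_le hn).contDiffAt
  exact ContDiffAt.comp q hS (contDiffAt_const.add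
    (EuclideanSpace.proj (0 : Fin 7) : W →L[ℝ] ℝ).contDiff.contDiffAt)

variable (hM : IsSmoothAction M)

include hM

/-- The factorization isolates the group element in `push`. An invariant form does not see it, so
its pull-back depends on `q` only through `t₀ + q₀` and `pullMap q`. -/
theorem IsSmoothAction.hasMFDerivAt_tubeChart (g : SU3) {γ : ℝ → M} {t₀ : ℝ} {q : W}
    (hγ : MDifferentiableAt 𝓘(ℝ, ℝ) 𝓘(ℝ, W) γ (t₀ + q 0)) :
    HasMFDerivAt 𝓘(ℝ, W) 𝓘(ℝ, W) (tubeChart g γ t₀) q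
      ((push (g * prodExp flagList q) (γ (t₀ + q 0))).comp
        ((tube γ (t₀ + q 0)).comp (pullMap q))) := by
  have h1 : HasFDerivAt (fun q : W => t₀ + q 0) (EuclideanSpace.proj 0 : W →L[ℝ] ℝ) q :=
    ((EuclideanSpace.proj 0 : W →L[ℝ] ℝ).hasFDerivAt).const_add t₀
  have h2 : HasMFDerivAt 𝓘(ℝ, W) 𝓘(ℝ, W) (fun q : W => γ (t₀ + q 0)) q
      ((EuclideanSpace.proj 0 : W →L[ℝ] ℝ).smulRight (vel γ (t₀ + q 0))) := by
    have h := HasMFDerivAt.comp q hγ.hasMFDerivAt h1.hasMFDerivAt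
    refine h.congr_mfderiv ?_
    have key : ∀ v : W, (mfderiv 𝓘(ℝ, ℝ) 𝓘(ℝ, W) γ (t₀ + q 0) : ℝ →L[ℝ] W) (v 0)
        = v 0 • vel γ (t₀ + q 0) := by
      intro v
      have h4 : ∀ (A : ℝ →L[ℝ] W) (r : ℝ), A r = r • A 1 := fun A r => by
        rw [← map_smul, smul_eq_mul, mul_one]
      exact h4 _ _
    exact ContinuousLinearMap.ext key
  have h3 := (hM.hasMFDerivAt g _).comp q (hM.hasMFDerivAt_prodExp flagList h2)
  refine HasMFDerivAt.congr_mfderiv h3 ?_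
  rw [hM.push_mul]
  have key : ∀ v : W, fund (γ (t₀ + q 0)) (logDeriv flagList q v) + v 0 • vel γ (t₀ + q 0)
      = tube γ (t₀ + q 0) (pullMap q v) := by
    intro v
    rw [tube_apply, add_comm]
    rfl
  refine ContinuousLinearMap.ext fun v => ?_
  exact congrArg (fun w => push g (prodExp flagList q • γ (t₀ + q 0))
    (push (prodExp flagList q) (γ (t₀ + q 0)) w)) (key v)

theorem IsSmoothAction.contMDiffAt_tubeChart (g : SU3) {γ : ℝ → M} {t₀ : ℝ} {q : W}
    (hγ : ContMDiffAt 𝓘(ℝ, ℝ) 𝓘(ℝ, W) ∞ γ (t₀ + q 0)) :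
    ContMDiffAt 𝓘(ℝ, W) 𝓘(ℝ, W) ∞ (tubeChart g γ t₀) q := by
  have h1 : ContMDiffAt 𝓘(ℝ, W) 𝓘(ℝ, W) ∞ (fun q : W => γ (t₀ + q 0)) q := by
    have h : ContDiff ℝ ∞ (fun q : W => t₀ + q 0) :=
      contDiff_const.add (EuclideanSpace.proj (0 : Fin 7) : W →L[ℝ] ℝ).contDiff
    exact ContMDiffAt.comp q hγ h.contMDiff.contMDiffAt
  have h2 : ∀ L : List ((W →L[ℝ] ℝ) × LieSU3), ContMDiffAt 𝓘(ℝ, W) 𝓘(ℝ, W) ∞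
      (fun q : W => prodExp L q • γ (t₀ + q 0)) q := by
    intro L
    induction L with
    | nil =>
      have : (fun q : W => prodExp [] q • γ (t₀ + q 0)) = fun q => γ (t₀ + q 0) := by
        funext q; exact one_smul _ _
      rw [this]; exact h1
    | cons x L ih =>
      have : (fun q : W => prodExp (x :: L) q • γ (t₀ + q 0))
          = fun q => suExp (x.1 q • x.2) • prodExp L q • γ (t₀ + q 0) := by
        funext q; simp only [prodExp, mul_smul]
      rw [this]
      have h3 : ContDiff ℝ ∞ fun q : W => x.1 q • x.2 := x.1.contDiff.smul contDiff_const
      exact ContMDiffAt.comp q (hM.exp.contMDiffAt (x := (x.1 q • x.2, prodExp L q • γ (t₀ + q 0))))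
        (ContMDiffAt.prodMk h3.contMDiff.contMDiffAt ih)
  exact ContMDiffAt.comp q (hM.smul g).contMDiffAt (h2 flagList)

omit hM in
/-- The pull-back of an invariant form by the local coordinates. -/
theorem comp_tubeChart {k : ℕ} {η : FormField M k} (hη : IsInvariantForm η)
    (g : SU3) (γ : ℝ → M) (t₀ : ℝ) (q : W) :
    (toForm η (tubeChart g γ t₀ q)).compContinuousLinearMap
      ((push (g * prodExp flagList q) (γ (t₀ + q 0))).comp
        ((tube γ (t₀ + q 0)).comp (pullMap q)))
      = tubeForm (fun t => (toForm η (γ t)).compContinuousLinearMap (tube γ t)) t₀ q := by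
  have h := (isInvariantForm_iff η).1 hη (g * prodExp flagList q) (γ (t₀ + q 0))
  rw [mul_smul] at h
  simp only [tubeForm, ← h]
  rfl

omit [MulAction SU3 M] hM in
theorem mfderiv_symm_comp [IsManifold 𝓘(ℝ, W) ∞ M] {E : Type*} [NormedAddCommGroup E]
    [NormedSpace ℝ E] {e : OpenPartialHomeomorph M W}
    (he : e ∈ atlas W M) {Ψ : E → M} {q : E} {A : E →L[ℝ] W}
    (hΨ : HasMFDerivAt 𝓘(ℝ, E) 𝓘(ℝ, W) Ψ q A) (hq : Ψ q ∈ e.source)  :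
    (mfderiv 𝓘(ℝ, W) 𝓘(ℝ, W) e.symm (e (Ψ q)) : W →L[ℝ] W).comp
      (fderiv ℝ (fun q => e (Ψ q)) q) = A := by
  have hmax : e ∈ IsManifold.maximalAtlas 𝓘(ℝ, W) ∞ M := IsManifold.subset_maximalAtlas he
  have h1 := (contMDiffAt_of_mem_maximalAtlas hmax hq).mdifferentiableAt (by simp)
  have h2 := (contMDiffAt_symm_of_mem_maximalAtlas hmax (e.map_source hq)).mdifferentiableAt
    (by simp)
  have h3 : HasFDerivAt (fun q => e (Ψ q)) (fderiv ℝ (fun q => e (Ψ q)) q) q := by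
    have := h1.hasMFDerivAt.comp q hΨ
    exact this.hasFDerivAt.differentiableAt.hasFDerivAt
  have h4 := h2.hasMFDerivAt.comp q h3.hasMFDerivAt
  have h5 : Ψ =ᶠ[nhds q] e.symm ∘ fun q => e (Ψ q) := by
    filter_upwards [hΨ.continuousAt.preimage_mem_nhds (e.open_source.mem_nhds hq)] with r hr
    exact (e.left_inv hr).symm
  have h6 : HasMFDerivAt 𝓘(ℝ, E) 𝓘(ℝ, W) Ψ q _ := h4.congr_of_eventuallyEq h5
  have h7 := hasMFDerivAt_unique h6 hΨ
  exact h7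

/-- The map `(t, k) ↦ k • γ t` is a submersion at `(t, 1)`, and the torus fixes `γ t`
infinitesimally. -/
structure IsTubePoint (γ : ℝ → M) (t : ℝ) : Prop where
  surjective : Function.Surjective (tube γ t)
  torus : ∀ c : LieSU3, (∀ i, c (offDiag i) = 0) → fund (γ t) c = 0

-- The coordinates provide no torus directions, but these are annihilated by the action: replacing
-- the torus components of a preimage by zero does not change its image.
omit hM in
theorem IsTubePoint.surjective_pullMap {γ : ℝ → M} {t : ℝ} (h : IsTubePoint γ t) :
    Function.Surjective ((tube γ t).comp (pullMap 0)) := by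
  intro w
  obtain ⟨x, hx⟩ := h.surjective w
  refine ⟨WithLp.toLp 2 ![x.1, x.2 0, x.2 1, x.2 2, x.2 3, x.2 4, x.2 5], ?_⟩
  set v : W := WithLp.toLp 2 ![x.1, x.2 0, x.2 1, x.2 2, x.2 3, x.2 4, x.2 5] with hv
  have h1 : pullMap 0 v = (x.1, sumExp flagList v) := by
    rw [← logDeriv_zero]; rfl
  have h2 : fund (γ t) (sumExp flagList v - x.2) = 0 := by
    apply h.torus
    intro i
    rw [sumExp_flagList]
    fin_cases i <;> simp [offDiag, hv]
  rw [map_sub, sub_eq_zero] at h2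
  rw [ContinuousLinearMap.comp_apply, h1, tube_apply, h2, ← hx, tube_apply]

/-- `χ` is the tube parametrization read in the chart `e`, a local diffeomorphism at the origin by
the inverse function theorem, and `κ` is its local inverse. The two germ identities allow regularity
and exterior derivatives to be transported in both directions. -/
theorem IsSmoothAction.exists_coordinates [IsManifold 𝓘(ℝ, W) ∞ M] (g : SU3) {γ : ℝ → M} {t₀ : ℝ}
    (hγ : ∀ᶠ t in nhds t₀, ContMDiffAt 𝓘(ℝ, ℝ) 𝓘(ℝ, W) ∞ γ t) (ht : IsTubePoint γ t₀)
    {e : OpenPartialHomeomorph M W} (he : e ∈ atlas W M) (hp : g • γ t₀ ∈ e.source) :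
    ∃ χ κ : W → W, χ 0 = e (g • γ t₀) ∧ κ (e (g • γ t₀)) = 0 ∧ ContDiffAt ℝ ∞ χ 0 ∧
      ContDiffAt ℝ ∞ κ (e (g • γ t₀)) ∧
      ∀ {k : ℕ} (η : FormField M k), IsInvariantForm η →
        ((tubeForm (fun t => (toForm η (γ t)).compContinuousLinearMap (tube γ t)) t₀) =ᶠ[nhds 0]
          fun q => (localRep η e (χ q)).compContinuousLinearMap (fderiv ℝ χ q)) ∧
        (localRep η e =ᶠ[nhds (e (g • γ t₀))] fun y =>
          (tubeForm (fun t => (toForm η (γ t)).compContinuousLinearMap (tube γ t)) t₀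
            (κ y)).compContinuousLinearMap (fderiv ℝ κ y)) := by
  set Ψ := tubeChart g γ t₀ with hΨ
  set χ : W → W := fun q => e (Ψ q) with hχ
  have hΨ0 : Ψ 0 = g • γ t₀ := by
    simp [hΨ, tubeChart, prodExp_zero]
  have hχ0 : χ 0 = e (g • γ t₀) := by rw [hχ, ← hΨ0]
  have hcont : Filter.Tendsto (fun q : W => t₀ + q 0) (nhds 0) (nhds t₀) := by
    have h : Continuous (fun q : W => t₀ + q 0) :=
      continuous_const.add (EuclideanSpace.proj (0 : Fin 7) : W →L[ℝ] ℝ).continuous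
    simpa using h.tendsto 0
  have hsm : ∀ᶠ q in nhds (0 : W), ContMDiffAt 𝓘(ℝ, W) 𝓘(ℝ, W) ∞ Ψ q := by
    filter_upwards [hcont.eventually hγ] with q hq
    exact hM.contMDiffAt_tubeChart g hq
  have hsrc : ∀ᶠ q in nhds (0 : W), Ψ q ∈ e.source := by
    refine hsm.self_of_nhds.continuousAt.preimage_mem_nhds (e.open_source.mem_nhds ?_)
    rw [hΨ0]; exact hp
  have hmax : e ∈ IsManifold.maximalAtlas 𝓘(ℝ, W) ∞ M := IsManifold.subset_maximalAtlas he
  have hχs : ∀ᶠ q in nhds (0 : W), ContDiffAt ℝ ∞ χ q := by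
    filter_upwards [hsm, hsrc] with q hq hq'
    exact ((contMDiffAt_of_mem_maximalAtlas hmax hq').comp q hq).contDiffAt
  set A : W → W →L[ℝ] W := fun q => (push (g * prodExp flagList q) (γ (t₀ + q 0))).comp
        ((tube γ (t₀ + q 0)).comp (pullMap q)) with hA
  have hD : ∀ᶠ q in nhds (0 : W), HasMFDerivAt 𝓘(ℝ, W) 𝓘(ℝ, W) Ψ q (A q) := by
    filter_upwards [hcont.eventually hγ] with q hq
    exact hM.hasMFDerivAt_tubeChart g (hq.mdifferentiableAt (by simp))
  have hcomp : ∀ᶠ q in nhds (0 : W),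
      (mfderiv 𝓘(ℝ, W) 𝓘(ℝ, W) e.symm (χ q) : W →L[ℝ] W).comp (fderiv ℝ χ q) = A q := by
    filter_upwards [hD, hsrc] with q hq hq'
    exact mfderiv_symm_comp he hq hq'
  have hA0 : Function.Surjective (A 0) := by
    have h1 : A 0 = (push (g * prodExp flagList 0) (γ t₀)).comp
        ((tube γ t₀).comp (pullMap 0)) := by
      simp [hA]
    rw [h1, ContinuousLinearMap.coe_comp]
    exact (hM.pushEquiv (g * prodExp flagList 0) (γ t₀)).surjective.comp ht.surjective_pullMap
  -- The differential of the parametrization is a surjective endomorphism of a space of dimension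
  -- seven, hence injective, and it factors through the derivative of `χ`.
  have hinj : Function.Injective (fderiv ℝ χ 0) := by
    have h1 : Function.Injective (A 0) :=
      (LinearMap.injective_iff_surjective (f := (A 0).toLinearMap)).2 hA0
    have h2 : ∀ v, (mfderiv 𝓘(ℝ, W) 𝓘(ℝ, W) e.symm (χ 0) : W →L[ℝ] W) (fderiv ℝ χ 0 v)
        = A 0 v := fun v => DFunLike.congr_fun hcomp.self_of_nhds v
    exact fun v w hvw => h1 (by rw [← h2, ← h2, hvw])
  obtain ⟨B, hB⟩ : ∃ B : W ≃L[ℝ] W, (B : W →L[ℝ] W) = fderiv ℝ χ 0 :=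
    ⟨(LinearEquiv.ofInjectiveEndo _ hinj).toContinuousLinearEquiv,
      ContinuousLinearMap.ext fun v => rfl⟩
  have hχc : ContDiffAt ℝ ∞ χ 0 := hχs.self_of_nhds
  have hχd : HasFDerivAt χ (B : W →L[ℝ] W) 0 := by
    rw [hB]; exact (hχc.differentiableAt (by simp)).hasFDerivAt
  set κ := hχc.localInverse hχd (by simp) with hκ
  have hκ0 : κ (χ 0) = 0 := hχc.localInverse_apply_image hχd (by simp)
  have hκc : ContDiffAt ℝ ∞ κ (χ 0) := hχc.to_localInverse hχd (by simp)
  have hr : ∀ᶠ y in nhds (χ 0), χ (κ y) = y :=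
    (hχc.hasStrictFDerivAt' hχd (by simp)).eventually_right_inverse
  refine ⟨χ, κ, hχ0, by rw [← hχ0, hκ0], hχc, by rw [← hχ0]; exact hκc, fun η hη => ?_⟩
  have hP : (tubeForm (fun t => (toForm η (γ t)).compContinuousLinearMap (tube γ t)) t₀)
      =ᶠ[nhds 0] fun q => (localRep η e (χ q)).compContinuousLinearMap (fderiv ℝ χ q) := by
    filter_upwards [hcomp, hsrc] with q hq hq'
    rw [← comp_tubeChart hη g γ t₀ q]
    change (toForm η (Ψ q)).compContinuousLinearMap (A q) = _
    rw [← hq]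
    have h1 : e.symm (χ q) = Ψ q := e.left_inv hq'
    change _ = ((toForm η (e.symm (χ q))).compContinuousLinearMap
      (mfderiv 𝓘(ℝ, W) 𝓘(ℝ, W) e.symm (χ q) : W →L[ℝ] W)).compContinuousLinearMap _
    rw [h1]
    rfl
  refine ⟨hP, ?_⟩
  rw [← hχ0]
  have hκt : Filter.Tendsto κ (nhds (χ 0)) (nhds 0) := by
    have := hκc.continuousAt.tendsto
    rwa [hκ0] at this
  have hκd : ∀ᶠ y in nhds (χ 0), DifferentiableAt ℝ κ y := by
    filter_upwards [(hκc.of_le (show (1 : WithTop ℕ∞) ≤ ∞ by simp)).eventually (by simp)] with y hy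
    exact hy.differentiableAt (by simp)
  filter_upwards [hκt.eventually hP, hκd, hr.eventually_nhds, hκt.eventually hχs] with y hy hd hy' hχy
  rw [hy, hy'.self_of_nhds]
  have h1 : (fderiv ℝ χ (κ y)).comp (fderiv ℝ κ y) = ContinuousLinearMap.id ℝ W := by
    have h2 := ((hχy.differentiableAt (by simp)).hasFDerivAt).comp y hd.hasFDerivAt
    exact (h2.congr_of_eventuallyEq (hy'.mono fun z hz => by
      simpa using hz.symm)).unique (hasFDerivAt_id y)
  change localRep η e y = (localRep η e y).compContinuousLinearMap
    ((fderiv ℝ χ (κ y)).comp (fderiv ℝ κ y))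
  rw [h1]
  rfl

end Tube

/-! ### Exterior derivatives of products of covector fields -/

/-- The value on five vectors of the product of a two-form and three covectors. -/
def fiveProd (τ : Fin 5 → Fin 5 → ℝ) (a b c : Fin 5 → ℝ) : ℝ :=
  let d := fun i j k => a i * (b j * c k - b k * c j) - a j * (b i * c k - b k * c i)
    + a k * (b i * c j - b j * c i)
  τ 0 1 * d 2 3 4 - τ 0 2 * d 1 3 4 + τ 0 3 * d 1 2 4 - τ 0 4 * d 1 2 3
    + τ 1 2 * d 0 3 4 - τ 1 3 * d 0 2 4 + τ 1 4 * d 0 2 3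
    + τ 2 3 * d 0 1 4 - τ 2 4 * d 0 1 3 + τ 3 4 * d 0 1 2

/-- The value on five vectors of a product of five covectors. -/
def five (x y a b c : Fin 5 → ℝ) : ℝ := fiveProd (fun i j => x i * y j - x j * y i) a b c

theorem five_swap01 (x y a b c : Fin 5 → ℝ) : five y x a b c = -five x y a b c := by
  simp only [five, fiveProd]; ring

theorem five_swap12 (x y a b c : Fin 5 → ℝ) : five x a y b c = -five x y a b c := by
  simp only [five, fiveProd]; ring

theorem five_swap23 (x y a b c : Fin 5 → ℝ) : five x y b a c = -five x y a b c := by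
  simp only [five, fiveProd]; ring

theorem five_swap34 (x y a b c : Fin 5 → ℝ) : five x y a c b = -five x y a b c := by
  simp only [five, fiveProd]; ring

section Sorting

variable (E : Fin 7 → Fin 5 → ℝ) {i j : Fin 7} (x y z : Fin 5 → ℝ)

/-- The condition `j < i` orients the transpositions as rewriting rules, so that simplification
sorts the indices of a product of five covectors, with signs, and stops. -/
theorem five_sort01 (_ : j < i) : five (E i) (E j) x y z = -five (E j) (E i) x y z :=
  five_swap01 _ _ _ _ _
theorem five_sort12 (_ : j < i) : five x (E i) (E j) y z = -five x (E j) (E i) y z :=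
  five_swap12 _ _ _ _ _
theorem five_sort23 (_ : j < i) : five x y (E i) (E j) z = -five x y (E j) (E i) z :=
  five_swap23 _ _ _ _ _
theorem five_sort34 (_ : j < i) : five x y z (E i) (E j) = -five x y z (E j) (E i) :=
  five_swap34 _ _ _ _ _

theorem five_self01 (a : Fin 5 → ℝ) : five a a x y z = 0 := by
  have := five_swap01 a a x y z; linarith
theorem five_self12 (a : Fin 5 → ℝ) : five x a a y z = 0 := by
  have := five_swap12 x a a y z; linarith
theorem five_self23 (a : Fin 5 → ℝ) : five x y a a z = 0 := by
  have := five_swap23 x y a a z; linarith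
theorem five_self34 (a : Fin 5 → ℝ) : five x y z a a = 0 := by
  have := five_swap34 x y z a a; linarith

end Sorting

section

variable {E : Type*} [NormedAddCommGroup E] [NormedSpace ℝ E]

/-- The Leibniz rule for a product of four covector fields, evaluated on five vectors. The function
`τ j` is the exterior derivative of the `j`-th factor. -/
theorem extDeriv_wedge_four {a : Fin 4 → E → E →L[ℝ] ℝ} {x : E}
    (ha : ∀ j, DifferentiableAt ℝ (a j) x)
    (h : DifferentiableAt ℝ (fun q => wedge fun j => a j q) x) (v : Fin 5 → E) :
    let τ := fun j i k => fderiv ℝ (a j) x (v i) (v k) - fderiv ℝ (a j) x (v k) (v i)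
    let A := fun j i => a j x (v i)
    extDeriv (fun q => wedge fun j => a j q) x v
      = fiveProd (τ 0) (A 1) (A 2) (A 3) - fiveProd (τ 1) (A 0) (A 2) (A 3)
        + fiveProd (τ 2) (A 0) (A 1) (A 3) - fiveProd (τ 3) (A 0) (A 1) (A 2) := by
  intro τ A
  have key : ∀ (w : Fin 4 → E) (u : E), fderiv ℝ (fun q => wedge (fun j => a j q) w) x u
      = ∑ j : Fin 4, wedge (Function.update (fun j => a j x) j (fderiv ℝ (a j) x u)) w := by
    intro w u
    -- For fixed vectors the product is multilinear in the covectors, so its derivative replaces one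
    -- covector at a time.
    let D : MultilinearMap ℝ (fun _ : Fin 4 => E →L[ℝ] ℝ) ℝ :=
      ((Matrix.detRowAlternating (n := Fin 4) (R := ℝ)).toMultilinearMap.compLinearMap
        (fun _ => LinearMap.pi fun i => (ContinuousLinearMap.apply ℝ ℝ (w i)).toLinearMap))
    have hD : ∀ b : Fin 4 → E →L[ℝ] ℝ, D b = wedge b w := by
      intro b
      rw [wedge_apply, ← Matrix.det_transpose]
      rfl
    let D' : ContinuousMultilinearMap ℝ (fun _ : Fin 4 => E →L[ℝ] ℝ) ℝ :=
      { D with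
        cont := by
          have h : Continuous fun b : Fin 4 → E →L[ℝ] ℝ =>
              Matrix.det (fun i j => b i (w j)) := by
            apply Continuous.matrix_det
            fun_prop
          exact h }
    have h1 : HasFDerivAt (fun q => D' (fun j => a j q))
        ((D'.linearDeriv (fun j => a j x)).comp (ContinuousLinearMap.pi fun j =>
          fderiv ℝ (a j) x)) x :=
      (D'.hasFDerivAt (fun j => a j x)).comp x (hasFDerivAt_pi.2 fun j => (ha j).hasFDerivAt)
    have h2 : (fun q => D' (fun j => a j q)) = fun q => wedge (fun j => a j q) w := by
      funext q; exact hD _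
    rw [h2] at h1
    rw [h1.fderiv]
    simp only [ContinuousLinearMap.comp_apply, ContinuousMultilinearMap.linearDeriv_apply]
    exact Finset.sum_congr rfl fun j _ => hD _
  rw [extDeriv_apply h]
  have hr : ∀ i : Fin 5, Fin.removeNth (α := fun _ => E) i v
      = ![v (i.succAbove 0), v (i.succAbove 1), v (i.succAbove 2), v (i.succAbove 3)] := by
    intro i; funext k; fin_cases k <;> rfl
  have hs : ∀ f : Fin 5 → ℝ, ∑ i : Fin (4 + 1), (-1 : ℤ) ^ i.val • f i
      = f 0 - f 1 + f 2 - f 3 + f 4 := by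
    intro f
    rw [Fin.sum_univ_five]
    simp
    ring
  rw [hs fun i => fderiv ℝ (fun q => wedge (fun j => a j q) (i.removeNth v)) x (v i)]
  simp only [key, Fin.sum_univ_four, hr]
  have h0 : ∀ b : E →L[ℝ] ℝ, Function.update (fun j => a j x) 0 b
      = ![b, a 1 x, a 2 x, a 3 x] := fun b => by funext k; fin_cases k <;> rfl
  have h1 : ∀ b : E →L[ℝ] ℝ, Function.update (fun j => a j x) 1 b
      = ![a 0 x, b, a 2 x, a 3 x] := fun b => by funext k; fin_cases k <;> rfl
  have h2 : ∀ b : E →L[ℝ] ℝ, Function.update (fun j => a j x) 2 b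
      = ![a 0 x, a 1 x, b, a 3 x] := fun b => by funext k; fin_cases k <;> rfl
  have h3 : ∀ b : E →L[ℝ] ℝ, Function.update (fun j => a j x) 3 b
      = ![a 0 x, a 1 x, a 2 x, b] := fun b => by funext k; fin_cases k <;> rfl
  simp only [h0, h1, h2, h3, wedge_four]
  simp only [τ, A, fiveProd]
  have e1 : (1 : Fin 5).succAbove 0 = 0 ∧ (1 : Fin 5).succAbove 1 = 2 ∧
    (1 : Fin 5).succAbove 2 = 3 ∧ (1 : Fin 5).succAbove 3 = 4 := by decide
  have e2 : (2 : Fin 5).succAbove 0 = 0 ∧ (2 : Fin 5).succAbove 1 = 1 ∧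
    (2 : Fin 5).succAbove 2 = 3 ∧ (2 : Fin 5).succAbove 3 = 4 := by decide
  have e3 : (3 : Fin 5).succAbove 0 = 0 ∧ (3 : Fin 5).succAbove 1 = 1 ∧
    (3 : Fin 5).succAbove 2 = 2 ∧ (3 : Fin 5).succAbove 3 = 4 := by decide
  have e4 : (4 : Fin 5).succAbove 0 = 0 ∧ (4 : Fin 5).succAbove 1 = 1 ∧
    (4 : Fin 5).succAbove 2 = 2 ∧ (4 : Fin 5).succAbove 3 = 3 := by decide
  have e0 : (0 : Fin 5).succAbove 0 = 1 ∧ (0 : Fin 5).succAbove 1 = 2 ∧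
    (0 : Fin 5).succAbove 2 = 3 ∧ (0 : Fin 5).succAbove 3 = 4 := by decide
  simp only [e0, e1, e2, e3, e4]
  ring

end

/-! ### The exterior derivative of the Hodge dual on the tube -/

/-- The structure constants of `su(3)` modulo the torus. The arguments have no torus components at
the origin, so brackets with the torus do not enter the structure equations there. -/
theorem lie_sumExp (u v : W) (i : Fin 6) :
    lie (sumExp flagList u) (sumExp flagList v) (offDiag i) =
    ![(1 / 2) * (u 3 * v 5 - v 3 * u 5) + (-1 / 2) * (u 4 * v 6 - v 4 * u 6),
      (-1 / 2) * (u 3 * v 6 - v 3 * u 6) + (-1 / 2) * (u 4 * v 5 - v 4 * u 5),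
      (-1 / 2) * (u 1 * v 5 - v 1 * u 5) + (1 / 2) * (u 2 * v 6 - v 2 * u 6),
      (1 / 2) * (u 1 * v 6 - v 1 * u 6) + (1 / 2) * (u 2 * v 5 - v 2 * u 5),
      (1 / 2) * (u 1 * v 3 - v 1 * u 3) + (-1 / 2) * (u 2 * v 4 - v 2 * u 4),
      (-1 / 2) * (u 1 * v 4 - v 1 * u 4) + (-1 / 2) * (u 2 * v 3 - v 2 * u 3)] i := by
  rw [lie, suCoord_apply, sumExp_flagList, sumExp_flagList, suMat_eq, suMat_eq]
  fin_cases i <;> simp [offDiag] <;> ring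

/-- The components of a vector of `W` in the coframe `dt, e₁, …, e₆` and the differentials of these
covectors, on five vectors. -/
noncomputable def dCoframe (E : Fin 7 → Fin 5 → ℝ) : Fin 7 → Fin 5 → Fin 5 → ℝ :=
  ![fun _ _ => 0,
    fun i j => -((1 / 2) * (E 3 i * E 5 j - E 3 j * E 5 i)
      + (-1 / 2) * (E 4 i * E 6 j - E 4 j * E 6 i)),
    fun i j => -((-1 / 2) * (E 3 i * E 6 j - E 3 j * E 6 i)
      + (-1 / 2) * (E 4 i * E 5 j - E 4 j * E 5 i)),
    fun i j => -((-1 / 2) * (E 1 i * E 5 j - E 1 j * E 5 i)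
      + (1 / 2) * (E 2 i * E 6 j - E 2 j * E 6 i)),
    fun i j => -((1 / 2) * (E 1 i * E 6 j - E 1 j * E 6 i)
      + (1 / 2) * (E 2 i * E 5 j - E 2 j * E 5 i)),
    fun i j => -((1 / 2) * (E 1 i * E 3 j - E 1 j * E 3 i)
      + (-1 / 2) * (E 2 i * E 4 j - E 2 j * E 4 i)),
    fun i j => -((-1 / 2) * (E 1 i * E 4 j - E 1 j * E 4 i)
      + (-1 / 2) * (E 2 i * E 3 j - E 2 j * E 3 i))]

theorem tubeCoframe_pullMap (j : Fin 7) (q v : W) : tubeCoframe j (pullMap q v)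
    = Fin.cons (α := fun _ => ℝ) (v 0) (fun i : Fin 6 => logDeriv flagList q v (offDiag i)) j := by
  fin_cases j <;> rfl

theorem tubeCoframe_pullMap_zero (j : Fin 7) (v : W) : tubeCoframe j (pullMap 0 v) = v j := by
  rw [tubeCoframe_pullMap, logDeriv_zero, sumExp_flagList]
  fin_cases j <;> rfl

/-- The structure equations at the origin: `dt` is closed, and the exterior derivatives of the other
covectors are minus the brackets, by the Maurer–Cartan equation `fderiv_logDeriv_sub`. -/
theorem hasFDerivAt_tubeCoframe_pullMap (j : Fin 7) :
    DifferentiableAt ℝ (fun q => (tubeCoframe j).comp (pullMap q)) 0 ∧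
    ∀ v : Fin 5 → W, ∀ i k,
      fderiv ℝ (fun q => (tubeCoframe j).comp (pullMap q)) 0 (v i) (v k)
        - fderiv ℝ (fun q => (tubeCoframe j).comp (pullMap q)) 0 (v k) (v i)
      = dCoframe (fun j i => v i j) j i k := by
  have hd : DifferentiableAt ℝ pullMap 0 := contDiff_pullMap.differentiable (by simp) 0
  have h1 : HasFDerivAt (fun q => (tubeCoframe j).comp (pullMap q))
      (((ContinuousLinearMap.compL ℝ W (ℝ × LieSU3) ℝ) (tubeCoframe j)).comp
        (fderiv ℝ pullMap 0)) 0 :=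
    ((ContinuousLinearMap.compL ℝ W (ℝ × LieSU3) ℝ) (tubeCoframe j)).hasFDerivAt.comp 0
      hd.hasFDerivAt
  refine ⟨h1.differentiableAt, fun v i k => ?_⟩
  rw [h1.fderiv]
  have h2 : HasFDerivAt (fun q => (EuclideanSpace.proj 0 : W →L[ℝ] ℝ).prod (logDeriv flagList q))
      (fderiv ℝ pullMap 0) 0 := hd.hasFDerivAt
  have hl : DifferentiableAt ℝ (logDeriv flagList) 0 :=
    (contDiff_logDeriv _).differentiable (by simp) 0
  have h3 : ∀ u w : W, fderiv ℝ pullMap 0 u w = (0, fderiv ℝ (logDeriv flagList) 0 u w) := by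
    intro u w
    have h4 : HasFDerivAt (fun q => (pullMap q w)) ((fderiv ℝ pullMap 0).flip w) 0 := by
      have := (ContinuousLinearMap.apply ℝ (ℝ × LieSU3) w).hasFDerivAt.comp 0 hd.hasFDerivAt
      exact this
    have h5 : HasFDerivAt (fun q => (w 0, logDeriv flagList q w))
        ((0 : W →L[ℝ] ℝ).prod ((fderiv ℝ (logDeriv flagList) 0).flip w)) 0 := by
      have := (ContinuousLinearMap.apply ℝ LieSU3 w).hasFDerivAt.comp 0 hl.hasFDerivAt
      exact (hasFDerivAt_const (w 0) (0 : W)).prodMk this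
    exact DFunLike.congr_fun (h4.unique h5) u
  have h6 := fderiv_logDeriv_sub flagList (v i) (v k)
  simp only [ContinuousLinearMap.comp_apply, ContinuousLinearMap.compL_apply, h3]
  rw [← map_sub, Prod.mk_sub_mk, h6, sub_zero]
  fin_cases j
  · rfl
  exacts [congrArg Neg.neg (lie_sumExp (v i) (v k) 0), congrArg Neg.neg (lie_sumExp (v i) (v k) 1),
    congrArg Neg.neg (lie_sumExp (v i) (v k) 2), congrArg Neg.neg (lie_sumExp (v i) (v k) 3),
    congrArg Neg.neg (lie_sumExp (v i) (v k) 4), congrArg Neg.neg (lie_sumExp (v i) (v k) 5)]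

/-- The field of four-forms `c₁ ω₁ω₂ + c₂ ω₂ω₃ + c₃ ω₃ω₁ + (b β - a α) ∧ dt`. -/
noncomputable def starField (c₁ c₂ c₃ a b : ℝ → ℝ) (t : ℝ) : (ℝ × LieSU3) [⋀^Fin 4]→L[ℝ] ℝ :=
  c₁ t • wedge ![tubeCoframe 1, tubeCoframe 2, tubeCoframe 3, tubeCoframe 4]
    + c₂ t • wedge ![tubeCoframe 3, tubeCoframe 4, tubeCoframe 5, tubeCoframe 6]
    + c₃ t • wedge ![tubeCoframe 5, tubeCoframe 6, tubeCoframe 1, tubeCoframe 2]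
    + b t • wedge ![tubeCoframe 1, tubeCoframe 3, tubeCoframe 5, tubeCoframe 0]
    - b t • wedge ![tubeCoframe 1, tubeCoframe 4, tubeCoframe 6, tubeCoframe 0]
    - b t • wedge ![tubeCoframe 2, tubeCoframe 3, tubeCoframe 6, tubeCoframe 0]
    - b t • wedge ![tubeCoframe 2, tubeCoframe 4, tubeCoframe 5, tubeCoframe 0]
    - a t • wedge ![tubeCoframe 2, tubeCoframe 4, tubeCoframe 6, tubeCoframe 0]
    + a t • wedge ![tubeCoframe 2, tubeCoframe 3, tubeCoframe 5, tubeCoframe 0]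
    + a t • wedge ![tubeCoframe 1, tubeCoframe 4, tubeCoframe 5, tubeCoframe 0]
    + a t • wedge ![tubeCoframe 1, tubeCoframe 3, tubeCoframe 6, tubeCoframe 0]

theorem contDiffAt_starField {n : WithTop ℕ∞} {c₁ c₂ c₃ a b : ℝ → ℝ} {t : ℝ}
    (h₁ : ContDiffAt ℝ n c₁ t) (h₂ : ContDiffAt ℝ n c₂ t) (h₃ : ContDiffAt ℝ n c₃ t)
    (ha : ContDiffAt ℝ n a t) (hb : ContDiffAt ℝ n b t) :
    ContDiffAt ℝ n (starField c₁ c₂ c₃ a b) t := by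
  unfold starField
  fun_prop

theorem tubeStar_eq (f₁ f₂ f₃ θ : ℝ → ℝ) (t : ℝ) : tubeStar (f₁ t) (f₂ t) (f₃ t) (θ t) =
    starField (fun t => f₁ t ^ 2 * f₂ t ^ 2) (fun t => f₂ t ^ 2 * f₃ t ^ 2)
      (fun t => f₁ t ^ 2 * f₃ t ^ 2) (fun t => f₁ t * f₂ t * f₃ t * Real.sin (θ t))
      (fun t => f₁ t * f₂ t * f₃ t * Real.cos (θ t)) t := by
  ext x
  rw [four_eta x, tubeStar, ContinuousAlternatingMap.compContinuousLinearMap_apply, comp_four]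
  simp only [starField, starPhiForm, ContinuousAlternatingMap.add_apply,
    ContinuousAlternatingMap.sub_apply, ContinuousAlternatingMap.smul_apply, wedge_four,
    stdCoframe_apply, smul_eq_mul, tubeCoframe_0, tubeCoframe_1, tubeCoframe_2, tubeCoframe_3,
    tubeCoframe_4, tubeCoframe_5, tubeCoframe_6, tubeFrame_apply]
  simp only [Matrix.cons_val]
  ring

/-- The coefficient is absorbed into the first covector, so the Leibniz rule for four covector
fields applies as it stands. Its derivative contributes `c' dt ∧ vᵢⱼₖₗ`. -/
theorem extDeriv_tubeForm_smul_wedge {c : ℝ → ℝ} {c' t₀ : ℝ} (hc : HasDerivAt c c' t₀)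
    (i j k l : Fin 7) (v : Fin 5 → W) :
    let E : Fin 7 → Fin 5 → ℝ := fun j i => v i j
    DifferentiableAt ℝ (tubeForm (fun t => c t • wedge ![tubeCoframe i, tubeCoframe j,
      tubeCoframe k, tubeCoframe l]) t₀) 0 ∧
    extDeriv (tubeForm (fun t => c t • wedge ![tubeCoframe i, tubeCoframe j,
        tubeCoframe k, tubeCoframe l]) t₀) 0 v
      = c' * five (E 0) (E i) (E j) (E k) (E l) + c t₀ * (fiveProd (dCoframe E i) (E j) (E k) (E l)
        - fiveProd (dCoframe E j) (E i) (E k) (E l) + fiveProd (dCoframe E k) (E i) (E j) (E l)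
        - fiveProd (dCoframe E l) (E i) (E j) (E k)) := by
  intro E
  have hc0 : HasFDerivAt (fun q : W => c (t₀ + q 0))
      ((EuclideanSpace.proj 0 : W →L[ℝ] ℝ).smulRight c') 0 := by
    have h1 : HasFDerivAt (fun q : W => t₀ + q 0) (EuclideanSpace.proj 0 : W →L[ℝ] ℝ) 0 :=
      ((EuclideanSpace.proj 0 : W →L[ℝ] ℝ).hasFDerivAt).const_add t₀
    have h2 : HasDerivAt c c' (t₀ + (0 : W) 0) := by simpa using hc
    exact h2.hasFDerivAt.comp 0 h1
  let a : Fin 4 → W → W →L[ℝ] ℝ := fun m q =>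
    ![c (t₀ + q 0) • (tubeCoframe i).comp (pullMap q), (tubeCoframe j).comp (pullMap q),
      (tubeCoframe k).comp (pullMap q), (tubeCoframe l).comp (pullMap q)] m
  have hi := hasFDerivAt_tubeCoframe_pullMap i
  have hj := hasFDerivAt_tubeCoframe_pullMap j
  have hk := hasFDerivAt_tubeCoframe_pullMap k
  have hl := hasFDerivAt_tubeCoframe_pullMap l
  have ha : ∀ m, DifferentiableAt ℝ (a m) 0 := by
    intro m
    fin_cases m
    · exact hc0.differentiableAt.smul hi.1
    · exact hj.1
    · exact hk.1
    · exact hl.1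
  have heq : tubeForm (fun t => c t • wedge ![tubeCoframe i, tubeCoframe j,
      tubeCoframe k, tubeCoframe l]) t₀ = fun q => wedge fun m => a m q := by
    funext q
    ext x
    have h1 : (fun m => a m q) = ![c (t₀ + q 0) • (tubeCoframe i).comp (pullMap q),
      (tubeCoframe j).comp (pullMap q), (tubeCoframe k).comp (pullMap q),
      (tubeCoframe l).comp (pullMap q)] := rfl
    rw [h1, four_eta x, tubeForm, ContinuousAlternatingMap.compContinuousLinearMap_apply,
      comp_four, ContinuousAlternatingMap.smul_apply, wedge_four, wedge_four]
    simp only [smul_apply, ContinuousLinearMap.comp_apply, smul_eq_mul]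
    ring
  have hd : DifferentiableAt ℝ (fun q => wedge fun m => a m q) 0 := by
    have h1 : (fun q => wedge fun m => a m q) = fun q : W => c (t₀ + q 0) •
        tubeForm (fun _ => wedge ![tubeCoframe i, tubeCoframe j,
          tubeCoframe k, tubeCoframe l]) t₀ q := by
      rw [← heq]; rfl
    rw [h1]
    exact hc0.differentiableAt.smul ((contDiffAt_tubeForm (n := ∞) le_rfl
      contDiffAt_const).differentiableAt (by simp))
  rw [heq]
  refine ⟨hd, ?_⟩
  rw [extDeriv_wedge_four ha hd v]
  have hv : ∀ (j : Fin 7) (i : Fin 5), tubeCoframe j (pullMap 0 (v i)) = E j i :=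
    fun j i => tubeCoframe_pullMap_zero j (v i)
  have hτ0 : ∀ m n, fderiv ℝ (a 0) 0 (v m) (v n) - fderiv ℝ (a 0) 0 (v n) (v m)
      = c' * (E 0 m * E i n - E 0 n * E i m) + c t₀ * dCoframe E i m n := by
    intro m n
    have h1 : HasFDerivAt (a 0) _ 0 := hc0.smul hi.1.hasFDerivAt
    rw [h1.fderiv, ← hi.2 v m n]
    simp [hv, E]
    ring
  have h1 : (fun m n => fderiv ℝ (a 1) 0 (v m) (v n) - fderiv ℝ (a 1) 0 (v n) (v m))
      = dCoframe E j := funext fun m => funext fun n => hj.2 v m n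
  have h2 : (fun m n => fderiv ℝ (a 2) 0 (v m) (v n) - fderiv ℝ (a 2) 0 (v n) (v m))
      = dCoframe E k := funext fun m => funext fun n => hk.2 v m n
  have h3 : (fun m n => fderiv ℝ (a 3) 0 (v m) (v n) - fderiv ℝ (a 3) 0 (v n) (v m))
      = dCoframe E l := funext fun m => funext fun n => hl.2 v m n
  have h4 : (fun m => a 0 0 (v m)) = fun m => c t₀ * E i m := by
    funext m; simp [a, hv]
  have h5 : (fun m => a 1 0 (v m)) = E j := funext fun m => hv j m
  have h6 : (fun m => a 2 0 (v m)) = E k := funext fun m => hv k m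
  have h7 : (fun m => a 3 0 (v m)) = E l := funext fun m => hv l m
  simp only [hτ0, h1, h2, h3, h4, h5, h6, h7]
  generalize dCoframe E i = τ₁
  generalize dCoframe E j = τ₂
  generalize dCoframe E k = τ₃
  generalize dCoframe E l = τ₄
  generalize E 0 = e₀
  generalize E i = e₁
  generalize E j = e₂
  generalize E k = e₃
  generalize E l = e₄
  simp only [five, fiveProd]
  ring

theorem fiveProd_zero (a b c : Fin 5 → ℝ) : fiveProd (fun _ _ => 0) a b c = 0 := by
  simp [fiveProd]

theorem fiveProd_two (x y z w a b c : Fin 5 → ℝ) (p q : ℝ) :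
    fiveProd (fun i j => -(p * (x i * y j - x j * y i) + q * (z i * w j - z j * w i))) a b c
      = -(p * five x y a b c + q * five z w a b c) := by
  simp only [five, fiveProd]; ring

/-- At the origin the structure equations give `d(ωᵢωⱼ) = 0`, `d(α ∧ dt) = 0` and `d(β ∧ dt) = -2 dt
∧ (ω₁ω₂ + ω₂ω₃ + ω₃ω₁)`. Hence `a` drops out and only the derivatives of the `cᵢ` and the value of
`b` remain. -/
theorem extDeriv_starField {c₁ c₂ c₃ a b : ℝ → ℝ} {c₁' c₂' c₃' a' b' t₀ : ℝ}
    (h₁ : HasDerivAt c₁ c₁' t₀) (h₂ : HasDerivAt c₂ c₂' t₀) (h₃ : HasDerivAt c₃ c₃' t₀)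
    (ha : HasDerivAt a a' t₀) (hb : HasDerivAt b b' t₀) (v : Fin 5 → W) :
    let E : Fin 7 → Fin 5 → ℝ := fun j i => v i j
    extDeriv (tubeForm (starField c₁ c₂ c₃ a b) t₀) 0 v =
      (c₁' - 2 * b t₀) * five (E 0) (E 1) (E 2) (E 3) (E 4)
      + (c₂' - 2 * b t₀) * five (E 0) (E 3) (E 4) (E 5) (E 6)
      + (c₃' - 2 * b t₀) * five (E 0) (E 1) (E 2) (E 5) (E 6) := by
  intro E
  have hs : tubeForm (starField c₁ c₂ c₃ a b) t₀ =
    tubeForm (fun t => c₁ t • wedge ![tubeCoframe 1, tubeCoframe 2, tubeCoframe 3, tubeCoframe 4]) t₀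
    + tubeForm (fun t => c₂ t • wedge ![tubeCoframe 3, tubeCoframe 4, tubeCoframe 5, tubeCoframe 6]) t₀
    + tubeForm (fun t => c₃ t • wedge ![tubeCoframe 5, tubeCoframe 6, tubeCoframe 1, tubeCoframe 2]) t₀
    + tubeForm (fun t => b t • wedge ![tubeCoframe 1, tubeCoframe 3, tubeCoframe 5, tubeCoframe 0]) t₀
    + tubeForm (fun t => -b t • wedge ![tubeCoframe 1, tubeCoframe 4, tubeCoframe 6, tubeCoframe 0]) t₀
    + tubeForm (fun t => -b t • wedge ![tubeCoframe 2, tubeCoframe 3, tubeCoframe 6, tubeCoframe 0]) t₀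
    + tubeForm (fun t => -b t • wedge ![tubeCoframe 2, tubeCoframe 4, tubeCoframe 5, tubeCoframe 0]) t₀
    + tubeForm (fun t => -a t • wedge ![tubeCoframe 2, tubeCoframe 4, tubeCoframe 6, tubeCoframe 0]) t₀
    + tubeForm (fun t => a t • wedge ![tubeCoframe 2, tubeCoframe 3, tubeCoframe 5, tubeCoframe 0]) t₀
    + tubeForm (fun t => a t • wedge ![tubeCoframe 1, tubeCoframe 4, tubeCoframe 5, tubeCoframe 0]) t₀
    + tubeForm (fun t => a t • wedge ![tubeCoframe 1, tubeCoframe 3, tubeCoframe 6, tubeCoframe 0]) t₀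
      := by
    funext q
    ext x
    simp only [tubeForm, starField, Pi.add_apply, ContinuousAlternatingMap.add_apply,
      ContinuousAlternatingMap.sub_apply, ContinuousAlternatingMap.smul_apply,
      ContinuousAlternatingMap.compContinuousLinearMap_apply, smul_eq_mul]
    ring
  have e1 := extDeriv_tubeForm_smul_wedge h₁ 1 2 3 4 v
  have e2 := extDeriv_tubeForm_smul_wedge h₂ 3 4 5 6 v
  have e3 := extDeriv_tubeForm_smul_wedge h₃ 5 6 1 2 v
  have e4 := extDeriv_tubeForm_smul_wedge hb 1 3 5 0 v
  have e5 := extDeriv_tubeForm_smul_wedge hb.fun_neg 1 4 6 0 v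
  have e6 := extDeriv_tubeForm_smul_wedge hb.fun_neg 2 3 6 0 v
  have e7 := extDeriv_tubeForm_smul_wedge hb.fun_neg 2 4 5 0 v
  have e8 := extDeriv_tubeForm_smul_wedge ha.fun_neg 2 4 6 0 v
  have e9 := extDeriv_tubeForm_smul_wedge ha 2 3 5 0 v
  have e10 := extDeriv_tubeForm_smul_wedge ha 1 4 5 0 v
  have e11 := extDeriv_tubeForm_smul_wedge ha 1 3 6 0 v
  have d2 := e1.1.add e2.1
  have d3 := d2.add e3.1
  have d4 := d3.add e4.1
  have d5 := d4.add e5.1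
  have d6 := d5.add e6.1
  have d7 := d6.add e7.1
  have d8 := d7.add e8.1
  have d9 := d8.add e9.1
  have d10 := d9.add e10.1
  rw [hs, extDeriv_add d10 e11.1, extDeriv_add d9 e10.1, extDeriv_add d8 e9.1,
    extDeriv_add d7 e8.1, extDeriv_add d6 e7.1, extDeriv_add d5 e6.1, extDeriv_add d4 e5.1,
    extDeriv_add d3 e4.1, extDeriv_add d2 e3.1, extDeriv_add e1.1 e2.1]
  simp only [ContinuousAlternatingMap.add_apply, e1.2, e2.2, e3.2, e4.2, e5.2, e6.2, e7.2, e8.2,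
    e9.2, e10.2, e11.2]
  have hd : ∀ j, dCoframe (fun j i => v i j) j = dCoframe E j := fun _ => rfl
  have f0 : dCoframe E 0 = fun _ _ => 0 := rfl
  have f1 : dCoframe E 1 = fun i j => -((1 / 2) * (E 3 i * E 5 j - E 3 j * E 5 i)
      + (-1 / 2) * (E 4 i * E 6 j - E 4 j * E 6 i)) := rfl
  have f2 : dCoframe E 2 = fun i j => -((-1 / 2) * (E 3 i * E 6 j - E 3 j * E 6 i)
      + (-1 / 2) * (E 4 i * E 5 j - E 4 j * E 5 i)) := rfl
  have f3 : dCoframe E 3 = fun i j => -((-1 / 2) * (E 1 i * E 5 j - E 1 j * E 5 i)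
      + (1 / 2) * (E 2 i * E 6 j - E 2 j * E 6 i)) := rfl
  have f4 : dCoframe E 4 = fun i j => -((1 / 2) * (E 1 i * E 6 j - E 1 j * E 6 i)
      + (1 / 2) * (E 2 i * E 5 j - E 2 j * E 5 i)) := rfl
  have f5 : dCoframe E 5 = fun i j => -((1 / 2) * (E 1 i * E 3 j - E 1 j * E 3 i)
      + (-1 / 2) * (E 2 i * E 4 j - E 2 j * E 4 i)) := rfl
  have f6 : dCoframe E 6 = fun i j => -((-1 / 2) * (E 1 i * E 4 j - E 1 j * E 4 i)
      + (-1 / 2) * (E 2 i * E 3 j - E 2 j * E 3 i)) := rfl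
  have hE : ∀ j, (fun i => (v i) j) = E j := fun _ => rfl
  simp only [hd, hE, f0, f1, f2, f3, f4, f5, f6, fiveProd_zero, fiveProd_two]
  clear_value E
  -- Every product is brought to increasing order, and products with a repeated factor vanish; what
  -- is left is linear in products of distinct covectors.
  simp (discharger := decide) only [five_sort01 E, five_sort12 E, five_sort23 E, five_sort34 E,
    five_self01, five_self12, five_self23, five_self34]
  ring

theorem minSmoothness_two_le : minSmoothness ℝ 2 ≤ (∞ : WithTop ℕ∞) := by
  rw [minSmoothness_of_isRCLikeNormedField]
  exact WithTop.coe_le_coe.2 le_top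

/-! ### Adapted frames along the curve -/

/-- The right inverse of `tubeFrame` with vanishing torus components. -/
noncomputable def tubeSection (a₁ a₂ a₃ : ℝ) : W →L[ℝ] ℝ × LieSU3 :=
  LinearMap.toContinuousLinearMap
    { toFun := fun w => (w 0, WithLp.toLp 2 ![w 1 / a₁, w 2 / a₁, w 3 / a₂, w 4 / a₂, w 5 / a₃,
        w 6 / a₃, 0, 0])
      map_add' := by
        intro x y
        refine Prod.ext (by simp) ?_
        ext i; fin_cases i <;> simp [add_div]
      map_smul' := by
        intro r x
        refine Prod.ext (by simp) ?_
        ext i; fin_cases i <;> simp [mul_div_assoc] }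

theorem tubeSection_apply (a₁ a₂ a₃ : ℝ) (w : W) : tubeSection a₁ a₂ a₃ w =
    (w 0, WithLp.toLp 2 ![w 1 / a₁, w 2 / a₁, w 3 / a₂, w 4 / a₂, w 5 / a₃, w 6 / a₃, 0, 0]) := rfl

/-- Both `T` and the frame annihilate exactly the torus directions, so `T` composed with the section
of the frame is an isomorphism. Its inverse is `b`, which does not depend on the three-form. -/
theorem exists_isAdapted {T : ℝ × LieSU3 →L[ℝ] W} (hT : Function.Surjective T)
    (ht : ∀ c : LieSU3, (∀ i, c (offDiag i) = 0) → T (0, c) = 0) {a₁ a₂ a₃ θ : ℝ} (h₁ : a₁ ≠ 0)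
    (h₂ : a₂ ≠ 0) (h₃ : a₃ ≠ 0) :
    ∃ b : W ≃L[ℝ] W, (∀ x, b (T x) = tubeFrame a₁ a₂ a₃ x) ∧ ∀ φ : W [⋀^Fin 3]→L[ℝ] ℝ,
      φ.compContinuousLinearMap T = tubePhi a₁ a₂ a₃ θ → IsAdapted φ b θ := by
  set σ := tubeSection a₁ a₂ a₃
  have h1 : ∀ x, T (σ (tubeFrame a₁ a₂ a₃ x)) = T x := by
    intro x
    rw [← sub_eq_zero, ← map_sub]
    have h2 : σ (tubeFrame a₁ a₂ a₃ x) - x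
        = (0, (σ (tubeFrame a₁ a₂ a₃ x) - x).2) := by
      refine Prod.ext ?_ rfl
      simp [σ, tubeSection_apply, tubeFrame_apply]
    rw [h2]
    refine ht _ fun i => ?_
    simp only [σ, tubeSection_apply, tubeFrame_apply, Prod.snd_sub]
    fin_cases i <;> simp [offDiag, h₁, h₂, h₃]
  have hsurj : Function.Surjective (T.comp σ) := by
    intro w
    obtain ⟨x, rfl⟩ := hT w
    exact ⟨_, h1 x⟩
  have hinj : Function.Injective (T.comp σ) :=
    (LinearMap.injective_iff_surjective (f := (T.comp σ).toLinearMap)).2 hsurj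
  let B : W ≃L[ℝ] W := (LinearEquiv.ofInjectiveEndo (T.comp σ).toLinearMap
    hinj).toContinuousLinearEquiv
  have hB : ∀ w, B w = T (σ w) := fun w => rfl
  have hb : ∀ x, B.symm (T x) = tubeFrame a₁ a₂ a₃ x := by
    intro x
    rw [← h1, ← hB, B.symm_apply_apply]
  refine ⟨B.symm, hb, fun φ hφ => ?_⟩
  rw [tubePhi_eq] at hφ
  ext v
  choose x hx using fun i => hT (v i)
  have hv : v = T ∘ x := funext fun i => (hx i).symm
  have := DFunLike.congr_fun hφ x
  rw [ContinuousAlternatingMap.compContinuousLinearMap_apply, ← hv] at this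
  rw [this, ContinuousAlternatingMap.compContinuousLinearMap_apply,
    ContinuousAlternatingMap.compContinuousLinearMap_apply, hv]
  congr 1
  funext i
  exact (hb (x i)).symm

section Tube

variable {M : Type*} [TopologicalSpace M] [ChartedSpace W M] [MulAction SU3 M]

/-- One adapted basis serves for the form, for its metric and for its Hodge dual, since the last two
may be computed in any adapted basis. -/
theorem IsTubePoint.adapted {γ : ℝ → M} {t : ℝ} (h : IsTubePoint γ t) {φ : W [⋀^Fin 3]→L[ℝ] ℝ}
    {a₁ a₂ a₃ θ : ℝ} (h₁ : a₁ ≠ 0) (h₂ : a₂ ≠ 0) (h₃ : a₃ ≠ 0)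
    (hφ : φ.compContinuousLinearMap (tube γ t) = tubePhi a₁ a₂ a₃ θ) :
    IsG2Form φ ∧
    (∀ x y, g2Metric φ (tube γ t x) (tube γ t y) = tubeMetric a₁ a₂ a₃ x y) ∧
    (g2Star φ).compContinuousLinearMap (tube γ t) = tubeStar a₁ a₂ a₃ θ := by
  obtain ⟨b, hb, hφb⟩ := exists_isAdapted (T := tube γ t) (θ := θ) h.surjective (fun c hc => by
    rw [tube_apply, h.torus c hc]; simp) h₁ h₂ h₃
  have ha := hφb φ hφ
  refine ⟨⟨b, θ, ha⟩, fun x y => ?_, ?_⟩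
  · rw [ha.g2Metric_eq, hb, hb, tubeMetric_eq]
  · rw [ha.g2Star_eq, tubeStar]
    ext v
    simp only [ContinuousAlternatingMap.compContinuousLinearMap_apply]
    congr 1
    funext i
    exact hb (v i)

variable (hM : IsSmoothAction M) [IsManifold 𝓘(ℝ, W) ∞ M]

include hM

/-- Near the point the chart expression is the pull-back by the smooth map `κ` of a form whose
regularity is that of its coefficients along `γ`. -/
theorem IsSmoothAction.contDiffAt_localRep (g : SU3) {γ : ℝ → M} {t₀ : ℝ}
    (hγ : ∀ᶠ t in nhds t₀, ContMDiffAt 𝓘(ℝ, ℝ) 𝓘(ℝ, W) ∞ γ t) (ht : IsTubePoint γ t₀)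
    {e : OpenPartialHomeomorph M W} (he : e ∈ atlas W M) (hp : g • γ t₀ ∈ e.source)
    {k : ℕ} {η : FormField M k} (hη : IsInvariantForm η) {n : WithTop ℕ∞} (hn : n ≤ ∞)
    (hS : ContDiffAt ℝ n (fun t => (toForm η (γ t)).compContinuousLinearMap (tube γ t)) t₀) :
    ContDiffAt ℝ n (localRep η e) (e (g • γ t₀)) := by
  obtain ⟨χ, κ, hχ0, hκ0, hχ, hκ, h⟩ := hM.exists_coordinates g hγ ht he hp
  refine ContDiffAt.congr_of_eventuallyEq ?_ (h η hη).2
  have h3 : ContDiffAt ℝ n (tubeForm (fun t => (toForm η (γ t)).compContinuousLinearMap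
      (tube γ t)) t₀) (κ (e (g • γ t₀))) := by
    rw [hκ0]
    exact contDiffAt_tubeForm hn (by simpa using hS)
  exact ContDiffAt.compForm (h3.comp _ (hκ.of_le hn))
    ((hκ.fderiv_right (m := ∞) (by simp)).of_le hn)

/-- The exterior derivative commutes with pull-back. One implication uses `χ`, the other its local
inverse `κ`. Invariance thus reduces closedness on a whole orbit to the origin of the tube
coordinates. -/
theorem IsSmoothAction.extDeriv_localRep_eq_zero_iff (g : SU3) {γ : ℝ → M} {t₀ : ℝ}
    (hγ : ∀ᶠ t in nhds t₀, ContMDiffAt 𝓘(ℝ, ℝ) 𝓘(ℝ, W) ∞ γ t) (ht : IsTubePoint γ t₀)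
    {e : OpenPartialHomeomorph M W} (he : e ∈ atlas W M) (hp : g • γ t₀ ∈ e.source)
    {k : ℕ} {η : FormField M k} (hη : IsInvariantForm η)
    (hS : ContDiffAt ℝ 1 (fun t => (toForm η (γ t)).compContinuousLinearMap (tube γ t)) t₀) :
    extDeriv (localRep η e) (e (g • γ t₀)) = 0 ↔
      extDeriv (tubeForm (fun t => (toForm η (γ t)).compContinuousLinearMap (tube γ t)) t₀) 0
        = 0 := by
  have hreg := hM.contDiffAt_localRep g hγ ht he hp hη (by simp) hS
  obtain ⟨χ, κ, hχ0, hκ0, hχ, hκ, h⟩ := hM.exists_coordinates g hγ ht he hp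
  have h1 := (h η hη).1
  have h2 := (h η hη).2
  set S := fun t => (toForm η (γ t)).compContinuousLinearMap (tube γ t)
  have hP : DifferentiableAt ℝ (tubeForm S t₀) 0 :=
    (contDiffAt_tubeForm (n := 1) (by simp) (by simpa using hS)).differentiableAt (by simp)
  constructor
  · intro h0
    rw [h1.extDeriv_eq, extDeriv_pullback (r := ∞) (by
      rw [hχ0]; exact hreg.differentiableAt (by simp)) hχ minSmoothness_two_le, hχ0, h0]
    ext; simp
  · intro h0
    rw [h2.extDeriv_eq, extDeriv_pullback (r := ∞) (by rw [hκ0]; exact hP) hκ minSmoothness_two_le,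
      hκ0, h0]
    ext; simp

end Tube

/-! ### The diagonal torus and the exponential map -/

theorem suMat_of_offDiag {c : LieSU3} (hc : ∀ i, c (offDiag i) = 0) : suMat c =
    Matrix.diagonal ![Complex.I * c 6, Complex.I * (c 7 - c 6), -(Complex.I * c 7)] := by
  have h0 : c 0 = 0 := hc 0
  have h1 : c 1 = 0 := hc 1
  have h2 : c 2 = 0 := hc 2
  have h3 : c 3 = 0 := hc 3
  have h4 : c 4 = 0 := hc 4
  have h5 : c 5 = 0 := hc 5
  rw [suMat_eq]
  ext i j
  fin_cases i <;> fin_cases j <;> apply Complex.ext <;> simp [h0, h1, h2, h3, h4, h5]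

theorem suExp_mem_T2 {c : LieSU3} (hc : ∀ i, c (offDiag i) = 0) : suExp c ∈ T2 := by
  intro i j hij
  change NormedSpace.exp (suMat c) i j = 0
  rw [suMat_of_offDiag hc, Matrix.exp_diagonal]
  exact Matrix.diagonal_apply_ne _ hij

/-- Arguments of the first and the last diagonal entry determine `c`; the middle entry is then
correct because the determinant is one. -/
theorem exists_suExp_eq {k : SU3} (hk : k ∈ T2) :
    ∃ c : LieSU3, (∀ i, c (offDiag i) = 0) ∧ suExp c = k := by
  have hd := T2_diagonal hk
  set z : Fin 3 → ℂ := fun i => k.1 i i with hz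
  have hunit : ∀ i, ‖z i‖ = 1 := by
    intro i
    have h1 := congrFun (congrFun (SU3_mul_star k) i) i
    have h2 := Ad_T2_entry hk 1 i i
    rw [mul_one, h1, Matrix.one_apply_eq, mul_one] at h2
    have h3 := congrArg norm h2
    rw [norm_one, norm_mul, norm_star] at h3
    have h4 : ‖z i‖ * ‖z i‖ = 1 := h3.symm
    nlinarith [norm_nonneg (z i)]
  have hdet : z 0 * z 1 * z 2 = 1 := by
    have h1 : k.1.det = 1 := (Matrix.mem_specialUnitaryGroup_iff.1 k.2).2
    rw [hd, Matrix.det_diagonal, Fin.prod_univ_three] at h1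
    exact h1
  set x := Complex.arg (z 0) with hx
  set y := Complex.arg (z 2) with hy
  have hzx : Complex.exp (Complex.I * x) = z 0 := by
    have := Complex.norm_mul_exp_arg_mul_I (z 0)
    rw [hunit, Complex.ofReal_one, one_mul, mul_comm] at this
    exact this
  have hzy : Complex.exp (Complex.I * y) = z 2 := by
    have := Complex.norm_mul_exp_arg_mul_I (z 2)
    rw [hunit, Complex.ofReal_one, one_mul, mul_comm] at this
    exact this
  have hz0 : z 0 ≠ 0 := fun h => by have := hunit 0; rw [h] at this; simp at this
  have hz2 : z 2 ≠ 0 := fun h => by have := hunit 2; rw [h] at this; simp at this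
  set c : LieSU3 := WithLp.toLp 2 ![0, 0, 0, 0, 0, 0, x, -y] with hc
  have hc0 : ∀ i, c (offDiag i) = 0 := by
    intro i; fin_cases i <;> rfl
  refine ⟨c, hc0, Subtype.ext ?_⟩
  change NormedSpace.exp (suMat c) = k.1
  rw [suMat_of_offDiag hc0, Matrix.exp_diagonal, hd]
  congr 1
  funext i
  rw [Pi.coe_exp, ← Complex.exp_eq_exp_ℂ]
  have h6 : c 6 = x := rfl
  have h7 : c 7 = -y := rfl
  rw [h6, h7]
  fin_cases i
  · exact hzx
  · change Complex.exp (Complex.I * (((-y : ℝ) : ℂ) - x)) = z 1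
    have h8 : Complex.I * (((-y : ℝ) : ℂ) - x) = -(Complex.I * x) + -(Complex.I * y) := by
      push_cast; ring
    rw [h8, Complex.exp_add, Complex.exp_neg, Complex.exp_neg, hzx, hzy]
    field_simp
    rw [← hdet]; ring
  · change Complex.exp (-(Complex.I * ((-y : ℝ) : ℂ))) = z 2
    rw [← hzy]; congr 1; push_cast; ring

/-! ### Invariant forms and fixed curves -/

section Action

variable {M : Type*} [TopologicalSpace M] [ChartedSpace W M] [MulAction SU3 M]

theorem form_ext {k : ℕ} {T : ℝ × LieSU3 →L[ℝ] W} (hT : Function.Surjective T)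
    {φ ψ : W [⋀^Fin k]→L[ℝ] ℝ}
    (h : φ.compContinuousLinearMap T = ψ.compContinuousLinearMap T) : φ = ψ := by
  ext v
  choose x hx using fun i => hT (v i)
  have hv : v = T ∘ x := funext fun i => (hx i).symm
  have := DFunLike.congr_fun h x
  rw [ContinuousAlternatingMap.compContinuousLinearMap_apply, ← hv,
    ContinuousAlternatingMap.compContinuousLinearMap_apply, ← hv] at this
  exact this

theorem tube_congr {γ δ : ℝ → M} {t : ℝ} (h : γ =ᶠ[nhds t] δ) : tube γ t = tube δ t := by
  have h1 : γ t = δ t := h.self_of_nhds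
  have h2 : vel γ t = vel δ t := DFunLike.congr_fun (h.mfderiv_eq (I := 𝓘(ℝ, ℝ))
    (I' := 𝓘(ℝ, W))) (1 : ℝ)
  refine ContinuousLinearMap.ext fun x => ?_
  rw [tube_apply, tube_apply, h2, h1]

variable (hM : IsSmoothAction M)

include hM

theorem IsSmoothAction.fund_eq_zero {p : M} {c : LieSU3} (h : ∀ s : ℝ, suExp (s • c) • p = p) :
    fund p c = 0 := by
  have hm : HasFDerivAt (fun r : ℝ => r • c)
      ((ContinuousLinearMap.id ℝ ℝ).smulRight c) (0 : ℝ) :=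
    (hasFDerivAt_id (0 : ℝ)).smul_const c
  have he : HasMFDerivAt 𝓘(ℝ, LieSU3) 𝓘(ℝ, W) (fun c : LieSU3 => suExp c • p) ((0 : ℝ) • c)
      (fund p) := by rw [zero_smul]; exact hM.hasMFDerivAt_exp p
  have h' := he.comp (0 : ℝ) hm.hasMFDerivAt
  have heq : (fun c : LieSU3 => suExp c • p) ∘ (fun r : ℝ => r • c) = fun _ => p := by
    funext r; exact h r
  rw [heq] at h'
  have h3 := DFunLike.congr_fun (hasMFDerivAt_unique h' (hasMFDerivAt_const p (0 : ℝ))) (1 : ℝ)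
  change fund p ((1 : ℝ) • c) = 0 at h3
  rwa [one_smul] at h3

theorem IsSmoothAction.push_tube_of_fixed {I : Set ℝ} (hI : IsOpen I) {γ : ℝ → M} {k : SU3}
    (hk : ∀ t ∈ I, k • γ t = γ t) {t : ℝ} (ht : t ∈ I)
    (hγ : MDifferentiableAt 𝓘(ℝ, ℝ) 𝓘(ℝ, W) γ t) (x : ℝ × LieSU3) :
    push k (γ t) (tube γ t x) = tube γ t (x.1, Ad k x.2) := by
  rw [hM.push_tube k γ hγ]
  congr 1
  refine tube_congr ?_
  filter_upwards [hI.mem_nhds ht] with s hs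
  exact hk s hs

theorem IsSmoothAction.isInvariantForm_star {φ : FormField M 3} (hφ : IsInvariantForm φ)
    (hG : ∀ p, IsG2Form (toForm φ p)) : IsInvariantForm fun p => g2Star (φ p) := by
  rw [isInvariantForm_iff] at hφ ⊢
  intro g p
  rw [toForm_star, toForm_star, ← hφ g p]
  exact (g2Star_comp (hG (g • p)) (hM.pushEquiv g p)).symm

/-- Invariant forms are determined by their values along a curve that meets all orbits. -/
theorem IsSmoothAction.invariantForm_ext {I : Set ℝ} {γ : ℝ → M}
    (hs : ∀ p : M, ∃ t ∈ I, ∃ g : SU3, g • γ t = p) {k : ℕ} {φ ψ : FormField M k}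
    (hφ : IsInvariantForm φ) (hψ : IsInvariantForm ψ)
    (h : ∀ t ∈ I, toForm φ (γ t) = toForm ψ (γ t)) : φ = ψ := by
  rw [isInvariantForm_iff] at hφ hψ
  funext p
  obtain ⟨t, ht, g, rfl⟩ := hs p
  change toForm φ (g • γ t) = toForm ψ (g • γ t)
  have h1 := (hφ g (γ t)).trans ((h t ht).trans (hψ g (γ t)).symm)
  ext v
  have h2 := DFunLike.congr_fun h1 (fun i => (hM.pushEquiv g (γ t)).symm (v i))
  have h3 : (push g (γ t)) ∘ (fun i => (hM.pushEquiv g (γ t)).symm (v i)) = v :=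
    funext fun i => (hM.pushEquiv g (γ t)).apply_symm_apply (v i)
  rw [ContinuousAlternatingMap.compContinuousLinearMap_apply,
    ContinuousAlternatingMap.compContinuousLinearMap_apply, h3] at h2
  exact h2

end Action

theorem contDiffAt_tubePhi {n : WithTop ℕ∞} {f₁ f₂ f₃ θ : ℝ → ℝ} {t : ℝ}
    (h₁ : ContDiffAt ℝ n f₁ t) (h₂ : ContDiffAt ℝ n f₂ t) (h₃ : ContDiffAt ℝ n f₃ t)
    (hθ : ContDiffAt ℝ n θ t) :
    ContDiffAt ℝ n (fun t => tubePhi (f₁ t) (f₂ t) (f₃ t) (θ t)) t := by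
  have hc := hθ.cos
  have hs := hθ.sin
  unfold tubePhi
  fun_prop

theorem exists_tubePhi {T : ℝ × LieSU3 →L[ℝ] W} (hT : Function.Surjective T)
    (ht : ∀ c : LieSU3, (∀ i, c (offDiag i) = 0) → T (0, c) = 0) {a₁ a₂ a₃ : ℝ} (h₁ : a₁ ≠ 0)
    (h₂ : a₂ ≠ 0) (h₃ : a₃ ≠ 0) (θ : ℝ) :
    ∃ φ : W [⋀^Fin 3]→L[ℝ] ℝ, φ.compContinuousLinearMap T = tubePhi a₁ a₂ a₃ θ := by
  obtain ⟨b, hb, -⟩ := exists_isAdapted hT ht (θ := θ) h₁ h₂ h₃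
  refine ⟨(phiForm stdCoframe θ).compContinuousLinearMap (b : W →L[ℝ] W), ?_⟩
  rw [tubePhi_eq]
  ext v
  simp only [ContinuousAlternatingMap.compContinuousLinearMap_apply]
  congr 1
  funext i
  exact hb (v i)

theorem five_std (j : Fin 5 → Fin 7) (x y a b c : Fin 7) :
    five (fun i => stdVec (j i) x) (fun i => stdVec (j i) y) (fun i => stdVec (j i) a)
      (fun i => stdVec (j i) b) (fun i => stdVec (j i) c) =
    five (fun i => if j i = x then 1 else 0) (fun i => if j i = y then 1 else 0)
      (fun i => if j i = a then 1 else 0) (fun i => if j i = b then 1 else 0)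
      (fun i => if j i = c then 1 else 0) := by
  have h : ∀ x : Fin 7, (fun i => stdVec (j i) x) = fun i => if j i = x then 1 else 0 := by
    intro x; funext i; simp [stdVec, eq_comm]
  rw [h, h, h, h, h]

/-- The tube forms of the Hodge duals are closed if and only if the `fᵢ` and `θ` satisfy ordinary
differential equations. -/
theorem extDeriv_tubeStar_eq_zero_iff {f₁ f₂ f₃ θ : ℝ → ℝ} {c₁' c₂' c₃' t₀ : ℝ}
    (h₁ : HasDerivAt (fun t => f₁ t ^ 2 * f₂ t ^ 2) c₁' t₀)
    (h₂ : HasDerivAt (fun t => f₂ t ^ 2 * f₃ t ^ 2) c₂' t₀)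
    (h₃ : HasDerivAt (fun t => f₁ t ^ 2 * f₃ t ^ 2) c₃' t₀)
    (hf : DifferentiableAt ℝ (fun t => f₁ t * f₂ t * f₃ t) t₀) (hθ : DifferentiableAt ℝ θ t₀) :
    extDeriv (tubeForm (fun t => tubeStar (f₁ t) (f₂ t) (f₃ t) (θ t)) t₀) 0 = 0 ↔
      c₁' = 2 * (f₁ t₀ * f₂ t₀ * f₃ t₀ * Real.cos (θ t₀)) ∧
      c₂' = 2 * (f₁ t₀ * f₂ t₀ * f₃ t₀ * Real.cos (θ t₀)) ∧
      c₃' = 2 * (f₁ t₀ * f₂ t₀ * f₃ t₀ * Real.cos (θ t₀)) := by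
  have hs : (fun t => tubeStar (f₁ t) (f₂ t) (f₃ t) (θ t)) = starField
      (fun t => f₁ t ^ 2 * f₂ t ^ 2) (fun t => f₂ t ^ 2 * f₃ t ^ 2)
      (fun t => f₁ t ^ 2 * f₃ t ^ 2) (fun t => f₁ t * f₂ t * f₃ t * Real.sin (θ t))
      (fun t => f₁ t * f₂ t * f₃ t * Real.cos (θ t)) := funext fun t => tubeStar_eq f₁ f₂ f₃ θ t
  have ha : DifferentiableAt ℝ (fun t => f₁ t * f₂ t * f₃ t * Real.sin (θ t)) t₀ := hf.mul hθ.sin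
  have hb : DifferentiableAt ℝ (fun t => f₁ t * f₂ t * f₃ t * Real.cos (θ t)) t₀ := hf.mul hθ.cos
  have key := extDeriv_starField h₁ h₂ h₃ ha.hasDerivAt hb.hasDerivAt
  rw [hs]
  constructor
  · intro h
    -- Each of the three five-tuples of basis vectors detects exactly one of the three five-forms in
    -- `extDeriv_starField`.
    have k1 := key (fun i => stdVec (![0, 1, 2, 3, 4] i))
    have k2 := key (fun i => stdVec (![0, 3, 4, 5, 6] i))
    have k3 := key (fun i => stdVec (![0, 1, 2, 5, 6] i))
    have h0 : ∀ v : Fin 5 → W, (0 : W [⋀^Fin 5]→L[ℝ] ℝ) v = 0 := fun _ => rfl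
    erw [h, h0] at k1 k2 k3
    simp only [five_std] at k1 k2 k3
    simp [five, fiveProd] at k1 k2 k3
    exact ⟨by linarith, by linarith, by linarith⟩
  · rintro ⟨e1, e2, e3⟩
    ext v
    have := key v
    simp only [e1, e2, e3, sub_self, zero_mul, add_zero] at this
    exact this

/-! ### Extension from a curve to the whole tube -/

section Manifold

variable {M : Type*} [TopologicalSpace M] [ChartedSpace W M] [MulAction SU3 M]

omit [MulAction SU3 M] in
theorem eventually_contMDiffAt {I : Set ℝ} (hI : IsOpen I) {γ : ℝ → M}
    (h : ContMDiffOn 𝓘(ℝ, ℝ) 𝓘(ℝ, W) ∞ γ I) {t : ℝ} (ht : t ∈ I) :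
    ∀ᶠ s in nhds t, ContMDiffAt 𝓘(ℝ, ℝ) 𝓘(ℝ, W) ∞ γ s := by
  filter_upwards [hI.mem_nhds ht] with s hs
  exact h.contMDiffAt (hI.mem_nhds hs)

variable (hM : IsSmoothAction M)

include hM

theorem IsSmoothAction.isTubePoint_of_torus {γ : ℝ → M} {t : ℝ}
    (hs : Function.Surjective (tube γ t)) (hk : ∀ k ∈ T2, k • γ t = γ t) : IsTubePoint γ t := by
  refine ⟨hs, fun c hc => hM.fund_eq_zero fun s => hk _ (suExp_mem_T2 fun i => ?_)⟩
  change s * c (offDiag i) = 0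
  rw [hc, mul_zero]

/-- An invariant form on a tube with prescribed torus invariant values along the curve. -/
theorem IsSmoothAction.exists_invariantForm {I : Set ℝ} (hI : IsOpen I) {γ : ℝ → M}
    (hP : IsProductTube I γ) {k : ℕ} {φ : ℝ → W [⋀^Fin k]→L[ℝ] ℝ}
    {S : ℝ → (ℝ × LieSU3) [⋀^Fin k]→L[ℝ] ℝ}
    (hφ : ∀ t ∈ I, (φ t).compContinuousLinearMap (tube γ t) = S t)
    (hS : ∀ t ∈ I, ∀ k ∈ T2, (S t).compContinuousLinearMap
      ((ContinuousLinearMap.id ℝ ℝ).prodMap (Ad k)) = S t) :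
    ∃ η : FormField M k, IsInvariantForm η ∧ ∀ t ∈ I, toForm η (γ t) = φ t := by
  have hfix : ∀ k ∈ T2, ∀ t ∈ I, k • γ t = γ t := by
    intro k hk t ht
    have := (hP.fibres t ht t ht k 1).2 ⟨rfl, by simpa using T2.inv_mem hk⟩
    rwa [one_smul] at this
  have hγ : ∀ t ∈ I, MDifferentiableAt 𝓘(ℝ, ℝ) 𝓘(ℝ, W) γ t := fun t ht =>
    (hP.smooth.contMDiffAt (hI.mem_nhds ht)).mdifferentiableAt (by simp)
  -- The prescribed form is invariant under the isotropy group of `γ t`: on `ℝ × su(3)` the torus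
  -- acts by `Ad`, for which `S t` is invariant.
  have hinv : ∀ k ∈ T2, ∀ t ∈ I, (φ t).compContinuousLinearMap (push k (γ t)) = φ t := by
    intro k hk t ht
    apply form_ext (T := tube γ t) (hP.submersion t ht)
    rw [hφ t ht, ← hS t ht k hk, ← hφ t ht]
    ext v
    simp only [ContinuousAlternatingMap.compContinuousLinearMap_apply]
    congr 1
    funext i
    exact hM.push_tube_of_fixed hI (hfix k hk) ht (hγ t ht) (v i)
  -- Some representation `p = g(p) • γ(τ(p))` of every point, without any regularity.
  choose τ hτ g hg using hP.surjective
  let η : FormField M k := fun p => (φ (τ p)).compContinuousLinearMap (push (g p)⁻¹ p)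
  have hη : ∀ p, toForm η p = (φ (τ p)).compContinuousLinearMap (push (g p)⁻¹ p) := fun _ => rfl
  -- Two representations have the same parameter and differ by an element of `T2`, so the choice is
  -- immaterial by `hinv`.
  have key : ∀ t ∈ I, ∀ h : SU3, toForm η (h • γ t)
      = (φ t).compContinuousLinearMap (push h⁻¹ (h • γ t)) := by
    intro t ht h
    set p := h • γ t with hp
    obtain ⟨e1, e2⟩ := (hP.fibres (τ p) (hτ p) t ht (g p) h).1 (hg p)
    rw [hη, e1]
    have e3 : h⁻¹ = ((g p)⁻¹ * h)⁻¹ * (g p)⁻¹ := by group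
    have e4 : (g p)⁻¹ • p = γ t := by
      rw [inv_smul_eq_iff, ← e1]; exact (hg p).symm
    rw [e3, hM.push_mul, e4]
    have e5 := hinv _ (T2.inv_mem e2) t ht
    conv_lhs => rw [← e5]
    rfl
  refine ⟨η, (isInvariantForm_iff η).2 fun h p => ?_, fun t ht => ?_⟩
  · obtain ⟨t, ht, g, rfl⟩ := hP.surjective p
    rw [key t ht g, ← mul_smul, key t ht (h * g)]
    have e1 : g⁻¹ = (h * g)⁻¹ * h := by group
    rw [e1, hM.push_mul, mul_smul]
    rfl
  · have := key t ht 1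
    rw [one_smul, inv_one, push_one] at this
    rw [this]; rfl

/-- The form is prescribed along `γ` and spread by the group. Its class and the closedness of its
dual are local questions which the tube coordinates reduce to the coefficients along `γ` and to the
three differential equations. Invariance gives uniqueness. -/
theorem IsSmoothAction.existsUnique_structure [IsManifold 𝓘(ℝ, W) ∞ M] {I : Set ℝ}
    (hI : IsOpen I) {γ : ℝ → M} (hP : IsProductTube I γ) {f₁ f₂ f₃ θ : ℝ → ℝ} {n : ℕ∞} (hn : 1 ≤ n)
    (h₁ : ContDiffOn ℝ ∞ f₁ I) (h₂ : ContDiffOn ℝ ∞ f₂ I) (h₃ : ContDiffOn ℝ ∞ f₃ I)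
    (hθ : ContDiffOn ℝ n θ I) (n₁ : ∀ t ∈ I, f₁ t ≠ 0) (n₂ : ∀ t ∈ I, f₂ t ≠ 0)
    (n₃ : ∀ t ∈ I, f₃ t ≠ 0)
    (d₁ : ∀ t ∈ I, HasDerivAt (fun t => f₁ t ^ 2 * f₂ t ^ 2)
      (2 * (f₁ t * f₂ t * f₃ t * Real.cos (θ t))) t)
    (d₂ : ∀ t ∈ I, HasDerivAt (fun t => f₂ t ^ 2 * f₃ t ^ 2)
      (2 * (f₁ t * f₂ t * f₃ t * Real.cos (θ t))) t)
    (d₃ : ∀ t ∈ I, HasDerivAt (fun t => f₁ t ^ 2 * f₃ t ^ 2)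
      (2 * (f₁ t * f₂ t * f₃ t * Real.cos (θ t))) t) :
    ∃! φ : FormField M 3, IsInvariantCosymplectic n φ ∧ HasTubeMetric φ I γ f₁ f₂ f₃ ∧
      HasTubeForm φ I γ f₁ f₂ f₃ θ := by
  have hn' : ((n : ℕ∞) : WithTop ℕ∞) ≤ ∞ := WithTop.coe_le_coe.2 le_top
  have hn1 : (1 : WithTop ℕ∞) ≤ n := WithTop.coe_le_coe.2 hn
  have hfix : ∀ t ∈ I, ∀ k ∈ T2, k • γ t = γ t := by
    intro t ht k hk
    have := (hP.fibres t ht t ht k 1).2 ⟨rfl, by simpa using T2.inv_mem hk⟩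
    rwa [one_smul] at this
  have hpt : ∀ t ∈ I, IsTubePoint γ t := fun t ht =>
    hM.isTubePoint_of_torus (hP.submersion t ht) (hfix t ht)
  have hex : ∀ t, ∃ ψ : W [⋀^Fin 3]→L[ℝ] ℝ, t ∈ I →
      ψ.compContinuousLinearMap (tube γ t) = tubePhi (f₁ t) (f₂ t) (f₃ t) (θ t) := by
    intro t
    by_cases ht : t ∈ I
    · obtain ⟨ψ, hψ⟩ := exists_tubePhi (hpt t ht).surjective (fun c hc => by
        rw [tube_apply, (hpt t ht).torus c hc]; simp) (n₁ t ht) (n₂ t ht) (n₃ t ht) (θ t)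
      exact ⟨ψ, fun _ => hψ⟩
    · exact ⟨0, fun h => absurd h ht⟩
  choose ψ hψ using hex
  obtain ⟨φ, hφ, hφψ⟩ := hM.exists_invariantForm hI hP (φ := ψ)
    (S := fun t => tubePhi (f₁ t) (f₂ t) (f₃ t) (θ t)) hψ
    fun t _ k hk => tubePhi_comp_Ad hk _ _ _ _
  have hform : ∀ t ∈ I, (toForm φ (γ t)).compContinuousLinearMap (tube γ t)
      = tubePhi (f₁ t) (f₂ t) (f₃ t) (θ t) := fun t ht => by rw [hφψ t ht, hψ t ht]
  have had := fun t ht => (hpt t ht).adapted (n₁ t ht) (n₂ t ht) (n₃ t ht) (hform t ht)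
  -- The property holds along `γ` and is carried over each orbit by the differentials of the group
  -- elements.
  have hG : ∀ p, IsG2Form (toForm φ p) := by
    intro p
    obtain ⟨t, ht, g, rfl⟩ := hP.surjective p
    have h1 := (isInvariantForm_iff φ).1 hφ g⁻¹ (g • γ t)
    rw [inv_smul_smul] at h1
    rw [← h1]
    exact (had t ht).1.comp (hM.pushEquiv g⁻¹ (g • γ t))
  have hstar := hM.isInvariantForm_star hφ hG
  have hS : ∀ t ∈ I, (fun t => (toForm φ (γ t)).compContinuousLinearMap (tube γ t))
      =ᶠ[nhds t] fun t => tubePhi (f₁ t) (f₂ t) (f₃ t) (θ t) := by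
    intro t ht
    filter_upwards [hI.mem_nhds ht] with s hs
    exact hform s hs
  have hS' : ∀ t ∈ I, (fun t => (toForm (fun p => g2Star (φ p)) (γ t)).compContinuousLinearMap
      (tube γ t)) =ᶠ[nhds t] fun t => tubeStar (f₁ t) (f₂ t) (f₃ t) (θ t) := by
    intro t ht
    filter_upwards [hI.mem_nhds ht] with s hs
    exact (had s hs).2.2
  have c₁ := fun t ht => (h₁.contDiffAt (hI.mem_nhds (x := t) ht)).of_le hn'
  have c₂ := fun t ht => (h₂.contDiffAt (hI.mem_nhds (x := t) ht)).of_le hn'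
  have c₃ := fun t ht => (h₃.contDiffAt (hI.mem_nhds (x := t) ht)).of_le hn'
  have cθ := fun t ht => hθ.contDiffAt (hI.mem_nhds (x := t) ht)
  refine ⟨φ, ⟨⟨hG, ?_, hφ, ?_⟩, (hasTubeMetric_iff φ I γ f₁ f₂ f₃).2 fun t ht => (had t ht).2.1,
    (hasTubeForm_iff φ I γ f₁ f₂ f₃ θ).2 hform⟩, ?_⟩
  · intro e he y hy
    obtain ⟨t, ht, g, hg⟩ := hP.surjective (e.symm y)
    have hp : g • γ t ∈ e.source := by rw [hg]; exact e.map_target hy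
    have h := hM.contDiffAt_localRep g (eventually_contMDiffAt hI hP.smooth ht) (hpt t ht) he hp
      hφ hn' ((contDiffAt_tubePhi (c₁ t ht) (c₂ t ht) (c₃ t ht)
        (cθ t ht)).congr_of_eventuallyEq (hS t ht))
    rw [hg, e.right_inv hy] at h
    exact h.contDiffWithinAt
  · intro e he y hy
    obtain ⟨t, ht, g, hg⟩ := hP.surjective (e.symm y)
    have hp : g • γ t ∈ e.source := by rw [hg]; exact e.map_target hy
    have k₁ := (c₁ t ht).of_le hn1
    have k₂ := (c₂ t ht).of_le hn1
    have k₃ := (c₃ t ht).of_le hn1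
    have kθ := (cθ t ht).of_le hn1
    have hd : ContDiffAt ℝ 1 (fun t => tubeStar (f₁ t) (f₂ t) (f₃ t) (θ t)) t := by
      rw [show (fun t => tubeStar (f₁ t) (f₂ t) (f₃ t) (θ t)) = _ from
        funext fun t => tubeStar_eq f₁ f₂ f₃ θ t]
      exact contDiffAt_starField ((k₁.pow 2).mul (k₂.pow 2)) ((k₂.pow 2).mul (k₃.pow 2))
        ((k₁.pow 2).mul (k₃.pow 2)) (((k₁.mul k₂).mul k₃).mul kθ.sin)
        (((k₁.mul k₂).mul k₃).mul kθ.cos)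
    have h := (hM.extDeriv_localRep_eq_zero_iff g (eventually_contMDiffAt hI hP.smooth ht)
      (hpt t ht) he hp hstar (hd.congr_of_eventuallyEq (hS' t ht))).2
    rw [hg, e.right_inv hy] at h
    refine h ?_
    have h3 : tubeForm (fun t => (toForm (fun p => g2Star (φ p)) (γ t)).compContinuousLinearMap
        (tube γ t)) t =ᶠ[nhds 0] tubeForm (fun t => tubeStar (f₁ t) (f₂ t) (f₃ t) (θ t)) t := by
      have hcont : Filter.Tendsto (fun q : W => t + q 0) (nhds 0) (nhds t) := by
        have h : Continuous (fun q : W => t + q 0) :=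
          continuous_const.add (EuclideanSpace.proj (0 : Fin 7) : W →L[ℝ] ℝ).continuous
        simpa using h.tendsto 0
      filter_upwards [hcont.eventually (hS' t ht)] with q hq
      simp only [tubeForm, hq]
    rw [h3.extDeriv_eq]
    exact (extDeriv_tubeStar_eq_zero_iff (d₁ t ht) (d₂ t ht) (d₃ t ht)
      (((k₁.mul k₂).mul k₃).differentiableAt (by simp)) (kθ.differentiableAt (by simp))).2
      ⟨rfl, rfl, rfl⟩
  -- The three-form along `γ` already determines the structure; the formula for the metric follows
  -- from it.
  · rintro η ⟨hη, -, hη'⟩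
    refine hM.invariantForm_ext hP.surjective hη.invariant hφ fun t ht => ?_
    refine form_ext (T := tube γ t) (hP.submersion t ht) ?_
    rw [hform t ht]
    exact (hasTubeForm_iff η I γ f₁ f₂ f₃ θ).1 hη' t ht

end Manifold

/-! ### From the relations (a), (b), (c) to the differential equations -/

section Converse

variable {I : Set ℝ} {μ ν : ℝ} {f₁ f₂ f₃ θ : ℝ → ℝ}

/-- Multiplying (c) by `2 f₁f₂` gives the derivative of `f₁²f₂²`. By the polynomial form of (b), the
other two products `f₂²f₃²` and `f₁²f₃²` differ from it by the constants `ν²` and `μ²`. -/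
theorem hasDerivAt_sq_mul_sq (hI : IsOpen I) (hμ : 0 ≤ μ) (hμν : μ ≤ ν)
    (h₁ : ContDiffOn ℝ ∞ f₁ I) (h₂ : ContDiffOn ℝ ∞ f₂ I) (n₁ : ∀ t ∈ I, f₁ t ≠ 0)
    (n₂ : ∀ t ∈ I, f₂ t ≠ 0) (n₃ : ∀ t ∈ I, f₃ t ≠ 0) (h : AlgebraicRelations μ ν I f₁ f₂ f₃)
    (hθ : AngleRelation I f₁ f₂ f₃ θ) {t : ℝ} (ht : t ∈ I) :
    HasDerivAt (fun t => f₁ t ^ 2 * f₂ t ^ 2) (2 * (f₁ t * f₂ t * f₃ t * Real.cos (θ t))) t ∧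
    HasDerivAt (fun t => f₂ t ^ 2 * f₃ t ^ 2) (2 * (f₁ t * f₂ t * f₃ t * Real.cos (θ t))) t ∧
    HasDerivAt (fun t => f₁ t ^ 2 * f₃ t ^ 2) (2 * (f₁ t * f₂ t * f₃ t * Real.cos (θ t))) t := by
  rw [AlgebraicRelations.polynomial hμ hμν n₁ n₂ n₃] at h
  have hu : HasDerivAt (fun s => f₁ s * f₂ s) (f₃ t * Real.cos (θ t)) t := by
    rw [hθ t ht]
    exact (((h₁.mul h₂).contDiffAt (hI.mem_nhds ht)).differentiableAt (by simp)).hasDerivAt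
  have key : HasDerivAt (fun t => f₁ t ^ 2 * f₂ t ^ 2)
      (2 * (f₁ t * f₂ t * f₃ t * Real.cos (θ t))) t := by
    have := hu.pow 2
    refine (this.congr_deriv ?_).congr_of_eventuallyEq (Filter.Eventually.of_forall fun s => ?_)
    · push_cast; ring
    · simp [mul_pow]
  refine ⟨key, (key.add_const (ν ^ 2)).congr_of_eventuallyEq ?_,
    (key.add_const (μ ^ 2)).congr_of_eventuallyEq ?_⟩
  · filter_upwards [hI.mem_nhds ht] with s hs
    have := (h s hs).2
    linear_combination this
  · filter_upwards [hI.mem_nhds ht] with s hs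
    have := (h s hs).1
    linear_combination this

theorem sq_le_sq_of_relations (hμ : 0 ≤ μ) (hμν : μ ≤ ν) (n₁ : ∀ t ∈ I, f₁ t ≠ 0)
    (n₂ : ∀ t ∈ I, f₂ t ≠ 0) (n₃ : ∀ t ∈ I, f₃ t ≠ 0) (h : AlgebraicRelations μ ν I f₁ f₂ f₃) :
    ∀ t ∈ I, f₁ t ^ 2 ≤ f₂ t ^ 2 ∧ f₂ t ^ 2 ≤ f₃ t ^ 2 := by
  rw [AlgebraicRelations.polynomial hμ hμν n₁ n₂ n₃] at h
  intro t ht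
  have a₁ := n₁ t ht
  have a₃ := n₃ t ht
  exact le_of_relations (by positivity) (by positivity) (by positivity)
    (pow_le_pow_left₀ hμ hμν 2) (h t ht).1 (h t ht).2

theorem sq_eq_sq_of_relations (hμ : 0 ≤ μ) (hμν : μ ≤ ν) {k₂ k₃ : ℝ → ℝ}
    (n₁ : ∀ t ∈ I, f₁ t ≠ 0)
    (n₂ : ∀ t ∈ I, f₂ t ≠ 0) (n₃ : ∀ t ∈ I, f₃ t ≠ 0) (m₂ : ∀ t ∈ I, k₂ t ≠ 0)
    (m₃ : ∀ t ∈ I, k₃ t ≠ 0) (h : AlgebraicRelations μ ν I f₁ f₂ f₃)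
    (k : AlgebraicRelations μ ν I f₁ k₂ k₃) :
    ∀ t ∈ I, k₂ t ^ 2 = f₂ t ^ 2 ∧ k₃ t ^ 2 = f₃ t ^ 2 := by
  rw [AlgebraicRelations.polynomial hμ hμν n₁ n₂ n₃] at h
  rw [AlgebraicRelations.polynomial hμ hμν n₁ m₂ m₃] at k
  intro t ht
  have a₁ := n₁ t ht
  have a₂ := n₂ t ht
  have b₂ := m₂ t ht
  exact relations_unique (by positivity) (by positivity) (by positivity) (sq_nonneg ν)
    (h t ht).1 (h t ht).2 (k t ht).1 (k t ht).2

/-- The inequality for `f₁'` says that the cosine of the angle is at most one. -/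
theorem sq_cos_le_one_iff (hI : IsOpen I) (hμ : 0 ≤ μ) (hμν : μ ≤ ν)
    (h₁ : ContDiffOn ℝ ∞ f₁ I) (h₂ : ContDiffOn ℝ ∞ f₂ I) (n₁ : ∀ t ∈ I, f₁ t ≠ 0)
    (n₂ : ∀ t ∈ I, f₂ t ≠ 0) (n₃ : ∀ t ∈ I, f₃ t ≠ 0) (h : AlgebraicRelations μ ν I f₁ f₂ f₃)
    {t : ℝ} (ht : t ∈ I) :
    ((deriv (fun s => f₁ s * f₂ s) t / f₃ t) ^ 2 ≤ 1 ↔ |deriv f₁ t| ≤ √(Xi (f₁ t) μ ν)) ∧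
    ((deriv (fun s => f₁ s * f₂ s) t / f₃ t) ^ 2 < 1 ↔ |deriv f₁ t| < √(Xi (f₁ t) μ ν)) := by
  obtain ⟨hpos, heq⟩ := sq_deriv_mul_Xi hI hμ hμν h₁ h₂ n₁ n₂ n₃ h ht
  have a₃ := n₃ t ht
  have hz : 0 < f₃ t ^ 2 := by positivity
  have e : (deriv (fun s => f₁ s * f₂ s) t / f₃ t) ^ 2 = deriv f₁ t ^ 2 / Xi (f₁ t) μ ν := by
    rw [div_pow, div_eq_div_iff hz.ne' hpos.ne', heq]; ring
  rw [e, div_le_one hpos, div_lt_one hpos, Real.le_sqrt (abs_nonneg _),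
    Real.lt_sqrt (abs_nonneg _), sq_abs]
  · exact ⟨Iff.rfl, Iff.rfl⟩
  · exact hpos.le

/-- The cosine must be `c = (f₁f₂)'/f₃`, which is smooth. An angle needs a sine with square `1 -
c²`: this has a `C¹` root when it is nonnegative and a smooth root when it is positive. -/
theorem exists_angleRelation (hI : IsOpen I) (hc : I.OrdConnected) (hμ : 0 ≤ μ) (hμν : μ ≤ ν)
    (h₁ : ContDiffOn ℝ ∞ f₁ I) (h₂ : ContDiffOn ℝ ∞ f₂ I) (h₃ : ContDiffOn ℝ ∞ f₃ I)
    (n₁ : ∀ t ∈ I, f₁ t ≠ 0)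
    (n₂ : ∀ t ∈ I, f₂ t ≠ 0) (n₃ : ∀ t ∈ I, f₃ t ≠ 0) (h : AlgebraicRelations μ ν I f₁ f₂ f₃)
    (hle : ∀ t ∈ I, |deriv f₁ t| ≤ √(Xi (f₁ t) μ ν)) :
    (∃ θ : ℝ → ℝ, ContDiffOn ℝ 1 θ I ∧ AngleRelation I f₁ f₂ f₃ θ) ∧
    ((∀ t ∈ I, |deriv f₁ t| < √(Xi (f₁ t) μ ν)) →
      ∃ θ : ℝ → ℝ, ContDiffOn ℝ ∞ θ I ∧ AngleRelation I f₁ f₂ f₃ θ) := by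
  set c : ℝ → ℝ := fun t => deriv (fun s => f₁ s * f₂ s) t / f₃ t with hcdef
  have hcs : ContDiffOn ℝ ∞ c I :=
    ((contDiffOn_infty_iff_deriv_of_isOpen hI).1 (h₁.mul h₂)).2.div h₃ n₃
  have hFs : ContDiffOn ℝ ∞ (fun t => 1 - c t ^ 2) I := contDiffOn_const.sub (hcs.pow 2)
  have hiff := fun t (ht : t ∈ I) => sq_cos_le_one_iff hI hμ hμν h₁ h₂ n₁ n₂ n₃ h ht
  have concl : ∀ θ : ℝ → ℝ, (∀ t ∈ I, Real.cos (θ t) = c t) → AngleRelation I f₁ f₂ f₃ θ := by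
    intro θ hθ t ht
    rw [hθ t ht, hcdef]
    exact mul_div_cancel₀ _ (n₃ t ht)
  constructor
  · obtain ⟨g, hg, hgF⟩ := exists_contDiffOn_one_sqrt hI hFs fun t ht =>
      sub_nonneg.2 ((hiff t ht).1.2 (hle t ht))
    obtain ⟨θ, hθ, hcs'⟩ := exists_angle (m := 0) hI hc (by simp) (a := c) (b := g)
      (by rw [zero_add]; exact hcs.of_le (by simp)) (by rw [zero_add]; exact hg)
      fun t ht => by rw [hgF t ht]; ring
    rw [zero_add] at hθ
    exact ⟨θ, hθ, concl θ fun t ht => (hcs' t ht).1⟩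
  · intro hlt
    have hpos : ∀ t ∈ I, 0 < 1 - c t ^ 2 := fun t ht => sub_pos.2 ((hiff t ht).2.2 (hlt t ht))
    obtain ⟨θ, hθ, hcs'⟩ := exists_angle (m := ∞) hI hc (by simp) (a := c)
      (b := fun t => √(1 - c t ^ 2)) hcs (hFs.sqrt fun t ht => (hpos t ht).ne')
      fun t ht => by rw [Real.sq_sqrt (hpos t ht).le]; ring
    exact ⟨θ, hθ, concl θ fun t ht => (hcs' t ht).1⟩

end Converse

/-! ### Unit normal vectors of the orbits -/

section UnitNormal

/-- The covector `⟨·, v⟩` of the bilinear form with matrix `G`. -/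
noncomputable def flat (G : Matrix (Fin 7) (Fin 7) ℝ) (v : W) : W →L[ℝ] ℝ :=
  ∑ i, (∑ j, G i j * v j) • stdCoframe i

theorem contDiffAt_flat {E : Type*} [NormedAddCommGroup E] [NormedSpace ℝ E]
    {G : E → Matrix (Fin 7) (Fin 7) ℝ} {v : E → W} {y : E}
    (hG : ∀ i j, ContDiffAt ℝ ∞ (fun y => G y i j) y) (hv : ContDiffAt ℝ ∞ v y) :
    ContDiffAt ℝ ∞ (fun y => flat (G y) (v y)) y := by
  refine ContDiffAt.sum fun i _ => ?_
  have h : ContDiffAt ℝ ∞ (fun y => ∑ j, G y i j * v y j) y := ContDiffAt.sum fun j _ =>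
    (hG i j).mul ((EuclideanSpace.proj j : W →L[ℝ] ℝ).contDiff.contDiffAt.comp y hv)
  exact h.smul contDiffAt_const

/-- The metric of a `G₂`-form extends to a smooth family of bilinear forms. -/
theorem exists_contDiffAt_bilin :
    ∃ G : (W [⋀^Fin 3]→L[ℝ] ℝ) → Matrix (Fin 7) (Fin 7) ℝ, ∀ φ, IsG2Form φ →
      (∀ i j, ContDiffAt ℝ ∞ (fun ψ => G ψ i j) φ) ∧
      ∀ u v, flat (G φ) v u = g2Metric φ u v := by
  obtain ⟨G, hG⟩ := exists_contDiffAt_g2Metric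
  refine ⟨G, fun φ hφ => ?_⟩
  obtain ⟨h1, h2⟩ := hG φ hφ
  refine ⟨h1, fun u v => ?_⟩
  obtain ⟨b, θ, hb⟩ := hφ
  conv_rhs => rw [← sum_smul_stdVec u, ← sum_smul_stdVec v, hb.g2Metric_eq]
  simp only [flat, map_sum, map_smul, sum_inner, inner_sum, inner_smul_left, inner_smul_right, h2,
    hb.g2Metric_eq, sum_apply, smul_apply, stdCoframe_apply, smul_eq_mul, conj_trivial]
  simp only [Finset.sum_mul, Finset.mul_sum]
  rw [Finset.sum_comm]
  refine Finset.sum_congr rfl fun i _ => Finset.sum_congr rfl fun j _ => ?_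
  ring

theorem exists_unitNormal (b : W ≃L[ℝ] W) {R : Submodule ℝ W} (hR : Module.finrank ℝ R = 6) :
    ∃ u, inner ℝ (b u) (b u) = 1 ∧ ∀ r ∈ R, inner ℝ (b u) (b r) = 0 := by
  set S : Submodule ℝ W := R.map (b : W →ₗ[ℝ] W) with hS
  have h1 : Module.finrank ℝ S = 6 := by
    rw [← hR]; exact LinearEquiv.finrank_map_eq b.toLinearEquiv R
  have h2 : Module.finrank ℝ Sᗮ = 1 := by
    have := S.finrank_add_finrank_orthogonal
    rw [h1, finrank_euclideanSpace_fin] at this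
    omega
  obtain ⟨x, hx⟩ := (Module.finrank_pos_iff_exists_ne_zero (R := ℝ) (M := Sᗮ)).1 (by omega)
  have hx0 : (x : W) ≠ 0 := by simpa using hx
  refine ⟨b.symm ((‖(x : W)‖⁻¹) • x), ?_, fun r hr => ?_⟩
  · rw [b.apply_symm_apply, inner_smul_left, inner_smul_right, real_inner_self_eq_norm_sq]
    have : ‖(x : W)‖ ≠ 0 := norm_ne_zero_iff.2 hx0
    simp only [conj_trivial]
    field_simp
  · rw [b.apply_symm_apply, inner_smul_left]
    have : inner ℝ (x : W) (b r) = 0 := by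
      rw [real_inner_comm]
      exact x.2 (b r) ⟨r, hr, rfl⟩
    rw [this, mul_zero]

theorem unitNormal_unique (b : W ≃L[ℝ] W) {R : Submodule ℝ W} (hR : Module.finrank ℝ R = 6)
    {u v : W} (hu : inner ℝ (b u) (b u) = 1) (hu' : ∀ r ∈ R, inner ℝ (b u) (b r) = 0)
    (hv' : ∀ r ∈ R, inner ℝ (b v) (b r) = 0) : v = inner ℝ (b v) (b u) • u := by
  set S : Submodule ℝ W := R.map (b : W →ₗ[ℝ] W) with hS
  have h1 : Module.finrank ℝ S = 6 := by
    rw [← hR]; exact LinearEquiv.finrank_map_eq b.toLinearEquiv R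
  have h2 : Module.finrank ℝ Sᗮ = 1 := by
    have := S.finrank_add_finrank_orthogonal
    rw [h1, finrank_euclideanSpace_fin] at this
    omega
  have hmem : ∀ w, (∀ r ∈ R, inner ℝ (b w) (b r) = 0) → b w ∈ Sᗮ := by
    intro w hw y hy
    obtain ⟨r, hr, rfl⟩ := hy
    rw [real_inner_comm]
    exact hw r hr
  obtain ⟨c, hc⟩ := exists_smul_eq_of_finrank_eq_one h2 (x := ⟨b u, hmem u hu'⟩)
    (fun h => by
      have h0 : b u = 0 := congrArg Subtype.val h
      rw [h0, inner_zero_left] at hu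
      exact zero_ne_one hu) ⟨b v, hmem v hv'⟩
  have hc' : c • b u = b v := congrArg Subtype.val hc
  rw [← hc', inner_smul_left, hu]
  apply b.injective
  rw [← hc', map_smul]
  simp

/-- A unit normal of a moving hyperplane that depends smoothly on the parameter. -/
theorem exists_contDiffAt_unitNormal {E : Type*} [NormedAddCommGroup E] [NormedSpace ℝ E]
    {G : E → Matrix (Fin 7) (Fin 7) ℝ} {X : Fin 6 → E → W} {y₀ : E} {u : W}
    (hG : ∀ᶠ y in nhds y₀, ∀ i j, ContDiffAt ℝ ∞ (fun y => G y i j) y)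
    (hX : ∀ᶠ y in nhds y₀, ∀ i, ContDiffAt ℝ ∞ (X i) y) (hu : flat (G y₀) u u = 1)
    (hu' : ∀ i, flat (G y₀) (X i y₀) u = 0)
    (hinj : ∀ v, flat (G y₀) u v = 0 → (∀ i, flat (G y₀) (X i y₀) v = 0) → v = 0) :
    ∃ N : E → W, ∀ᶠ y in nhds y₀, ContDiffAt ℝ ∞ N y ∧ flat (G y) (N y) (N y) = 1 ∧
      ∀ i, flat (G y) (X i y) (N y) = 0 := by
  set Y : Fin 7 → E → W := Fin.cons (fun _ => u) X with hY
  -- The components of `L y v` are the inner products of `v` with the fixed vector `u` and with the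
  -- spanning vectors `Xᵢ(y)`. Invertibility at `y₀` persists nearby.
  set L : E → W →L[ℝ] W := fun y => ∑ j, (flat (G y) (Y j y)).smulRight (stdVec j) with hL
  have hLs : ∀ᶠ y in nhds y₀, ContDiffAt ℝ ∞ L y := by
    filter_upwards [hG, hX] with y hG hX
    refine ContDiffAt.sum fun j _ => (contDiffAt_flat hG ?_).smulRight contDiffAt_const
    refine Fin.cases ?_ (fun i => ?_) j
    · exact contDiffAt_const
    · exact hX i
  have hLa : ∀ y v j, L y v j = flat (G y) (Y j y) v := by
    intro y v j
    simp only [hL, sum_apply, ContinuousLinearMap.smulRight_apply]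
    have := congrArg (fun w : W => w j)
      (sum_smul_stdVec (WithLp.toLp 2 fun j => flat (G y) (Y j y) v))
    simpa using this
  have hLinj : Function.Injective (L y₀) := by
    rw [injective_iff_map_eq_zero]
    intro v hv
    refine hinj v ?_ fun i => ?_
    · have := hLa y₀ v 0
      rw [hv] at this
      exact this.symm
    · have := hLa y₀ v i.succ
      rw [hv] at this
      exact this.symm
  let e : W ≃L[ℝ] W := (LinearEquiv.ofInjectiveEndo (L y₀ : W →ₗ[ℝ] W)
    hLinj).toContinuousLinearEquiv
  have he : (e : W →L[ℝ] W) = L y₀ := by ext1 v; rfl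
  -- The vector orthogonal to all `Xᵢ` with inner product one with `u`. It equals `u` at `y₀`, so
  -- its length is near one and may be normalized smoothly.
  set n : E → W := fun y => (L y).inverse (stdVec 0) with hn
  have hev : ∀ᶠ y in nhds y₀, ContDiffAt ℝ ∞ n y ∧ L y (n y) = stdVec 0 := by
    have h1 : ∀ᶠ A in nhds (L y₀), ∃ e : W ≃L[ℝ] W, (e : W →L[ℝ] W) = A := by
      rw [← he]; exact e.nhds
    filter_upwards [hLs.self_of_nhds.continuousAt.eventually h1, hLs] with y hy hLy
    obtain ⟨e', he'⟩ := hy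
    constructor
    · have h1 : ContDiffAt ℝ ∞ (ContinuousLinearMap.inverse : (W →L[ℝ] W) → W →L[ℝ] W) (L y) := by
        rw [← he']; exact contDiffAt_map_inverse e'
      exact (h1.comp y hLy).clm_apply contDiffAt_const
    · rw [hn]
      simp only
      rw [← he', ContinuousLinearMap.inverse_equiv]
      exact e'.apply_symm_apply _
  have hn0 : n y₀ = u := by
    apply hLinj
    rw [hev.self_of_nhds.2]
    ext j
    rw [hLa]
    refine Fin.cases ?_ (fun i => ?_) j
    · simpa [hY, stdVec] using hu.symm
    · simpa [hY, stdVec] using (hu' i).symm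
  set q : E → ℝ := fun y => flat (G y) (n y) (n y) with hq
  have hqs : ∀ᶠ y in nhds y₀, ContDiffAt ℝ ∞ q y := by
    filter_upwards [hG, hev] with y hG hn
    exact (contDiffAt_flat hG hn.1).clm_apply hn.1
  have hq0 : q y₀ = 1 := by rw [hq]; simp only [hn0, hu]
  have hpos : ∀ᶠ y in nhds y₀, 0 < q y :=
    hqs.self_of_nhds.continuousAt.eventually (lt_mem_nhds (by rw [hq0]; exact one_pos))
  refine ⟨fun y => (√(q y))⁻¹ • n y, ?_⟩
  filter_upwards [hev, hpos, hqs] with y hy hy' hqy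
  have h4 : √(q y) ≠ 0 := (Real.sqrt_pos.2 hy').ne'
  refine ⟨((hqy.sqrt hy'.ne').inv h4).smul hy.1, ?_, fun i => ?_⟩
  · have hsm : ∀ r : ℝ, flat (G y) (r • n y) = r • flat (G y) (n y) := by
      intro r
      simp only [flat, Finset.smul_sum, smul_smul, Finset.mul_sum]
      refine Finset.sum_congr rfl fun i _ => ?_
      congr 1
      refine Finset.sum_congr rfl fun j _ => ?_
      rw [PiLp.smul_apply, smul_eq_mul]; ring
    simp only [hsm, map_smul, smul_eq_mul]
    change (√(q y))⁻¹ * ((√(q y))⁻¹ * q y) = 1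
    have h3 := Real.mul_self_sqrt hy'.le
    field_simp
    linarith
  · have := hLa y (n y) i.succ
    rw [hy.2] at this
    simp only [map_smul, smul_eq_mul]
    have h5 : flat (G y) (X i y) (n y) = 0 := by simpa [hY, stdVec] using this.symm
    rw [h5, mul_zero]

end UnitNormal

section NormalField

variable {M : Type*} [TopologicalSpace M] [ChartedSpace W M] [MulAction SU3 M]

/-- `u` is a unit normal at `p` of the orbit of `p`. -/
def IsUnitNormal (φ : FormField M 3) (p : M) (u : W) : Prop :=
  g2Metric (toForm φ p) u u = 1 ∧ ∀ c, g2Metric (toForm φ p) u (fund p c) = 0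

theorem orbitDim_eq (p : M) : orbitDim p = Module.finrank ℝ (LinearMap.range (fund p).toLinearMap) :=
  rfl

theorem exists_isUnitNormal {φ : FormField M 3} (hφ : ∀ p, IsG2Form (φ p)) {p : M}
    (hp : orbitDim p = 6) : ∃ u, IsUnitNormal φ p u := by
  obtain ⟨b, θ, hb⟩ : IsG2Form (toForm φ p) := hφ p
  obtain ⟨u, h1, h2⟩ := exists_unitNormal b hp
  refine ⟨u, ?_, fun c => ?_⟩
  · rw [hb.g2Metric_eq, h1]
  · rw [hb.g2Metric_eq]; exact h2 _ ⟨c, rfl⟩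

theorem IsUnitNormal.eq_or_eq_neg {φ : FormField M 3} (hφ : ∀ p, IsG2Form (φ p)) {p : M}
    (hp : orbitDim p = 6) {u v : W} (hu : IsUnitNormal φ p u) (hv : IsUnitNormal φ p v) :
    v = u ∨ v = -u := by
  obtain ⟨b, θ, hb⟩ : IsG2Form (toForm φ p) := hφ p
  simp only [IsUnitNormal, hb.g2Metric_eq] at hu hv
  have h := unitNormal_unique b (R := LinearMap.range (fund p).toLinearMap) hp hu.1
    (by rintro _ ⟨c, rfl⟩; exact hu.2 c) (by rintro _ ⟨c, rfl⟩; exact hv.2 c)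
  set r := inner ℝ (b v) (b u)
  have h1 := hv.1
  rw [h, map_smul, inner_smul_left, inner_smul_right, hu.1] at h1
  have h2 : r * r = 1 := by simpa using h1
  rcases mul_self_eq_one_iff.1 h2 with h3 | h3
  · left; rw [h, h3, one_smul]
  · right; rw [h, h3, neg_smul, one_smul]

theorem IsUnitNormal.ne_zero {φ : FormField M 3} (hφ : ∀ p, IsG2Form (φ p)) {p : M}
    {u : W} (hu : IsUnitNormal φ p u) : u ≠ 0 := by
  rintro rfl
  obtain ⟨b, θ, hb⟩ : IsG2Form (toForm φ p) := hφ p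
  have h := hu.1
  rw [hb.g2Metric_eq, map_zero, inner_zero_left] at h
  exact zero_ne_one h

theorem isNormalCurve_iff {φ : FormField M 3} {I : Set ℝ} {γ : ℝ → M} : IsNormalCurve φ I γ ↔
    ContMDiffOn 𝓘(ℝ, ℝ) 𝓘(ℝ, W) ∞ γ I ∧ ∀ t ∈ I, orbitDim (γ t) = 6 ∧
      IsUnitNormal φ (γ t) (vel γ t) :=
  ⟨fun h => ⟨h.smooth, fun t ht => ⟨h.regular t ht, h.unit t ht, h.orthogonal t ht⟩⟩,
    fun h => ⟨h.1, fun t ht => (h.2 t ht).1, fun t ht => (h.2 t ht).2.1,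
      fun t ht => (h.2 t ht).2.2⟩⟩

omit [MulAction SU3 M] in
/-- The differential of the inverse of a chart, as an equivalence. -/
theorem exists_chartEquiv [IsManifold 𝓘(ℝ, W) ∞ M] {e : OpenPartialHomeomorph M W}
    (he : e ∈ atlas W M) {y : W} (hy : y ∈ e.target) :
    ∃ D : W ≃L[ℝ] W, (D : W →L[ℝ] W) = mfderiv 𝓘(ℝ, W) 𝓘(ℝ, W) e.symm y :=
  haveI : IsManifold 𝓘(ℝ, W) 1 M := IsManifold.of_le (n := ∞) (by simp)
  ⟨(mdifferentiable_of_mem_atlas (I := 𝓘(ℝ, W)) he).symm.mfderiv hy, rfl⟩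

variable (hM : IsSmoothAction M)

include hM

theorem IsSmoothAction.orbitDim_smul (g : SU3) (p : M) : orbitDim (g • p) = orbitDim p := by
  rw [orbitDim_eq, orbitDim_eq]
  have h : LinearMap.range (fund (g • p)).toLinearMap =
      (LinearMap.range (fund p).toLinearMap).map
        ((hM.pushEquiv g p).toLinearEquiv : W →ₗ[ℝ] W) := by
    ext w
    constructor
    · rintro ⟨c, rfl⟩
      refine ⟨fund p (Ad g⁻¹ c), ⟨_, rfl⟩, ?_⟩
      have := hM.push_fund g p (Ad g⁻¹ c)
      rwa [Ad_apply_Ad_inv] at this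
    · rintro ⟨_, ⟨c, rfl⟩, rfl⟩
      exact ⟨Ad g c, (hM.push_fund g p c).symm⟩
  rw [h, LinearEquiv.finrank_map_eq]

theorem IsSmoothAction.isUnitNormal_push {φ : FormField M 3} (hφ : ∀ p, IsG2Form (φ p))
    (hinv : IsInvariantForm φ) (g : SU3) {p : M} {u : W} (hu : IsUnitNormal φ p u) :
    IsUnitNormal φ (g • p) (push g p u) := by
  have h : ∀ x y, g2Metric (toForm φ p) x y
      = g2Metric (toForm φ (g • p)) (push g p x) (push g p y) := by
    intro x y
    have h1 := (isInvariantForm_iff φ).1 hinv g p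
    rw [← h1]
    exact g2Metric_comp (hφ (g • p)) (hM.pushEquiv g p) x y
  refine ⟨by rw [← h, hu.1], fun c => ?_⟩
  have := hM.push_fund g p (Ad g⁻¹ c)
  rw [Ad_apply_Ad_inv] at this
  rw [← this, ← h, hu.2]

theorem IsSmoothAction.vel_smul (g : SU3) {γ : ℝ → M} {t : ℝ}
    (hγ : MDifferentiableAt 𝓘(ℝ, ℝ) 𝓘(ℝ, W) γ t) :
    vel (fun s => g • γ s) t = push g (γ t) (vel γ t) := by
  have := hM.push_tube g γ hγ (1, 0)
  simpa [tube_apply] using this.symm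

theorem IsSmoothAction.isNormalCurve_smul {φ : FormField M 3} (hφ : ∀ p, IsG2Form (φ p))
    (hinv : IsInvariantForm φ) {I : Set ℝ} (hI : IsOpen I) {γ : ℝ → M} (hγ : IsNormalCurve φ I γ)
    (g : SU3) : IsNormalCurve φ I (fun t => g • γ t) := by
  rw [isNormalCurve_iff] at hγ ⊢
  refine ⟨(hM.smul g).comp_contMDiffOn hγ.1, fun t ht => ⟨?_, ?_⟩⟩
  · rw [hM.orbitDim_smul]; exact (hγ.2 t ht).1
  · rw [hM.vel_smul g ((hγ.1.contMDiffAt (hI.mem_nhds ht)).mdifferentiableAt (by simp))]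
    exact hM.isUnitNormal_push hφ hinv g (hγ.2 t ht).2

variable [IsManifold 𝓘(ℝ, W) ∞ M]

/-- The fundamental vector fields in a chart. -/
theorem IsSmoothAction.exists_chartFund {e : OpenPartialHomeomorph M W} (he : e ∈ atlas W M) :
    ∃ A : W → LieSU3 →L[ℝ] W, ∀ y ∈ e.target, ContDiffAt ℝ ∞ A y ∧ ∀ c, (mfderiv 𝓘(ℝ, W) 𝓘(ℝ, W) e.symm y : W →L[ℝ] W) (A y c)
        = fund (e.symm y) c := by
  have hmax : e ∈ IsManifold.maximalAtlas 𝓘(ℝ, W) ∞ M := IsManifold.subset_maximalAtlas he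
  -- The derivative at `c = 0` of the action read in the chart; joint smoothness of the action makes
  -- it smooth in `y`.
  refine ⟨fun y => fderiv ℝ (fun c => e (suExp c • e.symm y)) 0, fun y hy => ⟨?_, ?_⟩⟩
  · refine ContDiffAt.fderiv (n := ∞) (f := fun y c => e (suExp c • e.symm y)) ?_
      contDiffAt_const (by simp)
    have h1 : ContMDiffAt 𝓘(ℝ, W × LieSU3) 𝓘(ℝ, W) ∞
        (fun q : W × LieSU3 => e.symm q.1) (y, 0) :=
      ContMDiffAt.comp (y, (0 : LieSU3))
        (contMDiffAt_symm_of_mem_maximalAtlas hmax hy)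
        (contDiff_fst (𝕜 := ℝ) (E := W) (F := LieSU3)).contMDiff.contMDiffAt
    have h2 : ContMDiffAt 𝓘(ℝ, W × LieSU3) 𝓘(ℝ, LieSU3) ∞
        (fun q : W × LieSU3 => q.2) (y, 0) :=
      (contDiff_snd (𝕜 := ℝ) (E := W) (F := LieSU3)).contMDiff.contMDiffAt
    have h3 := hM.exp.contMDiffAt.comp (y, (0 : LieSU3)) (h2.prodMk h1)
    have h4 : suExp (0 : LieSU3) • e.symm y = e.symm y := by
      rw [suExp_zero, one_smul]
    have h5 : ContMDiffAt 𝓘(ℝ, W) 𝓘(ℝ, W) ∞ e (suExp (0 : LieSU3) • e.symm y) := by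
      rw [h4]; exact contMDiffAt_of_mem_maximalAtlas hmax (e.map_target hy)
    exact (h5.comp (y, (0 : LieSU3)) h3).contDiffAt
  · intro c
    have h1 := hM.hasMFDerivAt_exp (e.symm y)
    have h2 : suExp (0 : LieSU3) • e.symm y = e.symm y := by rw [suExp_zero, one_smul]
    have h3 := mfderiv_symm_comp he h1 (by rw [h2]; exact e.map_target hy)
    rw [h2, e.right_inv hy] at h3
    exact DFunLike.congr_fun h3 c

/-- Locally there is a smooth unit normal field of the orbits of dimension six. -/
theorem IsSmoothAction.exists_normalField (hM6 : ∀ p : M, orbitDim p ≤ 6) {φ : FormField M 3}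
    (hφ : ∀ p, IsG2Form (φ p)) (hs : IsCnForm ∞ φ) {e : OpenPartialHomeomorph M W}
    (he : e ∈ atlas W M) {p : M} (hp : p ∈ e.source) (hp6 : orbitDim p = 6) :
    ∃ (N : W → W) (U : Set W), IsOpen U ∧ e p ∈ U ∧ U ⊆ e.target ∧ ContDiffOn ℝ ∞ N U ∧
      ∀ y ∈ U, orbitDim (e.symm y) = 6 ∧ IsUnitNormal φ (e.symm y)
        ((mfderiv 𝓘(ℝ, W) 𝓘(ℝ, W) e.symm y : W →L[ℝ] W) (N y)) := by
  have hy₀ : e p ∈ e.target := e.map_source hp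
  obtain ⟨A, hA⟩ := hM.exists_chartFund he
  obtain ⟨G, hG⟩ := exists_contDiffAt_bilin
  choose D hD using fun (y : W) (hy : y ∈ e.target) => exists_chartEquiv he hy
  have hloc : ∀ y (hy : y ∈ e.target), localRep φ e y
      = (toForm φ (e.symm y)).compContinuousLinearMap (D y hy : W →L[ℝ] W) := by
    intro y hy; rw [hD]; rfl
  have hlocG : ∀ y ∈ e.target, IsG2Form (localRep φ e y) := by
    intro y hy; rw [hloc y hy]; exact IsG2Form.comp (hφ (e.symm y)) _
  have hflat : ∀ y (hy : y ∈ e.target) u v, flat (G (localRep φ e y)) v u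
      = g2Metric (toForm φ (e.symm y)) (D y hy u) (D y hy v) := by
    intro y hy u v
    rw [(hG _ (hlocG y hy)).2, hloc y hy, g2Metric_comp (show IsG2Form (toForm φ (e.symm y)) from hφ (e.symm y))]
  have hDA : ∀ y (hy : y ∈ e.target) c, D y hy (A y c) = fund (e.symm y) c := by
    intro y hy c
    rw [← (hA y hy).2 c, ← hD y hy]; rfl
  -- six vectors that span the tangent space of the orbit
  obtain ⟨c, hc⟩ : ∃ c : Fin 6 → LieSU3, LinearIndependent ℝ fun i => fund p (c i) := by
    have h1 : Module.finrank ℝ (LinearMap.range (fund p).toLinearMap) = 6 := hp6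
    obtain ⟨f, hf⟩ := exists_linearIndependent_of_le_finrank (R := ℝ) (n := 6) h1.ge
    choose c hc using fun i => (f i).2
    refine ⟨c, ?_⟩
    have h2 := hf.map' (LinearMap.range (fund p).toLinearMap).subtype (Submodule.ker_subtype _)
    have h3 : (fun i => fund p (c i)) = (LinearMap.range (fund p).toLinearMap).subtype ∘ f :=
      funext hc
    rw [h3]
    exact h2
  have hAi : ∀ y ∈ e.target, ∀ i, ContDiffAt ℝ ∞ (fun y => A y (c i)) y := fun y hy i =>
    (hA y hy).1.clm_apply contDiffAt_const
  have hloce : ∀ y ∈ e.target, ContDiffAt ℝ ∞ (localRep φ e) y := fun y hy =>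
    (hs e he).contDiffAt (e.open_target.mem_nhds hy)
  have htarget := e.open_target.eventually_mem hy₀
  have hep : e.symm (e p) = p := e.left_inv hp
  have hAind : LinearIndependent ℝ fun i => A (e p) (c i) := by
    have h1 : (fun i => fund p (c i)) = fun i => (D (e p) hy₀).toLinearEquiv (A (e p) (c i)) := by
      funext i
      have := hDA (e p) hy₀ (c i)
      rw [hep] at this
      exact this.symm
    rw [h1] at hc
    exact LinearIndependent.of_comp ((D (e p) hy₀).toLinearEquiv : W →ₗ[ℝ] W) hc
  -- they remain a basis of the tangent spaces of the orbits nearby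
  have hspan : ∀ y (hy : y ∈ e.target), (LinearIndependent ℝ fun i => A y (c i)) →
      orbitDim (e.symm y) = 6 ∧
      LinearMap.range (fund (e.symm y)).toLinearMap
        = Submodule.span ℝ (Set.range fun i => fund (e.symm y) (c i)) := by
    intro y hy hli
    have h1 : LinearIndependent ℝ fun i => fund (e.symm y) (c i) := by
      have := hli.map' ((D y hy).toLinearEquiv : W →ₗ[ℝ] W) (LinearEquiv.ker _)
      have h3 : (fun i => fund (e.symm y) (c i))
          = ((D y hy).toLinearEquiv : W →ₗ[ℝ] W) ∘ fun i => A y (c i) :=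
        funext fun i => (hDA y hy (c i)).symm
      rw [h3]
      exact this
    have h2 := finrank_span_eq_card h1
    rw [Fintype.card_fin] at h2
    have h3 : Submodule.span ℝ (Set.range fun i => fund (e.symm y) (c i))
        ≤ LinearMap.range (fund (e.symm y)).toLinearMap := by
      rw [Submodule.span_le]
      rintro _ ⟨i, rfl⟩
      exact ⟨c i, rfl⟩
    -- Six independent fundamental vectors span the tangent space of the orbit because no orbit has
    -- larger dimension. This is where maximality of six is used.
    have h4 : Module.finrank ℝ (LinearMap.range (fund (e.symm y)).toLinearMap) ≤ 6 :=
      hM6 (e.symm y)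
    have h5 := Submodule.finrank_mono h3
    refine ⟨le_antisymm h4 (h2 ▸ h5),
      (Submodule.eq_of_le_of_finrank_le h3 (by rw [h2]; exact h4)).symm⟩
  have hnormal : ∀ y (hy : y ∈ e.target), (LinearIndependent ℝ fun i => A y (c i)) → ∀ u : W,
      (∀ i, flat (G (localRep φ e y)) (A y (c i)) u = 0) →
      ∀ c', g2Metric (toForm φ (e.symm y)) (D y hy u) (fund (e.symm y) c') = 0 := by
    intro y hy hli u hu c'
    obtain ⟨b, θ, hb⟩ : IsG2Form (toForm φ (e.symm y)) := hφ _
    have h1 : fund (e.symm y) c' ∈ Submodule.span ℝ (Set.range fun i => fund (e.symm y) (c i)) := by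
      rw [← (hspan y hy hli).2]; exact ⟨c', rfl⟩
    generalize fund (e.symm y) c' = x at h1
    induction h1 using Submodule.span_induction with
    | mem x hx =>
      obtain ⟨i, rfl⟩ := hx
      have := hu i
      rwa [hflat y hy, hDA y hy] at this
    | zero => rw [hb.g2Metric_eq, map_zero, inner_zero_right]
    | add x y _ _ hx hy =>
      rw [hb.g2Metric_eq] at hx hy ⊢
      rw [map_add, inner_add_right, hx, hy, add_zero]
    | smul r x _ hx =>
      rw [hb.g2Metric_eq] at hx ⊢
      rw [map_smul, inner_smul_right, hx, mul_zero]
  obtain ⟨w, hw⟩ := exists_isUnitNormal hφ hp6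
  set u := (D (e p) hy₀).symm w with hu
  have hDu : D (e p) hy₀ u = w := (D (e p) hy₀).apply_symm_apply w
  obtain ⟨N, hN⟩ := exists_contDiffAt_unitNormal (G := fun y => G (localRep φ e y))
    (X := fun i y => A y (c i)) (y₀ := e p) (u := u)
    (htarget.mono fun y hy i j => ((hG _ (hlocG y hy)).1 i j).comp y (hloce y hy))
    (htarget.mono hAi)
    (by rw [hflat _ hy₀, hDu, hep]; exact hw.1)
    (fun i => by rw [hflat _ hy₀, hDu, hDA _ hy₀, hep]; exact hw.2 _)
    (fun v h1 h2 => by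
      have h3 := hnormal _ hy₀ hAind v h2
      rw [hflat _ hy₀, hDu] at h1
      rw [hep] at h1 h3
      obtain ⟨b, θ, hb⟩ : IsG2Form (toForm φ p) := hφ _
      simp only [IsUnitNormal, hb.g2Metric_eq] at hw h1 h3
      have h4 := unitNormal_unique b (R := LinearMap.range (fund p).toLinearMap) hp6 hw.1
        (by rintro _ ⟨c, rfl⟩; exact hw.2 c) (by rintro _ ⟨c, rfl⟩; exact h3 c)
      rw [h1, zero_smul] at h4
      simpa using h4)
  have hli : ∀ᶠ y in nhds (e p), LinearIndependent ℝ fun i => A y (c i) := by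
    have h1 : ContinuousAt (fun y => fun i => A y (c i)) (e p) :=
      continuousAt_pi.2 fun i => (hAi _ hy₀ i).continuousAt
    exact h1.eventually hAind.eventually
  have hev := (hN.and hli).and htarget
  obtain ⟨U, hU, hUo, hpU⟩ := mem_nhds_iff.1 hev
  refine ⟨N, U, hUo, hpU, fun y hy => (hU hy).2,
    fun y hy => (hU hy).1.1.1.contDiffWithinAt, fun y hy => ?_⟩
  obtain ⟨⟨⟨-, h1, h2⟩, h3⟩, h5⟩ := hU hy
  refine ⟨(hspan y h5 h3).1, ?_⟩
  have h6 := hnormal y h5 h3 (N y) h2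
  rw [hflat y h5] at h1
  rw [← hD y h5]
  exact ⟨h1, h6⟩

end NormalField

/-! ### Normal curves -/

section NormalCurve

/-- Bootstrapping: if `α` is of class `Cⁿ`, then so is its derivative `N ∘ α`, and `α` is of class
`Cⁿ⁺¹`. -/
theorem contDiffOn_of_hasDerivAt {E : Type*} [NormedAddCommGroup E] [NormedSpace ℝ E] {N : E → E}
    {U : Set E} {I : Set ℝ} (hI : IsOpen I) {α : ℝ → E} (hN : ContDiffOn ℝ ∞ N U)
    (hα : ∀ t ∈ I, HasDerivAt α (N (α t)) t) (hU : ∀ t ∈ I, α t ∈ U) : ContDiffOn ℝ ∞ α I := by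
  have hd : DifferentiableOn ℝ α I := fun t ht => (hα t ht).differentiableAt.differentiableWithinAt
  rw [contDiffOn_infty]
  intro n
  induction n with
  | zero => exact contDiffOn_zero.2 hd.continuousOn
  | succ n ih =>
    push_cast
    rw [contDiffOn_succ_iff_deriv_of_isOpen hI]
    refine ⟨hd, by simp, ?_⟩
    have h1 : ContDiffOn ℝ n (N ∘ α) I := (hN.of_le (by exact_mod_cast le_top)).comp ih hU
    exact h1.congr fun t ht => (hα t ht).deriv

theorem continuousAt_deriv {E : Type*} [NormedAddCommGroup E] [NormedSpace ℝ E] {u : ℝ → E} {t : ℝ}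
    (hu : ContDiffAt ℝ ∞ u t) : ContinuousAt (deriv u) t := by
  have h : deriv u = fun t => fderiv ℝ u t 1 := funext fun t => fderiv_apply_one_eq_deriv.symm
  rw [h]
  exact (hu.continuousAt_fderiv (by simp)).clm_apply continuousAt_const

variable {M : Type*} [TopologicalSpace M] [ChartedSpace W M] [MulAction SU3 M]
  [IsManifold 𝓘(ℝ, W) ∞ M]

omit [MulAction SU3 M] [IsManifold 𝓘(ℝ, W) ∞ M] in
theorem hasMFDerivAt_vel {γ : ℝ → M} {t : ℝ} (hγ : MDifferentiableAt 𝓘(ℝ, ℝ) 𝓘(ℝ, W) γ t) :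
    HasMFDerivAt 𝓘(ℝ, ℝ) 𝓘(ℝ, W) γ t
      ((ContinuousLinearMap.id ℝ ℝ).smulRight (vel γ t)) := by
  have key : ∀ r : ℝ, (mfderiv 𝓘(ℝ, ℝ) 𝓘(ℝ, W) γ t : ℝ →L[ℝ] W) r = r • vel γ t := by
    intro r
    have h : ∀ A : ℝ →L[ℝ] W, A r = r • A 1 := fun A => by
      rw [← map_smul, smul_eq_mul, mul_one]
    exact h (mfderiv 𝓘(ℝ, ℝ) 𝓘(ℝ, W) γ t)
  exact hγ.hasMFDerivAt.congr_mfderiv (ContinuousLinearMap.ext key)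

omit [MulAction SU3 M] in
/-- The velocity of a curve in a chart. -/
theorem mfderiv_symm_deriv {e : OpenPartialHomeomorph M W} (he : e ∈ atlas W M) {γ : ℝ → M} {t : ℝ}
    (hγ : MDifferentiableAt 𝓘(ℝ, ℝ) 𝓘(ℝ, W) γ t) (ht : γ t ∈ e.source) :
    (mfderiv 𝓘(ℝ, W) 𝓘(ℝ, W) e.symm (e (γ t)) : W →L[ℝ] W) (deriv (fun s => e (γ s)) t)
      = vel γ t := by
  have h := DFunLike.congr_fun (mfderiv_symm_comp he (hasMFDerivAt_vel hγ) ht) (1 : ℝ)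
  change (mfderiv 𝓘(ℝ, W) 𝓘(ℝ, W) e.symm (e (γ t)) : W →L[ℝ] W) (fderiv ℝ (fun s => e (γ s)) t 1)
    = (1 : ℝ) • vel γ t at h
  rwa [one_smul, fderiv_apply_one_eq_deriv] at h

variable (hM : IsSmoothAction M)

include hM

/-- An integral curve in a chart of the local unit normal field. -/
theorem IsSmoothAction.exists_normalCurve (hM6 : ∀ p : M, orbitDim p ≤ 6) {φ : FormField M 3}
    (hφ : ∀ p, IsG2Form (φ p)) (hs : IsCnForm ∞ φ) {p : M} (hp6 : orbitDim p = 6) :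
    ∃ (ε : ℝ) (γ : ℝ → M), 0 < ε ∧ γ 0 = p ∧ IsNormalCurve φ (Set.Ioo (-ε) ε) γ := by
  set e := chartAt W p with he'
  have he : e ∈ atlas W M := chart_mem_atlas W p
  have hp : p ∈ e.source := mem_chart_source W p
  obtain ⟨N, U, hUo, hpU, hUt, hN, h⟩ := hM.exists_normalField hM6 hφ hs he hp hp6
  obtain ⟨α, hα0, ε, hε, hα⟩ := ((hN.contDiffAt (hUo.mem_nhds hpU)).of_le
    (by simp : (1 : WithTop ℕ∞) ≤ ∞)).exists_forall_mem_closedBall_exists_eq_forall_mem_Ioo_hasDerivAt₀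
    0
  rw [zero_sub, zero_add] at hα
  have hc : ContinuousAt α 0 := (hα 0 ⟨by linarith, hε⟩).continuousAt
  -- The interval is shortened so that the curve stays where the normal field is defined.
  obtain ⟨ε', hε', hU⟩ := Metric.mem_nhds_iff.1
    (hc.preimage_mem_nhds (by rw [hα0]; exact hUo.mem_nhds hpU))
  set r := min ε ε' with hr
  have hrε : ∀ t ∈ Set.Ioo (-r) r, t ∈ Set.Ioo (-ε) ε := fun t ht =>
    ⟨by linarith [ht.1, min_le_left ε ε'], by linarith [ht.2, min_le_left ε ε']⟩
  have hrU : ∀ t ∈ Set.Ioo (-r) r, α t ∈ U := fun t ht => hU (by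
    rw [Metric.mem_ball, Real.dist_eq, sub_zero, abs_lt]
    exact ⟨by linarith [ht.1, min_le_right ε ε'], by linarith [ht.2, min_le_right ε ε']⟩)
  have hαs : ContDiffOn ℝ ∞ α (Set.Ioo (-r) r) :=
    contDiffOn_of_hasDerivAt isOpen_Ioo hN (fun t ht => hα t (hrε t ht)) hrU
  have hmax : e ∈ IsManifold.maximalAtlas 𝓘(ℝ, W) ∞ M := IsManifold.subset_maximalAtlas he
  refine ⟨r, fun t => e.symm (α t), lt_min hε hε', by simp only [hα0, e.left_inv hp], ?_⟩
  rw [isNormalCurve_iff]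
  constructor
  · exact (contMDiffOn_symm_of_mem_maximalAtlas hmax).comp hαs.contMDiffOn
      fun t ht => hUt (hrU t ht)
  · intro t ht
    obtain ⟨h1, h2⟩ := h _ (hrU t ht)
    refine ⟨h1, ?_⟩
    have h3 := (contMDiffAt_symm_of_mem_maximalAtlas hmax (hUt (hrU t ht))).mdifferentiableAt
      (by simp)
    have h4 := (h3.hasMFDerivAt.comp t (hα t (hrε t ht)).hasFDerivAt.hasMFDerivAt).mfderiv
    have h5 := DFunLike.congr_fun h4 (1 : ℝ)
    change vel (fun t => e.symm (α t)) t
      = (mfderiv 𝓘(ℝ, W) 𝓘(ℝ, W) e.symm (α t) : W →L[ℝ] W) ((1 : ℝ) • N (α t)) at h5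
    rw [one_smul] at h5
    rw [h5]
    exact h2

/-- The normal spaces are lines, so at each time the velocity is `N` or `-N`. By continuity the sign
is constant near `t₀`, and equal velocities give both curves the same sign. They solve one
differential equation with Lipschitz right side. -/
theorem IsSmoothAction.normalCurve_eventuallyEq (hM6 : ∀ p : M, orbitDim p ≤ 6) {φ : FormField M 3}
    (hφ : ∀ p, IsG2Form (φ p)) (hs : IsCnForm ∞ φ) {I : Set ℝ} (hI : IsOpen I) {γ δ : ℝ → M}
    (hγ : IsNormalCurve φ I γ) (hδ : IsNormalCurve φ I δ) {t₀ : ℝ} (ht₀ : t₀ ∈ I)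
    (h0 : γ t₀ = δ t₀) (h1 : vel γ t₀ = vel δ t₀) : γ =ᶠ[nhds t₀] δ := by
  set p := γ t₀ with hpdef
  set e := chartAt W p with he'
  have he : e ∈ atlas W M := chart_mem_atlas W p
  have hp : p ∈ e.source := mem_chart_source W p
  have hmax : e ∈ IsManifold.maximalAtlas 𝓘(ℝ, W) ∞ M := IsManifold.subset_maximalAtlas he
  obtain ⟨N, U, hUo, hpU, hUt, hN, h⟩ := hM.exists_normalField hM6 hφ hs he hp
    (hγ.regular t₀ ht₀)
  have hNc : ContDiffAt ℝ ∞ N (e p) := hN.contDiffAt (hUo.mem_nhds hpU)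
  have hne : N (e p) ≠ 0 := by
    intro hn
    refine (h _ hpU).2.ne_zero hφ ?_
    rw [hn]; exact map_zero _
  obtain ⟨K, S, hS, hK⟩ := (hNc.of_le (by simp : (1 : WithTop ℕ∞) ≤ ∞)).exists_lipschitzOnWith
  -- a normal curve is an integral curve of `N` or of `-N`
  have key : ∀ {γ : ℝ → M}, IsNormalCurve φ I γ → γ t₀ = p →
      ((deriv (fun s => e (γ s)) t₀ = N (e p) ∨ deriv (fun s => e (γ s)) t₀ = -N (e p)) ∧
      ∀ r : ℝ, r = 1 ∨ r = -1 → deriv (fun s => e (γ s)) t₀ = r • N (e p) →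
        ∀ᶠ t in nhds t₀, γ t ∈ e.source ∧
          HasDerivAt (fun s => e (γ s)) (r • N (e (γ t))) t ∧ e (γ t) ∈ S) := by
    intro γ hγ hγp
    have hγs : ∀ t ∈ I, ContMDiffAt 𝓘(ℝ, ℝ) 𝓘(ℝ, W) ∞ γ t := fun t ht =>
      hγ.smooth.contMDiffAt (hI.mem_nhds ht)
    have hp' : γ t₀ ∈ e.source := by rw [hγp]; exact hp
    have hu : ContDiffAt ℝ ∞ (fun s => e (γ s)) t₀ :=
      ((contMDiffAt_of_mem_maximalAtlas hmax hp').comp t₀ (hγs t₀ ht₀)).contDiffAt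
    have hu' : ContinuousAt (deriv fun s => e (γ s)) t₀ :=
      continuousAt_deriv hu
    have hsrc : ∀ᶠ t in nhds t₀, γ t ∈ e.source :=
      (hγs t₀ ht₀).continuousAt.eventually (e.open_source.eventually_mem hp')
    have huU : ∀ᶠ t in nhds t₀, e (γ t) ∈ U :=
      hu.continuousAt.eventually (hUo.eventually_mem (by simpa only [hγp] using hpU))
    have huS : ∀ᶠ t in nhds t₀, e (γ t) ∈ S :=
      hu.continuousAt.preimage_mem_nhds (by simpa only [hγp] using hS)
    have hor : ∀ t, t ∈ I → γ t ∈ e.source → e (γ t) ∈ U →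
        (deriv (fun s => e (γ s)) t = N (e (γ t)) ∨
          deriv (fun s => e (γ s)) t = -N (e (γ t))) := by
      intro t ht hts htU
      obtain ⟨D, hD⟩ := exists_chartEquiv he (hUt htU)
      have h2 := mfderiv_symm_deriv he ((hγs t ht).mdifferentiableAt (by simp)) hts
      have h3 := h _ htU
      rw [← hD] at h2 h3
      rw [e.left_inv hts] at h3
      have h4 := ((isNormalCurve_iff.1 hγ).2 t ht).2
      rw [← h2] at h4
      rcases h3.2.eq_or_eq_neg hφ h3.1 h4 with h5 | h5
      · left; exact D.injective h5
      · right; apply D.injective; rw [map_neg]; exact h5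
    refine ⟨?_, fun r hr hr' => ?_⟩
    · have := hor t₀ ht₀ hp' huU.self_of_nhds
      rwa [hγp] at this
    · have hNu : ContinuousAt (fun t => -(r • N (e (γ t)))) t₀ := by
        have h2 : ContinuousAt N (e (γ t₀)) := by rw [hγp]; exact hNc.continuousAt
        exact ((ContinuousAt.comp (f := fun s => e (γ s)) h2 hu.continuousAt).const_smul r).neg
      have hr0 : r ≠ 0 := by rcases hr with rfl | rfl <;> norm_num
      -- Since `N ≠ 0`, the opposite sign is excluded at `t₀`, and hence in a neighbourhood, by
      -- continuity of the velocity.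
      have hnev : ∀ᶠ t in nhds t₀, deriv (fun s => e (γ s)) t ≠ -(r • N (e (γ t))) := by
        refine ((hu'.sub hNu).eventually_ne (sub_ne_zero.2 ?_)).mono fun t =>
          sub_ne_zero.1
        rw [hr']
        simp only [hγp]
        intro h2
        have h3 : (2 : ℝ) • (r • N (e p)) = 0 := by
          rw [two_smul]; exact eq_neg_iff_add_eq_zero.1 h2
        exact hne ((smul_eq_zero.1 ((smul_eq_zero.1 h3).resolve_left two_ne_zero)).resolve_left hr0)
      have hdiff : ∀ᶠ t in nhds t₀, DifferentiableAt ℝ (fun s => e (γ s)) t :=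
        ((hu.of_le (by simp : (1 : WithTop ℕ∞) ≤ ∞)).eventually (by simp)).mono fun t ht =>
          ht.differentiableAt (by simp)
      filter_upwards [hsrc, huU, huS, hnev, hdiff, hI.eventually_mem ht₀] with t a1 a2 a3 a4 a5 a6
      refine ⟨a1, ?_, a3⟩
      have h2 := a5.hasDerivAt
      rcases hr with rfl | rfl
      · rw [one_smul] at a4 ⊢
        rwa [(hor t a6 a1 a2).resolve_right a4] at h2
      · rw [neg_one_smul] at a4 ⊢
        rw [neg_neg] at a4
        rwa [(hor t a6 a1 a2).resolve_left a4] at h2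
  have hderiv : deriv (fun s => e (γ s)) t₀ = deriv (fun s => e (δ s)) t₀ := by
    obtain ⟨D, hD⟩ := exists_chartEquiv he (hUt hpU)
    have h2 := mfderiv_symm_deriv he (γ := γ) (t := t₀)
      ((hγ.smooth.contMDiffAt (hI.mem_nhds ht₀)).mdifferentiableAt (by simp)) hp
    have h3 := mfderiv_symm_deriv he (γ := δ) (t := t₀)
      ((hδ.smooth.contMDiffAt (hI.mem_nhds ht₀)).mdifferentiableAt (by simp)) (h0 ▸ hp)
    rw [← h0, ← hD] at h3
    rw [← hpdef, ← hD] at h2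
    apply D.injective
    exact h2.trans (h1.trans h3.symm)
  obtain ⟨k1, k2⟩ := key hγ rfl
  obtain ⟨-, k3⟩ := key hδ h0.symm
  obtain ⟨r, hr, hr'⟩ : ∃ r : ℝ, (r = 1 ∨ r = -1) ∧
      deriv (fun s => e (γ s)) t₀ = r • N (e p) := by
    rcases k1 with k1 | k1
    · exact ⟨1, Or.inl rfl, by rw [one_smul, k1]⟩
    · exact ⟨-1, Or.inr rfl, by rw [neg_one_smul, k1]⟩
  have e1 := k2 r hr hr'
  have e2 := k3 r hr (hderiv ▸ hr')
  have hLip : LipschitzOnWith (‖r‖₊ * K) (fun y => r • N y) S := by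
    have := (lipschitzWith_smul r).comp_lipschitzOnWith hK
    exact this
  have hu : (fun s => e (γ s)) =ᶠ[nhds t₀] fun s => e (δ s) :=
    ODE_solution_unique_of_eventually (v := fun _ y => r • N y) (s := fun _ => S)
      (Filter.Eventually.of_forall fun _ => hLip) (e1.mono fun t ht => ht.2)
      (e2.mono fun t ht => ht.2) (by rw [← h0])
  filter_upwards [hu, e1, e2] with t a1 a2 a3
  exact e.injOn a2.1 a3.1 a1

/-- The set of times near which the curves agree is open. It is closed in the interval, since at a
limit time the positions agree by the Hausdorff property and the velocities by continuity, and local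
uniqueness applies again. -/
theorem IsSmoothAction.normalCurve_eqOn [T2Space M] (hM6 : ∀ p : M, orbitDim p ≤ 6)
    {φ : FormField M 3} (hφ : ∀ p, IsG2Form (φ p)) (hs : IsCnForm ∞ φ) {I : Set ℝ}
    (hI : IsOpen I) (hc : I.OrdConnected) {γ δ : ℝ → M}
    (hγ : IsNormalCurve φ I γ) (hδ : IsNormalCurve φ I δ) {t₀ : ℝ} (ht₀ : t₀ ∈ I)
    (h0 : γ t₀ = δ t₀) (h1 : vel γ t₀ = vel δ t₀) : ∀ t ∈ I, γ t = δ t := by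
  have hsub : I ⊆ {t | γ =ᶠ[nhds t] δ} := by
    refine hc.isPreconnected.subset_of_closure_inter_subset ?_
      ⟨t₀, ht₀, hM.normalCurve_eventuallyEq hM6 hφ hs hI hγ hδ ht₀ h0 h1⟩ ?_
    · rw [isOpen_iff_mem_nhds]
      intro t ht
      exact Filter.Eventually.eventually_nhds ht
    · rintro t ⟨ht, htI⟩
      have hfr := mem_closure_iff_frequently.1 ht
      have hγt := hγ.smooth.contMDiffAt (hI.mem_nhds htI)
      have hδt := hδ.smooth.contMDiffAt (hI.mem_nhds htI)
      have e0 : γ t = δ t := tendsto_nhds_unique_of_frequently_eq hγt.continuousAt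
        hδt.continuousAt (hfr.mono fun s hs => hs.self_of_nhds)
      refine hM.normalCurve_eventuallyEq hM6 hφ hs hI hγ hδ htI e0 ?_
      set e := chartAt W (γ t) with he'
      have he : e ∈ atlas W M := chart_mem_atlas W _
      have hp : γ t ∈ e.source := mem_chart_source W _
      have hmax : e ∈ IsManifold.maximalAtlas 𝓘(ℝ, W) ∞ M := IsManifold.subset_maximalAtlas he
      have hder : ∀ {γ : ℝ → M}, ContMDiffAt 𝓘(ℝ, ℝ) 𝓘(ℝ, W) ∞ γ t → γ t ∈ e.source →
          ContinuousAt (deriv fun s => e (γ s)) t := fun hγ hγs =>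
        continuousAt_deriv ((contMDiffAt_of_mem_maximalAtlas hmax hγs).comp t hγ).contDiffAt
      have e1 : deriv (fun s => e (γ s)) t = deriv (fun s => e (δ s)) t :=
        tendsto_nhds_unique_of_frequently_eq (hder hγt hp) (hder hδt (e0 ▸ hp))
          (hfr.mono fun s hs => (hs.fun_comp e).deriv_eq)
      obtain ⟨D, hD⟩ := exists_chartEquiv he (e.map_source hp)
      have h2 := mfderiv_symm_deriv he (hγt.mdifferentiableAt (by simp)) hp
      have h3 := mfderiv_symm_deriv he (hδt.mdifferentiableAt (by simp)) (e0 ▸ hp)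
      rw [← e0, ← hD] at h3
      rw [← hD] at h2
      exact h2.symm.trans ((congrArg D e1).trans h3)
  intro t ht
  exact (hsub ht).self_of_nhds

end NormalCurve

/-! ### Torus invariant `G₂`-forms -/

section NormalForm

/-- The action of `diag(i, 1, -i)` on the tangent space of the tube. -/
noncomputable def quarterOne : W →L[ℝ] W :=
  LinearMap.toContinuousLinearMap
    { toFun := fun x => WithLp.toLp 2 ![x 0, -x 2, x 1, -x 3, -x 4, -x 6, x 5]
      map_add' := by intro x y; ext i; fin_cases i <;> simp <;> ring
      map_smul' := by intro r x; ext i; fin_cases i <;> simp }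

/-- The action of `diag(i, -i, 1)` on the tangent space of the tube. -/
noncomputable def quarterTwo : W →L[ℝ] W :=
  LinearMap.toContinuousLinearMap
    { toFun := fun x => WithLp.toLp 2 ![x 0, x 2, -x 1, x 4, -x 3, -x 5, -x 6]
      map_add' := by intro x y; ext i; fin_cases i <;> simp <;> ring
      map_smul' := by intro r x; ext i; fin_cases i <;> simp }

theorem quarterOne_apply (x : W) :
    quarterOne x = WithLp.toLp 2 ![x 0, -x 2, x 1, -x 3, -x 4, -x 6, x 5] := rfl

theorem quarterTwo_apply (x : W) :
    quarterTwo x = WithLp.toLp 2 ![x 0, x 2, -x 1, x 4, -x 3, -x 5, -x 6] := rfl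

/-- The squares of the quarter rotations are sign changes. -/
def signOne : Fin 7 → ℤ := ![1, -1, -1, 1, 1, -1, -1]

/-- The squares of the quarter rotations are sign changes. -/
def signTwo : Fin 7 → ℤ := ![1, -1, -1, -1, -1, 1, 1]

theorem quarterOne_sq (i : Fin 7) :
    quarterOne (quarterOne (stdVec i)) = (signOne i : ℝ) • stdVec i := by
  ext j
  fin_cases i <;> fin_cases j <;> simp [quarterOne_apply, stdVec, signOne]

theorem quarterTwo_sq (i : Fin 7) :
    quarterTwo (quarterTwo (stdVec i)) = (signTwo i : ℝ) • stdVec i := by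
  ext j
  fin_cases i <;> fin_cases j <;> simp [quarterTwo_apply, stdVec, signTwo]

theorem quarterOne_stdVec : quarterOne (stdVec 0) = stdVec 0 ∧ quarterOne (stdVec 1) = stdVec 2 ∧
    quarterOne (stdVec 2) = -stdVec 1 ∧ quarterOne (stdVec 3) = -stdVec 3 ∧
    quarterOne (stdVec 4) = -stdVec 4 ∧ quarterOne (stdVec 5) = stdVec 6 ∧
    quarterOne (stdVec 6) = -stdVec 5 := by
  refine ⟨?_, ?_, ?_, ?_, ?_, ?_, ?_⟩ <;> ext j <;> fin_cases j <;>
    simp [quarterOne_apply, stdVec]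

theorem quarterTwo_stdVec : quarterTwo (stdVec 0) = stdVec 0 ∧ quarterTwo (stdVec 1) = -stdVec 2 ∧
    quarterTwo (stdVec 2) = stdVec 1 ∧ quarterTwo (stdVec 3) = -stdVec 4 ∧
    quarterTwo (stdVec 4) = stdVec 3 ∧ quarterTwo (stdVec 5) = -stdVec 5 ∧
    quarterTwo (stdVec 6) = -stdVec 6 := by
  refine ⟨?_, ?_, ?_, ?_, ?_, ?_, ?_⟩ <;> ext j <;> fin_cases j <;>
    simp [quarterTwo_apply, stdVec]

theorem exists_quarterEquiv : (∃ e : W ≃L[ℝ] W, (e : W →L[ℝ] W) = quarterOne) ∧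
    ∃ e : W ≃L[ℝ] W, (e : W →L[ℝ] W) = quarterTwo := by
  constructor
  · refine ⟨ContinuousLinearEquiv.equivOfInverse quarterOne
      (quarterOne.comp (quarterOne.comp quarterOne)) (fun x => ?_) fun x => ?_, rfl⟩ <;>
    · ext j
      fin_cases j <;> simp [quarterOne_apply]
  · refine ⟨ContinuousLinearEquiv.equivOfInverse quarterTwo
      (quarterTwo.comp (quarterTwo.comp quarterTwo)) (fun x => ?_) fun x => ?_, rfl⟩ <;>
    · ext j
      fin_cases j <;> simp [quarterTwo_apply]

/-- A form is determined by its values on increasing sequences of basis vectors. -/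
theorem form_ext_stdVec {k : ℕ} {φ ψ : W [⋀^Fin k]→L[ℝ] ℝ}
    (h : ∀ v : Fin k → Fin 7, StrictMono v → (φ fun i => stdVec (v i)) = ψ fun i => stdVec (v i)) :
    φ = ψ := by
  apply ContinuousAlternatingMap.toAlternatingMap_injective
  refine (EuclideanSpace.basisFun (Fin 7) ℝ).toBasis.ext_alternating fun v hv => ?_
  have e : ∀ i, (EuclideanSpace.basisFun (Fin 7) ℝ).toBasis i = stdVec i := by
    intro i; simp [stdVec]
  simp only [e]
  set σ := Tuple.sort v with hσ
  have hm : StrictMono (v ∘ σ) :=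
    (Tuple.monotone_sort v).strictMono_of_injective (hv.comp σ.injective)
  have h1 := h _ hm
  have h2 := φ.toAlternatingMap.map_perm (fun i => stdVec (v i)) σ
  have h3 := ψ.toAlternatingMap.map_perm (fun i => stdVec (v i)) σ
  have h4 : φ.toAlternatingMap ((fun i => stdVec (v i)) ∘ σ)
      = ψ.toAlternatingMap ((fun i => stdVec (v i)) ∘ σ) := h1
  rw [h2, h3] at h4
  exact smul_left_cancel _ h4

variable {ψ : W [⋀^Fin 3]→L[ℝ] ℝ}

theorem form_swap (i j k : Fin 7) :
    ψ ![stdVec i, stdVec j, stdVec k] = -ψ ![stdVec j, stdVec i, stdVec k] := by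
  have := ψ.map_swap ![stdVec j, stdVec i, stdVec k] (i := 0) (j := 1) (by decide)
  have e : (![stdVec j, stdVec i, stdVec k] ∘ Equiv.swap (0 : Fin 3) 1)
      = ![stdVec i, stdVec j, stdVec k] := by
    ext k; fin_cases k <;> rfl
  rwa [e] at this

/-- Invariance under `A` implies invariance under `A²`, which multiplies the component by the
product of three signs. -/
theorem form_sign {A : W →L[ℝ] W} {s : Fin 7 → ℤ}
    (hA : ∀ i, A (A (stdVec i)) = (s i : ℝ) • stdVec i)
    (h : ψ.compContinuousLinearMap A = ψ) {i j k : Fin 7} (hs : s i * s j * s k = -1) :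
    ψ ![stdVec i, stdVec j, stdVec k] = 0 := by
  have h1 : ψ ![stdVec i, stdVec j, stdVec k]
      = ψ ![A (A (stdVec i)), A (A (stdVec j)), A (A (stdVec k))] := by
    conv_lhs => rw [← h, ← h]
    simp only [ContinuousAlternatingMap.compContinuousLinearMap_apply, comp_three]
  rw [hA, hA, hA] at h1
  have h2 := ψ.toMultilinearMap.map_smul_univ ![(s i : ℝ), s j, s k]
    ![stdVec i, stdVec j, stdVec k]
  have e : (fun l => (![(s i : ℝ), s j, s k] : Fin 3 → ℝ) l •
      (![stdVec i, stdVec j, stdVec k] : Fin 3 → W) l)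
      = ![(s i : ℝ) • stdVec i, (s j : ℝ) • stdVec j, (s k : ℝ) • stdVec k] := by
    funext l; fin_cases l <;> rfl
  rw [e, Fin.prod_univ_three] at h2
  have h3 : (s i : ℝ) * s j * s k = -1 := by exact_mod_cast hs
  have h4 : ψ ![(s i : ℝ) • stdVec i, (s j : ℝ) • stdVec j, (s k : ℝ) • stdVec k]
      = ((s i : ℝ) * s j * s k) • ψ ![stdVec i, stdVec j, stdVec k] := h2
  rw [h4, h3, neg_one_smul] at h1
  linarith

variable (h₁ : ψ.compContinuousLinearMap quarterOne = ψ)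
  (h₂ : ψ.compContinuousLinearMap quarterTwo = ψ)

include h₁ h₂

/-- The components of an invariant form of type `(1, 1, 1)`. -/
theorem form_components :
    ψ ![stdVec 2, stdVec 3, stdVec 5] = -ψ ![stdVec 2, stdVec 4, stdVec 6] ∧
    ψ ![stdVec 1, stdVec 4, stdVec 5] = -ψ ![stdVec 2, stdVec 4, stdVec 6] ∧
    ψ ![stdVec 1, stdVec 3, stdVec 6] = -ψ ![stdVec 2, stdVec 4, stdVec 6] ∧
    ψ ![stdVec 1, stdVec 4, stdVec 6] = -ψ ![stdVec 1, stdVec 3, stdVec 5] ∧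
    ψ ![stdVec 2, stdVec 3, stdVec 6] = -ψ ![stdVec 1, stdVec 3, stdVec 5] ∧
    ψ ![stdVec 2, stdVec 4, stdVec 5] = -ψ ![stdVec 1, stdVec 3, stdVec 5] := by
  have neg0 : ∀ x y z, ψ ![-x, y, z] = -ψ ![x, y, z] := fun x y z => by
    have h := ψ.toMultilinearMap.map_update_neg ![x, y, z] 0 x
    rwa [show Function.update ![x, y, z] 0 (-x) = ![-x, y, z] from by
        ext k; fin_cases k <;> rfl, show Function.update ![x, y, z] 0 x = ![x, y, z] from by
        ext k; fin_cases k <;> rfl] at h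
  have neg1 : ∀ x y z, ψ ![x, -y, z] = -ψ ![x, y, z] := fun x y z => by
    have h := ψ.toMultilinearMap.map_update_neg ![x, y, z] 1 y
    rwa [show Function.update ![x, y, z] 1 (-y) = ![x, -y, z] from by
        ext k; fin_cases k <;> rfl, show Function.update ![x, y, z] 1 y = ![x, y, z] from by
        ext k; fin_cases k <;> rfl] at h
  have neg2 : ∀ x y z, ψ ![x, y, -z] = -ψ ![x, y, z] := fun x y z => by
    have h := ψ.toMultilinearMap.map_update_neg ![x, y, z] 2 z
    rwa [show Function.update ![x, y, z] 2 (-z) = ![x, y, -z] from by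
        ext k; fin_cases k <;> rfl, show Function.update ![x, y, z] 2 z = ![x, y, z] from by
        ext k; fin_cases k <;> rfl] at h
  have k1 : ∀ x y z, ψ ![x, y, z] = ψ ![quarterOne x, quarterOne y, quarterOne z] := fun x y z => by
    conv_lhs => rw [← h₁, ContinuousAlternatingMap.compContinuousLinearMap_apply, comp_three]
  have k2 : ∀ x y z, ψ ![x, y, z] = ψ ![quarterTwo x, quarterTwo y, quarterTwo z] := fun x y z => by
    conv_lhs => rw [← h₂, ContinuousAlternatingMap.compContinuousLinearMap_apply, comp_three]
  obtain ⟨a0, a1, a2, a3, a4, a5, a6⟩ := quarterOne_stdVec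
  obtain ⟨b0, b1, b2, b3, b4, b5, b6⟩ := quarterTwo_stdVec
  have e1 := k1 (stdVec 2) (stdVec 3) (stdVec 5)
  have e2 := k1 (stdVec 1) (stdVec 4) (stdVec 5)
  have e3 := k1 (stdVec 1) (stdVec 3) (stdVec 6)
  have e4 := k1 (stdVec 1) (stdVec 4) (stdVec 6)
  have e5 := k1 (stdVec 2) (stdVec 3) (stdVec 6)
  have e6 := k2 (stdVec 1) (stdVec 3) (stdVec 6)
  have e7 := k2 (stdVec 2) (stdVec 4) (stdVec 5)
  simp only [a1, a2, a3, a4, a5, a6, b1, b2, b3, b4, b5, b6, neg0, neg1, neg2, neg_neg]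
    at e1 e2 e3 e4 e5 e6 e7
  refine ⟨?_, ?_, ?_, ?_, ?_, ?_⟩ <;> linarith

/-- The two sign changes annihilate all but eleven of the components with increasing indices: three
containing `0`, and the eight with one index from each plane. The eight are `±p` or `±q` by
`form_components`. -/
theorem form_eq_zero_of_invariant (z₁ : ψ ![stdVec 0, stdVec 1, stdVec 2] = 0)
    (z₂ : ψ ![stdVec 0, stdVec 3, stdVec 4] = 0) (z₃ : ψ ![stdVec 0, stdVec 5, stdVec 6] = 0)
    (zp : ψ ![stdVec 2, stdVec 4, stdVec 6] = 0) (zq : ψ ![stdVec 1, stdVec 3, stdVec 5] = 0) :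
    ψ = 0 := by
  obtain ⟨c1, c2, c3, c4, c5, c6⟩ := form_components h₁ h₂
  rw [zp, neg_zero] at c1 c2 c3
  rw [zq, neg_zero] at c4 c5 c6
  have hcase : ∀ i j k : Fin 7, i < j → j < k → signOne i * signOne j * signOne k = -1 ∨
      signTwo i * signTwo j * signTwo k = -1 ∨ (i, j, k) ∈ [((0 : Fin 7), (1 : Fin 7), (2 : Fin 7)),
        (0, 3, 4), (0, 5, 6), (2, 4, 6), (1, 3, 5), (2, 3, 5), (1, 4, 5), (1, 3, 6), (1, 4, 6),
        (2, 3, 6), (2, 4, 5)] := by decide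
  apply form_ext_stdVec
  intro v hv
  have e : (fun i => stdVec (v i)) = ![stdVec (v 0), stdVec (v 1), stdVec (v 2)] := by
    funext l; fin_cases l <;> rfl
  rw [e]
  change _ = (0 : ℝ)
  rcases hcase (v 0) (v 1) (v 2) (hv (by decide)) (hv (by decide)) with h | h | h
  · exact form_sign quarterOne_sq h₁ h
  · exact form_sign quarterTwo_sq h₂ h
  · simp only [List.mem_cons, List.not_mem_nil, or_false, Prod.mk.injEq] at h
    rcases h with h | h | h | h | h | h | h | h | h | h | h <;> rw [h.1, h.2.1, h.2.2] <;>
      assumption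

/-- Invariant orthonormality: the planes of the torus action are orthogonal, and the torus acts by
rotations. -/
theorem IsAdapted.invariant_metric {b : W ≃L[ℝ] W} {θ : ℝ} (h : IsAdapted ψ b θ) :
    (∀ i j, i ≠ j → inner ℝ (b (stdVec i)) (b (stdVec j)) = 0) ∧
    inner ℝ (b (stdVec 1)) (b (stdVec 1)) = inner ℝ (b (stdVec 2)) (b (stdVec 2)) ∧
    inner ℝ (b (stdVec 3)) (b (stdVec 3)) = inner ℝ (b (stdVec 4)) (b (stdVec 4)) ∧
    inner ℝ (b (stdVec 5)) (b (stdVec 5)) = inner ℝ (b (stdVec 6)) (b (stdVec 6)) := by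
  obtain ⟨⟨e₁, he₁⟩, e₂, he₂⟩ := exists_quarterEquiv
  have k1 : ∀ x y, inner ℝ (b x) (b y) = inner ℝ (b (quarterOne x)) (b (quarterOne y)) := by
    intro x y
    have := g2Metric_comp ⟨b, θ, h⟩ e₁ x y
    rw [he₁, h₁, h.g2Metric_eq, h.g2Metric_eq] at this
    rw [← he₁]; exact this
  have k2 : ∀ x y, inner ℝ (b x) (b y) = inner ℝ (b (quarterTwo x)) (b (quarterTwo y)) := by
    intro x y
    have := g2Metric_comp ⟨b, θ, h⟩ e₂ x y
    rw [he₂, h₂, h.g2Metric_eq, h.g2Metric_eq] at this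
    rw [← he₂]; exact this
  obtain ⟨a0, a1, a2, a3, a4, a5, a6⟩ := quarterOne_stdVec
  obtain ⟨b0, b1, b2, b3, b4, b5, b6⟩ := quarterTwo_stdVec
  have s1 : ∀ i j, signOne i * signOne j = -1 → inner ℝ (b (stdVec i)) (b (stdVec j)) = 0 := by
    intro i j hs
    have h3 := (k1 (stdVec i) (stdVec j)).trans (k1 _ _)
    rw [quarterOne_sq, quarterOne_sq, map_smul, map_smul, inner_smul_left, inner_smul_right,
      ← mul_assoc] at h3
    have h4 : (signOne i : ℝ) * signOne j = -1 := by exact_mod_cast hs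
    simp only [conj_trivial, h4] at h3
    linarith
  have s2 : ∀ i j, signTwo i * signTwo j = -1 → inner ℝ (b (stdVec i)) (b (stdVec j)) = 0 := by
    intro i j hs
    have h3 := (k2 (stdVec i) (stdVec j)).trans (k2 _ _)
    rw [quarterTwo_sq, quarterTwo_sq, map_smul, map_smul, inner_smul_left, inner_smul_right,
      ← mul_assoc] at h3
    have h4 : (signTwo i : ℝ) * signTwo j = -1 := by exact_mod_cast hs
    simp only [conj_trivial, h4] at h3
    linarith
  -- The quarter turn sends `(e₁, e₂)` to `(e₂, -e₁)`, so the inner product equals its negative. The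
  -- other planes are similar.
  have o12 : inner ℝ (b (stdVec 1)) (b (stdVec 2)) = 0 := by
    have := k1 (stdVec 1) (stdVec 2)
    rw [a1, a2, map_neg, inner_neg_right, real_inner_comm] at this
    rw [real_inner_comm]; linarith
  have o34 : inner ℝ (b (stdVec 3)) (b (stdVec 4)) = 0 := by
    have := k2 (stdVec 3) (stdVec 4)
    rw [b3, b4, map_neg, inner_neg_left, real_inner_comm] at this
    rw [real_inner_comm]; linarith
  have o56 : inner ℝ (b (stdVec 5)) (b (stdVec 6)) = 0 := by
    have := k1 (stdVec 5) (stdVec 6)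
    rw [a5, a6, map_neg, inner_neg_right, real_inner_comm] at this
    rw [real_inner_comm]; linarith
  refine ⟨fun i j hij => ?_, ?_, ?_, ?_⟩
  · have hcase : ∀ i j : Fin 7, i ≠ j → signOne i * signOne j = -1 ∨ signTwo i * signTwo j = -1 ∨
        (i, j) ∈ [((1 : Fin 7), (2 : Fin 7)), (2, 1), (3, 4), (4, 3), (5, 6), (6, 5)] := by decide
    rcases hcase i j hij with h | h | h
    · exact s1 i j h
    · exact s2 i j h
    · simp only [List.mem_cons, List.not_mem_nil, or_false, Prod.mk.injEq] at h
      rcases h with h | h | h | h | h | h <;> rw [h.1, h.2] <;>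
        first | assumption | (rw [real_inner_comm]; assumption)
  · have := k1 (stdVec 1) (stdVec 1)
    rwa [a1] at this
  · have := k2 (stdVec 4) (stdVec 4)
    rw [b4] at this
    exact this.symm
  · have := k1 (stdVec 5) (stdVec 5)
    rwa [a5] at this

omit h₁ h₂ in
theorem inner_eq_sum_of_orthogonal (b : W ≃L[ℝ] W)
    (ho : ∀ i j, i ≠ j → inner ℝ (b (stdVec i)) (b (stdVec j)) = 0) (z w : W) :
    inner ℝ z w = ∑ i, inner ℝ z (b (stdVec i)) * inner ℝ w (b (stdVec i))
      / inner ℝ (b (stdVec i)) (b (stdVec i)) := by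
  have hpos : ∀ i, inner ℝ (b (stdVec i)) (b (stdVec i)) ≠ 0 := by
    intro i h0
    have h1 : b (stdVec i) = 0 := inner_self_eq_zero.1 h0
    have h2 : stdVec i = 0 := b.injective (by rw [h1, map_zero])
    have h3 := congrArg (fun v : W => v i) h2
    simp [stdVec] at h3
  obtain ⟨x, rfl⟩ := b.surjective z
  have hx : ∀ i, inner ℝ (b x) (b (stdVec i)) = x i * inner ℝ (b (stdVec i)) (b (stdVec i)) := by
    intro i
    conv_lhs => rw [← sum_smul_stdVec x]
    rw [map_sum, sum_inner, Finset.sum_eq_single i]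
    · rw [map_smul, inner_smul_left]; rfl
    · intro j _ hj
      rw [map_smul, inner_smul_left, ho j i hj, mul_zero]
    · simp
  conv_lhs => rw [← sum_smul_stdVec x, map_sum, sum_inner]
  refine Finset.sum_congr rfl fun i _ => ?_
  rw [hx, map_smul, inner_smul_left, real_inner_comm]
  have := hpos i
  field_simp
  exact mul_comm _ _

/-- The normal form of a torus invariant `G₂`-form. -/
theorem IsAdapted.normalForm {b : W ≃L[ℝ] W} {θ : ℝ} (h : IsAdapted ψ b θ)
    (hn : inner ℝ (b (stdVec 0)) (b (stdVec 0)) = 1) :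
    0 < ψ ![stdVec 0, stdVec 1, stdVec 2] * ψ ![stdVec 0, stdVec 3, stdVec 4] ∧
    0 < ψ ![stdVec 0, stdVec 1, stdVec 2] * ψ ![stdVec 0, stdVec 5, stdVec 6] ∧
    (ψ ![stdVec 2, stdVec 4, stdVec 6] ^ 2 + ψ ![stdVec 1, stdVec 3, stdVec 5] ^ 2) ^ 2 =
      (ψ ![stdVec 0, stdVec 1, stdVec 2] * ψ ![stdVec 0, stdVec 3, stdVec 4] *
        ψ ![stdVec 0, stdVec 5, stdVec 6]) ^ 2 := by
  obtain ⟨ho, n1, n2, n3⟩ := h.invariant_metric h₁ h₂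
  obtain ⟨c1, c2, c3, c4, c5, c6⟩ := form_components h₁ h₂
  have hpos : ∀ i, 0 < inner ℝ (b (stdVec i)) (b (stdVec i)) := by
    intro i
    refine real_inner_self_pos.2 fun h1 => ?_
    have h2 : stdVec i = 0 := b.injective (by rw [h1, map_zero])
    have h3 := congrArg (fun v : W => v i) h2
    simp [stdVec] at h3
  set C : Fin 7 → Fin 7 → Fin 7 → ℝ := fun i j k => ψ ![stdVec i, stdVec j, stdVec k] with hC
  have hCdef : ∀ i j k, ψ ![stdVec i, stdVec j, stdVec k] = C i j k := fun _ _ _ => rfl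
  have sw : ∀ i j k, C i j k = -C j i k := fun i j k => form_swap i j k
  have sw' : ∀ i j k, C i j k = -C i k j := fun i j k => threeForm_swap ψ _ _ _
  have zz : ∀ i j, C i j j = 0 := fun i j => by have := sw' i j j; linarith
  have zz2 : ∀ i j, C i i j = 0 := fun i j => by have := sw i i j; linarith
  have zz' : ∀ i j, C i j i = 0 := fun i j => by rw [sw', zz2, neg_zero]
  have z1 : ∀ i j k, signOne i * signOne j * signOne k = -1 → C i j k = 0 := fun i j k hs =>
    form_sign quarterOne_sq h₁ hs
  have z2 : ∀ i j k, signTwo i * signTwo j * signTwo k = -1 → C i j k = 0 := fun i j k hs =>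
    form_sign quarterTwo_sq h₂ hs
  have hcross : ∀ i j k, inner ℝ (cross θ (b (stdVec i)) (b (stdVec j))) (b (stdVec k)) = C i j k := by
    intro i j k
    rw [← phiForm_apply, ← hCdef, h, ContinuousAlternatingMap.compContinuousLinearMap_apply,
      comp_three]
    rfl
  set G : Fin 7 → ℝ := fun i => inner ℝ (b (stdVec i)) (b (stdVec i)) with hG
  have hpars : ∀ i j k l, inner ℝ (cross θ (b (stdVec i)) (b (stdVec j)))
      (cross θ (b (stdVec k)) (b (stdVec l))) = ∑ m, C i j m * C k l m / G m := by
    intro i j k l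
    rw [inner_eq_sum_of_orthogonal b ho]
    simp only [hcross, hG]
  set S : Fin 7 → Fin 7 → Fin 7 → Fin 7 → ℝ := fun i j k l => starPhiForm stdCoframe θ
    ![b (stdVec i), b (stdVec j), b (stdVec k), b (stdVec l)] with hS
  -- The cross product identity with its left side expanded in the orthogonal basis `b(eₘ)`.
  -- Together with the vanishing components `C`, it turns the `G₂` condition into algebra in `C`,
  -- the squared lengths `G` and the values `S` of the four-form.
  have hcc : ∀ i j k l, ∑ m, C i j m * C k l m / G m =
      inner ℝ (b (stdVec i)) (b (stdVec k)) * inner ℝ (b (stdVec j)) (b (stdVec l)) -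
        inner ℝ (b (stdVec i)) (b (stdVec l)) * inner ℝ (b (stdVec j)) (b (stdVec k)) + S i j k l :=
    fun i j k l => (hpars i j k l).symm.trans
      (inner_cross_cross θ (b (stdVec i)) (b (stdVec j)) (b (stdVec k)) (b (stdVec l)))
  have hS0 : ∀ i j, S i j i j = 0 := fun i j =>
    (starPhiForm stdCoframe θ).map_eq_zero_of_eq _ (i := 0) (j := 2) rfl (by decide)
  -- A cyclic permutation of three arguments is even.
  have hS1 : ∀ i j k l, S i j k l = S i k l j := by
    intro i j k l
    have e := (starPhiForm stdCoframe θ).toAlternatingMap.map_perm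
      ![b (stdVec i), b (stdVec j), b (stdVec k), b (stdVec l)]
      (Equiv.swap (1 : Fin 4) 2 * Equiv.swap 2 3)
    rw [show (![b (stdVec i), b (stdVec j), b (stdVec k), b (stdVec l)] ∘
        ⇑(Equiv.swap (1 : Fin 4) 2 * Equiv.swap 2 3 : Equiv.Perm (Fin 4))) =
        ![b (stdVec i), b (stdVec k), b (stdVec l), b (stdVec j)] from by
      funext m; fin_cases m <;> rfl] at e
    rw [show Equiv.Perm.sign (Equiv.swap (1 : Fin 4) 2 * Equiv.swap 2 3) = 1 from by decide,
      one_smul] at e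
    exact e.symm
  -- For the pairs used below the cross product of `b(eᵢ)` and `b(eⱼ)` is a multiple of a single
  -- basis vector, so the sum has one term.
  have single : ∀ i j m₀ : Fin 7, (∀ m, m ≠ m₀ → m = i ∨ m = j ∨
      signOne i * signOne j * signOne m = -1 ∨ signTwo i * signTwo j * signTwo m = -1) →
      ∀ k l, inner ℝ (b (stdVec i)) (b (stdVec k)) * inner ℝ (b (stdVec j)) (b (stdVec l)) -
        inner ℝ (b (stdVec i)) (b (stdVec l)) * inner ℝ (b (stdVec j)) (b (stdVec k)) + S i j k l
        = C i j m₀ * C k l m₀ / G m₀ := by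
    intro i j m₀ hm k l
    rw [← hcc, Finset.sum_eq_single m₀]
    · intro m _ hmm
      have : C i j m = 0 := by
        rcases hm m hmm with rfl | rfl | h | h
        · exact zz' _ _
        · exact zz _ _
        · exact z1 _ _ _ h
        · exact z2 _ _ _ h
      rw [this, zero_mul, zero_div]
    · simp
  have t01 := single 0 1 2 (by decide)
  have t03 := single 0 3 4 (by decide)
  have t05 := single 0 5 6 (by decide)
  have t06 := single 0 6 5 (by decide)
  have e1 := t01 0 1
  have e2 := t03 0 3
  have e3 := t05 0 5
  have e4 := hcc 1 3 1 3
  have e5 := t01 3 5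
  have e6 := t03 5 1
  have e7 := t05 1 3
  have e8 := t01 3 6
  have e9 := t03 6 1
  have e10 := t06 1 3
  -- The same value of the four-form is computed in three ways, from the pairs `01`, `03` and `05`.
  -- This links the signs of the three coefficients.
  rw [← hS1 0 1 3 5] at e6
  rw [hS1 0 5 1 3] at e7
  rw [← hS1 0 1 3 6] at e9
  rw [hS1 0 6 1 3] at e10
  have hGi : ∀ i, inner ℝ (b (stdVec i)) (b (stdVec i)) = G i := fun _ => rfl
  rw [Fin.sum_univ_seven, z1 1 3 0 (by decide), zz', z2 1 3 2 (by decide), zz, z2 1 3 4 (by decide)]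
    at e4
  simp only [hS0, hGi, ho 0 1 (by decide), ho 1 0 (by decide), ho 0 3 (by decide),
    ho 3 0 (by decide), ho 0 5 (by decide), ho 5 0 (by decide), ho 0 6 (by decide),
    ho 1 3 (by decide), ho 3 1 (by decide)] at e1 e2 e3 e4 e5 e6 e7 e8 e9 e10
  simp only [hGi] at n1 n2 n3 hn hpos
  simp only [hCdef] at c1 c2 c3 c4 c5 c6 ⊢
  have p1 : C 3 5 2 = -C 2 4 6 := by linarith [sw' 3 5 2, sw 3 2 5]
  have p2 : C 5 1 4 = -C 2 4 6 := by linarith [sw 5 1 4, sw' 1 5 4]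
  have p3 : C 3 6 2 = -C 1 3 5 := by linarith [sw' 3 6 2, sw 3 2 6]
  have p4 : C 6 1 4 = -C 1 3 5 := by linarith [sw 6 1 4, sw' 1 6 4]
  have p5 : C 0 6 5 = -C 0 5 6 := sw' _ _ _
  rw [p1] at e5
  rw [p2] at e6
  rw [c3] at e7 e4
  rw [p3] at e8
  rw [p4] at e9
  rw [p5] at e10
  rw [hn, ← n1] at e1
  rw [hn, ← n2] at e2
  rw [hn, ← n3] at e3
  rw [← n3] at e4 e7
  rw [← n1] at e5 e8
  rw [← n2] at e6 e9
  clear_value S C G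
  have g1 := hpos 1
  have g3 := hpos 3
  have g5 := hpos 5
  generalize C 0 1 2 = A₁ at *
  generalize C 0 3 4 = A₂ at *
  generalize C 0 5 6 = A₃ at *
  generalize C 2 4 6 = p at *
  generalize C 1 3 5 = q at *
  generalize G 1 = x at *
  generalize G 3 = y at *
  generalize G 5 = z at *
  have hA₁ : A₁ ^ 2 = x ^ 2 := by field_simp at e1; linarith
  have hA₂ : A₂ ^ 2 = y ^ 2 := by field_simp at e2; linarith
  have hA₃ : A₃ ^ 2 = z ^ 2 := by field_simp at e3; linarith
  have hpq : p ^ 2 + q ^ 2 = x * y * z := by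
    have h0 : (0 : ℝ) < G 0 := hpos 0
    simp only [mul_zero, zero_div, zero_add, add_zero, sub_zero] at e4
    field_simp at e4
    linarith
  generalize S 0 1 3 5 = s at *
  generalize S 0 1 3 6 = u at *
  have e5' : x * s = -(A₁ * p) := by field_simp at e5; linarith
  have e6' : y * s = -(A₂ * p) := by field_simp at e6; linarith
  have e7' : z * s = -(A₃ * p) := by field_simp at e7; linarith
  have e8' : x * u = -(A₁ * q) := by field_simp at e8; linarith
  have e9' : y * u = -(A₂ * q) := by field_simp at e9; linarith
  have e10' : z * u = -(A₃ * q) := by field_simp at e10; linarith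
  have hpqpos : 0 < p ^ 2 + q ^ 2 := by rw [hpq]; positivity
  -- The numbers `s` and `u` are `-p` and `-q` times the ratio of coefficient and squared length,
  -- for each plane. As `(p, q) ≠ 0`, the ratios coincide and the coefficients have one sign.
  have key : ∀ {B w : ℝ}, 0 < w → B ^ 2 = w ^ 2 → w * s = -(B * p) → w * u = -(B * q) →
      0 < A₁ * B := by
    intro B w hw hB h5 h6
    have h7 : A₁ * B * (p ^ 2 + q ^ 2) = x * w * (s ^ 2 + u ^ 2) := by
      linear_combination (B * p) * e5' - (x * s) * h5 + (B * q) * e8' - (x * u) * h6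
    have h8 : 0 ≤ A₁ * B := by
      by_contra hc
      have := mul_neg_of_neg_of_pos (not_le.1 hc) hpqpos
      rw [h7] at this
      exact absurd this (not_lt.2 (by positivity))
    refine lt_of_le_of_ne h8 fun h9 => ?_
    have h10 : (A₁ * B) ^ 2 = (x * w) ^ 2 := by rw [mul_pow, mul_pow, hA₁, hB]
    rw [← h9] at h10
    have : 0 < (x * w) ^ 2 := by positivity
    linarith [h10, this, zero_pow (M₀ := ℝ) two_ne_zero]
  refine ⟨key g3 hA₂ e6' e9', key g5 hA₃ e7' e10', ?_⟩
  rw [hpq, mul_pow, mul_pow, mul_pow, mul_pow, hA₁, hA₂, hA₃]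

end NormalForm

/-! ### Isotropy groups along normal curves -/

section Isotropy

variable {M : Type*} [TopologicalSpace M] [ChartedSpace W M] [MulAction SU3 M]
  (hM : IsSmoothAction M)

include hM

/-- The velocity of a one-parameter orbit at time `s` is the image under the group element `exp(s
c)` of its velocity at time zero. -/
theorem IsSmoothAction.hasMFDerivAt_suExp_smul {p : M} {c : LieSU3} (h : fund p c = 0) (s : ℝ) :
    HasMFDerivAt 𝓘(ℝ, ℝ) 𝓘(ℝ, W) (fun r : ℝ => suExp (r • c) • p) s (0 : ℝ →L[ℝ] W) := by
  have h0 : (s - s) • c = 0 := by rw [sub_self, zero_smul]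
  have hm : HasFDerivAt (fun r : ℝ => (r - s) • c)
      ((ContinuousLinearMap.id ℝ ℝ).smulRight c) s :=
    ((hasFDerivAt_id s).sub_const s).smul_const c
  have he : HasMFDerivAt 𝓘(ℝ, LieSU3) 𝓘(ℝ, W) (fun c : LieSU3 => suExp c • p) ((s - s) • c)
      (fund p) := by rw [h0]; exact hM.hasMFDerivAt_exp p
  have hg : HasMFDerivAt 𝓘(ℝ, W) 𝓘(ℝ, W) (fun q : M => suExp (s • c) • q)
      (suExp ((s - s) • c) • p) (push (suExp (s • c)) p) := by
    rw [h0, suExp_zero, one_smul]; exact hM.hasMFDerivAt _ p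
  have h' := hg.comp s (he.comp s hm.hasMFDerivAt)
  have heq : (fun q : M => suExp (s • c) • q) ∘ (fun c : LieSU3 => suExp c • p) ∘
      (fun r : ℝ => (r - s) • c) = fun r : ℝ => suExp (r • c) • p := by
    funext r
    simp only [Function.comp_apply]
    rw [← mul_smul, ← suExp_add_smul, add_sub_cancel]
  rw [heq] at h'
  have key : ∀ r : ℝ, push (suExp (s • c)) p (fund p (r • c)) = 0 := by
    intro r
    rw [map_smul, h, smul_zero, map_zero]
  exact h'.congr_mfderiv (ContinuousLinearMap.ext key)

variable [IsManifold 𝓘(ℝ, W) ∞ M]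

/-- The zeros of a fundamental vector field are fixed by the one-parameter group. -/
theorem IsSmoothAction.suExp_smul_of_fund_eq_zero {p : M} {c : LieSU3} (h : fund p c = 0) (s : ℝ) :
    suExp (s • c) • p = p := by
  -- The derivative vanishes at all times, so the curve is constant in charts, and `ℝ` is connected.
  have hloc : IsLocallyConstant fun r : ℝ => suExp (r • c) • p := by
    rw [IsLocallyConstant.iff_eventually_eq]
    intro s
    set q := suExp (s • c) • p with hq
    set e := chartAt W q with he'
    have hmax : e ∈ IsManifold.maximalAtlas 𝓘(ℝ, W) ∞ M :=
      IsManifold.subset_maximalAtlas (chart_mem_atlas W q)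
    have hsrc : ∀ᶠ r in nhds s, suExp (r • c) • p ∈ e.source :=
      (hM.hasMFDerivAt_suExp_smul h s).continuousAt.eventually
        (e.open_source.eventually_mem (mem_chart_source W q))
    obtain ⟨ε, hε, hball⟩ := Metric.mem_nhds_iff.1 hsrc
    have hder : ∀ r ∈ Metric.ball s ε,
        HasFDerivAt (fun r : ℝ => e (suExp (r • c) • p)) (0 : ℝ →L[ℝ] W) r := by
      intro r hr
      have h1 := ((contMDiffAt_of_mem_maximalAtlas hmax (hball hr)).mdifferentiableAt
        (by simp)).hasMFDerivAt.comp r (hM.hasMFDerivAt_suExp_smul h r)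
      have key : ∀ x : ℝ, (mfderiv 𝓘(ℝ, W) 𝓘(ℝ, W) e (suExp (r • c) • p) : W →L[ℝ] W)
          ((0 : ℝ →L[ℝ] W) x) = 0 := fun x => map_zero _
      have h2 : HasMFDerivAt 𝓘(ℝ, ℝ) 𝓘(ℝ, W) (fun r : ℝ => e (suExp (r • c) • p)) r
          (0 : ℝ →L[ℝ] W) := h1.congr_mfderiv (ContinuousLinearMap.ext key)
      exact h2.hasFDerivAt
    filter_upwards [Metric.ball_mem_nhds s hε] with r hr
    refine e.injOn (hball hr) (mem_chart_source W q) ?_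
    exact (convex_ball s ε).is_const_of_fderivWithin_eq_zero (𝕜 := ℝ)
      (fun x hx => (hder x hx).differentiableAt.differentiableWithinAt)
      (fun x hx => by
        rw [fderivWithin_of_isOpen Metric.isOpen_ball hx]
        exact (hder x hx).fderiv) hr (Metric.mem_ball_self hε)
  have h1 := hloc.apply_eq_of_preconnectedSpace s 0
  simpa [suExp_zero] using h1

/-- The isotropy algebra of a point of a normal curve fixes the curve. -/
theorem IsSmoothAction.suExp_smul_normalCurve [T2Space M] (hM6 : ∀ p : M, orbitDim p ≤ 6)
    {φ : FormField M 3} (hφ : ∀ p, IsG2Form (φ p)) (hs : IsCnForm ∞ φ) (hinv : IsInvariantForm φ)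
    {I : Set ℝ} (hI : IsOpen I) (hc : I.OrdConnected) {γ : ℝ → M} (hγ : IsNormalCurve φ I γ)
    {t₀ : ℝ} (ht₀ : t₀ ∈ I) {c : LieSU3} (h : fund (γ t₀) c = 0) :
    ∀ t ∈ I, suExp c • γ t = γ t := by
  -- A square root of `exp c` in the isotropy group. It maps the unit normal to plus or minus
  -- itself, so its square fixes the velocity of `γ`; uniqueness of normal curves does the rest.
  set k := suExp ((1 / 2 : ℝ) • c) with hk
  have hkk : suExp c = k * k := by
    rw [hk, ← suExp_add_smul]; norm_num
  have hkp : k • γ t₀ = γ t₀ := hM.suExp_smul_of_fund_eq_zero h _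
  have hu := ((isNormalCurve_iff.1 hγ).2 t₀ ht₀).2
  have hpush : push (suExp c) (γ t₀) (vel γ t₀) = vel γ t₀ := by
    have h1 := hM.isUnitNormal_push hφ hinv k hu
    rw [hkp] at h1
    rw [hkk, hM.push_mul, hkp, ContinuousLinearMap.comp_apply]
    rcases hu.eq_or_eq_neg hφ (hγ.regular t₀ ht₀) h1 with h2 | h2
    · rw [h2, h2]
    · rw [h2, map_neg, h2, neg_neg]
  have hd := (hγ.smooth.contMDiffAt (hI.mem_nhds ht₀)).mdifferentiableAt (by simp)
  refine fun t ht => (hM.normalCurve_eqOn hM6 hφ hs hI hc hγ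
    (hM.isNormalCurve_smul hφ hinv hI hγ (suExp c)) ht₀ ?_ ?_ t ht).symm
  · rw [hkk, mul_smul, hkp, hkp]
  · rw [hM.vel_smul _ hd, hpush]

-- The kernel of the infinitesimal action is preserved by `Ad` of the isotropy group.
-- Differentiating along `exp(s c)` shows that it is a subalgebra.
omit [IsManifold 𝓘(ℝ, W) ∞ M] in
theorem IsSmoothAction.fund_lie_eq_zero {p : M} {c d : LieSU3}
    (hc : ∀ s : ℝ, suExp (s • c) • p = p) (hd : fund p d = 0) : fund p (lie c d) = 0 := by
  have h1 := (fund p).hasFDerivAt.comp_hasDerivAt (0 : ℝ) (hasDerivAt_Ad_suExp c d)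
  have h2 : (fund p) ∘ (fun s : ℝ => Ad (suExp (s • c)) d) = fun _ => 0 := by
    funext s
    have := hM.push_fund (suExp (s • c)) p d
    rw [hc, hd, map_zero] at this
    exact this.symm
  rw [h2] at h1
  exact h1.unique (hasDerivAt_const _ _)

/-- A translate of a normal curve is fixed by the diagonal torus. -/
theorem IsSmoothAction.exists_torus_fixed [T2Space M] (hM6 : ∀ p : M, orbitDim p ≤ 6)
    {φ : FormField M 3} (hφ : ∀ p, IsG2Form (φ p)) (hs : IsCnForm ∞ φ) (hinv : IsInvariantForm φ)
    {I : Set ℝ} (hI : IsOpen I) (hc : I.OrdConnected) {γ : ℝ → M} (hγ : IsNormalCurve φ I γ) :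
    ∃ h : SU3, ∀ t ∈ I, ∀ k ∈ T2, k • (h • γ t) = h • γ t := by
  rcases I.eq_empty_or_nonempty with rfl | ⟨t₀, ht₀⟩
  · exact ⟨1, fun t ht => ht.elim⟩
  set K := LinearMap.ker (fund (γ t₀)).toLinearMap with hKdef
  have hK : Module.finrank ℝ K = 2 := by
    have h1 := LinearMap.finrank_range_add_finrank_ker (fund (γ t₀)).toLinearMap
    have h2 := hγ.regular t₀ ht₀
    rw [orbitDim_eq] at h2
    rw [h2, finrank_euclideanSpace_fin] at h1
    exact Nat.add_left_cancel (n := 6) h1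
  obtain ⟨h, hh⟩ := exists_Ad_diagonal K hK fun x hx y hy =>
    hM.fund_lie_eq_zero (fun s => hM.suExp_smul_of_fund_eq_zero hx s) hy
  refine ⟨h, fun t ht k hk => ?_⟩
  -- The torus components after conjugation. On `K` they determine the element, since the others
  -- vanish, and both dimensions are two; hence `Ad h` maps `K` onto the diagonal subalgebra.
  let P : LieSU3 →ₗ[ℝ] ℝ × ℝ := LinearMap.prod
    ((EuclideanSpace.proj 6 : LieSU3 →L[ℝ] ℝ) ∘L Ad h).toLinearMap
    ((EuclideanSpace.proj 7 : LieSU3 →L[ℝ] ℝ) ∘L Ad h).toLinearMap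
  have hPapp : ∀ c, P c = (Ad h c 6, Ad h c 7) := fun _ => rfl
  have hPinj : Function.Injective (P ∘ₗ K.subtype) := by
    rw [← LinearMap.ker_eq_bot, LinearMap.ker_eq_bot']
    rintro ⟨c, hcK⟩ hc0
    have h1 : P c = 0 := hc0
    rw [hPapp, Prod.mk_eq_zero] at h1
    have h2 : Ad h c = 0 := by
      have h3 := hh c hcK
      ext i
      fin_cases i
      exacts [h3 0, h3 1, h3 2, h3 3, h3 4, h3 5, h1.1, h1.2]
    have h3 := Ad_inv_apply_Ad h c
    rw [h2, map_zero] at h3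
    exact Subtype.ext h3.symm
  have hPsurj : Function.Surjective (P ∘ₗ K.subtype) :=
    (LinearMap.injective_iff_surjective_of_finrank_eq_finrank (by
      rw [hK, Module.finrank_prod, Module.finrank_self])).1 hPinj
  -- Every torus element is an exponential, so knowing the isotropy algebra suffices to fix the
  -- curve under the whole torus.
  obtain ⟨c, hc0, rfl⟩ := exists_suExp_eq hk
  obtain ⟨⟨d, hdK⟩, hd⟩ := hPsurj (c 6, c 7)
  have hd' : P d = (c 6, c 7) := hd
  rw [hPapp, Prod.mk.injEq] at hd'
  have hcd : Ad h d = c := by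
    have h3 := hh d hdK
    ext i
    fin_cases i
    exacts [(h3 0).trans (hc0 0).symm, (h3 1).trans (hc0 1).symm, (h3 2).trans (hc0 2).symm,
      (h3 3).trans (hc0 3).symm, (h3 4).trans (hc0 4).symm, (h3 5).trans (hc0 5).symm, hd'.1, hd'.2]
  rw [← hcd, suExp_Ad, mul_smul, mul_smul, inv_smul_smul,
    hM.suExp_smul_normalCurve hM6 hφ hs hinv hI hc hγ ht₀ hdK t ht]

omit [IsManifold 𝓘(ℝ, W) ∞ M] in
/-- A normal curve fixed by the torus consists of tube points. -/
theorem IsSmoothAction.isTubePoint_normalCurve {φ : FormField M 3}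
    {I : Set ℝ} {γ : ℝ → M} (hγ : IsNormalCurve φ I γ) {t : ℝ} (ht : t ∈ I)
    (hk : ∀ k ∈ T2, k • γ t = γ t) : IsTubePoint γ t := by
  refine hM.isTubePoint_of_torus ?_ hk
  set R := LinearMap.range (fund (γ t)).toLinearMap with hR
  set S := LinearMap.range (tube γ t).toLinearMap with hS
  have hu := ((isNormalCurve_iff.1 hγ).2 t ht).2
  have h6 : Module.finrank ℝ R = 6 := hγ.regular t ht
  have hle : R ≤ S := by
    rintro _ ⟨c, rfl⟩
    exact ⟨(0, c), by
      change tube γ t (0, c) = fund (γ t) c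
      rw [tube_apply]; simp⟩
  have hv : vel γ t ∈ S := ⟨(1, 0), by
    change tube γ t (1, 0) = vel γ t
    rw [tube_apply]; simp⟩
  have hvR : vel γ t ∉ R := by
    rintro ⟨c, hc⟩
    have h1 := hu.2 c
    rw [show fund (γ t) c = vel γ t from hc, hu.1] at h1
    exact one_ne_zero h1
  have hlt : R < S := lt_of_le_of_ne hle fun h => hvR (h ▸ hv)
  have h7 := Submodule.finrank_lt_finrank_of_lt hlt
  have htop : S = ⊤ := by
    apply Submodule.eq_top_of_finrank_eq
    have h8 := Submodule.finrank_le S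
    rw [finrank_euclideanSpace_fin] at h8 ⊢
    omega
  exact LinearMap.range_eq_top.1 htop

end Isotropy

/-! ### Normal forms along tubes -/

section Frame

/-- The inclusion of the tangent space of the tube, as a complement of the diagonal matrices. -/
noncomputable def frameIncl : W →L[ℝ] ℝ × LieSU3 :=
  LinearMap.toContinuousLinearMap
    { toFun := fun x => (x 0, WithLp.toLp 2 ![x 1, x 2, x 3, x 4, x 5, x 6, 0, 0])
      map_add' := by
        intro x y
        refine Prod.ext rfl ?_
        ext i; fin_cases i <;> simp
      map_smul' := by
        intro r x
        refine Prod.ext rfl ?_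
        ext i; fin_cases i <;> simp }

theorem frameIncl_apply (x : W) :
    frameIncl x = (x 0, WithLp.toLp 2 ![x 1, x 2, x 3, x 4, x 5, x 6, 0, 0]) := rfl

theorem apply_frameIncl_tubeFrame {T : ℝ × LieSU3 →L[ℝ] W}
    (ht : ∀ c : LieSU3, (∀ i, c (offDiag i) = 0) → T (0, c) = 0) (x : ℝ × LieSU3) :
    T (frameIncl (tubeFrame 1 1 1 x)) = T x := by
  rw [← sub_eq_zero, ← map_sub]
  have h : frameIncl (tubeFrame 1 1 1 x) - x
      = (0, (frameIncl (tubeFrame 1 1 1 x)).2 - x.2) := by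
    refine Prod.ext ?_ rfl
    simp [frameIncl_apply, tubeFrame_apply]
  rw [h]
  refine ht _ fun i => ?_
  simp only [frameIncl_apply, tubeFrame_apply]
  fin_cases i <;> simp [offDiag]

theorem exists_SU3 {m : Matrix (Fin 3) (Fin 3) ℂ} (h : m * star m = 1) (hd : m.det = 1) :
    ∃ g : SU3, g.1 = m :=
  ⟨⟨m, Matrix.mem_specialUnitaryGroup_iff.2 ⟨Matrix.mem_unitaryGroup_iff.2 h, hd⟩⟩, rfl⟩

theorem exists_Ad_quarterOne : ∃ k ∈ T2, ∀ x : W,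
    frameIncl (quarterOne x) = (x 0, Ad k (frameIncl x).2) := by
  obtain ⟨k, hk⟩ := exists_SU3 (m := !![Complex.I, 0, 0; 0, 1, 0; 0, 0, -Complex.I])
    (by ext i j; fin_cases i <;> fin_cases j <;> simp [Matrix.mul_apply, Fin.sum_univ_three])
    (by simp [Matrix.det_fin_three])
  refine ⟨k, ?_, fun x => ?_⟩
  · intro i j hij
    rw [hk]
    fin_cases i <;> fin_cases j <;> first | exact absurd rfl hij | simp
  · rw [frameIncl_apply, quarterOne_apply]
    refine Prod.ext rfl (suMat_injective ?_)
    rw [suMat_Ad, hk, frameIncl_apply, suMat_eq, suMat_eq]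
    ext i j
    fin_cases i <;> fin_cases j <;> apply Complex.ext <;>
      simp [Matrix.mul_apply, Fin.sum_univ_three] <;> ring

theorem exists_Ad_quarterTwo : ∃ k ∈ T2, ∀ x : W,
    frameIncl (quarterTwo x) = (x 0, Ad k (frameIncl x).2) := by
  obtain ⟨k, hk⟩ := exists_SU3 (m := !![Complex.I, 0, 0; 0, -Complex.I, 0; 0, 0, 1])
    (by ext i j; fin_cases i <;> fin_cases j <;> simp [Matrix.mul_apply, Fin.sum_univ_three])
    (by simp [Matrix.det_fin_three])
  refine ⟨k, ?_, fun x => ?_⟩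
  · intro i j hij
    rw [hk]
    fin_cases i <;> fin_cases j <;> first | exact absurd rfl hij | simp
  · rw [frameIncl_apply, quarterTwo_apply]
    refine Prod.ext rfl (suMat_injective ?_)
    rw [suMat_Ad, hk, frameIncl_apply, suMat_eq, suMat_eq]
    ext i j
    fin_cases i <;> fin_cases j <;> apply Complex.ext <;>
      simp [Matrix.mul_apply, Fin.sum_univ_three] <;> ring

/-- An element of the normalizer of the torus that reverses the orientations of the root spaces. -/
theorem exists_reversing : ∃ s : SU3, (∀ k ∈ T2, s⁻¹ * k * s ∈ T2) ∧
    Ad s (frameIncl (stdVec 1)).2 = (frameIncl (stdVec 3)).2 ∧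
    Ad s (frameIncl (stdVec 2)).2 = -(frameIncl (stdVec 4)).2 := by
  obtain ⟨s, hs⟩ := exists_SU3 (m := !![0, 1, 0; 1, 0, 0; 0, 0, -1])
    (by ext i j; fin_cases i <;> fin_cases j <;> simp [Matrix.mul_apply, Fin.sum_univ_three])
    (by simp [Matrix.det_fin_three])
  refine ⟨s, fun k hk i j hij => ?_, ?_, ?_⟩
  · change (star s.1 * k.1 * s.1) i j = 0
    have h01 := hk 0 1 (by decide)
    have h02 := hk 0 2 (by decide)
    have h10 := hk 1 0 (by decide)
    have h12 := hk 1 2 (by decide)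
    have h20 := hk 2 0 (by decide)
    have h21 := hk 2 1 (by decide)
    rw [hs]
    fin_cases i <;> fin_cases j <;> first
      | exact absurd rfl hij
      | simp [Matrix.mul_apply, Fin.sum_univ_three, h01, h02, h10, h12, h20, h21]
  all_goals
    refine suMat_injective ?_
    try rw [suMat_neg]
    rw [suMat_Ad, hs, frameIncl_apply, frameIncl_apply, suMat_eq, suMat_eq]
    ext i j
    fin_cases i <;> fin_cases j <;> apply Complex.ext <;>
      simp [Matrix.mul_apply, Fin.sum_univ_three, stdVec] <;> norm_num

end Frame

/-! ### The five-parameter family of torus invariant three-forms -/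

section Invariant

variable {ψ : W [⋀^Fin 3]→L[ℝ] ℝ} (h₁ : ψ.compContinuousLinearMap quarterOne = ψ)
  (h₂ : ψ.compContinuousLinearMap quarterTwo = ψ)

/-- The invariant three-forms. -/
noncomputable def invariantForm (a₁ a₂ a₃ p q : ℝ) : W [⋀^Fin 3]→L[ℝ] ℝ :=
  a₁ • wedge ![stdCoframe 1, stdCoframe 2, stdCoframe 0]
    + a₂ • wedge ![stdCoframe 3, stdCoframe 4, stdCoframe 0]
    + a₃ • wedge ![stdCoframe 5, stdCoframe 6, stdCoframe 0]
    + p • alphaForm stdCoframe + q • betaForm stdCoframe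

theorem invariantForm_apply (a₁ a₂ a₃ p q : ℝ) (x y z : W) :
    invariantForm a₁ a₂ a₃ p q ![x, y, z] =
      a₁ * wedge ![stdCoframe 1, stdCoframe 2, stdCoframe 0] ![x, y, z]
    + a₂ * wedge ![stdCoframe 3, stdCoframe 4, stdCoframe 0] ![x, y, z]
    + a₃ * wedge ![stdCoframe 5, stdCoframe 6, stdCoframe 0] ![x, y, z]
    + p * alphaForm stdCoframe ![x, y, z] + q * betaForm stdCoframe ![x, y, z] := rfl

theorem invariantForm_comp_quarterOne (a₁ a₂ a₃ p q : ℝ) :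
    (invariantForm a₁ a₂ a₃ p q).compContinuousLinearMap quarterOne
      = invariantForm a₁ a₂ a₃ p q := by
  ext x
  rw [three_eta x, ContinuousAlternatingMap.compContinuousLinearMap_apply, comp_three]
  simp only [invariantForm_apply, alphaForm, betaForm,
    ContinuousAlternatingMap.sub_apply, wedge_three, stdCoframe_apply, quarterOne_apply]
  simp only [Matrix.cons_val]
  ring

theorem invariantForm_comp_quarterTwo (a₁ a₂ a₃ p q : ℝ) :
    (invariantForm a₁ a₂ a₃ p q).compContinuousLinearMap quarterTwo
      = invariantForm a₁ a₂ a₃ p q := by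
  ext x
  rw [three_eta x, ContinuousAlternatingMap.compContinuousLinearMap_apply, comp_three]
  simp only [invariantForm_apply, alphaForm, betaForm,
    ContinuousAlternatingMap.sub_apply, wedge_three, stdCoframe_apply, quarterTwo_apply]
  simp only [Matrix.cons_val]
  ring

-- The difference is invariant, and its five basic components vanish.
include h₁ h₂ in
theorem eq_invariantForm : ψ = invariantForm (ψ ![stdVec 0, stdVec 1, stdVec 2])
    (ψ ![stdVec 0, stdVec 3, stdVec 4]) (ψ ![stdVec 0, stdVec 5, stdVec 6])
    (ψ ![stdVec 2, stdVec 4, stdVec 6]) (ψ ![stdVec 1, stdVec 3, stdVec 5]) := by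
  rw [← sub_eq_zero]
  generalize e1 : ψ ![stdVec 0, stdVec 1, stdVec 2] = a₁
  generalize e2 : ψ ![stdVec 0, stdVec 3, stdVec 4] = a₂
  generalize e3 : ψ ![stdVec 0, stdVec 5, stdVec 6] = a₃
  generalize e4 : ψ ![stdVec 2, stdVec 4, stdVec 6] = p
  generalize e5 : ψ ![stdVec 1, stdVec 3, stdVec 5] = q
  have hs : ∀ v, (ψ - invariantForm a₁ a₂ a₃ p q) v = ψ v - invariantForm a₁ a₂ a₃ p q v :=
    fun _ => rfl
  refine form_eq_zero_of_invariant ?_ ?_ ?_ ?_ ?_ ?_ ?_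
  · ext v
    rw [ContinuousAlternatingMap.compContinuousLinearMap_apply, hs, hs,
      ← ContinuousAlternatingMap.compContinuousLinearMap_apply, h₁,
      ← ContinuousAlternatingMap.compContinuousLinearMap_apply, invariantForm_comp_quarterOne]
  · ext v
    rw [ContinuousAlternatingMap.compContinuousLinearMap_apply, hs, hs,
      ← ContinuousAlternatingMap.compContinuousLinearMap_apply, h₂,
      ← ContinuousAlternatingMap.compContinuousLinearMap_apply, invariantForm_comp_quarterTwo]
  all_goals
    rw [hs, invariantForm_apply]
    simp only [e1, e2, e3, e4, e5]
    simp [alphaForm, betaForm, wedge_three, stdCoframe_apply, stdVec]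

theorem invariantForm_comp_tubeFrame {f₁ f₂ f₃ p q θ : ℝ} (hp : p = f₁ * f₂ * f₃ * Real.cos θ)
    (hq : q = f₁ * f₂ * f₃ * Real.sin θ) :
    (invariantForm (f₁ ^ 2) (f₂ ^ 2) (f₃ ^ 2) p q).compContinuousLinearMap (tubeFrame 1 1 1)
      = tubePhi f₁ f₂ f₃ θ := by
  ext x
  rw [three_eta x, ContinuousAlternatingMap.compContinuousLinearMap_apply, comp_three, hp, hq]
  simp only [tubePhi, invariantForm_apply, alphaForm, betaForm, ContinuousAlternatingMap.add_apply,
    ContinuousAlternatingMap.sub_apply, ContinuousAlternatingMap.smul_apply, wedge_three,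
    stdCoframe_apply, smul_eq_mul, tubeCoframe_0, tubeCoframe_1, tubeCoframe_2, tubeCoframe_3,
    tubeCoframe_4, tubeCoframe_5, tubeCoframe_6, tubeFrame_apply]
  simp only [Matrix.cons_val]
  ring

end Invariant

section Smooth

/-- The moving vectors are packed into one linear map from a fixed space, so that smoothness of
pull-backs applies and the arguments become constant. -/
theorem ContDiffAt.form_apply {E V : Type*} [NormedAddCommGroup E] [NormedSpace ℝ E]
    [NormedAddCommGroup V] [NormedSpace ℝ V] {n : WithTop ℕ∞} {f : E → V [⋀^Fin 3]→L[ℝ] ℝ}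
    {v : Fin 3 → E → V} {x : E} (hf : ContDiffAt ℝ n f x) (hv : ∀ i, ContDiffAt ℝ n (v i) x) :
    ContDiffAt ℝ n (fun y => f y fun i => v i y) x := by
  let J : Fin 3 → Fin 7 := Fin.castLE (by norm_num)
  let B : E → W →L[ℝ] V := fun y => ∑ i, (stdCoframe (J i)).smulRight (v i y)
  have hB : ContDiffAt ℝ n B x := by
    refine ContDiffAt.sum fun i _ => ?_
    exact ((ContinuousLinearMap.smulRightL ℝ W V (stdCoframe (J i))).contDiff.contDiffAt).comp x
      (hv i)
  have hBJ : ∀ y i, B y (stdVec (J i)) = v i y := by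
    intro y i
    simp only [B, _root_.sum_apply, ContinuousLinearMap.smulRight_apply, stdCoframe_apply]
    rw [Finset.sum_eq_single i]
    · simp [stdVec]
    · intro j _ hj
      have : J j ≠ J i := fun h => hj (by simpa [J] using h)
      simp [stdVec, this]
    · simp
  have h := ContDiffAt.compForm hf hB
  let ev : (W [⋀^Fin 3]→L[ℝ] ℝ) →L[ℝ] ℝ :=
    ContinuousAlternatingMap.apply ℝ W ℝ (fun i => stdVec (J i))
  refine (ev.contDiff.contDiffAt.comp x h).congr_of_eventuallyEq
    (Filter.Eventually.of_forall fun y => ?_)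
  change (f y fun i => v i y) = f y (B y ∘ fun i => stdVec (J i))
  exact congrArg (f y) (funext fun i => (hBJ y i).symm)

end Smooth

/-! ### The invariant form along a torus fixed normal curve -/

section Tube

variable {M : Type*} [TopologicalSpace M] [ChartedSpace W M] [MulAction SU3 M]

/-- The pull-back of a three-form to the tube. -/
noncomputable def tubePull (φ : FormField M 3) (γ : ℝ → M) (t : ℝ) :
    (ℝ × LieSU3) [⋀^Fin 3]→L[ℝ] ℝ :=
  (toForm φ (γ t)).compContinuousLinearMap (tube γ t)

/-- The coefficients of the pull-back of a three-form to the tube. -/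
noncomputable def tubeCoeff (φ : FormField M 3) (γ : ℝ → M) (i j k : Fin 7) (t : ℝ) : ℝ :=
  tubePull φ γ t fun l => frameIncl (![stdVec i, stdVec j, stdVec k] l)

variable (hM : IsSmoothAction M)

include hM

/-- The pull-back of the form to the tube is smooth. -/
theorem IsSmoothAction.contDiffOn_tubePull [IsManifold 𝓘(ℝ, W) ∞ M] {φ : FormField M 3}
    (hs : IsCnForm ∞ φ) {I : Set ℝ} (hI : IsOpen I) {γ : ℝ → M}
    (hγ : ContMDiffOn 𝓘(ℝ, ℝ) 𝓘(ℝ, W) ∞ γ I) (x : Fin 3 → ℝ × LieSU3) :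
    ContDiffOn ℝ ∞ (fun t => tubePull φ γ t x) I := by
  intro t₀ ht₀
  refine ContDiffAt.contDiffWithinAt ?_
  set e := chartAt W (γ t₀) with he'
  have he : e ∈ atlas W M := chart_mem_atlas W _
  have hp : γ t₀ ∈ e.source := mem_chart_source W _
  have hmax : e ∈ IsManifold.maximalAtlas 𝓘(ℝ, W) ∞ M := IsManifold.subset_maximalAtlas he
  have hγs : ∀ t ∈ I, ContMDiffAt 𝓘(ℝ, ℝ) 𝓘(ℝ, W) ∞ γ t := fun t ht =>
    hγ.contMDiffAt (hI.mem_nhds ht)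
  obtain ⟨A, hA⟩ := hM.exists_chartFund he
  have hsrc : ∀ᶠ t in nhds t₀, γ t ∈ e.source :=
    (hγs t₀ ht₀).continuousAt.eventually (e.open_source.eventually_mem hp)
  have hu : ∀ t ∈ I, γ t ∈ e.source → ContDiffAt ℝ ∞ (fun s => e (γ s)) t := fun t ht hts =>
    ((contMDiffAt_of_mem_maximalAtlas hmax hts).comp t (hγs t ht)).contDiffAt
  obtain ⟨U, hU, hUo, htU⟩ := mem_nhds_iff.1 (hsrc.and (hI.eventually_mem ht₀))
  have hu' : ContDiffAt ℝ ∞ (deriv fun s => e (γ s)) t₀ := by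
    have h1 : ContDiffOn ℝ ∞ (fun s => e (γ s)) U := fun t ht =>
      (hu t (hU ht).2 (hU ht).1).contDiffWithinAt
    exact ((contDiffOn_infty_iff_deriv_of_isOpen hUo).1 h1).2.contDiffAt (hUo.mem_nhds htU)
  have hloc : ContDiffAt ℝ ∞ (fun t => localRep φ e (e (γ t))) t₀ :=
    ContDiffAt.comp (g := localRep φ e) (f := fun t => e (γ t)) t₀
      ((hs e he).contDiffAt (e.open_target.mem_nhds (e.map_source hp))) (hu t₀ ht₀ hp)
  -- The arguments of the pull-back in the chart: the velocity of the curve and the fundamental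
  -- vectors, both smooth in `t`.
  have hC : ∀ i, ContDiffAt ℝ ∞ (fun t => (x i).1 • deriv (fun s => e (γ s)) t
      + A (e (γ t)) (x i).2) t₀ := fun i =>
    (hu'.const_smul _).add (((hA _ (e.map_source hp)).1.comp t₀ (hu t₀ ht₀ hp)).clm_apply
      contDiffAt_const)
  refine (ContDiffAt.form_apply hloc hC).congr_of_eventuallyEq ?_
  filter_upwards [hUo.mem_nhds htU] with t ht
  obtain ⟨hts, htI⟩ := hU ht
  have h1 := mfderiv_symm_deriv he ((hγs t htI).mdifferentiableAt (by simp)) hts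
  have h2 := (hA _ (e.map_source hts)).2
  -- A variable point `q` in place of `e.symm (e (γ t))` allows the identification with `γ t` to be
  -- substituted in all tangent spaces at once.
  have key : ∀ {q : M} (_ : q = γ t) {D : W →L[ℝ] W},
      D (deriv (fun s => e (γ s)) t) = vel γ t → (∀ c, D (A (e (γ t)) c) = fund q c) →
      toForm φ (γ t) (fun i => tube γ t (x i)) = toForm φ q (fun i =>
        D ((x i).1 • deriv (fun s => e (γ s)) t + A (e (γ t)) (x i).2)) := by
    rintro q rfl D e1 e2
    congr 1
    funext i
    rw [map_add, map_smul, e1, e2, tube_apply]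
  exact key (e.left_inv hts) h1 h2

theorem IsSmoothAction.tubePull_comp_frameIncl {φ : FormField M 3}
    (hinv : IsInvariantForm φ) {I : Set ℝ} (hI : IsOpen I) {γ : ℝ → M}
    {k : SU3} (hk : ∀ t ∈ I, k • γ t = γ t) {t : ℝ} (ht : t ∈ I)
    (hγ : MDifferentiableAt 𝓘(ℝ, ℝ) 𝓘(ℝ, W) γ t) {A : W →L[ℝ] W}
    (hA : ∀ x : W, frameIncl (A x) = (x 0, Ad k (frameIncl x).2)) :
    ((tubePull φ γ t).compContinuousLinearMap frameIncl).compContinuousLinearMap A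
      = (tubePull φ γ t).compContinuousLinearMap frameIncl := by
  have h1 := (isInvariantForm_iff φ).1 hinv k (γ t)
  rw [hk t ht] at h1
  ext v
  change toForm φ (γ t) (fun i => tube γ t (frameIncl (A (v i))))
    = toForm φ (γ t) (fun i => tube γ t (frameIncl (v i)))
  conv_rhs => rw [← h1, ContinuousAlternatingMap.compContinuousLinearMap_apply]
  congr 1
  funext i
  rw [Function.comp_apply, hM.push_tube_of_fixed hI hk ht hγ, hA]
  rfl

/-- The pull-back of the form to the tube of a torus fixed normal curve. -/
theorem IsSmoothAction.tubePull_normalForm {φ : FormField M 3}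
    (hφ : ∀ p, IsG2Form (φ p)) (hinv : IsInvariantForm φ) {I : Set ℝ} (hI : IsOpen I) {γ : ℝ → M}
    (hγ : IsNormalCurve φ I γ) (hk : ∀ t ∈ I, ∀ k ∈ T2, k • γ t = γ t) {t : ℝ} (ht : t ∈ I) :
    tubePull φ γ t = (invariantForm (tubeCoeff φ γ 0 1 2 t) (tubeCoeff φ γ 0 3 4 t)
      (tubeCoeff φ γ 0 5 6 t) (tubeCoeff φ γ 2 4 6 t)
      (tubeCoeff φ γ 1 3 5 t)).compContinuousLinearMap (tubeFrame 1 1 1) ∧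
    0 < tubeCoeff φ γ 0 1 2 t * tubeCoeff φ γ 0 3 4 t ∧
    0 < tubeCoeff φ γ 0 1 2 t * tubeCoeff φ γ 0 5 6 t ∧
    (tubeCoeff φ γ 2 4 6 t ^ 2 + tubeCoeff φ γ 1 3 5 t ^ 2) ^ 2 =
      (tubeCoeff φ γ 0 1 2 t * tubeCoeff φ γ 0 3 4 t * tubeCoeff φ γ 0 5 6 t) ^ 2 := by
  have hd := (hγ.smooth.contMDiffAt (hI.mem_nhds ht)).mdifferentiableAt (by simp)
  have hpt := hM.isTubePoint_normalCurve hγ ht (hk t ht)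
  have htor : ∀ c : LieSU3, (∀ i, c (offDiag i) = 0) → tube γ t (0, c) = 0 := fun c hc => by
    rw [tube_apply, hpt.torus c hc, zero_smul, zero_add]
  set ψ := (tubePull φ γ t).compContinuousLinearMap frameIncl with hψ
  have hcoeff : ∀ i j k, tubeCoeff φ γ i j k t = ψ ![stdVec i, stdVec j, stdVec k] :=
    fun _ _ _ => rfl
  obtain ⟨k₁, hk₁, hA₁⟩ := exists_Ad_quarterOne
  obtain ⟨k₂, hk₂, hA₂⟩ := exists_Ad_quarterTwo
  have h₁ : ψ.compContinuousLinearMap quarterOne = ψ :=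
    hM.tubePull_comp_frameIncl hinv hI (fun t ht => hk t ht k₁ hk₁) ht hd hA₁
  have h₂ : ψ.compContinuousLinearMap quarterTwo = ψ :=
    hM.tubePull_comp_frameIncl hinv hI (fun t ht => hk t ht k₂ hk₂) ht hd hA₂
  have hsurj : Function.Surjective ((tube γ t).comp frameIncl).toLinearMap := by
    intro w
    obtain ⟨x, rfl⟩ := hpt.surjective w
    exact ⟨tubeFrame 1 1 1 x, apply_frameIncl_tubeFrame htor x⟩
  -- The tube map restricted to the complement of the torus, as an isomorphism. It carries the `G₂`
  -- property to `ψ`, and `e₀` to the unit velocity.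
  let L : W ≃L[ℝ] W := (LinearEquiv.ofBijective ((tube γ t).comp frameIncl).toLinearMap
    ⟨LinearMap.injective_iff_surjective.2 hsurj, hsurj⟩).toContinuousLinearEquiv
  obtain ⟨b, θ, hb⟩ : IsG2Form (toForm φ (γ t)) := hφ _
  have hL : ∀ x, L x = tube γ t (frameIncl x) := fun _ => rfl
  have hψad : IsAdapted ψ (L.trans b) θ := by
    ext v
    change toForm φ (γ t) (fun i => L (v i)) = phiForm stdCoframe θ (fun i => b (L (v i)))
    rw [hb]
    rfl
  have hL0 : L (stdVec 0) = vel γ t := by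
    rw [hL, tube_apply]
    have h1 : (frameIncl (stdVec 0)).1 = 1 := by simp [frameIncl_apply, stdVec]
    have h2 : (frameIncl (stdVec 0)).2 = 0 := by
      ext i; fin_cases i <;> simp [frameIncl_apply, stdVec]
    rw [h1, h2, map_zero, one_smul, add_zero]
  have hn : inner ℝ ((L.trans b) (stdVec 0)) ((L.trans b) (stdVec 0)) = 1 := by
    have h1 := ((isNormalCurve_iff.1 hγ).2 t ht).2.1
    rw [hb.g2Metric_eq] at h1
    rw [ContinuousLinearEquiv.trans_apply, hL0, h1]
  obtain ⟨n1, n2, n3⟩ := hψad.normalForm h₁ h₂ hn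
  simp only [hcoeff]
  refine ⟨?_, n1, n2, n3⟩
  rw [← eq_invariantForm h₁ h₂]
  ext v
  change toForm φ (γ t) (fun i => tube γ t (v i))
    = toForm φ (γ t) (fun i => tube γ t (frameIncl (tubeFrame 1 1 1 (v i))))
  congr 1
  funext i
  exact (apply_frameIncl_tubeFrame htor (v i)).symm

end Tube

/-! ### Positive coefficients and the structure along a normal curve -/

section Structure

variable {M : Type*} [TopologicalSpace M] [ChartedSpace W M] [MulAction SU3 M]

theorem form_neg_last (ψ : W [⋀^Fin 3]→L[ℝ] ℝ) (x y z : W) : ψ ![x, y, -z] = -ψ ![x, y, z] := by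
  have h := ψ.toMultilinearMap.map_update_neg ![x, y, z] 2 z
  rwa [show Function.update ![x, y, z] 2 (-z) = ![x, y, -z] from by
      ext k; fin_cases k <;> rfl, show Function.update ![x, y, z] 2 z = ![x, y, z] from by
      ext k; fin_cases k <;> rfl] at h

theorem pos_or_neg_of_ne_zero {I : Set ℝ} (hc : I.OrdConnected) {a : ℝ → ℝ} (ha : ContinuousOn a I)
    (h0 : ∀ t ∈ I, a t ≠ 0) : (∀ t ∈ I, 0 < a t) ∨ ∀ t ∈ I, a t < 0 := by
  by_contra! h
  obtain ⟨⟨s, hs, hs'⟩, t, ht, ht'⟩ := h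
  obtain ⟨r, hr, hr0⟩ := hc.isPreconnected.intermediate_value hs ht ha ⟨hs', ht'⟩
  exact h0 r hr hr0

variable (hM : IsSmoothAction M)

include hM

/-- The Weyl element carries the first root plane to the second with reversed orientation, so by
invariance the coefficient changes sign. -/
theorem IsSmoothAction.tubeCoeff_reversing {φ : FormField M 3} (hinv : IsInvariantForm φ)
    {γ : ℝ → M} {t : ℝ} (hγ : MDifferentiableAt 𝓘(ℝ, ℝ) 𝓘(ℝ, W) γ t) {s : SU3}
    (h1 : Ad s (frameIncl (stdVec 1)).2 = (frameIncl (stdVec 3)).2)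
    (h2 : Ad s (frameIncl (stdVec 2)).2 = -(frameIncl (stdVec 4)).2) :
    tubeCoeff φ γ 0 1 2 t = -tubeCoeff φ (fun t => s • γ t) 0 3 4 t := by
  have e1 := (isInvariantForm_iff φ).1 hinv s (γ t)
  set ψ := (tubePull φ (fun t => s • γ t) t).compContinuousLinearMap frameIncl with hψ
  have e2 : tubeCoeff φ γ 0 1 2 t = ψ ![stdVec 0, stdVec 3, -stdVec 4] := by
    change toForm φ (γ t) (fun l => tube γ t (frameIncl (![stdVec 0, stdVec 1, stdVec 2] l)))
      = toForm φ (s • γ t) (fun l => tube (fun t => s • γ t) t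
        (frameIncl (![stdVec 0, stdVec 3, -stdVec 4] l)))
    rw [← e1, ContinuousAlternatingMap.compContinuousLinearMap_apply]
    congr 1
    funext l
    rw [Function.comp_apply, hM.push_tube s γ hγ]
    congr 1
    have h3 : (frameIncl (stdVec 0)).2 = 0 := by
      ext i; fin_cases i <;> simp [frameIncl_apply, stdVec]
    fin_cases l
    · refine Prod.ext rfl ?_
      change Ad s (frameIncl (stdVec 0)).2 = (frameIncl (stdVec 0)).2
      rw [h3, map_zero]
    · refine Prod.ext ?_ h1
      simp [frameIncl_apply, stdVec]
    · refine Prod.ext ?_ (h2.trans ?_)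
      · simp [frameIncl_apply, stdVec]
      · change _ = (frameIncl (-stdVec 4)).2
        rw [map_neg]; rfl
  rw [e2, form_neg_last]
  rfl

/-- The coefficients of the two-forms are positive after a translation. -/
theorem IsSmoothAction.exists_tubeCoeff_pos [IsManifold 𝓘(ℝ, W) ∞ M] [T2Space M]
    (hM6 : ∀ p : M, orbitDim p ≤ 6) {φ : FormField M 3} (hφ : ∀ p, IsG2Form (φ p))
    (hs : IsCnForm ∞ φ) (hinv : IsInvariantForm φ) {I : Set ℝ} (hI : IsOpen I)
    (hc : I.OrdConnected) {γ : ℝ → M} (hγ : IsNormalCurve φ I γ) :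
    ∃ h : SU3, (∀ t ∈ I, ∀ k ∈ T2, k • (h • γ t) = h • γ t) ∧
      ∀ t ∈ I, 0 < tubeCoeff φ (fun t => h • γ t) 0 1 2 t := by
  obtain ⟨h, hh⟩ := hM.exists_torus_fixed hM6 hφ hs hinv hI hc hγ
  have hδ := hM.isNormalCurve_smul hφ hinv hI hγ h
  -- The coefficient is continuous and, by the normal form, nowhere zero; its sign is constant on
  -- the interval.
  rcases pos_or_neg_of_ne_zero hc
    (hM.contDiffOn_tubePull hs hI hδ.smooth
      fun l => frameIncl (![stdVec 0, stdVec 1, stdVec 2] l)).continuousOn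
    (fun t ht h0 => by
      have h1 := (hM.tubePull_normalForm hφ hinv hI hδ hh ht).2.1
      rw [show tubeCoeff φ (fun t => h • γ t) 0 1 2 t = 0 from h0, zero_mul] at h1
      exact lt_irrefl _ h1) with hpos | hneg
  · exact ⟨h, hh, hpos⟩
  · obtain ⟨s, hsT, hs1, hs2⟩ := exists_reversing
    have hfix : ∀ t ∈ I, ∀ k ∈ T2, k • (s * h) • γ t = (s * h) • γ t := by
      intro t ht k hk
      have h1 := hh t ht _ (hsT k hk)
      rw [mul_smul, mul_smul, inv_smul_eq_iff] at h1
      rw [mul_smul, h1]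
    refine ⟨s * h, hfix, fun t ht => ?_⟩
    have hε := hM.isNormalCurve_smul hφ hinv hI hγ (s * h)
    have h1 := hM.tubeCoeff_reversing hinv
      ((hδ.smooth.contMDiffAt (hI.mem_nhds ht)).mdifferentiableAt (by simp)) hs1 hs2
    have h2 : (fun t => s • h • γ t) = fun t => (s * h) • γ t := by
      funext t; rw [mul_smul]
    -- If the first coefficient was negative, the second one along the reversed curve is positive.
    -- The first has the sign of the second by the normal form.
    rw [h2] at h1
    have h3 : tubeCoeff φ (fun t => h • γ t) 0 1 2 t < 0 := hneg t ht
    have h4 := (hM.tubePull_normalForm hφ hinv hI hε hfix ht).2.1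
    exact pos_of_mul_pos_left h4 (by linarith)

/-- The metric and the form of an invariant cosymplectic structure along a normal curve. -/
theorem IsSmoothAction.exists_tubeStructure [IsManifold 𝓘(ℝ, W) ∞ M] [T2Space M]
    (hM6 : ∀ p : M, orbitDim p ≤ 6) {φ : FormField M 3} (hφ : IsInvariantCosymplectic ∞ φ)
    {I : Set ℝ} (hI : IsOpen I) (hc : I.OrdConnected) {γ : ℝ → M} (hγ : IsNormalCurve φ I γ) :
    ∃ (h : SU3) (f : Fin 3 → ℝ → ℝ) (θ : ℝ → ℝ),
      (∀ t ∈ I, ∀ k ∈ T2, k • (h • γ t) = h • γ t) ∧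
      (∀ i, ContDiffOn ℝ ∞ (f i) I) ∧ (∀ i, ∀ t ∈ I, 0 < f i t) ∧ ContDiffOn ℝ ∞ θ I ∧
      HasTubeMetric φ I (fun t => h • γ t) (f 0) (f 1) (f 2) ∧
      HasTubeForm φ I (fun t => h • γ t) (f 0) (f 1) (f 2) θ ∧
      ∀ t ∈ I, ∀ i j, i ≠ j → HasDerivAt (fun t => f i t ^ 2 * f j t ^ 2)
        (2 * (f 0 t * f 1 t * f 2 t * Real.cos (θ t))) t := by
  obtain ⟨hG, hs, hinv, hcl⟩ := hφ
  obtain ⟨h, hh, hpos⟩ := hM.exists_tubeCoeff_pos hM6 hG hs hinv hI hc hγ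
  have hδ := hM.isNormalCurve_smul hG hinv hI hγ h
  set δ : ℝ → M := fun t => h • γ t with hδdef
  have hnf := fun t ht => hM.tubePull_normalForm hG hinv hI hδ hh (t := t) ht
  set a : Fin 3 → ℝ → ℝ :=
    ![tubeCoeff φ δ 0 1 2, tubeCoeff φ δ 0 3 4, tubeCoeff φ δ 0 5 6] with ha
  have hapos : ∀ i, ∀ t ∈ I, 0 < a i t := by
    intro i t ht
    obtain ⟨-, h1, h2, -⟩ := hnf t ht
    fin_cases i
    · exact hpos t ht
    · exact pos_of_mul_pos_right h1 (hpos t ht).le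
    · exact pos_of_mul_pos_right h2 (hpos t ht).le
  have hcoef : ∀ i j k, ContDiffOn ℝ ∞ (tubeCoeff φ δ i j k) I := fun i j k =>
    hM.contDiffOn_tubePull hs hI hδ.smooth fun l => frameIncl (![stdVec i, stdVec j, stdVec k] l)
  have hacont : ∀ i, ContDiffOn ℝ ∞ (a i) I := by
    intro i; fin_cases i <;> exact hcoef _ _ _
  set f : Fin 3 → ℝ → ℝ := fun i t => √(a i t) with hf
  have hfcont : ∀ i, ContDiffOn ℝ ∞ (f i) I := fun i =>
    (hacont i).sqrt fun t ht => (hapos i t ht).ne'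
  have hfpos : ∀ i, ∀ t ∈ I, 0 < f i t := fun i t ht => Real.sqrt_pos.2 (hapos i t ht)
  have hfsq : ∀ i, ∀ t ∈ I, f i t ^ 2 = a i t := fun i t ht => Real.sq_sqrt (hapos i t ht).le
  set p := tubeCoeff φ δ 2 4 6 with hp
  set q := tubeCoeff φ δ 1 3 5 with hq
  set F : ℝ → ℝ := fun t => f 0 t * f 1 t * f 2 t with hF
  have hFpos : ∀ t ∈ I, 0 < F t := fun t ht =>
    mul_pos (mul_pos (hfpos 0 t ht) (hfpos 1 t ht)) (hfpos 2 t ht)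
  have hFcont : ContDiffOn ℝ ∞ F I := ((hfcont 0).mul (hfcont 1)).mul (hfcont 2)
  have hpq : ∀ t ∈ I, p t ^ 2 + q t ^ 2 = F t ^ 2 := by
    intro t ht
    have h1 := (hnf t ht).2.2.2
    have h2 : F t ^ 2 = a 0 t * a 1 t * a 2 t := by
      rw [← hfsq 0 t ht, ← hfsq 1 t ht, ← hfsq 2 t ht, hF]; ring
    rw [h2]
    -- The normal form gives equality of squares. Both sides are nonnegative once the `aᵢ` are
    -- positive.
    refine (pow_left_inj₀ (by positivity) ?_ two_ne_zero).1 h1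
    exact (mul_pos (mul_pos (hapos 0 t ht) (hapos 1 t ht)) (hapos 2 t ht)).le
  obtain ⟨θ, hθ, hθ'⟩ := exists_angle hI hc (m := ∞) (by simp)
    (a := fun t => p t / F t) (b := fun t => q t / F t)
    ((hcoef _ _ _).div hFcont fun t ht => (hFpos t ht).ne')
    ((hcoef _ _ _).div hFcont fun t ht => (hFpos t ht).ne')
    (fun t ht => by
      have h1 := hFpos t ht
      rw [div_pow, div_pow, ← add_div, hpq t ht, div_self (by positivity)])
  have hform : ∀ t ∈ I, (toForm φ (δ t)).compContinuousLinearMap (tube δ t) =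
      tubePhi (f 0 t) (f 1 t) (f 2 t) (θ t) := by
    intro t ht
    have h1 := (hnf t ht).1
    have hF0 := (hFpos t ht).ne'
    obtain ⟨e1, e2⟩ := hθ' t ht
    rw [← invariantForm_comp_tubeFrame (p := p t) (q := q t)
      (by rw [e1]; exact (mul_div_cancel₀ _ hF0).symm)
      (by rw [e2]; exact (mul_div_cancel₀ _ hF0).symm), hfsq 0 t ht, hfsq 1 t ht, hfsq 2 t ht]
    exact h1
  have hpt : ∀ t ∈ I, IsTubePoint δ t := fun t ht => hM.isTubePoint_normalCurve hδ ht (hh t ht)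
  have had := fun t ht => (hpt t ht).adapted (hfpos 0 t ht).ne' (hfpos 1 t ht).ne'
    (hfpos 2 t ht).ne' (hform t ht)
  refine ⟨h, f, θ, hh, hfcont, hfpos, hθ, fun t ht => (had t ht).2.1, hform, fun t ht => ?_⟩
  have c := fun i => ((hfcont i).contDiffAt (hI.mem_nhds ht)).of_le (by simp : (1 : WithTop ℕ∞) ≤ ∞)
  have cθ : ContDiffAt ℝ 1 θ t := (hθ.contDiffAt (hI.mem_nhds ht)).of_le (by simp)
  have hstar := hM.isInvariantForm_star hinv hG
  have hS : (fun t => (toForm (fun p => g2Star (φ p)) (δ t)).compContinuousLinearMap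
      (tube δ t)) =ᶠ[nhds t] fun t => tubeStar (f 0 t) (f 1 t) (f 2 t) (θ t) := by
    filter_upwards [hI.mem_nhds ht] with s hs
    exact (had s hs).2.2
  have hd : ContDiffAt ℝ 1 (fun t => tubeStar (f 0 t) (f 1 t) (f 2 t) (θ t)) t := by
    rw [show (fun t => tubeStar (f 0 t) (f 1 t) (f 2 t) (θ t)) = _ from
      funext fun t => tubeStar_eq (f 0) (f 1) (f 2) θ t]
    exact contDiffAt_starField (((c 0).pow 2).mul ((c 1).pow 2)) (((c 1).pow 2).mul ((c 2).pow 2))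
      (((c 0).pow 2).mul ((c 2).pow 2)) ((((c 0).mul (c 1)).mul (c 2)).mul cθ.sin)
      ((((c 0).mul (c 1)).mul (c 2)).mul cθ.cos)
  -- Closedness at one point of each orbit is all that is needed to extract the differential
  -- equations.
  set e := chartAt W (δ t) with he'
  have he : e ∈ atlas W M := chart_mem_atlas W _
  have hsrc : δ t ∈ e.source := mem_chart_source W _
  have h1 := (hM.extDeriv_localRep_eq_zero_iff 1 (eventually_contMDiffAt hI hδ.smooth ht)
    (hpt t ht) he (by rw [one_smul]; exact hsrc) hstar (hd.congr_of_eventuallyEq hS)).1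
  rw [one_smul] at h1
  have h2 := h1 (hcl e he _ (e.map_source hsrc))
  have h3 : tubeForm (fun t => (toForm (fun p => g2Star (φ p)) (δ t)).compContinuousLinearMap
      (tube δ t)) t =ᶠ[nhds 0] tubeForm (fun t => tubeStar (f 0 t) (f 1 t) (f 2 t) (θ t)) t := by
    have hcont : Filter.Tendsto (fun q : W => t + q 0) (nhds 0) (nhds t) := by
      have h : Continuous (fun q : W => t + q 0) :=
        continuous_const.add (EuclideanSpace.proj (0 : Fin 7) : W →L[ℝ] ℝ).continuous
      simpa using h.tendsto 0
    filter_upwards [hcont.eventually hS] with q hq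
    simp only [tubeForm, hq]
  rw [h3.extDeriv_eq] at h2
  have hder : ∀ i j, HasDerivAt (fun t => f i t ^ 2 * f j t ^ 2)
      (deriv (fun t => f i t ^ 2 * f j t ^ 2) t) t := fun i j =>
    ((((c i).pow 2).mul ((c j).pow 2)).differentiableAt (by simp)).hasDerivAt
  obtain ⟨d1, d2, d3⟩ := (extDeriv_tubeStar_eq_zero_iff (hder 0 1) (hder 1 2) (hder 0 2)
    ((((c 0).mul (c 1)).mul (c 2)).differentiableAt (by simp)) (cθ.differentiableAt (by simp))).1 h2
  have key : ∀ i j : Fin 3, i < j → HasDerivAt (fun t => f i t ^ 2 * f j t ^ 2)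
      (2 * (f 0 t * f 1 t * f 2 t * Real.cos (θ t))) t := by
    intro i j hij
    have h01 := d1 ▸ hder 0 1
    have h12 := d2 ▸ hder 1 2
    have h02 := d3 ▸ hder 0 2
    fin_cases i <;> fin_cases j <;> first
      | exact absurd hij (by decide)
      | exact h01
      | exact h12
      | exact h02
  intro i j hij
  rcases lt_or_gt_of_ne hij with h | h
  · exact key i j h
  · have := key j i h
    simp only [mul_comm (f j _ ^ 2)] at this
    exact this

end Structure

/-! ### The ordinary differential equations -/

/-- The conservation laws of the differential equations of cosymplectic structures. -/
theorem exists_relations_of_hasDerivAt {I : Set ℝ} (hI : IsOpen I) (hc : I.OrdConnected)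
    {f : Fin 3 → ℝ → ℝ} {θ : ℝ → ℝ} (hf : ∀ i, ContDiffOn ℝ ∞ (f i) I)
    (hpos : ∀ i, ∀ t ∈ I, 0 < f i t)
    (h : ∀ t ∈ I, ∀ i j, i ≠ j → HasDerivAt (fun t => f i t ^ 2 * f j t ^ 2)
      (2 * (f 0 t * f 1 t * f 2 t * Real.cos (θ t))) t) :
    ∃ (σ : Equiv.Perm (Fin 3)) (μ ν : ℝ), 0 ≤ μ ∧ μ ≤ ν ∧
      (∀ t ∈ I, f (σ 0) t ^ 2 ≤ f (σ 1) t ^ 2 ∧ f (σ 1) t ^ 2 ≤ f (σ 2) t ^ 2) ∧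
      (∀ t ∈ I, |deriv (f (σ 0)) t| ≤ √(Xi (f (σ 0) t) μ ν)) ∧
      AlgebraicRelations μ ν I (f (σ 0)) (f (σ 1)) (f (σ 2)) ∧
      AngleRelation I (f (σ 0)) (f (σ 1)) (f (σ 2)) θ := by
  rcases I.eq_empty_or_nonempty with rfl | ⟨t₀, ht₀⟩
  · exact ⟨1, 0, 0, le_rfl, le_rfl, fun t ht => ht.elim, fun t ht => ht.elim, fun t ht => ht.elim,
      fun t ht => ht.elim⟩
  -- The products `fₖ²fⱼ²` and `fₖ²fᵢ²` have the same derivative, so their difference is conserved.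
  have hconst : ∀ i j k : Fin 3, k ≠ i → k ≠ j → ∀ t ∈ I,
      f k t ^ 2 * (f j t ^ 2 - f i t ^ 2) = f k t₀ ^ 2 * (f j t₀ ^ 2 - f i t₀ ^ 2) := by
    intro i j k hki hkj t ht
    have hd : ∀ t ∈ I, HasDerivAt (fun t => f k t ^ 2 * f j t ^ 2 - f k t ^ 2 * f i t ^ 2) 0 t :=
      fun t ht => by
        have := (h t ht k j hkj).sub (h t ht k i hki)
        rwa [sub_self] at this
    have h1 := hI.is_const_of_deriv_eq_zero hc.isPreconnected
      (fun t ht => (hd t ht).differentiableAt.differentiableWithinAt)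
      (fun t ht => (hd t ht).deriv) ht ht₀
    simp only [mul_sub]
    exact h1
  -- The conserved quantity fixes the sign of `fⱼ² - fᵢ²`, so the order at `t₀` persists and one
  -- permutation serves on the whole interval.
  have hle : ∀ i j : Fin 3, f i t₀ ^ 2 ≤ f j t₀ ^ 2 → ∀ t ∈ I, f i t ^ 2 ≤ f j t ^ 2 := by
    intro i j hij t ht
    obtain ⟨k, hki, hkj⟩ : ∃ k : Fin 3, k ≠ i ∧ k ≠ j :=
      (by decide : ∀ i j : Fin 3, ∃ k, k ≠ i ∧ k ≠ j) i j
    have h1 := hconst i j k hki hkj t ht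
    have h2 := hpos k t ht
    have h3 : 0 ≤ f k t ^ 2 * (f j t ^ 2 - f i t ^ 2) := by
      rw [h1]; exact mul_nonneg (sq_nonneg _) (sub_nonneg.2 hij)
    exact sub_nonneg.1 (nonneg_of_mul_nonneg_right h3 (by positivity))
  set σ : Equiv.Perm (Fin 3) := Tuple.sort fun i => f i t₀ ^ 2 with hσ
  have hmono := Tuple.monotone_sort fun i => f i t₀ ^ 2
  have h01 := hle _ _ (hmono (by decide : (0 : Fin 3) ≤ 1))
  have h12 := hle _ _ (hmono (by decide : (1 : Fin 3) ≤ 2))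
  rw [← hσ] at h01 h12
  have n01 : σ 0 ≠ σ 1 := σ.injective.ne (by decide)
  have n02 : σ 0 ≠ σ 2 := σ.injective.ne (by decide)
  have n12 : σ 1 ≠ σ 2 := σ.injective.ne (by decide)
  have k1 := hconst (σ 1) (σ 2) (σ 0) n01 n02
  have k2 := hconst (σ 0) (σ 2) (σ 1) n01.symm n12
  -- The right side of the equations is symmetric in the `fᵢ`; relabelling does not change `θ`.
  have hprod : ∀ t, f (σ 0) t * f (σ 1) t * f (σ 2) t = f 0 t * f 1 t * f 2 t := by
    intro t
    have := Equiv.prod_comp σ fun i => f i t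
    rwa [Fin.prod_univ_three, Fin.prod_univ_three] at this
  have hd := fun t ht => h t ht (σ 0) (σ 1) n01
  simp only [← hprod] at hd
  set x := f (σ 0) t₀ ^ 2 with hx
  set y := f (σ 1) t₀ ^ 2 with hy
  set z := f (σ 2) t₀ ^ 2 with hz
  have hxy : x ≤ y := h01 t₀ ht₀
  have hyz : y ≤ z := h12 t₀ ht₀
  have hx0 : 0 ≤ x := sq_nonneg _
  have hy0 : 0 ≤ y := sq_nonneg _
  have hμ0 : 0 ≤ x * (z - y) := mul_nonneg hx0 (sub_nonneg.2 hyz)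
  -- The difference is `z (y - x)`, the third conserved quantity.
  have hμν : x * (z - y) ≤ y * (z - x) := by nlinarith
  have hne : ∀ i, ∀ t ∈ I, f i t ≠ 0 := fun i t ht => (hpos i t ht).ne'
  have hrel : AlgebraicRelations √(x * (z - y)) √(y * (z - x)) I (f (σ 0)) (f (σ 1)) (f (σ 2)) :=
    (AlgebraicRelations.polynomial (Real.sqrt_nonneg _) (Real.sqrt_le_sqrt hμν) (hne _) (hne _)
      (hne _)).2 fun t ht => by
        rw [Real.sq_sqrt hμ0, Real.sq_sqrt (hμ0.trans hμν)]
        exact ⟨k1 t ht, k2 t ht⟩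
  have hang : AngleRelation I (f (σ 0)) (f (σ 1)) (f (σ 2)) θ := by
    intro t ht
    have h1 := hd t ht
    have c := fun i => (((hf i).contDiffAt (hI.mem_nhds ht)).differentiableAt (by simp))
    have h2 := (((c (σ 0)).fun_mul (c (σ 1))).hasDerivAt.fun_pow 2)
    have h3 : (fun t => (f (σ 0) t * f (σ 1) t) ^ 2)
        = fun t => f (σ 0) t ^ 2 * f (σ 1) t ^ 2 := by
      funext t; rw [mul_pow]
    rw [h3] at h2
    have h4 := h1.unique h2
    have h5 : f (σ 0) t * f (σ 1) t ≠ 0 := mul_ne_zero (hne _ t ht) (hne _ t ht)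
    apply mul_left_cancel₀ (mul_ne_zero two_ne_zero h5)
    norm_num at h4
    linarith
  refine ⟨σ, _, _, Real.sqrt_nonneg _, Real.sqrt_le_sqrt hμν, fun t ht => ⟨h01 t ht, h12 t ht⟩,
    fun t ht => ?_, hrel, hang⟩
  -- Inequality (a) holds because the quotient `(f₁f₂)'/f₃` is a cosine.
  refine (sq_cos_le_one_iff hI (Real.sqrt_nonneg _) (Real.sqrt_le_sqrt hμν) (hf _) (hf _) (hne _)
    (hne _) (hne _) hrel ht).1.1 ?_
  rw [← hang t ht, mul_div_cancel_left₀ _ (hne _ t ht)]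
  exact Real.cos_sq_le_one _

end G2SU3

/-- The product `I × SU(3)/T²` enters part (2) through `IsProductTube`, for every manifold with an
action of this kind. In part (1) the permutation acts on the functions only, while the formulas for
metric and form keep the labelling of the root planes. -/
theorem theorem6p1 :
    (∀ (M : Type*) [TopologicalSpace M] [T2Space M] [ChartedSpace G2SU3.W M]
        [IsManifold 𝓘(ℝ, G2SU3.W) ∞ M] [MulAction G2SU3.SU3 M],
        G2SU3.IsSmoothAction M → G2SU3.IsCohomogeneityOne M →
        ∀ φ : G2SU3.FormField M 3, G2SU3.IsInvariantCosymplectic ∞ φ →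
        (∀ p : M, G2SU3.orbitDim p = 6 →
          ∃ (ε : ℝ) (γ : ℝ → M), 0 < ε ∧ γ 0 = p ∧
            G2SU3.IsNormalCurve φ (Set.Ioo (-ε) ε) γ) ∧
        ∀ (I : Set ℝ) (γ : ℝ → M), IsOpen I → I.OrdConnected → G2SU3.IsNormalCurve φ I γ →
          ∃ (h : G2SU3.SU3) (f : Fin 3 → ℝ → ℝ) (θ : ℝ → ℝ),
            (∀ t ∈ I, ∀ k ∈ G2SU3.T2, k • (h • γ t) = h • γ t) ∧
            (∀ i, ContDiffOn ℝ ∞ (f i) I) ∧ (∀ i, ∀ t ∈ I, f i t ≠ 0) ∧ ContDiffOn ℝ ∞ θ I ∧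
            G2SU3.HasTubeMetric φ I (fun t => h • γ t) (f 0) (f 1) (f 2) ∧
            G2SU3.HasTubeForm φ I (fun t => h • γ t) (f 0) (f 1) (f 2) θ ∧
            ∃ (σ : Equiv.Perm (Fin 3)) (μ ν : ℝ), 0 ≤ μ ∧ μ ≤ ν ∧
              (∀ t ∈ I, f (σ 0) t ^ 2 ≤ f (σ 1) t ^ 2 ∧ f (σ 1) t ^ 2 ≤ f (σ 2) t ^ 2) ∧
              (∀ t ∈ I, |deriv (f (σ 0)) t| ≤ √(G2SU3.Xi (f (σ 0) t) μ ν)) ∧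
              G2SU3.AlgebraicRelations μ ν I (f (σ 0)) (f (σ 1)) (f (σ 2)) ∧
              G2SU3.AngleRelation I (f (σ 0)) (f (σ 1)) (f (σ 2)) θ) ∧
    (∀ (I : Set ℝ) (μ ν : ℝ) (f₁ : ℝ → ℝ), IsOpen I → I.OrdConnected → 0 ≤ μ → μ ≤ ν →
        ContDiffOn ℝ ∞ f₁ I → (∀ t ∈ I, f₁ t ≠ 0) →
        (∀ t ∈ I, |deriv f₁ t| ≤ √(G2SU3.Xi (f₁ t) μ ν)) →
        (∃ f₂ f₃ : ℝ → ℝ, ContDiffOn ℝ ∞ f₂ I ∧ ContDiffOn ℝ ∞ f₃ I ∧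
          (∀ t ∈ I, 0 < f₂ t ∧ 0 < f₃ t) ∧ G2SU3.AlgebraicRelations μ ν I f₁ f₂ f₃ ∧
          ∀ k₂ k₃ : ℝ → ℝ, (∀ t ∈ I, k₂ t ≠ 0 ∧ k₃ t ≠ 0) →
            G2SU3.AlgebraicRelations μ ν I f₁ k₂ k₃ →
            ∀ t ∈ I, k₂ t ^ 2 = f₂ t ^ 2 ∧ k₃ t ^ 2 = f₃ t ^ 2) ∧
        ∀ f₂ f₃ : ℝ → ℝ, ContDiffOn ℝ ∞ f₂ I → ContDiffOn ℝ ∞ f₃ I →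
          (∀ t ∈ I, f₂ t ≠ 0 ∧ f₃ t ≠ 0) → G2SU3.AlgebraicRelations μ ν I f₁ f₂ f₃ →
          (∀ t ∈ I, f₁ t ^ 2 ≤ f₂ t ^ 2 ∧ f₂ t ^ 2 ≤ f₃ t ^ 2) ∧
          (∃ θ : ℝ → ℝ, ContDiffOn ℝ 1 θ I ∧ G2SU3.AngleRelation I f₁ f₂ f₃ θ) ∧
          ((∀ t ∈ I, |deriv f₁ t| < √(G2SU3.Xi (f₁ t) μ ν)) →
            ∃ θ : ℝ → ℝ, ContDiffOn ℝ ∞ θ I ∧ G2SU3.AngleRelation I f₁ f₂ f₃ θ) ∧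
          ∀ (n : ℕ∞) (θ : ℝ → ℝ), 1 ≤ n → ContDiffOn ℝ n θ I →
            G2SU3.AngleRelation I f₁ f₂ f₃ θ →
            ∀ (M : Type*) [TopologicalSpace M] [ChartedSpace G2SU3.W M]
              [IsManifold 𝓘(ℝ, G2SU3.W) ∞ M] [MulAction G2SU3.SU3 M] (γ : ℝ → M),
              G2SU3.IsSmoothAction M → G2SU3.IsProductTube I γ →
              ∃! φ : G2SU3.FormField M 3,
                G2SU3.IsInvariantCosymplectic n φ ∧
                G2SU3.HasTubeMetric φ I γ f₁ f₂ f₃ ∧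
                G2SU3.HasTubeForm φ I γ f₁ f₂ f₃ θ) := by
  refine ⟨?_, ?_⟩
  · intro M _ _ _ _ _ hM hcoh φ hφ
    refine ⟨fun p hp => hM.exists_normalCurve hcoh.2 hφ.isG2Form hφ.isCn hp, ?_⟩
    intro I γ hI hc hγ
    obtain ⟨h, f, θ, hT, hf, hpos, hθ, hmet, hform, hder⟩ :=
      hM.exists_tubeStructure hcoh.2 hφ hI hc hγ
    exact ⟨h, f, θ, hT, hf, fun i t ht => (hpos i t ht).ne', hθ, hmet, hform,
      G2SU3.exists_relations_of_hasDerivAt hI hc hf hpos hder⟩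
  · intro I μ ν f₁ hI hc hμ hμν h₁ n₁ hle
    constructor
    · obtain ⟨f₂, f₃, h₂, h₃, hp, h⟩ := G2SU3.exists_relations hμ hμν h₁ n₁
      exact ⟨f₂, f₃, h₂, h₃, hp, h, fun k₂ k₃ hk k => G2SU3.sq_eq_sq_of_relations hμ hμν n₁
        (fun t ht => (hp t ht).1.ne') (fun t ht => (hp t ht).2.ne') (fun t ht => (hk t ht).1)
        (fun t ht => (hk t ht).2) h k⟩
    · intro f₂ f₃ h₂ h₃ hn h
      have n₂ := fun t ht => (hn t ht).1
      have n₃ := fun t ht => (hn t ht).2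
      obtain ⟨hθ, hθ'⟩ := G2SU3.exists_angleRelation hI hc hμ hμν h₁ h₂ h₃ n₁ n₂ n₃ h hle
      refine ⟨G2SU3.sq_le_sq_of_relations hμ hμν n₁ n₂ n₃ h, hθ, hθ', ?_⟩
      intro n θ hn' hθn hθr M _ _ _ _ γ hM hP
      have hd := fun t (ht : t ∈ I) => G2SU3.hasDerivAt_sq_mul_sq hI hμ hμν h₁ h₂ n₁ n₂ n₃ h hθr ht
      exact hM.existsUnique_structure hI hP hn' h₁ h₂ h₃ hθn n₁ n₂ n₃ (fun t ht => (hd t ht).1)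
        (fun t ht => (hd t ht).2.1) fun t ht => (hd t ht).2.2
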